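/- Let $\sigma\in\{1,-1\}$ and $K(x)=\dfrac{\sigma}{4\pi|x|}$ on $\mathbb R^3$. For $f=f(t,x,\xi)\ge 0$ put $\rho_f(t,x)=\int_{\mathbb R^3} f(t,x,\xi)\,d\xi$ and $E_f=-\nabla(K*\rho_f)=-(\nabla K)*\rho_f$, and consider the Vlasov--Poisson equation $$\partial_t f+\xi\cdot\nabla_x f+E_f\cdot\nabla_\xi f=0,\qquad f|_{t=0}=f^{\mathrm{in}}\ge 0 .$$ A solution on $[0,T]$ is understood in the sense of DiPerna and Lions: $f\ge 0$, $f\in C([0,T];L^1(\mathbb R^6))$, $f|_{t=0}=f^{\mathrm{in}}$, $E_f f\in L^1((0,T)\times\mathbb R^6)$, and for every bounded $\beta\in C^1(\mathbb R)$ the equation $\partial_t\beta(f)+\mathrm{div}_x(\xi\,\beta(f))+\mathrm{div}_\xi(E_f\,\beta(f))=0$ holds in the sense of distributions on $(0,T)\times\mathbb R^6$. **Theorem.** There is a universal constant $C>0$ such that the following holds. Let $f_1,f_2$ be two solutions on $[0,T]$ (for the same $\sigma$) with initial data $f_1^{\mathrm{in}},f_2^{\mathrm{in}}$, such that $\|f_1(t)\|_{L^\infty}\le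 \mathcal C_\infty$ and $\|f_2(t)\|_{L^\infty}\le\mathcal C_\infty$ for all $t\in[0,T]$, and such that for almost every $t\in[0,T]$ the distributional gradient $\nabla_\xi\sqrt{f_2}(t)$ is a locally integrable function on $\mathbb R^6$. Set $\rho_2=\rho_{f_2}$ and $$\lambda(t)=\|\rho_2\|_{L^\infty_x}^{1/2}\,\|\nabla_\xi\sqrt{f_2}\|_{L^3_xL^2_\xi}+\mathcal C_\infty^{1/2}\,\|\nabla_\xi\sqrt{f_2}\|_{L^{3,1}_xL^1_\xi},\qquad \Lambda(t)=C\int_0^t\lambda(s)\,ds,$$ where $L^{3,1}$ is the Lorentz space with norm $\|h\|_{L^{3,1}}=3\int_0^\infty|\{|h|>s\}|^{1/3}\,ds$. Then for every $t\in[0,T]$ with $\Lambda(t)<\infty$, $$\big\|\sqrt{f_1(t)}-\sqrt{f_2(t)}\big\|_{L^2}\le\big\|\sqrt{f_1^{\mathrm{in}}}-\sqrt{f_2^{\mathrm{in}}}\big\|_{L^2}\,e^{\Lambda(t)},$$ and, in particular, $$\|f_1(t)-f_2(t)\|_{L^2}\le 2\,\mathcal C_\infty^{1/2}\,\big\|f_1^{\mathrm{in}}-f_2^{\mathrm{in}}\big\|_{L^1}^{1/2}\,e^{\Lambda(t)}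 .$$ -/

import Mathlib

open MeasureTheory Set Filter Topology
open scoped ENNReal NNReal ContDiff

namespace VlasovPoisson

/-- Physical three-dimensional space, also used for velocities. -/
abbrev R3 : Type := EuclideanSpace ℝ (Fin 3)

/-- One-particle phase space; a point is `z = (x, ξ)`. -/
abbrev Phase : Type := R3 × R3

/-- The interaction potential `K(x) = σ / (4π|x|)`; the sign `σ = 1` is the Coulomb (repulsive)
case, `σ = -1` is the gravitational (attractive) case. -/
noncomputable def kernelK (σ : ℝ) (x : R3) : ℝ := σ / (4 * Real.pi * ‖x‖)

/-- The spatial density `ρ_f(x) = ∫ f(x, ξ) dξ`. -/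
noncomputable def density (f : Phase → ℝ) (x : R3) : ℝ := ∫ ξ, f (x, ξ)

/-- The self-consistent force field `E_f = -∇(K * ρ_f) = -(∇K) * ρ_f`. The convolution integral
converges for almost every `x` when `f` is integrable. -/
noncomputable def forceField (σ : ℝ) (f : Phase → ℝ) (x : R3) : R3 :=
  -∫ y, density f y • gradient (kernelK σ) (x - y)

/-- Nonnegative solutions on the time interval `[0, T]`, in the sense of DiPerna and Lions, of
`∂_t f + ξ · ∇_x f + E_f · ∇_ξ f = 0`: `f ∈ C([0, T]; L¹)`, the nonlinear term `E_f f` is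
integrable, and for every bounded `β ∈ C¹` the function `β(f)` satisfies
`∂_t β(f) + div_x (ξ β(f)) + div_ξ (E_f β(f)) = 0` in the sense of distributions on
`(0, T) × ℝ³ × ℝ³`. The initial datum is `f 0`. -/
structure IsSolution (σ T : ℝ) (f : ℝ → Phase → ℝ) : Prop where
  aestronglyMeasurable : AEStronglyMeasurable (fun p : ℝ × Phase => f p.1 p.2)
    (volume.restrict (Icc 0 T ×ˢ univ))
  nonneg : ∀ t ∈ Icc 0 T, ∀ᵐ z, 0 ≤ f t z
  integrable : ∀ t ∈ Icc 0 T, Integrable (f t)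
  continuous_L1 : ∀ t ∈ Icc 0 T,
    Tendsto (fun s => eLpNorm (f s - f t) 1 volume) (𝓝[Icc 0 T] t) (𝓝 0)
  integrable_force : Integrable (fun p : ℝ × Phase => f p.1 p.2 • forceField σ (f p.1) p.2.1)
    (volume.restrict (Ioo 0 T ×ˢ univ))
  -- `fderiv ℝ φ (t, x, ξ) (1, ξ, E)` is `∂_t φ + ξ · ∇_x φ + E · ∇_ξ φ` at `(t, x, ξ)`.
  transport : ∀ β : ℝ → ℝ, ContDiff ℝ 1 β → (∃ M : ℝ, ∀ s, |β s| ≤ M) →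
    ∀ φ : ℝ × Phase → ℝ, ContDiff ℝ ∞ φ → HasCompactSupport φ →
      tsupport φ ⊆ Ioo 0 T ×ˢ univ →
      ∫ p : ℝ × Phase, β (f p.1 p.2) *
        fderiv ℝ φ p ((1 : ℝ), (p.2.2, forceField σ (f p.1) p.2.1)) = 0

/-- `g` is the distributional gradient of `v` with respect to the velocity variable `ξ`. -/
def IsWeakVelocityGradient (v : Phase → ℝ) (g : Phase → R3) : Prop :=
  LocallyIntegrable g ∧
    ∀ φ : Phase → ℝ, ContDiff ℝ ∞ φ → HasCompactSupport φ → ∀ e : R3,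
      ∫ z, v z * fderiv ℝ φ z (0, e) = -∫ z, inner ℝ (g z) e * φ z

/-- The mixed norm of `L^p_x L^q_ξ`. -/
noncomputable def mixedNorm (p q : ℝ≥0∞) (g : Phase → R3) : ℝ≥0∞ :=
  eLpNorm (fun x : R3 => eLpNorm (fun ξ : R3 => g (x, ξ)) q volume) p volume

/-- The norm of the Lorentz space `L^{p,1}(ℝ³)` of a nonnegative function,
`p ∫_0^∞ |{x : h(x) > s}|^{1/p} ds`. -/
noncomputable def lorentzNormOne (p : ℝ) (h : R3 → ℝ≥0∞) : ℝ≥0∞ :=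
  ENNReal.ofReal p * ∫⁻ s in Ioi (0 : ℝ), volume {x | ENNReal.ofReal s < h x} ^ (1 / p)

/-- The mixed norm of `L^{p,1}_x L^q_ξ`. -/
noncomputable def mixedLorentzNorm (p : ℝ) (q : ℝ≥0∞) (g : Phase → R3) : ℝ≥0∞ :=
  lorentzNormOne p (fun x : R3 => eLpNorm (fun ξ : R3 => g (x, ξ)) q volume)

/-- `‖ρ_f‖_{L^∞}^{1/2} ‖g‖_{L³_x L²_ξ} + C_∞^{1/2} ‖g‖_{L^{3,1}_x L¹_ξ}`, at a fixed time; below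
`g` is the velocity gradient of `√f`. -/
noncomputable def rate (Cinf : ℝ≥0) (f : Phase → ℝ) (g : Phase → R3) : ℝ≥0∞ :=
  eLpNorm (density f) ⊤ volume ^ (1 / 2 : ℝ) * mixedNorm 3 2 g +
    (Cinf : ℝ≥0∞) ^ (1 / 2 : ℝ) * mixedLorentzNorm 3 1 g

end VlasovPoisson

/-! Write u_i = √f_i, E_i for the force of f_i, g = ∇_ξ u₂ and w = u₁ - u₂. Expanding the square,
‖w‖² = ∫f₁ + ∫f₂ - 2∫u₁u₂. The masses are conserved (`IsWeakCurve.integral_eq`). The square roots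
are transported by the same fields as the f_i, and pairing the two equations gives d/dt ∫u₁u₂ = ∫ u₁
(E₁-E₂)·g (`integral_mul_sub`). Since E₁-E₂ does not depend on ξ, ∫ u₂ (E₁-E₂)·g = ½ ∫ (E₁-E₂)·∇_ξ
f₂ = 0 (`integral_mul_inner_force_eq_zero`). Subtracting this zero leaves d/dt ‖w‖² = -2 ∫ w
(E₁-E₂)·g (`IsSolution.sq_distance_eq`).

The right side is bounded by λ‖w‖² (`lintegral_forceField_sub_le`). With D(x) = ∫ w² dξ, the
identity f₁-f₂ = w² + 2u₂w and Cauchy–Schwarz in ξ give |ρ₁-ρ₂| ≤ D + 2‖ρ₂‖_∞^{1/2} D^{1/2}, while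
|E₁-E₂| ≤ |·|⁻² * |ρ₁-ρ₂|. The part coming from D ∈ L¹ is paired with ‖g‖_{L¹_ξ} ∈ L^{3,1} after |w|
≤ C_∞^{1/2} (`lintegral_riesz_mul_le_lorentz`). The part coming from D^{1/2} ∈ L² is paired by
Hardy–Littlewood–Sobolev with D^{1/2}‖g‖_{L²_ξ}, which lies in L^{6/5} because 5/6 = 1/2 + 1/3
(`lintegral_riesz_mul_le`). Grönwall with an integrable coefficient concludes
(`le_mul_exp_integral`).

The labour is in justifying the evolution of ∫u₁u₂. The densities are used only as L¹ functions, so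
there is no regularity of E for a commutator estimate; the regularity of u₂ in ξ is used instead.
Both functions are mollified by the same even kernel and every velocity derivative is put on u₂
(`velocity_left`, `velocity_right`). The limit is controlled because |·|⁻² * |ρ_i| is integrable
against |g|, and because mollification preserves domination by a Riesz potential up to a constant
(`lintegral_normed_mul_riesz_le`). The commutator with ξ·∇_x vanishes because the kernel
concentrates much faster in ξ than in x. When the cutoff is removed, integrability of E u₁u₂ is
missing; it is replaced by the bound of the mass of u₂ in a velocity ball of radius R by a multiple
of R ∫|g| dξ (`IsWeakVelocityGradient.ae_setLIntegral_le`). -/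

namespace VlasovPoisson

/-! ### The kernel |x|⁻²: layer cake, integrals over sets, pairing with L^{3,1}. -/

/-- The kernel `|x|⁻²` with values in `[0, ∞]`. -/
noncomputable def rieszKernel (x : R3) : ℝ≥0∞ := ‖x‖ₑ ^ (-2 : ℝ)

/-- The Riesz potential `|·|⁻² * h` of a nonnegative function. -/
noncomputable def riesz (h : R3 → ℝ≥0∞) (x : R3) : ℝ≥0∞ := ∫⁻ y, h y * rieszKernel (x - y)

@[fun_prop]
lemma measurable_rieszKernel : Measurable rieszKernel := by
  unfold rieszKernel; fun_prop

lemma rieszKernel_neg (x : R3) : rieszKernel (-x) = rieszKernel x := by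
  simp [rieszKernel]

lemma rieszKernel_sub_comm (x y : R3) : rieszKernel (x - y) = rieszKernel (y - x) := by
  rw [← rieszKernel_neg, neg_sub]

lemma lintegral_Ioi_indicator_ofReal_lt (a : ℝ≥0∞) :
    ∫⁻ s in Ioi (0 : ℝ), {s : ℝ | ENNReal.ofReal s < a}.indicator 1 s = a := by
  have hm : MeasurableSet {s : ℝ | ENNReal.ofReal s < a} :=
    measurableSet_lt (by fun_prop) measurable_const
  rw [lintegral_indicator_one hm, Measure.restrict_apply hm]
  rcases eq_or_ne a ⊤ with rfl | ha
  · have : {s : ℝ | ENNReal.ofReal s < ⊤} ∩ Ioi 0 = Ioi 0 := by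
      ext s; simp
    rw [this, Real.volume_Ioi]
  · have : {s : ℝ | ENNReal.ofReal s < a} ∩ Ioi 0 = Ioo 0 a.toReal := by
      ext s
      simp only [mem_inter_iff, mem_ofPred_eq, mem_Ioi, mem_Ioo]
      refine ⟨fun ⟨h1, h2⟩ => ⟨h2, (ENNReal.ofReal_lt_iff_lt_toReal h2.le ha).1 h1⟩,
        fun ⟨h1, h2⟩ => ⟨(ENNReal.ofReal_lt_iff_lt_toReal h1.le ha).2 h2, h1⟩⟩
    rw [this, Real.volume_Ioo, sub_zero, ENNReal.ofReal_toReal ha]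

/-- Layer cake in one factor only: h(x) is the length of {s > 0 : s < h(x)}, then Tonelli. The other
factor k is carried along, so k may be the singular kernel. -/
lemma lintegral_mul_eq_lintegral_superlevel {α : Type*} [MeasurableSpace α] (μ : Measure α)
    [SFinite μ] {h k : α → ℝ≥0∞} (hh : Measurable h) (hk : Measurable k) :
    ∫⁻ x, h x * k x ∂μ =
      ∫⁻ s in Ioi (0 : ℝ), ∫⁻ x in {x | ENNReal.ofReal s < h x}, k x ∂μ := by
  have hms : MeasurableSet {p : ℝ × α | ENNReal.ofReal p.1 < h p.2} :=
    measurableSet_lt (by fun_prop) (by fun_prop)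
  have h1 : ∀ x, h x * k x =
      ∫⁻ s in Ioi (0 : ℝ), {p : ℝ × α | ENNReal.ofReal p.1 < h p.2}.indicator
        (fun p => k p.2) (s, x) := by
    intro x
    conv_lhs => rw [← lintegral_Ioi_indicator_ofReal_lt (h x)]
    rw [← lintegral_mul_const _ (by
      exact (measurable_one.indicator (measurableSet_lt (by fun_prop) measurable_const)))]
    refine lintegral_congr fun s => ?_
    by_cases hs : ENNReal.ofReal s < h x <;> simp [hs]
  simp_rw [h1]
  rw [lintegral_lintegral_swap]
  · refine lintegral_congr fun s => ?_
    rw [← lintegral_indicator (measurableSet_lt measurable_const hh)]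
    refine lintegral_congr fun x => ?_
    by_cases hs : ENNReal.ofReal s < h x <;> simp [hs]
  · refine Measurable.aemeasurable ?_
    have : Measurable ({p : ℝ × α | ENNReal.ofReal p.1 < h p.2}.indicator (fun p => k p.2)) :=
      (by fun_prop : Measurable fun p : ℝ × α => k p.2).indicator hms
    exact this.comp measurable_swap

lemma ofReal_lt_rieszKernel_iff {s : ℝ} (hs : 0 < s) (x y : R3) :
    ENNReal.ofReal s < rieszKernel (x - y) ↔ x ∈ Metric.ball y (s ^ (-(1 / 2) : ℝ)) := by
  rw [mem_ball_iff_norm, rieszKernel]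
  rcases eq_or_ne (x - y) 0 with h0 | h0
  -- On the diagonal the kernel is 0^(-2) = ⊤, in agreement with the centre lying in every ball.
  · simp only [h0, enorm_zero, norm_zero]
    rw [ENNReal.zero_rpow_of_neg (by norm_num)]
    simp [Real.rpow_pos_of_pos hs]
  · have hn : 0 < ‖x - y‖ := norm_pos_iff.2 h0
    rw [← ofReal_norm, ENNReal.ofReal_rpow_of_pos hn,
      ENNReal.ofReal_lt_ofReal_iff (Real.rpow_pos_of_pos hn _)]
    have e1 : s = (s ^ (-(1 / 2) : ℝ)) ^ (-2 : ℝ) := by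
      rw [← Real.rpow_mul hs.le]; norm_num
    conv_lhs => rw [e1]
    exact Real.rpow_lt_rpow_iff_of_neg (Real.rpow_pos_of_pos hs _) hn (by norm_num)

lemma lintegral_Ioi_rpow_neg_three_halves {c : ℝ} (hc : 0 < c) :
    ∫⁻ s in Ioi c, ENNReal.ofReal (s ^ (-(3 / 2) : ℝ)) = ENNReal.ofReal (2 * c ^ (-(1/2) : ℝ)) := by
  rw [← ofReal_integral_eq_lintegral_ofReal (integrableOn_Ioi_rpow_of_lt (by norm_num) hc)]
  · rw [integral_Ioi_rpow_of_lt (by norm_num) hc]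
    congr 1; norm_num; ring
  · filter_upwards [ae_restrict_mem measurableSet_Ioi] with s hs
    exact Real.rpow_nonneg (hc.le.trans (le_of_lt hs)) _

/-- The constant in the estimates for the kernel `|x|⁻²`. -/
noncomputable def rieszConst : ℝ≥0∞ := 1 + 2 * volume (Metric.ball (0 : R3) 1)

lemma rieszConst_ne_top : rieszConst ≠ ⊤ := by
  unfold rieszConst
  exact ENNReal.add_ne_top.2 ⟨by simp, ENNReal.mul_ne_top (by simp) measure_ball_lt_top.ne⟩

lemma one_le_rieszConst : 1 ≤ rieszConst := by unfold rieszConst; exact le_self_add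

lemma volume_ball_R3 (x : R3) {r : ℝ} (hr : 0 ≤ r) :
    volume (Metric.ball x r) = ENNReal.ofReal (r ^ 3) * volume (Metric.ball (0 : R3) 1) := by
  rw [Measure.addHaar_ball _ _ hr]; simp

/-- `∫_A |x - y|⁻² dx ≤ C |A|^{1/3}`. -/
lemma setLIntegral_rieszKernel_le (A : Set R3) (y : R3) :
    ∫⁻ x in A, rieszKernel (x - y) ≤ rieszConst * volume A ^ (1 / 3 : ℝ) := by
  rcases eq_or_ne (volume A) 0 with h0 | h0
  · rw [Measure.restrict_eq_zero.2 h0]; simp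
  rcases eq_or_ne (volume A) ⊤ with ht | ht
  · rw [ht, ENNReal.top_rpow_of_pos (by norm_num), ENNReal.mul_top]
    · simp
    · exact (zero_lt_one.trans_le one_le_rieszConst).ne'
  set r : ℝ := (volume A).toReal ^ (1 / 3 : ℝ) with hr
  have hA : 0 < (volume A).toReal := ENNReal.toReal_pos h0 ht
  have hrpos : 0 < r := Real.rpow_pos_of_pos hA _
  have hrA : volume A ^ (1 / 3 : ℝ) = ENNReal.ofReal r := by
    rw [hr, ← ENNReal.ofReal_rpow_of_pos hA, ENNReal.ofReal_toReal ht]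
  have hAr : volume A = ENNReal.ofReal (r ^ 3) := by
    rw [hr, ← Real.rpow_natCast, ← Real.rpow_mul hA.le]; norm_num [ENNReal.ofReal_toReal ht]
  have key := lintegral_mul_eq_lintegral_superlevel (volume.restrict A)
    (h := fun x => rieszKernel (x - y)) (k := fun _ => 1) (by fun_prop) measurable_const
  simp only [mul_one] at key
  rw [key]
  -- The level at which the superlevel ball has radius r = |A|^{1/3}. Below it the trivial bound |A|
  -- is used and contributes c r³ = r; above it the ball volume s^{-3/2}|B₁| is used and contributes
  -- 2|B₁| c^{-1/2} = 2|B₁| r. Hence the form of `rieszConst`.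
  set c : ℝ := r ^ (-2 : ℝ)
  have hc : 0 < c := Real.rpow_pos_of_pos hrpos _
  have hsplit : Ioi (0 : ℝ) = Ioc 0 c ∪ Ioi c := (Ioc_union_Ioi_eq_Ioi hc.le).symm
  rw [hsplit]
  refine (lintegral_union_le _ _ _).trans ?_
  have b1 : ∫⁻ s in Ioc 0 c, ∫⁻ x in {x | ENNReal.ofReal s < rieszKernel (x - y)}, 1
      ∂volume.restrict A ≤ ENNReal.ofReal r := by
    calc _ ≤ ∫⁻ s in Ioc 0 c, volume A := by
          refine lintegral_mono fun s => ?_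
          simp only [lintegral_const, one_mul, Measure.restrict_apply MeasurableSet.univ, univ_inter]
          exact (measure_mono (subset_univ _)).trans (by simp)
      _ = ENNReal.ofReal r := by
          rw [lintegral_const, Measure.restrict_apply MeasurableSet.univ, univ_inter,
            Real.volume_Ioc, sub_zero, hAr, ← ENNReal.ofReal_mul (by positivity)]
          congr 1
          simp only [c]
          rw [← Real.rpow_natCast, ← Real.rpow_add hrpos]; norm_num
  have b2 : ∫⁻ s in Ioi c, ∫⁻ x in {x | ENNReal.ofReal s < rieszKernel (x - y)}, 1
      ∂volume.restrict A ≤ 2 * volume (Metric.ball (0 : R3) 1) * ENNReal.ofReal r := by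
    calc _ ≤ ∫⁻ s in Ioi c, ENNReal.ofReal (s ^ (-(3 / 2) : ℝ)) *
            volume (Metric.ball (0 : R3) 1) := by
          refine setLIntegral_mono' measurableSet_Ioi fun s hs => ?_
          have hs0 : 0 < s := hc.trans hs
          simp only [lintegral_const, one_mul, Measure.restrict_apply MeasurableSet.univ, univ_inter]
          refine (Measure.restrict_apply_le _ _).trans ?_
          have : {x | ENNReal.ofReal s < rieszKernel (x - y)} =
              Metric.ball y (s ^ (-(1 / 2) : ℝ)) := by
            ext x; exact ofReal_lt_rieszKernel_iff hs0 x y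
          rw [this, volume_ball_R3 _ (Real.rpow_nonneg hs0.le _), ← Real.rpow_natCast,
            ← Real.rpow_mul hs0.le]
          norm_num
      _ = _ := by
          rw [lintegral_mul_const _ (by fun_prop), lintegral_Ioi_rpow_neg_three_halves hc,
            ENNReal.ofReal_mul (by norm_num), ← Real.rpow_mul hrpos.le]
          norm_num
          ring
  calc _ ≤ ENNReal.ofReal r + 2 * volume (Metric.ball (0 : R3) 1) * ENNReal.ofReal r :=
        add_le_add b1 b2
    _ = _ := by rw [hrA, rieszConst]; ring

lemma setLIntegral_rieszKernel_le' (A : Set R3) (y : R3) :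
    ∫⁻ x in A, rieszKernel (y - x) ≤ rieszConst * volume A ^ (1 / 3 : ℝ) := by
  simp_rw [rieszKernel_sub_comm y]; exact setLIntegral_rieszKernel_le A y

lemma measurable_riesz {h : R3 → ℝ≥0∞} (hh : Measurable h) : Measurable (riesz h) := by
  unfold riesz
  exact Measurable.lintegral_prod_right' (f := fun p : R3 × R3 => h p.2 * rieszKernel (p.1 - p.2))
    (by fun_prop)

lemma riesz_congr {h h' : R3 → ℝ≥0∞} (e : h =ᵐ[volume] h') : riesz h = riesz h' := by
  ext x; exact lintegral_congr_ae (e.mono fun y hy => by simp only [hy])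

lemma riesz_mono {h h' : R3 → ℝ≥0∞} (e : h ≤ᵐ[volume] h') (x : R3) : riesz h x ≤ riesz h' x :=
  lintegral_mono_ae (e.mono fun y hy => by gcongr)

/-- Tonelli; the kernel is even, so it acts equally well on either factor. -/
lemma lintegral_riesz_mul {h G : R3 → ℝ≥0∞} (hh : AEMeasurable h) (hG : AEMeasurable G) :
    ∫⁻ x, riesz h x * G x = ∫⁻ y, h y * ∫⁻ x, G x * rieszKernel (x - y) := by
  wlog H : Measurable h ∧ Measurable G generalizing h G
  · have e1 := hh.ae_eq_mk
    have e2 := hG.ae_eq_mk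
    have := this (h := hh.mk h) (G := hG.mk G) hh.measurable_mk.aemeasurable
      hG.measurable_mk.aemeasurable ⟨hh.measurable_mk, hG.measurable_mk⟩
    rw [riesz_congr e1]
    calc _ = ∫⁻ x, riesz (hh.mk h) x * hG.mk G x :=
          lintegral_congr_ae (e2.mono fun x hx => by dsimp only; rw [← hx])
      _ = _ := this
      _ = _ := lintegral_congr_ae (e1.mono fun x hx => by
          dsimp only; rw [← hx]
          congr 1
          exact lintegral_congr_ae (e2.mono fun x hx => by dsimp only; rw [← hx]))
  obtain ⟨mh, mG⟩ := H
  unfold riesz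
  have e1 : ∀ x, (∫⁻ y, h y * rieszKernel (x - y)) * G x =
      ∫⁻ y, h y * (G x * rieszKernel (x - y)) := fun x => by
    rw [← lintegral_mul_const _ (by fun_prop)]
    exact lintegral_congr fun y => by ring
  simp_rw [e1]
  rw [lintegral_lintegral_swap (by fun_prop)]
  refine lintegral_congr fun y => ?_
  rw [lintegral_const_mul _ (by fun_prop)]

/-- Cut G into its superlevel sets; the integral of the kernel over each costs the cube root of the
measure, which is exactly the integrand of the L^{3,1} norm. The bound is uniform in the pole y, so
it can be integrated against any L¹ function. -/
lemma lintegral_mul_rieszKernel_le {G : R3 → ℝ≥0∞} (hG : AEMeasurable G) (y : R3) :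
    ∫⁻ x, G x * rieszKernel (x - y) ≤
      rieszConst * ∫⁻ s in Ioi (0 : ℝ), volume {x | ENNReal.ofReal s < G x} ^ (1 / 3 : ℝ) := by
  have e2 := hG.ae_eq_mk
  calc ∫⁻ x, G x * rieszKernel (x - y) = ∫⁻ x, hG.mk G x * rieszKernel (x - y) :=
        lintegral_congr_ae (e2.mono fun x hx => by dsimp only; rw [← hx])
    _ = ∫⁻ s in Ioi (0 : ℝ), ∫⁻ x in {x | ENNReal.ofReal s < hG.mk G x}, rieszKernel (x - y) :=
        lintegral_mul_eq_lintegral_superlevel volume hG.measurable_mk (by fun_prop)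
    _ ≤ ∫⁻ s in Ioi (0 : ℝ), rieszConst * volume {x | ENNReal.ofReal s < G x} ^ (1 / 3 : ℝ) := by
        refine lintegral_mono fun s => ?_
        refine (setLIntegral_rieszKernel_le _ y).trans_eq ?_
        congr 2
        refine measure_congr (Filter.eventuallyEq_set.2 ?_)
        filter_upwards [e2] with x hx
        simp only [hx]
    _ = _ := lintegral_const_mul' _ _ rieszConst_ne_top

/-- The pairing of `|·|⁻² * L¹` with the Lorentz space `L^{3,1}`. -/
lemma lintegral_riesz_mul_le_lorentz {h G : R3 → ℝ≥0∞} (hh : AEMeasurable h)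
    (hG : AEMeasurable G) :
    ∫⁻ x, riesz h x * G x ≤ rieszConst * (∫⁻ y, h y) * lorentzNormOne 3 G := by
  rw [lintegral_riesz_mul hh hG]
  set I := ∫⁻ s in Ioi (0 : ℝ), volume {x | ENNReal.ofReal s < G x} ^ (1 / 3 : ℝ) with hI
  have hIl : I ≤ lorentzNormOne 3 G := by
    unfold lorentzNormOne
    rw [← hI]
    -- The normalising factor 3 of the Lorentz norm is at least 1 and is discarded.
    exact le_mul_of_one_le_left' (by simp)
  calc _ ≤ ∫⁻ y, h y * (rieszConst * I) :=
        lintegral_mono fun y => by dsimp only; gcongr; exact lintegral_mul_rieszKernel_le hG y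
    _ = (∫⁻ y, h y) * (rieszConst * I) := lintegral_mul_const'' _ hh
    _ ≤ _ := by
        rw [mul_comm rieszConst (∫⁻ y, h y), mul_assoc]
        gcongr

/-- The same pairing with G an indicator. It makes the potential of an L¹ function locally
integrable, hence finite almost everywhere. -/
lemma setLIntegral_riesz_le {h : R3 → ℝ≥0∞} (hh : AEMeasurable h) {A : Set R3}
    (hA : MeasurableSet A) :
    ∫⁻ x in A, riesz h x ≤ rieszConst * (∫⁻ y, h y) * volume A ^ (1 / 3 : ℝ) := by
  have e : ∫⁻ x in A, riesz h x = ∫⁻ x, riesz h x * A.indicator 1 x := by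
    rw [← lintegral_indicator hA]
    refine lintegral_congr fun x => ?_
    by_cases hx : x ∈ A <;> simp [hx]
  rw [e, lintegral_riesz_mul hh (measurable_one.indicator hA).aemeasurable]
  calc _ ≤ ∫⁻ y, h y * (rieszConst * volume A ^ (1 / 3 : ℝ)) := by
        refine lintegral_mono fun y => ?_
        dsimp only
        gcongr
        refine le_trans (le_of_eq ?_) (setLIntegral_rieszKernel_le A y)
        rw [← lintegral_indicator hA]
        refine lintegral_congr fun x => ?_
        by_cases hx : x ∈ A <;> simp [hx]
    _ = (∫⁻ y, h y) * (rieszConst * volume A ^ (1 / 3 : ℝ)) := lintegral_mul_const'' _ hh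
    _ = _ := by ring

/-! ### Hardy–Littlewood–Sobolev between L² and L^{6/5}, by level sets. -/

lemma lintegral_Ioc_rpow {r B : ℝ} (hr : -1 < r) (hB : 0 ≤ B) :
    ∫⁻ b in Ioc 0 B, ENNReal.ofReal (b ^ r) = ENNReal.ofReal (B ^ (r + 1) / (r + 1)) := by
  have hi : IntervalIntegrable (fun b : ℝ => b ^ r) volume 0 B :=
    intervalIntegral.intervalIntegrable_rpow' hr
  rw [← ofReal_integral_eq_lintegral_ofReal hi.1]
  · rw [← intervalIntegral.integral_of_le hB, integral_rpow (Or.inl hr),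
      Real.zero_rpow (by linarith), sub_zero]
  · filter_upwards [ae_restrict_mem measurableSet_Ioc] with s hs
    exact Real.rpow_nonneg hs.1.le _

/-- Layer cake for p-th powers. One inequality suffices, so points where h is infinite need no care:
there the right side is infinite too. -/
lemma lintegral_superlevel_rpow_le {p : ℝ} (hp : 0 < p) {h : R3 → ℝ≥0∞} (hh : Measurable h) :
    ∫⁻ b in Ioi (0 : ℝ), ENNReal.ofReal (b ^ (p - 1)) * volume {x | ENNReal.ofReal b < h x} ≤
      ENNReal.ofReal (1 / p) * ∫⁻ x, h x ^ p := by
  have hms : MeasurableSet {q : ℝ × R3 | ENNReal.ofReal q.1 < h q.2} :=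
    measurableSet_lt (by fun_prop) (by fun_prop)
  have e1 : ∀ b : ℝ, ENNReal.ofReal (b ^ (p - 1)) * volume {x | ENNReal.ofReal b < h x} =
      ∫⁻ x, ({q : ℝ × R3 | ENNReal.ofReal q.1 < h q.2}.indicator
        (fun q => ENNReal.ofReal (q.1 ^ (p - 1))) (b, x)) := by
    intro b
    rw [← lintegral_indicator_one (measurableSet_lt measurable_const hh),
      ← lintegral_const_mul _ (measurable_one.indicator (measurableSet_lt measurable_const hh))]
    refine lintegral_congr fun x => ?_
    by_cases hx : ENNReal.ofReal b < h x <;> simp [hx]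
  have hm : Measurable ({q : ℝ × R3 | ENNReal.ofReal q.1 < h q.2}.indicator
        (fun q => ENNReal.ofReal (q.1 ^ (p - 1)))) := Measurable.indicator (by fun_prop) hms
  simp_rw [e1]
  rw [lintegral_lintegral_swap (f := fun b x => {q : ℝ × R3 | ENNReal.ofReal q.1 < h q.2}.indicator
        (fun q => ENNReal.ofReal (q.1 ^ (p - 1))) (b, x)) hm.aemeasurable]
  rw [← lintegral_const_mul _ (by fun_prop)]
  refine lintegral_mono fun x => ?_
  dsimp only
  rcases eq_or_ne (h x) ⊤ with ht | ht
  · rw [ht, ENNReal.top_rpow_of_pos hp, ENNReal.mul_top]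
    · exact le_top
    · simpa using hp
  · calc _ ≤ ∫⁻ b in Ioi (0 : ℝ), (Ioc 0 (h x).toReal).indicator
          (fun b => ENNReal.ofReal (b ^ (p - 1))) b := by
          refine setLIntegral_mono' measurableSet_Ioi fun b hb => ?_
          by_cases hx : ENNReal.ofReal b < h x
          · have : b ∈ Ioc 0 (h x).toReal :=
              ⟨hb, ((ENNReal.ofReal_lt_iff_lt_toReal (le_of_lt hb) ht).1 hx).le⟩
            simp [hx, this]
          · simp [hx]
      _ = ∫⁻ b in Ioc 0 (h x).toReal, ENNReal.ofReal (b ^ (p - 1)) := by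
          rw [lintegral_indicator measurableSet_Ioc, Measure.restrict_restrict measurableSet_Ioc]
          congr 2
          ext b; simp +contextual
      _ = _ := by
          rw [lintegral_Ioc_rpow (by linarith) ENNReal.toReal_nonneg, sub_add_cancel,
            div_eq_mul_one_div, mul_comm, ENNReal.ofReal_mul (by positivity),
            ← ENNReal.ofReal_rpow_of_nonneg ENNReal.toReal_nonneg hp.le, ENNReal.ofReal_toReal ht]

/-- Hölder with exponents 3 and 3/2 after writing w^{1/3} = (b^α w)^{1/3} b^{-α/3}. The second
factor gives the integral of b^{-α/2} over (0, B], finite exactly when α < 2. -/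
lemma lintegral_Ioc_rpow_third_le {α B : ℝ} (hα2 : α < 2) (hB : 0 ≤ B)
    {w : ℝ → ℝ≥0∞} (hw : Measurable w)
    (h1 : ∫⁻ b in Ioi (0 : ℝ), ENNReal.ofReal (b ^ α) * w b ≤ 1) :
    ∫⁻ b in Ioc 0 B, w b ^ (1 / 3 : ℝ) ≤
      ENNReal.ofReal ((1 / (1 - α / 2)) ^ (2 / 3 : ℝ) * B ^ ((2 - α) / 3)) := by
  have hol := ENNReal.lintegral_mul_le_Lp_mul_Lq (volume.restrict (Ioc 0 B))
    (p := 3) (q := 3 / 2) (Real.holderConjugate_iff.2 ⟨by norm_num, by norm_num⟩)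
    (f := fun b => (ENNReal.ofReal (b ^ α) * w b) ^ (1 / 3 : ℝ))
    (g := fun b => ENNReal.ofReal (b ^ (-α / 3))) (by fun_prop) (by fun_prop)
  calc _ = ∫⁻ b in Ioc 0 B, ((fun b => (ENNReal.ofReal (b ^ α) * w b) ^ (1 / 3 : ℝ)) *
          (fun b => ENNReal.ofReal (b ^ (-α / 3)))) b := by
        refine setLIntegral_congr_fun measurableSet_Ioc fun b hb => ?_
        simp only [Pi.mul_apply]
        rw [ENNReal.mul_rpow_of_nonneg _ _ (by norm_num),
          ENNReal.ofReal_rpow_of_nonneg (Real.rpow_nonneg hb.1.le _) (by norm_num),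
          ← Real.rpow_mul hb.1.le, mul_right_comm,
          ← ENNReal.ofReal_mul (Real.rpow_nonneg hb.1.le _), ← Real.rpow_add hb.1]
        have : α * (1 / 3) + -α / 3 = 0 := by ring
        rw [this]; simp
    _ ≤ _ := hol
    _ ≤ 1 * ENNReal.ofReal ((1 / (1 - α / 2)) ^ (2 / 3 : ℝ) * B ^ ((2 - α) / 3)) := by
        gcongr
        · refine (ENNReal.rpow_le_rpow (z := 1 / 3) (?_ : _ ≤ (1 : ℝ≥0∞)) (by norm_num)).trans_eq
            (by simp)
          refine le_trans (le_trans (le_of_eq ?_)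
            (lintegral_mono_set (Ioc_subset_Ioi_self : Ioc 0 B ⊆ Ioi 0))) h1
          refine lintegral_congr fun b => ?_
          rw [← ENNReal.rpow_mul]; norm_num
        · have e : ∫⁻ b in Ioc 0 B, ENNReal.ofReal (b ^ (-α / 3)) ^ (3 / 2 : ℝ) =
              ∫⁻ b in Ioc 0 B, ENNReal.ofReal (b ^ (-α / 2)) := by
            refine setLIntegral_congr_fun measurableSet_Ioc fun b hb => ?_
            rw [ENNReal.ofReal_rpow_of_nonneg (Real.rpow_nonneg hb.1.le _) (by norm_num),
              ← Real.rpow_mul hb.1.le]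
            congr 2; ring
          have hpos : 0 < -α / 2 + 1 := by linarith
          rw [e, lintegral_Ioc_rpow (by linarith) hB,
            ENNReal.ofReal_rpow_of_nonneg (by positivity) (by norm_num), div_eq_mul_one_div,
            Real.mul_rpow (by positivity) (by positivity), ← Real.rpow_mul hB, mul_comm]
          refine le_of_eq ?_
          congr 2
          · norm_num; congr 2; ring
          · congr 1; ring
    _ = _ := one_mul _

/-- Layer cake in both functions reduces the pairing to indicators of sets F and H, for which the
double integral of |x-y|⁻² is at most C|F||H|^{1/3} and, integrating in the other order,
C|H||F|^{1/3}. -/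
lemma lintegral_riesz_mul_le_levels {f h : R3 → ℝ≥0∞} (hf : Measurable f) (hh : Measurable h) :
    ∫⁻ x, riesz f x * h x ≤ ∫⁻ a in Ioi (0 : ℝ), ∫⁻ b in Ioi (0 : ℝ), rieszConst *
      min (volume {y | ENNReal.ofReal a < f y} * volume {x | ENNReal.ofReal b < h x} ^ (1 / 3 : ℝ))
        (volume {x | ENNReal.ofReal b < h x} *
          volume {y | ENNReal.ofReal a < f y} ^ (1 / 3 : ℝ)) := by
  have hms : MeasurableSet {q : (R3 × ℝ) × R3 | ENNReal.ofReal q.1.2 < h q.2} :=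
    measurableSet_lt (by fun_prop) (by fun_prop)
  have hΦ : Measurable fun q : R3 × ℝ => ∫⁻ x in {x | ENNReal.ofReal q.2 < h x},
      rieszKernel (x - q.1) := by
    have : (fun q : R3 × ℝ => ∫⁻ x in {x | ENNReal.ofReal q.2 < h x}, rieszKernel (x - q.1)) =
        fun q => ∫⁻ x, {q : (R3 × ℝ) × R3 | ENNReal.ofReal q.1.2 < h q.2}.indicator
          (fun q => rieszKernel (q.2 - q.1.1)) (q, x) := by
      ext q
      rw [← lintegral_indicator (measurableSet_lt measurable_const hh)]
      refine lintegral_congr fun x => ?_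
      by_cases hx : ENNReal.ofReal q.2 < h x <;> simp [hx]
    rw [this]
    exact Measurable.lintegral_prod_right' (Measurable.indicator (by fun_prop) hms)
  rw [lintegral_riesz_mul hf.aemeasurable hh.aemeasurable,
    lintegral_mul_eq_lintegral_superlevel volume hf (by
      exact Measurable.lintegral_prod_right' (f := fun p : R3 × R3 => h p.2 * rieszKernel (p.2 - p.1))
        (by fun_prop))]
  refine lintegral_mono fun a => ?_
  have e : ∀ y, ∫⁻ x, h x * rieszKernel (x - y) =
      ∫⁻ b in Ioi (0 : ℝ), ∫⁻ x in {x | ENNReal.ofReal b < h x}, rieszKernel (x - y) := fun y =>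
    lintegral_mul_eq_lintegral_superlevel volume hh (by fun_prop)
  simp_rw [e]
  rw [lintegral_lintegral_swap hΦ.aemeasurable]
  refine lintegral_mono fun b => ?_
  dsimp only
  rw [mul_min]
  refine le_min ?_ ?_
  · calc _ ≤ ∫⁻ y in {y | ENNReal.ofReal a < f y},
          rieszConst * volume {x | ENNReal.ofReal b < h x} ^ (1 / 3 : ℝ) :=
          lintegral_mono fun y => setLIntegral_rieszKernel_le _ y
      _ = _ := by
          rw [lintegral_const, Measure.restrict_apply MeasurableSet.univ, univ_inter]; ring
  · rw [lintegral_lintegral_swap (by fun_prop)]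
    calc _ ≤ ∫⁻ x in {x | ENNReal.ofReal b < h x},
          rieszConst * volume {y | ENNReal.ofReal a < f y} ^ (1 / 3 : ℝ) :=
          lintegral_mono fun x => setLIntegral_rieszKernel_le' _ x
      _ = _ := by
          rw [lintegral_const, Measure.restrict_apply MeasurableSet.univ, univ_inter]; ring

lemma measurable_volume_superlevel (f : R3 → ℝ≥0∞) :
    Measurable fun a : ℝ => volume {y | ENNReal.ofReal a < f y} :=
  Antitone.measurable fun _ _ hab => measure_mono fun _ hy =>
    (ENNReal.ofReal_le_ofReal hab).trans_lt hy

/-- The quadrant of levels (a, b) is split along b = a^{5/3}, the curve on which both set bounds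
close up. For b ≤ a^{5/3} the b-integral of w^{1/3} is at most 2(a^{5/3})^{3/5} = 2a, and ∫ a v(a)
da is controlled by the L² norm of f. For a < b^{3/5} the a-integral of v^{1/3} is at most
2(b^{3/5})^{1/3} = 2b^{1/5}, and ∫ b^{1/5} w(b) db is controlled by the L^{6/5} norm of h. -/
lemma lintegral_riesz_mul_le_of_le_one {f h : R3 → ℝ≥0∞} (hf : Measurable f) (hh : Measurable h)
    (hf1 : ∫⁻ x, f x ^ (2 : ℝ) ≤ 1) (hh1 : ∫⁻ x, h x ^ (6 / 5 : ℝ) ≤ 1) :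
    ∫⁻ x, riesz f x * h x ≤ 4 * rieszConst := by
  set v := fun a : ℝ => volume {y | ENNReal.ofReal a < f y} with hv
  set w := fun b : ℝ => volume {x | ENNReal.ofReal b < h x} with hw
  have mv : Measurable v := measurable_volume_superlevel f
  have mw : Measurable w := measurable_volume_superlevel h
  have iv : ∫⁻ a in Ioi (0 : ℝ), ENNReal.ofReal (a ^ (1 : ℝ)) * v a ≤ 1 := by
    have := lintegral_superlevel_rpow_le (p := 2) (by norm_num) hf
    norm_num at this ⊢
    refine this.trans ?_
    calc _ ≤ ENNReal.ofReal (1 / 2) * 1 := by gcongr; simpa using hf1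
      _ ≤ 1 := by rw [mul_one]; exact ENNReal.ofReal_le_one.2 (by norm_num)
  have iw : ∫⁻ b in Ioi (0 : ℝ), ENNReal.ofReal (b ^ (1 / 5 : ℝ)) * w b ≤ 1 := by
    have := lintegral_superlevel_rpow_le (p := 6 / 5) (by norm_num) hh
    norm_num at this ⊢
    refine this.trans ?_
    calc _ ≤ ENNReal.ofReal (5 / 6) * 1 := by gcongr
      _ ≤ 1 := by rw [mul_one]; exact ENNReal.ofReal_le_one.2 (by norm_num)
  -- The Hölder constants for the weights α = 1/5 and α = 1 are both rounded up to 2.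
  have c1 : (1 / (1 - (1 / 5 : ℝ) / 2)) ^ (2 / 3 : ℝ) ≤ 2 := by
    calc _ ≤ (2 : ℝ) ^ (2 / 3 : ℝ) := Real.rpow_le_rpow (by norm_num) (by norm_num) (by norm_num)
      _ ≤ 2 ^ (1 : ℝ) := Real.rpow_le_rpow_of_exponent_le (by norm_num) (by norm_num)
      _ = 2 := by norm_num
  have c2 : (1 / (1 - (1 : ℝ) / 2)) ^ (2 / 3 : ℝ) ≤ 2 := by
    calc _ = (2 : ℝ) ^ (2 / 3 : ℝ) := by norm_num
      _ ≤ 2 ^ (1 : ℝ) := Real.rpow_le_rpow_of_exponent_le (by norm_num) (by norm_num)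
      _ = 2 := by norm_num
  have I1 : ∫⁻ a in Ioi (0 : ℝ), ∫⁻ b in Ioc 0 (a ^ (5 / 3 : ℝ)), v a * w b ^ (1 / 3 : ℝ) ≤ 2 := by
    calc _ ≤ ∫⁻ a in Ioi (0 : ℝ), 2 * (ENNReal.ofReal (a ^ (1 : ℝ)) * v a) := by
          refine setLIntegral_mono' measurableSet_Ioi fun a ha => ?_
          have ha' : 0 < a := ha
          rw [lintegral_const_mul _ (by fun_prop)]
          have := lintegral_Ioc_rpow_third_le (by norm_num)
            (Real.rpow_nonneg ha'.le (5 / 3)) mw iw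
          have e : (a ^ (5 / 3 : ℝ)) ^ ((2 - 1 / 5 : ℝ) / 3) = a ^ (1 : ℝ) := by
            rw [← Real.rpow_mul ha'.le]; norm_num
          rw [e] at this
          calc _ ≤ v a * (2 * ENNReal.ofReal (a ^ (1 : ℝ))) := by
                gcongr
                refine this.trans ?_
                rw [ENNReal.ofReal_mul (by positivity)]
                gcongr
                simpa using ENNReal.ofReal_le_ofReal c1
            _ = _ := by ring
      _ ≤ 2 * 1 := by
          rw [lintegral_const_mul _ (by fun_prop)]
          gcongr
      _ = 2 := by norm_num
  have I2 : ∫⁻ a in Ioi (0 : ℝ), ∫⁻ b in Ioi (a ^ (5 / 3 : ℝ)), w b * v a ^ (1 / 3 : ℝ) ≤ 2 := by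
    have hms : MeasurableSet {q : ℝ × ℝ | 0 < q.1 ∧ q.1 ^ (5 / 3 : ℝ) < q.2} :=
      (measurableSet_lt measurable_const measurable_fst).inter
        (measurableSet_lt (by fun_prop) measurable_snd)
    set Θ := {q : ℝ × ℝ | 0 < q.1 ∧ q.1 ^ (5 / 3 : ℝ) < q.2}.indicator
      (fun q => w q.2 * v q.1 ^ (1 / 3 : ℝ)) with hΘ
    have mΘ : Measurable Θ := Measurable.indicator (by fun_prop) hms
    -- Here the order of integration has to be exchanged, since the bound to be used integrates
    -- v^{1/3} in a for fixed b.
    calc _ = ∫⁻ a in Ioi (0 : ℝ), ∫⁻ b in Ioi (0 : ℝ), Θ (a, b) := by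
          refine setLIntegral_congr_fun measurableSet_Ioi fun a ha => ?_
          have ha' : 0 < a := ha
          rw [← lintegral_indicator measurableSet_Ioi, ← lintegral_indicator measurableSet_Ioi]
          refine lintegral_congr fun b => ?_
          by_cases hb : a ^ (5 / 3 : ℝ) < b
          · have : 0 < b := (Real.rpow_pos_of_pos ha' _).trans hb
            simp [hΘ, hb, this, ha']
          · simp [hΘ, hb, indicator]
      _ = ∫⁻ b in Ioi (0 : ℝ), ∫⁻ a in Ioi (0 : ℝ), Θ (a, b) :=
          lintegral_lintegral_swap mΘ.aemeasurable
      _ ≤ ∫⁻ b in Ioi (0 : ℝ), 2 * (ENNReal.ofReal (b ^ (1 / 5 : ℝ)) * w b) := by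
          refine setLIntegral_mono' measurableSet_Ioi fun b hb => ?_
          have hb' : 0 < b := hb
          calc _ ≤ ∫⁻ a in Ioi (0 : ℝ), (Ioc 0 (b ^ (3 / 5 : ℝ))).indicator
                (fun a => w b * v a ^ (1 / 3 : ℝ)) a := by
                refine setLIntegral_mono' measurableSet_Ioi fun a ha => ?_
                have ha' : 0 < a := ha
                by_cases hab : a ^ (5 / 3 : ℝ) < b
                · have hab' : a ≤ b ^ (3 / 5 : ℝ) := by
                    calc a = (a ^ (5 / 3 : ℝ)) ^ (3 / 5 : ℝ) := by
                          rw [← Real.rpow_mul ha'.le]; norm_num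
                      _ ≤ _ := Real.rpow_le_rpow (by positivity) hab.le (by norm_num)
                  have : a ∈ Ioc 0 (b ^ (3 / 5 : ℝ)) := ⟨ha', hab'⟩
                  simp [hΘ, this, ha', hab]
                · simp [hΘ, hab]
            _ = ∫⁻ a in Ioc 0 (b ^ (3 / 5 : ℝ)), w b * v a ^ (1 / 3 : ℝ) := by
                rw [lintegral_indicator measurableSet_Ioc,
                  Measure.restrict_restrict measurableSet_Ioc]
                congr 2
                ext b; simp +contextual
            _ ≤ w b * (2 * ENNReal.ofReal (b ^ (1 / 5 : ℝ))) := by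
                rw [lintegral_const_mul _ (by fun_prop)]
                gcongr
                have := lintegral_Ioc_rpow_third_le (by norm_num)
                  (Real.rpow_nonneg hb'.le (3 / 5)) mv iv
                have e : (b ^ (3 / 5 : ℝ)) ^ ((2 - 1 : ℝ) / 3) = b ^ (1 / 5 : ℝ) := by
                  rw [← Real.rpow_mul hb'.le]; norm_num
                rw [e] at this
                refine this.trans ?_
                rw [ENNReal.ofReal_mul (by positivity)]
                gcongr
                simpa using ENNReal.ofReal_le_ofReal c2
            _ = _ := by ring
      _ ≤ 2 * 1 := by
          rw [lintegral_const_mul _ (by fun_prop)]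
          gcongr
      _ = 2 := by norm_num
  calc _ ≤ _ := lintegral_riesz_mul_le_levels hf hh
    _ = rieszConst * ∫⁻ a in Ioi (0 : ℝ), ∫⁻ b in Ioi (0 : ℝ),
          min (v a * w b ^ (1 / 3 : ℝ)) (w b * v a ^ (1 / 3 : ℝ)) := by
        rw [← lintegral_const_mul' _ _ rieszConst_ne_top]
        refine lintegral_congr fun a => ?_
        rw [← lintegral_const_mul' _ _ rieszConst_ne_top]
    _ ≤ rieszConst * ∫⁻ a in Ioi (0 : ℝ), ((∫⁻ b in Ioc 0 (a ^ (5 / 3 : ℝ)),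
          v a * w b ^ (1 / 3 : ℝ)) + ∫⁻ b in Ioi (a ^ (5 / 3 : ℝ)), w b * v a ^ (1 / 3 : ℝ)) := by
        refine mul_le_mul_right ?_ _
        refine setLIntegral_mono' measurableSet_Ioi fun a ha => ?_
        have ha' : 0 < a := ha
        rw [← Ioc_union_Ioi_eq_Ioi (Real.rpow_nonneg ha'.le (5 / 3))]
        refine (lintegral_union_le _ _ _).trans ?_
        gcongr
        · exact min_le_left _ _
        · exact min_le_right _ _
    _ ≤ rieszConst * (2 + 2) := by
        gcongr
        rw [lintegral_add_left]
        · exact add_le_add I1 I2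
        · have hms : MeasurableSet {q : ℝ × ℝ | 0 < q.2 ∧ q.2 ≤ q.1 ^ (5 / 3 : ℝ)} :=
            (measurableSet_lt measurable_const measurable_snd).inter
              (measurableSet_le measurable_snd (by fun_prop))
          have : (fun a => ∫⁻ b in Ioc 0 (a ^ (5 / 3 : ℝ)), v a * w b ^ (1 / 3 : ℝ)) =
              fun a => ∫⁻ b, {q : ℝ × ℝ | 0 < q.2 ∧ q.2 ≤ q.1 ^ (5 / 3 : ℝ)}.indicator
                (fun q => v q.1 * w q.2 ^ (1 / 3 : ℝ)) (a, b) := by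
            ext a
            rw [← lintegral_indicator measurableSet_Ioc]
            refine lintegral_congr fun b => ?_
            by_cases hb : 0 < b ∧ b ≤ a ^ (5 / 3 : ℝ) <;> simp [indicator, hb]
          rw [this]
          exact Measurable.lintegral_prod_right' (Measurable.indicator (by fun_prop) hms)
    _ = _ := by ring

lemma riesz_const_mul {c : ℝ≥0∞} {f : R3 → ℝ≥0∞} (hf : AEMeasurable f) (x : R3) :
    riesz (fun y => c * f y) x = c * riesz f x := by
  unfold riesz
  simp_rw [mul_assoc]
  exact lintegral_const_mul'' _ (hf.mul (by fun_prop))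

/-- The Hardy–Littlewood–Sobolev inequality for the kernel `|x|⁻²` on `ℝ³`, pairing `L²` with
`L^{6/5}`. -/
theorem lintegral_riesz_mul_le {f h : R3 → ℝ≥0∞} (hf : AEMeasurable f) (hh : AEMeasurable h) :
    ∫⁻ x, riesz f x * h x ≤ 4 * rieszConst *
      ((∫⁻ x, f x ^ (2 : ℝ)) ^ (1 / 2 : ℝ) * (∫⁻ x, h x ^ (6 / 5 : ℝ)) ^ (5 / 6 : ℝ)) := by
  wlog H : Measurable f ∧ Measurable h generalizing f h
  · have e1 := hf.ae_eq_mk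
    have e2 := hh.ae_eq_mk
    have := this (f := hf.mk f) (h := hh.mk h) hf.measurable_mk.aemeasurable
      hh.measurable_mk.aemeasurable ⟨hf.measurable_mk, hh.measurable_mk⟩
    rw [riesz_congr e1]
    calc _ = ∫⁻ x, riesz (hf.mk f) x * hh.mk h x :=
          lintegral_congr_ae (e2.mono fun x hx => by dsimp only; rw [← hx])
      _ ≤ _ := this
      _ = _ := by
          congr 3
          · exact lintegral_congr_ae (e1.mono fun x hx => by dsimp only; rw [← hx])
          · exact lintegral_congr_ae (e2.mono fun x hx => by dsimp only; rw [← hx])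
  obtain ⟨mf, mh⟩ := H
  set F := (∫⁻ x, f x ^ (2 : ℝ)) ^ (1 / 2 : ℝ) with hF
  set G := (∫⁻ x, h x ^ (6 / 5 : ℝ)) ^ (5 / 6 : ℝ) with hG
  have hC : 4 * rieszConst ≠ 0 :=
    mul_ne_zero (by norm_num) (zero_lt_one.trans_le one_le_rieszConst).ne'
  rcases eq_or_ne F 0 with F0 | F0
  · rw [hF, ENNReal.rpow_eq_zero_iff_of_pos (by norm_num), lintegral_eq_zero_iff (by fun_prop)] at F0
    have : f =ᵐ[volume] fun _ => 0 := F0.mono fun x hx => by simpa using hx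
    rw [riesz_congr this]
    simp [riesz]
  rcases eq_or_ne G 0 with G0 | G0
  · rw [hG, ENNReal.rpow_eq_zero_iff_of_pos (by norm_num), lintegral_eq_zero_iff (by fun_prop)] at G0
    have : h =ᵐ[volume] fun _ => 0 := G0.mono fun x hx => by
      have := (ENNReal.rpow_eq_zero_iff_of_pos (by norm_num)).1 hx
      simpa using this
    have e : ∫⁻ x, riesz f x * h x = ∫⁻ x : R3, 0 :=
      lintegral_congr_ae (this.mono fun x hx => by simp [hx])
    simp [e]
  rcases eq_or_ne F ⊤ with Ft | Ft
  · rw [Ft, ENNReal.top_mul G0, ENNReal.mul_top hC]; exact le_top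
  rcases eq_or_ne G ⊤ with Gt | Gt
  · rw [Gt, ENNReal.mul_top F0, ENNReal.mul_top hC]; exact le_top
  -- Both norms are now positive and finite, so homogeneity reduces to norms at most one.
  have key := lintegral_riesz_mul_le_of_le_one (f := fun x => F⁻¹ * f x) (h := fun x => G⁻¹ * h x)
    (by fun_prop) (by fun_prop) (by
      simp_rw [ENNReal.mul_rpow_of_nonneg _ _ (zero_le_two : (0 : ℝ) ≤ 2)]
      rw [lintegral_const_mul _ (by fun_prop)]
      have : ∫⁻ x, f x ^ (2 : ℝ) = F ^ (2 : ℝ) := by rw [hF, ← ENNReal.rpow_mul]; norm_num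
      rw [this, ← ENNReal.mul_rpow_of_nonneg _ _ (by norm_num), ENNReal.inv_mul_cancel F0 Ft]
      simp) (by
      simp_rw [ENNReal.mul_rpow_of_nonneg _ _ (by norm_num : (0 : ℝ) ≤ 6 / 5)]
      rw [lintegral_const_mul _ (by fun_prop)]
      have : ∫⁻ x, h x ^ (6 / 5 : ℝ) = G ^ (6 / 5 : ℝ) := by
        rw [hG, ← ENNReal.rpow_mul]; norm_num
      rw [this, ← ENNReal.mul_rpow_of_nonneg _ _ (by norm_num), ENNReal.inv_mul_cancel G0 Gt]
      simp)
  simp_rw [riesz_const_mul mf.aemeasurable] at key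
  have e : ∫⁻ x, riesz f x * h x = F * G * ∫⁻ x, F⁻¹ * riesz f x * (G⁻¹ * h x) := by
    have := measurable_riesz mf
    rw [← lintegral_const_mul _ (by fun_prop)]
    refine lintegral_congr fun x => ?_
    calc _ = (F * F⁻¹) * (G * G⁻¹) * (riesz f x * h x) := by
          rw [ENNReal.mul_inv_cancel F0 Ft, ENNReal.mul_inv_cancel G0 Gt]; simp
      _ = _ := by ring
  rw [e, mul_comm]
  gcongr

/-! ### Mollification of Riesz potentials. -/

/-- The constant in the domination of mollifications of `|x|⁻²` by itself. -/
noncomputable def mollifyConst : ℝ≥0∞ :=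
  4 + 32 * rieszConst * volume (Metric.ball (0 : R3) 1) ^ (-(2 / 3) : ℝ)

lemma mollifyConst_ne_top : mollifyConst ≠ ⊤ := by
  unfold mollifyConst
  refine ENNReal.add_ne_top.2 ⟨by simp, ENNReal.mul_ne_top (ENNReal.mul_ne_top (by simp)
    rieszConst_ne_top) ?_⟩
  exact ENNReal.rpow_ne_top_of_ne_zero (Metric.measure_ball_pos _ _ one_pos).ne'
    measure_ball_lt_top.ne

lemma lintegral_ofReal_normed (η : ContDiffBump (0 : R3)) (x : R3) :
    ∫⁻ a, ENNReal.ofReal (η.normed volume (x - a)) = 1 := by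
  rw [lintegral_sub_left_eq_self (fun a => ENNReal.ofReal (η.normed volume a)) x,
    ← ofReal_integral_eq_lintegral_ofReal η.integrable_normed
      (Eventually.of_forall η.nonneg_normed), η.integral_normed, ENNReal.ofReal_one]

lemma rieszKernel_of_ne {x : R3} (hx : x ≠ 0) :
    rieszKernel x = ENNReal.ofReal (‖x‖ ^ (-2 : ℝ)) := by
  rw [rieszKernel, ← ofReal_norm, ENNReal.ofReal_rpow_of_pos (norm_pos_iff.2 hx)]

lemma rieszKernel_le_of_norm_le {x y : R3} {c : ℝ} (hc : 0 < c) (h : c * ‖x‖ ≤ ‖y‖) :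
    rieszKernel y ≤ ENNReal.ofReal (c ^ (-2 : ℝ)) * rieszKernel x := by
  rcases eq_or_ne x 0 with rfl | hx
  · rw [rieszKernel, rieszKernel, enorm_zero, ENNReal.zero_rpow_of_neg (by norm_num),
      ENNReal.mul_top]
    · exact le_top
    · simp [hc.ne']
  · have hx' : 0 < ‖x‖ := norm_pos_iff.2 hx
    have hy : y ≠ 0 := norm_pos_iff.1 (lt_of_lt_of_le (by positivity) h)
    rw [rieszKernel_of_ne hx, rieszKernel_of_ne hy, ← ENNReal.ofReal_mul (by positivity),
      ← Real.mul_rpow hc.le hx'.le]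
    exact ENNReal.ofReal_le_ofReal
      (Real.rpow_le_rpow_of_nonpos (by positivity) h (by norm_num))

/-- Mollification of `|x|⁻²` at any scale is dominated by a multiple of `|x|⁻²`. -/
lemma lintegral_normed_mul_rieszKernel_le (η : ContDiffBump (0 : R3)) (hη : η.rOut ≤ 2 * η.rIn)
    (x : R3) :
    ∫⁻ a, ENNReal.ofReal (η.normed volume (x - a)) * rieszKernel a ≤
      mollifyConst * rieszKernel x := by
  set r := η.rOut with hr
  have hrpos : 0 < r := η.rOut_pos
  have hsupp : ∀ a, η.normed volume (x - a) ≠ 0 → a ∈ Metric.ball x r := fun a ha => by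
    have : x - a ∈ Function.support (η.normed volume) := ha
    rw [η.support_normed_eq, mem_ball_zero_iff] at this
    rwa [mem_ball_iff_norm, norm_sub_rev]
  -- Away from the pole all points of the bump satisfy |a| ≥ |x|/2, whence the constant 4. Near the
  -- pole the bump is replaced by its supremum, at most 2³ over the volume of the ball because the
  -- outer radius is at most twice the inner one; the kernel integral over the ball is then of order
  -- r⁻² ≤ 4|x|⁻², whence 32 = 8·4.
  rcases le_or_gt (2 * r) ‖x‖ with hx | hx
  · calc _ ≤ ∫⁻ a, ENNReal.ofReal (η.normed volume (x - a)) * (4 * rieszKernel x) := by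
          refine lintegral_mono fun a => ?_
          by_cases h0 : η.normed volume (x - a) = 0
          · simp [h0]
          · have hb := hsupp a h0
            rw [mem_ball_iff_norm] at hb
            dsimp only
            refine mul_le_mul_right ?_ _
            have h1 : ‖x‖ ≤ ‖a‖ + ‖a - x‖ := by
              have := norm_sub_le a (a - x); simpa using this
            have := rieszKernel_le_of_norm_le (x := x) (y := a) (c := 1 / 2) (by norm_num)
              (by linarith)
            norm_num at this
            exact this
      _ = 4 * rieszKernel x := by
          rw [lintegral_mul_const _ (by
            have := η.continuous_normed (μ := volume); fun_prop), lintegral_ofReal_normed, one_mul]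
      _ ≤ _ := by gcongr; exact le_self_add
  · set V := volume (Metric.ball (0 : R3) 1) with hV
    have V0 : V ≠ 0 := (Metric.measure_ball_pos _ _ one_pos).ne'
    have Vt : V ≠ ⊤ := measure_ball_lt_top.ne
    have hVr : 0 < V.toReal := ENNReal.toReal_pos V0 Vt
    have hsup : ∀ a, ENNReal.ofReal (η.normed volume a) ≤
        8 * (ENNReal.ofReal (r ^ 3) * V)⁻¹ := fun a => by
      have h := η.normed_le_div_measure_closedBall_rOut volume 2 hη a
      have e : volume.real (Metric.closedBall (0 : R3) η.rOut) = r ^ 3 * V.toReal := by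
        rw [Measure.addHaar_real_closedBall _ _ hrpos.le]
        simp [Measure.real, hV]
      rw [e] at h
      refine (ENNReal.ofReal_le_ofReal h).trans_eq ?_
      rw [ENNReal.ofReal_div_of_pos (by positivity), ENNReal.ofReal_mul (by positivity),
        ENNReal.ofReal_toReal Vt, div_eq_mul_inv]
      norm_num
    have hvol : volume (Metric.ball x r) = ENNReal.ofReal (r ^ 3) * V := volume_ball_R3 x hrpos.le
    calc _ ≤ ∫⁻ a, (Metric.ball x r).indicator
          (fun a => 8 * (ENNReal.ofReal (r ^ 3) * V)⁻¹ * rieszKernel a) a := by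
          refine lintegral_mono fun a => ?_
          by_cases h0 : η.normed volume (x - a) = 0
          · simp [h0]
          · simp only [indicator_of_mem (hsupp a h0)]
            gcongr
            exact hsup _
      _ = 8 * (ENNReal.ofReal (r ^ 3) * V)⁻¹ * ∫⁻ a in Metric.ball x r, rieszKernel (a - 0) := by
          rw [lintegral_indicator measurableSet_ball, lintegral_const_mul _ (by fun_prop)]
          simp
      _ ≤ 8 * (ENNReal.ofReal (r ^ 3) * V)⁻¹ *
            (rieszConst * (ENNReal.ofReal (r ^ 3) * V) ^ (1 / 3 : ℝ)) := by
          gcongr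
          rw [← hvol]
          exact setLIntegral_rieszKernel_le _ _
      _ = 8 * rieszConst * V ^ (-(2 / 3) : ℝ) * ENNReal.ofReal (r ^ (-2 : ℝ)) := by
          have hne : ENNReal.ofReal (r ^ 3) * V ≠ 0 :=
            mul_ne_zero (by simpa using by positivity) V0
          have hnt : ENNReal.ofReal (r ^ 3) * V ≠ ⊤ := ENNReal.mul_ne_top (by simp) Vt
          have e2 : (ENNReal.ofReal (r ^ 3) * V)⁻¹ * (ENNReal.ofReal (r ^ 3) * V) ^ (1 / 3 : ℝ) =
              V ^ (-(2 / 3) : ℝ) * ENNReal.ofReal (r ^ (-2 : ℝ)) := by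
            rw [← ENNReal.rpow_neg_one, ← ENNReal.rpow_add _ _ hne hnt,
              ENNReal.mul_rpow_of_ne_top (by simp) Vt, mul_comm,
              ENNReal.ofReal_rpow_of_pos (by positivity), ← Real.rpow_natCast,
              ← Real.rpow_mul hrpos.le]
            norm_num
          calc _ = 8 * rieszConst * ((ENNReal.ofReal (r ^ 3) * V)⁻¹ *
                (ENNReal.ofReal (r ^ 3) * V) ^ (1 / 3 : ℝ)) := by ring
            _ = _ := by rw [e2]; ring
      _ ≤ 8 * rieszConst * V ^ (-(2 / 3) : ℝ) * (4 * rieszKernel x) := by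
          gcongr
          rcases eq_or_ne x 0 with rfl | hx0
          · rw [rieszKernel, enorm_zero, ENNReal.zero_rpow_of_neg (by norm_num), ENNReal.mul_top]
            · exact le_top
            · norm_num
          · rw [rieszKernel_of_ne hx0]
            have : (4 : ℝ≥0∞) = ENNReal.ofReal ((1 / 2 : ℝ) ^ (-2 : ℝ)) := by norm_num
            rw [this, ← ENNReal.ofReal_mul (by positivity),
              ← Real.mul_rpow (by norm_num) (by positivity)]
            exact ENNReal.ofReal_le_ofReal (Real.rpow_le_rpow_of_nonpos
              (by have := norm_pos_iff.2 hx0; positivity) (by linarith) (by norm_num))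
      _ = 32 * rieszConst * V ^ (-(2 / 3) : ℝ) * rieszKernel x := by ring
      _ ≤ _ := by rw [mollifyConst]; gcongr; exact le_add_self

/-- A potential is a superposition of translated kernels, and the kernel bound is invariant under
translation. The constant does not depend on the scale of the bump; this is what supplies dominating
functions in all limits below. -/
lemma lintegral_normed_mul_riesz_le (η : ContDiffBump (0 : R3)) (hη : η.rOut ≤ 2 * η.rIn)
    {h : R3 → ℝ≥0∞} (hh : AEMeasurable h) (x : R3) :
    ∫⁻ a, ENNReal.ofReal (η.normed volume (x - a)) * riesz h a ≤ mollifyConst * riesz h x := by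
  wlog H : Measurable h generalizing h
  · rw [riesz_congr hh.ae_eq_mk]
    exact this hh.measurable_mk.aemeasurable hh.measurable_mk
  have hc := η.continuous_normed (μ := volume)
  calc _ = ∫⁻ a, ∫⁻ y, ENNReal.ofReal (η.normed volume (x - a)) * (h y * rieszKernel (a - y)) := by
        refine lintegral_congr fun a => ?_
        rw [riesz, lintegral_const_mul _ (by fun_prop)]
    _ = ∫⁻ y, ∫⁻ a, ENNReal.ofReal (η.normed volume (x - a)) * (h y * rieszKernel (a - y)) :=
        lintegral_lintegral_swap (by fun_prop)
    _ ≤ ∫⁻ y, mollifyConst * (h y * rieszKernel (x - y)) := by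
        refine lintegral_mono fun y => ?_
        calc _ = h y * ∫⁻ a, ENNReal.ofReal (η.normed volume (x - a)) * rieszKernel (a - y) := by
              rw [← lintegral_const_mul _ (by fun_prop)]
              exact lintegral_congr fun a => by ring
          _ = h y * ∫⁻ a, ENNReal.ofReal (η.normed volume (x - y - a)) * rieszKernel a := by
              congr 1
              rw [← lintegral_sub_right_eq_self (fun a => ENNReal.ofReal
                (η.normed volume (x - y - a)) * rieszKernel a) y]
              simp
          _ ≤ h y * (mollifyConst * rieszKernel (x - y)) := by
              gcongr
              exact lintegral_normed_mul_rieszKernel_le η hη _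
          _ = _ := by ring
    _ = _ := by rw [riesz, lintegral_const_mul _ (by fun_prop)]

/-! ### The force field: domination by Riesz potentials and measurability. -/

lemma hasGradientAt_kernelK (σ : ℝ) {x : R3} (hx : x ≠ 0) :
    HasGradientAt (kernelK σ) (-(σ / (4 * Real.pi) * (‖x‖ ^ 3)⁻¹) • x) x := by
  have hn : ‖x‖ ≠ 0 := norm_ne_zero_iff.2 hx
  have h1 : HasFDerivAt (fun y : R3 => ‖y‖ ^ 2) (2 • innerSL ℝ x) x :=
    (hasStrictFDerivAt_norm_sq x).hasFDerivAt
  have h2 : HasDerivAt (fun s : ℝ => σ / (4 * Real.pi) * (√s)⁻¹)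
      (σ / (4 * Real.pi) * (-(1 / (2 * √(‖x‖ ^ 2))) / (√(‖x‖ ^ 2)) ^ 2)) (‖x‖ ^ 2) :=
    ((Real.hasDerivAt_sqrt (by positivity)).inv (by positivity)).const_mul _
  have h3 := h2.comp_hasFDerivAt x h1
  rw [hasGradientAt_iff_hasFDerivAt]
  have e : kernelK σ = (fun s : ℝ => σ / (4 * Real.pi) * (√s)⁻¹) ∘ fun y : R3 => ‖y‖ ^ 2 := by
    ext y
    simp only [kernelK, Function.comp, Real.sqrt_sq (norm_nonneg y)]
    rw [div_mul_eq_div_div, div_eq_mul_inv (_ / _)]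
  rw [e]
  refine h3.congr_fderiv ?_
  ext v
  rw [Real.sqrt_sq (norm_nonneg x)]
  simp only [FunLike.coe_smul, Pi.smul_apply, smul_eq_mul, nsmul_eq_mul,
    InnerProductSpace.toDual_apply_apply, inner_smul_left, Nat.cast_ofNat]
  simp
  field_simp

lemma enorm_gradient_kernelK_le {σ : ℝ} (hσ : σ = 1 ∨ σ = -1) (x : R3) :
    ‖gradient (kernelK σ) x‖ₑ ≤ rieszKernel x := by
  rcases eq_or_ne x 0 with rfl | hx
  · rw [rieszKernel, enorm_zero, ENNReal.zero_rpow_of_neg (by norm_num)]; exact le_top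
  have hn : 0 < ‖x‖ := norm_pos_iff.2 hx
  rw [(hasGradientAt_kernelK σ hx).gradient, rieszKernel_of_ne hx, ← ofReal_norm]
  refine ENNReal.ofReal_le_ofReal ?_
  have hσ1 : |σ| = 1 := by rcases hσ with rfl | rfl <;> simp
  rw [norm_smul, norm_neg, norm_mul, norm_div, norm_inv, norm_pow, norm_norm, Real.norm_eq_abs,
    hσ1, Real.norm_eq_abs, abs_of_pos (by positivity : 0 < 4 * Real.pi)]
  have : ‖x‖ ^ (-2 : ℝ) = (‖x‖ ^ 3)⁻¹ * ‖x‖ := by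
    rw [Real.rpow_neg hn.le]; norm_cast; field_simp
  rw [this, mul_assoc]
  refine mul_le_of_le_one_left (by positivity) ?_
  rw [div_le_one (by positivity)]
  -- The factor 1/(4π) ≤ 1 is given away.
  nlinarith [Real.pi_gt_three]

lemma measurable_gradient_kernelK (σ : ℝ) : Measurable (gradient (kernelK σ)) := by
  unfold gradient
  exact (InnerProductSpace.toDual ℝ R3).symm.continuous.measurable.comp
    (measurable_fderiv ℝ (kernelK σ))

lemma density_congr {f f' : Phase → ℝ} (e : f =ᵐ[volume] f') :
    density f =ᵐ[volume] density f' := by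
  have := Measure.ae_ae_of_ae_prod e
  filter_upwards [this] with x hx
  exact integral_congr_ae hx

/-- Equality holds at every point, not merely almost everywhere, since the density enters through an
integral. Measurable representatives of f may therefore be substituted freely. -/
lemma forceField_congr (σ : ℝ) {f f' : Phase → ℝ} (e : f =ᵐ[volume] f') :
    forceField σ f = forceField σ f' := by
  ext1 x
  unfold forceField
  congr 1
  exact integral_congr_ae ((density_congr e).mono fun y hy => by simp only [hy])

lemma aestronglyMeasurable_density {f : Phase → ℝ} (hf : AEStronglyMeasurable f) :
    AEStronglyMeasurable (density f) :=
  AEStronglyMeasurable.integral_prod_right' (μ := (volume : Measure R3)) (f := f) hf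

lemma enorm_density_le (f : Phase → ℝ) (y : R3) : ‖density f y‖ₑ ≤ ∫⁻ ξ, ‖f (y, ξ)‖ₑ :=
  enorm_integral_le_lintegral_enorm _

lemma lintegral_enorm_density_le {f : Phase → ℝ} (hf : AEStronglyMeasurable f) :
    ∫⁻ y, ‖density f y‖ₑ ≤ ∫⁻ z, ‖f z‖ₑ := by
  calc _ ≤ ∫⁻ y, ∫⁻ ξ, ‖f (y, ξ)‖ₑ := lintegral_mono fun y => enorm_density_le f y
    _ = _ := (lintegral_prod (μ := (volume : Measure R3)) (ν := (volume : Measure R3)) _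
      hf.enorm).symm

/-- Valid at every x: where the convolution fails to converge the integral takes the value 0. -/
lemma enorm_forceField_le {σ : ℝ} (hσ : σ = 1 ∨ σ = -1) (f : Phase → ℝ) (x : R3) :
    ‖forceField σ f x‖ₑ ≤ riesz (fun y => ‖density f y‖ₑ) x := by
  unfold forceField
  rw [enorm_neg]
  refine (enorm_integral_le_lintegral_enorm _).trans (lintegral_mono fun y => ?_)
  rw [enorm_smul]
  gcongr
  exact enorm_gradient_kernelK_le hσ _

lemma ae_riesz_lt_top {h : R3 → ℝ≥0∞} (hh : AEMeasurable h) (hi : ∫⁻ y, h y ≠ ⊤) :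
    ∀ᵐ x, riesz h x < ⊤ := by
  have hm : Measurable (riesz h) := by
    rw [riesz_congr hh.ae_eq_mk]; exact measurable_riesz hh.measurable_mk
  have : ∀ n : ℕ, ∀ᵐ x, x ∈ Metric.ball (0 : R3) n → riesz h x < ⊤ := fun n => by
    rw [← ae_restrict_iff' measurableSet_ball]
    refine ae_lt_top hm (ne_top_of_le_ne_top ?_ (setLIntegral_riesz_le hh measurableSet_ball))
    exact ENNReal.mul_ne_top (ENNReal.mul_ne_top rieszConst_ne_top hi)
      (ENNReal.rpow_ne_top_of_nonneg (by norm_num) measure_ball_lt_top.ne)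
  rw [← ae_all_iff] at this
  filter_upwards [this] with x hx
  obtain ⟨n, hn⟩ := exists_nat_gt ‖x‖
  exact hx n (by simpa using hn)

/-- Subtracting the two convolutions under the integral needs both to converge absolutely. This
holds wherever the potentials of both densities are finite, hence only almost everywhere. -/
lemma enorm_forceField_sub_le {σ : ℝ} (hσ : σ = 1 ∨ σ = -1) {f₁ f₂ : Phase → ℝ}
    (h₁ : Integrable f₁) (h₂ : Integrable f₂) :
    ∀ᵐ x, ‖forceField σ f₁ x - forceField σ f₂ x‖ₑ ≤
      riesz (fun y => ‖density f₁ y - density f₂ y‖ₑ) x := by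
  have key : ∀ f : Phase → ℝ, Integrable f → ∀ᵐ x,
      Integrable fun y => density f y • gradient (kernelK σ) (x - y) := fun f hf => by
    have hd := aestronglyMeasurable_density hf.1
    have hfin : ∫⁻ y, ‖density f y‖ₑ ≠ ⊤ :=
      ne_top_of_le_ne_top hf.2.ne (lintegral_enorm_density_le hf.1)
    filter_upwards [ae_riesz_lt_top hd.enorm hfin] with x hx
    refine ⟨hd.smul ?_, lt_of_le_of_lt (lintegral_mono fun y => ?_) hx⟩
    · exact ((measurable_gradient_kernelK σ).comp
        (measurable_const.sub measurable_id)).aestronglyMeasurable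
    · rw [enorm_smul]
      gcongr
      exact enorm_gradient_kernelK_le hσ _
  filter_upwards [key f₁ h₁, key f₂ h₂] with x hx₁ hx₂
  unfold forceField
  rw [neg_sub_neg, ← integral_sub hx₂ hx₁]
  refine (enorm_integral_le_lintegral_enorm _).trans (lintegral_mono fun y => ?_)
  rw [← sub_smul, enorm_smul, ← enorm_neg, neg_sub]
  gcongr
  exact enorm_gradient_kernelK_le hσ _

lemma stronglyMeasurable_forceField (σ : ℝ) {f : ℝ → Phase → ℝ}
    (hf : StronglyMeasurable fun p : ℝ × Phase => f p.1 p.2) :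
    StronglyMeasurable fun p : ℝ × R3 => forceField σ (f p.1) p.2 := by
  have hd : StronglyMeasurable fun p : ℝ × R3 => density (f p.1) p.2 := by
    have : StronglyMeasurable fun q : (ℝ × R3) × R3 => f q.1.1 (q.1.2, q.2) :=
      hf.comp_measurable (g := fun q : (ℝ × R3) × R3 => (q.1.1, (q.1.2, q.2))) (by fun_prop)
    exact this.integral_prod_right' (ν := (volume : Measure R3))
  unfold forceField
  refine StronglyMeasurable.neg ?_
  have hk := (measurable_gradient_kernelK σ).stronglyMeasurable
  have : StronglyMeasurable fun q : (ℝ × R3) × R3 =>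
      density (f q.1.1) q.2 • gradient (kernelK σ) (q.1.2 - q.2) :=
    (hd.comp_measurable (g := fun q : (ℝ × R3) × R3 => (q.1.1, q.2)) (by fun_prop)).smul
      (hk.comp_measurable (by fun_prop))
  exact this.integral_prod_right' (ν := (volume : Measure R3))

lemma aestronglyMeasurable_forceField (σ : ℝ) {f : ℝ → Phase → ℝ} {τ : Measure ℝ} [SFinite τ]
    (hf : AEStronglyMeasurable (fun p : ℝ × Phase => f p.1 p.2) (τ.prod volume)) :
    AEStronglyMeasurable (fun p : ℝ × R3 => forceField σ (f p.1) p.2) (τ.prod volume) := by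
  set f' := fun t z => hf.mk _ (t, z) with hf'
  have e : ∀ᵐ t ∂τ, f t =ᵐ[volume] f' t := Measure.ae_ae_of_ae_prod hf.ae_eq_mk
  refine ⟨fun p => forceField σ (f' p.1) p.2,
    stronglyMeasurable_forceField σ hf.stronglyMeasurable_mk, ?_⟩
  have := (Measure.quasiMeasurePreserving_fst (μ := τ) (ν := (volume : Measure R3))).ae e
  filter_upwards [this] with p hp
  rw [forceField_congr σ hp]

/-! ### The fixed-time estimate of the force difference. -/

lemma mul_mixedLorentzNorm_le_rate (Cinf : ℝ≥0) (f : Phase → ℝ) (g : Phase → R3) :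
    (Cinf : ℝ≥0∞) ^ (1 / 2 : ℝ) * mixedLorentzNorm 3 1 g ≤ rate Cinf f g := le_add_self

lemma lintegral_prod_mul_left {a : R3 → ℝ≥0∞} {b : Phase → ℝ≥0∞} (ha : AEMeasurable a)
    (hb : AEMeasurable b) : ∫⁻ z : Phase, a z.1 * b z = ∫⁻ x, a x * ∫⁻ ξ, b (x, ξ) := by
  have ha' : AEMeasurable (fun z : Phase => a z.1) :=
    ha.comp_quasiMeasurePreserving Measure.quasiMeasurePreserving_fst
  rw [show (volume : Measure Phase) = (volume : Measure R3).prod volume from rfl,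
    lintegral_prod _ (ha'.fun_mul hb)]
  have hb' : ∀ᵐ x, AEMeasurable (fun ξ => b (x, ξ)) := by
    have e := Measure.ae_ae_of_ae_prod (μ := (volume : Measure R3)) hb.ae_eq_mk
    filter_upwards [e] with x hx
    exact ⟨fun ξ => hb.mk b (x, ξ), hb.measurable_mk.comp measurable_prodMk_left, hx⟩
  refine lintegral_congr_ae ?_
  filter_upwards [hb'] with x hx
  exact lintegral_const_mul'' _ hx

lemma aemeasurable_riesz {h : R3 → ℝ≥0∞} (hh : AEMeasurable h) : AEMeasurable (riesz h) := by
  rw [riesz_congr hh.ae_eq_mk]; exact (measurable_riesz hh.measurable_mk).aemeasurable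

lemma aemeasurable_lintegral_slice {b : Phase → ℝ≥0∞} (hb : AEMeasurable b) :
    AEMeasurable fun x : R3 => ∫⁻ ξ, b (x, ξ) :=
  AEMeasurable.lintegral_prod_right' (μ := (volume : Measure R3)) hb

/-- Integrating first in ξ reduces to the pairing of a potential of an L¹ function with L^{3,1}.
With h = |ρ| this makes E·∇_ξ√f₂ integrable on phase space, on which every passage to the limit
rests. -/
lemma lintegral_riesz_mul_enorm_le {h : R3 → ℝ≥0∞} (hh : AEMeasurable h) {g : Phase → R3}
    (hg : AEStronglyMeasurable g) :
    ∫⁻ z, riesz h z.1 * ‖g z‖ₑ ≤ rieszConst * (∫⁻ y, h y) * mixedLorentzNorm 3 1 g := by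
  rw [lintegral_prod_mul_left (aemeasurable_riesz hh) hg.enorm]
  unfold mixedLorentzNorm
  simp_rw [eLpNorm_one_eq_lintegral_enorm]
  exact lintegral_riesz_mul_le_lorentz hh (aemeasurable_lintegral_slice hg.enorm)

lemma aemeasurable_slice {b : Phase → ℝ≥0∞} (hb : AEMeasurable b) :
    ∀ᵐ x : R3, AEMeasurable fun ξ => b (x, ξ) := by
  have e := Measure.ae_ae_of_ae_prod (μ := (volume : Measure R3)) hb.ae_eq_mk
  filter_upwards [e] with x hx
  exact ⟨fun ξ => hb.mk b (x, ξ), hb.measurable_mk.comp measurable_prodMk_left, hx⟩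

lemma lintegral_mul_le_sqrt {f g : R3 → ℝ≥0∞} (hf : AEMeasurable f) (hg : AEMeasurable g) :
    ∫⁻ x, f x * g x ≤ (∫⁻ x, f x ^ (2 : ℝ)) ^ (1 / 2 : ℝ) * (∫⁻ x, g x ^ (2 : ℝ)) ^ (1 / 2 : ℝ) :=
  ENNReal.lintegral_mul_le_Lp_mul_Lq volume Real.HolderConjugate.two_two hf hg

/-- Hardy–Littlewood–Sobolev puts d in L² and the product d b in L^{6/5}; Hölder then splits the
product according to 5/6 = 1/2 + 1/3. -/
lemma lintegral_riesz_mul_mul_le {d b : R3 → ℝ≥0∞} (hd : AEMeasurable d) (hb : AEMeasurable b) :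
    ∫⁻ x, riesz d x * (d x * b x) ≤
      4 * rieszConst * ((∫⁻ x, d x ^ (2 : ℝ)) * (∫⁻ x, b x ^ (3 : ℝ)) ^ (1 / 3 : ℝ)) := by
  refine (lintegral_riesz_mul_le hd (hd.fun_mul hb)).trans (mul_le_mul_right ?_ _)
  -- The conjugate pair is chosen so that (6/5)(5/3) = 2 and (6/5)(5/2) = 3.
  have hol := ENNReal.lintegral_mul_le_Lp_mul_Lq (volume : Measure R3)
    (p := 5 / 3) (q := 5 / 2) (Real.holderConjugate_iff.2 ⟨by norm_num, by norm_num⟩)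
    (f := fun x => d x ^ (6 / 5 : ℝ)) (g := fun x => b x ^ (6 / 5 : ℝ)) (by fun_prop) (by fun_prop)
  set D := ∫⁻ x, d x ^ (2 : ℝ)
  set B := ∫⁻ x, b x ^ (3 : ℝ)
  have h1 : ∫⁻ x, (d x * b x) ^ (6 / 5 : ℝ) ≤ D ^ (3 / 5 : ℝ) * B ^ (2 / 5 : ℝ) := by
    calc _ = ∫⁻ x, ((fun x => d x ^ (6 / 5 : ℝ)) * (fun x => b x ^ (6 / 5 : ℝ))) x :=
          lintegral_congr fun x => ENNReal.mul_rpow_of_nonneg _ _ (by norm_num)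
      _ ≤ _ := hol
      _ = _ := by simp_rw [← ENNReal.rpow_mul]; norm_num [D, B]
  calc _ ≤ D ^ (1 / 2 : ℝ) * (D ^ (3 / 5 : ℝ) * B ^ (2 / 5 : ℝ)) ^ (5 / 6 : ℝ) :=
        mul_le_mul_right (ENNReal.rpow_le_rpow h1 (by norm_num)) _
    _ = D ^ (1 / 2 : ℝ) * D ^ (1 / 2 : ℝ) * B ^ (1 / 3 : ℝ) := by
        rw [ENNReal.mul_rpow_of_nonneg _ _ (by norm_num), ← ENNReal.rpow_mul, ← ENNReal.rpow_mul]
        norm_num [mul_assoc]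
    _ = _ := by
        rw [← ENNReal.rpow_add_of_nonneg _ _ (by norm_num) (by norm_num)]
        norm_num [D, B]

/-- From a - b = (√a-√b)² + 2√b(√a-√b). The asymmetric form keeps only √b, so that only the density
of the second solution has to be bounded. -/
lemma abs_sub_le_sq_sqrt {a b : ℝ} (ha : 0 ≤ a) (hb : 0 ≤ b) :
    |a - b| ≤ (√a - √b) ^ 2 + 2 * (√b * |√a - √b|) := by
  have h1 : a - b = (√a - √b) * (√a - √b) + 2 * (√b * (√a - √b)) := by
    nlinarith [Real.sq_sqrt ha, Real.sq_sqrt hb]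
  rw [h1]
  refine (abs_add_le _ _).trans ?_
  rw [abs_mul_self, abs_mul 2, abs_mul (√b), abs_of_nonneg (Real.sqrt_nonneg b),
    abs_of_pos (zero_lt_two : (0 : ℝ) < 2)]
  exact le_of_eq (by ring)

/-- The fixed-time estimate of the force difference tested against `∇_ξ √f₂`. -/
theorem lintegral_forceField_sub_le {σ : ℝ} (hσ : σ = 1 ∨ σ = -1) (Cinf : ℝ≥0)
    {f₁ f₂ : Phase → ℝ} {g : Phase → R3} (h₁ : Integrable f₁) (h₂ : Integrable f₂)
    (p₁ : ∀ᵐ z, 0 ≤ f₁ z) (p₂ : ∀ᵐ z, 0 ≤ f₂ z)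
    (b₁ : ∀ᵐ z, f₁ z ≤ Cinf) (b₂ : ∀ᵐ z, f₂ z ≤ Cinf) (hg : AEStronglyMeasurable g) :
    ∫⁻ z : Phase, ‖forceField σ f₁ z.1 - forceField σ f₂ z.1‖ₑ *
        (‖√(f₁ z) - √(f₂ z)‖ₑ * ‖g z‖ₑ) ≤
      8 * rieszConst * rate Cinf f₂ g * ∫⁻ z, ‖√(f₁ z) - √(f₂ z)‖ₑ ^ (2 : ℝ) := by
  set w : Phase → ℝ≥0∞ := fun z => ‖√(f₁ z) - √(f₂ z)‖ₑ with hw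
  have mw : AEMeasurable w := by
    have m1 := h₁.1.aemeasurable; have m2 := h₂.1.aemeasurable
    exact ((m1.sqrt).sub (m2.sqrt)).enorm
  set D : R3 → ℝ≥0∞ := fun x => ∫⁻ ξ, w (x, ξ) ^ (2 : ℝ) with hD
  have mD : AEMeasurable D := aemeasurable_lintegral_slice (mw.pow_const _)
  set b : R3 → ℝ≥0∞ := fun x => eLpNorm (fun ξ => g (x, ξ)) 2 volume with hb
  have eb : b = fun x => (∫⁻ ξ, ‖g (x, ξ)‖ₑ ^ (2 : ℝ)) ^ (1 / 2 : ℝ) := by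
    ext x
    simp [hb, eLpNorm_eq_lintegral_rpow_enorm_toReal]
  have mb : AEMeasurable b := by
    rw [eb]; exact (aemeasurable_lintegral_slice (hg.enorm.pow_const _)).pow_const _
  set c : ℝ≥0∞ := eLpNorm (density f₂) ⊤ volume ^ (1 / 2 : ℝ) with hc
  -- Integrate the pointwise inequality in ξ; the cross term is treated by Cauchy–Schwarz, using ∫
  -- (√f₂)² dξ = ρ₂ ≤ ‖ρ₂‖_∞.
  have hρ : ∀ᵐ y, ‖density f₁ y - density f₂ y‖ₑ ≤ D y + 2 * c * D y ^ (1 / 2 : ℝ) := by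
    have i1 := (show Integrable f₁ ((volume : Measure R3).prod volume) from h₁).prod_right_ae
    have i2 := (show Integrable f₂ ((volume : Measure R3).prod volume) from h₂).prod_right_ae
    have q1 := Measure.ae_ae_of_ae_prod (μ := (volume : Measure R3)) p₁
    have q2 := Measure.ae_ae_of_ae_prod (μ := (volume : Measure R3)) p₂
    have hsup := ae_le_eLpNormEssSup (f := density f₂) (μ := volume)
    filter_upwards [i1, i2, q1, q2, hsup, aemeasurable_slice mw] with y i1 i2 q1 q2 hs mwy
    have e2 : ∫⁻ ξ, ‖√(f₂ (y, ξ))‖ₑ ^ (2 : ℝ) ≤ eLpNorm (density f₂) ⊤ volume := by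
      rw [eLpNorm_exponent_top]
      refine le_trans (le_of_eq ?_) hs
      have hd0 : 0 ≤ density f₂ y := integral_nonneg_of_ae q2
      rw [← ofReal_norm, Real.norm_of_nonneg hd0, density,
        ofReal_integral_eq_lintegral_ofReal i2 q2]
      refine lintegral_congr_ae (q2.mono fun ξ hξ => ?_)
      dsimp only
      rw [← ofReal_norm, ENNReal.ofReal_rpow_of_nonneg (norm_nonneg _) (by norm_num),
        Real.norm_of_nonneg (Real.sqrt_nonneg _)]
      congr 1
      norm_cast
      exact Real.sq_sqrt hξ
    have mu2 : AEMeasurable fun ξ => ‖√(f₂ (y, ξ))‖ₑ := i2.1.aemeasurable.sqrt.enorm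
    calc ‖density f₁ y - density f₂ y‖ₑ = ‖∫ ξ, (f₁ (y, ξ) - f₂ (y, ξ))‖ₑ := by
          rw [density, density, integral_sub i1 i2]
      _ ≤ ∫⁻ ξ, ‖f₁ (y, ξ) - f₂ (y, ξ)‖ₑ := enorm_integral_le_lintegral_enorm _
      _ ≤ ∫⁻ ξ, (w (y, ξ) ^ (2 : ℝ) + 2 * (‖√(f₂ (y, ξ))‖ₑ * w (y, ξ))) := by
          refine lintegral_mono_ae ?_
          filter_upwards [q1, q2] with ξ h1 h2
          have := abs_sub_le_sq_sqrt h1 h2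
          have h2 := ENNReal.ofReal_le_ofReal this
          rw [ENNReal.ofReal_add (by positivity) (by positivity),
            ENNReal.ofReal_mul (by norm_num), ENNReal.ofReal_mul (by positivity),
            ← sq_abs, ENNReal.ofReal_pow (by positivity)] at h2
          simp only [hw, ← ofReal_norm, Real.norm_eq_abs,
            abs_of_nonneg (Real.sqrt_nonneg (f₂ (y, ξ)))]
          simpa using h2
      _ = D y + 2 * ∫⁻ ξ, ‖√(f₂ (y, ξ))‖ₑ * w (y, ξ) := by
          rw [lintegral_add_left' (mwy.pow_const _), lintegral_const_mul' _ _ (by simp)]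
      _ ≤ D y + 2 * (c * D y ^ (1 / 2 : ℝ)) := by
          gcongr
          refine (lintegral_mul_le_sqrt mu2 mwy).trans ?_
          gcongr
          rw [hc]
          gcongr
      _ = _ := by ring
  have hE := enorm_forceField_sub_le hσ h₁ h₂
  have hE' : ∀ᵐ x, ‖forceField σ f₁ x - forceField σ f₂ x‖ₑ ≤
      riesz D x + 2 * c * riesz (fun y => D y ^ (1 / 2 : ℝ)) x := by
    filter_upwards [hE] with x hx
    refine hx.trans ((riesz_mono hρ x).trans_eq ?_)
    rw [← riesz_const_mul (mD.pow_const _)]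
    unfold riesz
    simp_rw [add_mul]
    rw [lintegral_add_left' (mD.fun_mul (by fun_prop))]
  have hEz : ∀ᵐ z : Phase, ‖forceField σ f₁ z.1 - forceField σ f₂ z.1‖ₑ ≤
      riesz D z.1 + 2 * c * riesz (fun y => D y ^ (1 / 2 : ℝ)) z.1 :=
    (Measure.quasiMeasurePreserving_fst (μ := (volume : Measure R3))
      (ν := (volume : Measure R3))).ae hE'
  have mr1 := aemeasurable_riesz mD
  have mr2 := aemeasurable_riesz (mD.pow_const (1 / 2 : ℝ))
  have hwC : ∀ᵐ z, w z ≤ (Cinf : ℝ≥0∞) ^ (1 / 2 : ℝ) := by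
    filter_upwards [p₁, p₂, b₁, b₂] with z p₁ p₂ b₁ b₂
    have hle : |√(f₁ z) - √(f₂ z)| ≤ √(Cinf : ℝ) := by
      have s1 := Real.sqrt_le_sqrt b₁
      have s2 := Real.sqrt_le_sqrt b₂
      have n1 := Real.sqrt_nonneg (f₁ z)
      have n2 := Real.sqrt_nonneg (f₂ z)
      rw [abs_le]; constructor <;> linarith
    simp only [hw]
    rw [← ofReal_norm, Real.norm_eq_abs]
    refine (ENNReal.ofReal_le_ofReal hle).trans_eq ?_
    rw [Real.sqrt_eq_rpow, ← ENNReal.ofReal_rpow_of_nonneg (by positivity) (by norm_num)]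
    simp
  have hDtot : ∫⁻ x, D x = ∫⁻ z, w z ^ (2 : ℝ) :=
    (lintegral_prod (μ := (volume : Measure R3)) (ν := (volume : Measure R3)) _
      (mw.pow_const _)).symm
  -- One factor w is spent on the bound C_∞^{1/2}; the quadratic smallness is already contained in
  -- D.
  have T1 : ∫⁻ z : Phase, riesz D z.1 * (w z * ‖g z‖ₑ) ≤
      rieszConst * (∫⁻ x, D x) * ((Cinf : ℝ≥0∞) ^ (1 / 2 : ℝ) * mixedLorentzNorm 3 1 g) := by
    calc _ ≤ ∫⁻ z : Phase, (Cinf : ℝ≥0∞) ^ (1 / 2 : ℝ) * (riesz D z.1 * ‖g z‖ₑ) := by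
          refine lintegral_mono_ae (hwC.mono fun z hz => ?_)
          calc riesz D z.1 * (w z * ‖g z‖ₑ)
              ≤ riesz D z.1 * ((Cinf : ℝ≥0∞) ^ (1 / 2 : ℝ) * ‖g z‖ₑ) := by gcongr
            _ = _ := by ring
      _ = (Cinf : ℝ≥0∞) ^ (1 / 2 : ℝ) * ∫⁻ z : Phase, riesz D z.1 * ‖g z‖ₑ :=
          lintegral_const_mul' _ _ (ENNReal.rpow_ne_top_of_nonneg (by norm_num) (by simp))
      _ ≤ (Cinf : ℝ≥0∞) ^ (1 / 2 : ℝ) *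
          (rieszConst * (∫⁻ y, D y) * mixedLorentzNorm 3 1 g) := by
          gcongr; exact lintegral_riesz_mul_enorm_le mD hg
      _ = _ := by ring
  -- Cauchy–Schwarz in ξ turns w|g| into D^{1/2} times the L²_ξ norm of g, so D^{1/2} occurs twice
  -- and produces the total mass of D.
  have T2 : ∫⁻ z : Phase, riesz (fun y => D y ^ (1 / 2 : ℝ)) z.1 * (w z * ‖g z‖ₑ) ≤
      4 * rieszConst * ((∫⁻ x, D x) * mixedNorm 3 2 g) := by
    rw [lintegral_prod_mul_left mr2 (mw.fun_mul hg.enorm)]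
    calc _ ≤ ∫⁻ x, riesz (fun y => D y ^ (1 / 2 : ℝ)) x * (D x ^ (1 / 2 : ℝ) * b x) := by
          refine lintegral_mono_ae ?_
          filter_upwards [aemeasurable_slice mw, aemeasurable_slice hg.enorm] with x h1 h2
          gcongr
          rw [eb]
          exact lintegral_mul_le_sqrt h1 h2
      _ ≤ _ := lintegral_riesz_mul_mul_le (mD.pow_const _) mb
      _ = _ := by
          have e1 : ∀ x, (D x ^ (1 / 2 : ℝ)) ^ (2 : ℝ) = D x := fun x => by
            rw [← ENNReal.rpow_mul]; norm_num
          have e2 : (∫⁻ x, b x ^ (3 : ℝ)) ^ (1 / 3 : ℝ) = mixedNorm 3 2 g := by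
            rw [mixedNorm, eLpNorm_eq_lintegral_rpow_enorm_toReal (by simp) (by simp)]
            simp [hb]
          simp_rw [e1, e2]
  have mwg := mw.fun_mul hg.enorm
  calc _ ≤ ∫⁻ z : Phase, (riesz D z.1 * (w z * ‖g z‖ₑ) +
          2 * c * (riesz (fun y => D y ^ (1 / 2 : ℝ)) z.1 * (w z * ‖g z‖ₑ))) := by
        refine lintegral_mono_ae (hEz.mono fun z hz => ?_)
        calc _ ≤ (riesz D z.1 + 2 * c * riesz (fun y => D y ^ (1 / 2 : ℝ)) z.1) *
              (w z * ‖g z‖ₑ) := by gcongr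
          _ = _ := by ring
    _ = (∫⁻ z : Phase, riesz D z.1 * (w z * ‖g z‖ₑ)) +
          2 * c * ∫⁻ z : Phase, riesz (fun y => D y ^ (1 / 2 : ℝ)) z.1 * (w z * ‖g z‖ₑ) := by
        have q1 : AEMeasurable (fun z : Phase => riesz D z.1) :=
          mr1.comp_quasiMeasurePreserving Measure.quasiMeasurePreserving_fst
        have q2 : AEMeasurable (fun z : Phase => riesz (fun y => D y ^ (1 / 2 : ℝ)) z.1) :=
          mr2.comp_quasiMeasurePreserving Measure.quasiMeasurePreserving_fst
        rw [lintegral_add_left' (q1.fun_mul mwg), lintegral_const_mul'' _ (q2.fun_mul mwg)]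
    _ ≤ rieszConst * (∫⁻ x, D x) * ((Cinf : ℝ≥0∞) ^ (1 / 2 : ℝ) * mixedLorentzNorm 3 1 g) +
          2 * c * (4 * rieszConst * ((∫⁻ x, D x) * mixedNorm 3 2 g)) := by gcongr
    -- The second term carries 2·4 = 8; the first is enlarged to the same factor so that `rate` can
    -- be taken out.
    _ ≤ 8 * (rieszConst * (∫⁻ x, D x) *
          ((Cinf : ℝ≥0∞) ^ (1 / 2 : ℝ) * mixedLorentzNorm 3 1 g)) +
          2 * c * (4 * rieszConst * ((∫⁻ x, D x) * mixedNorm 3 2 g)) := by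
        refine add_le_add_left (le_mul_of_one_le_left' ?_) _
        norm_num
    _ = 8 * rieszConst * rate Cinf f₂ g * ∫⁻ x, D x := by
        rw [rate, ← hc]; ring
    _ = _ := by rw [hDtot]

/-! ### Mollification on phase space. -/

instance : (volume : Measure Phase).IsAddHaarMeasure :=
  inferInstanceAs ((volume : Measure R3).prod (volume : Measure R3)).IsAddHaarMeasure

instance : (volume : Measure Phase).IsNegInvariant :=
  Measure.IsAddHaarMeasure.isNegInvariant_of_regular _

/-- Convolution of a function on phase space with a kernel `H`. -/
noncomputable def mollify (H f : Phase → ℝ) : Phase → ℝ :=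
  convolution f H (ContinuousLinearMap.mul ℝ ℝ) volume

lemma mollify_apply (H f : Phase → ℝ) (w : Phase) : mollify H f w = ∫ z, f z * H (w - z) := rfl

/-- A smooth even probability density supported in the unit ball. -/
structure IsMollifier (H : Phase → ℝ) : Prop where
  contDiff : ContDiff ℝ ∞ H
  support : Function.support H ⊆ Metric.closedBall 0 1
  nonneg : ∀ z, 0 ≤ H z
  even : ∀ z, H (-z) = H z
  lintegral_eq : ∫⁻ z, ENNReal.ofReal (H z) = 1

namespace IsMollifier

variable {H : Phase → ℝ}

lemma hasCompactSupport (hH : IsMollifier H) : HasCompactSupport H :=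
  HasCompactSupport.of_support_subset_isCompact (isCompact_closedBall 0 1) hH.support

lemma continuous (hH : IsMollifier H) : Continuous H := hH.contDiff.continuous

lemma sub_comm (hH : IsMollifier H) (w z : Phase) : H (w - z) = H (z - w) := by
  rw [← hH.even, neg_sub]

lemma enorm_eq (hH : IsMollifier H) (z : Phase) : ‖H z‖ₑ = ENNReal.ofReal (H z) :=
  Real.enorm_of_nonneg (hH.nonneg z)

lemma integrable (hH : IsMollifier H) : Integrable H :=
  hH.continuous.integrable_of_hasCompactSupport hH.hasCompactSupport

lemma lintegral_sub_left (hH : IsMollifier H) (w : Phase) :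
    ∫⁻ z, ENNReal.ofReal (H (w - z)) = 1 := by
  rw [lintegral_sub_left_eq_self (fun z => ENNReal.ofReal (H z)), hH.lintegral_eq]

lemma lintegral_sub_right (hH : IsMollifier H) (z : Phase) :
    ∫⁻ w, ENNReal.ofReal (H (w - z)) = 1 := by
  rw [lintegral_sub_right_eq_self (fun z => ENNReal.ofReal (H z)), hH.lintegral_eq]

lemma integral_sub_left (hH : IsMollifier H) (w : Phase) : ∫ z, H (w - z) = 1 := by
  have h1 : ∫ z, H z = 1 := by
    rw [integral_eq_lintegral_of_nonneg_ae (Eventually.of_forall hH.nonneg)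
      hH.continuous.aestronglyMeasurable, hH.lintegral_eq, ENNReal.toReal_one]
  rw [integral_sub_left_eq_self H volume w, h1]

lemma contDiff_mollify (hH : IsMollifier H) {f : Phase → ℝ} (hf : LocallyIntegrable f) :
    ContDiff ℝ ∞ (mollify H f) :=
  hH.hasCompactSupport.contDiff_convolution_right (n := ⊤) _ hf hH.contDiff

lemma integrable_mul_sub (hH : IsMollifier H) {f : Phase → ℝ} (hf : LocallyIntegrable f)
    (w : Phase) : Integrable fun z => f z * H (w - z) := by
  simp_rw [mul_comm (f _)]
  refine hf.integrable_smul_left_of_hasCompactSupport (g := fun z => H (w - z))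
    (hH.continuous.comp (by fun_prop)) ?_
  exact hH.hasCompactSupport.comp_homeomorph (Homeomorph.subLeft w)

lemma fderiv_mollify (hH : IsMollifier H) {f : Phase → ℝ} (hf : LocallyIntegrable f)
    (w y : Phase) : fderiv ℝ (mollify H f) w y = ∫ z, f z * fderiv ℝ H (w - z) y := by
  have h1 : ContDiff ℝ 1 H := hH.contDiff.of_le (by norm_cast)
  have h := (hH.hasCompactSupport.hasFDerivAt_convolution_right
    (ContinuousLinearMap.mul ℝ ℝ) hf h1 w).fderiv
  unfold mollify
  rw [h, convolution_precompR_apply _ hf (hH.hasCompactSupport.fderiv ℝ)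
    (h1.continuous_fderiv one_ne_zero)]
  rfl

lemma enorm_mollify_le (hH : IsMollifier H) (f : Phase → ℝ) (w : Phase) :
    ‖mollify H f w‖ₑ ≤ ∫⁻ z, ‖f z‖ₑ * ENNReal.ofReal (H (w - z)) := by
  rw [mollify_apply]
  refine (enorm_integral_le_lintegral_enorm _).trans_eq ?_
  simp_rw [enorm_mul, hH.enorm_eq]

lemma abs_mollify_le (hH : IsMollifier H) {f : Phase → ℝ} {M : ℝ} (hM : 0 ≤ M)
    (hf : ∀ᵐ z, |f z| ≤ M) (w : Phase) : |mollify H f w| ≤ M := by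
  have h := hH.enorm_mollify_le f w
  have h2 : ∫⁻ z, ‖f z‖ₑ * ENNReal.ofReal (H (w - z)) ≤
      ∫⁻ z, ENNReal.ofReal M * ENNReal.ofReal (H (w - z)) := by
    refine lintegral_mono_ae (hf.mono fun z hz => ?_)
    gcongr
    rw [← ofReal_norm]
    exact ENNReal.ofReal_le_ofReal hz
  rw [lintegral_const_mul' _ _ (by simp), hH.lintegral_sub_left, mul_one] at h2
  have h3 := h.trans h2
  rw [← ofReal_norm, ENNReal.ofReal_le_ofReal_iff hM] at h3
  exact h3

lemma aemeasurable_mul_sub (hH : IsMollifier H) {f : Phase → ℝ} (hf : AEStronglyMeasurable f) :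
    AEMeasurable (fun p : Phase × Phase => ‖f p.2‖ₑ * ENNReal.ofReal (H (p.1 - p.2)))
      (volume.prod volume) := by
  have h1 : AEMeasurable (fun p : Phase × Phase => ‖f p.2‖ₑ) (volume.prod volume) :=
    hf.enorm.comp_quasiMeasurePreserving Measure.quasiMeasurePreserving_snd
  have h2 : Measurable fun p : Phase × Phase => ENNReal.ofReal (H (p.1 - p.2)) := by
    have := hH.continuous.measurable; fun_prop
  exact h1.fun_mul h2.aemeasurable

lemma lintegral_enorm_mollify_le (hH : IsMollifier H) {f : Phase → ℝ}
    (hf : AEStronglyMeasurable f) : ∫⁻ w, ‖mollify H f w‖ₑ ≤ ∫⁻ z, ‖f z‖ₑ := by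
  calc _ ≤ ∫⁻ w, ∫⁻ z, ‖f z‖ₑ * ENNReal.ofReal (H (w - z)) :=
        lintegral_mono fun w => hH.enorm_mollify_le f w
    _ = ∫⁻ z, ∫⁻ w, ‖f z‖ₑ * ENNReal.ofReal (H (w - z)) :=
        lintegral_lintegral_swap (hH.aemeasurable_mul_sub hf)
    _ = _ := by
        refine lintegral_congr fun z => ?_
        rw [lintegral_const_mul' _ _ (by simp), hH.lintegral_sub_right, mul_one]

/-- Mollification is symmetric with respect to the pairing `∫ f k`. -/
lemma integral_mollify_mul (hH : IsMollifier H) {f k : Phase → ℝ} (hf : LocallyIntegrable f)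
    (hk : Continuous k) (hks : HasCompactSupport k) :
    ∫ w, mollify H f w * k w = ∫ z, f z * mollify H k z := by
  have hint : Integrable (fun p : Phase × Phase => f p.2 * (H (p.1 - p.2) * k p.1))
      (volume.prod volume) := by
    rw [integrable_prod_iff']
    · obtain ⟨R, hR⟩ := hks.isCompact.isBounded.subset_closedBall 0
      obtain ⟨c, hc⟩ := hk.bounded_above_of_compact_support hks
      have hc0 : 0 ≤ c := (norm_nonneg _).trans (hc 0)
      constructor
      · refine Eventually.of_forall fun z => ?_
        have := hH.continuous
        exact (Continuous.integrable_of_hasCompactSupport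
          (f := fun w => H (w - z) * k w) (μ := volume) (by fun_prop) hks.mul_left).const_mul (f z)
      -- The kernel lives in the unit ball and k in the ball of radius R, so only |z| ≤ R + 1
      -- matters; there the kernel has mass one and k is at most c.
      · have hb : Integrable fun z => (c * (Metric.closedBall (0 : Phase) (R + 1)).indicator 1 z) *
            ‖f z‖ := by
          have hi : IntegrableOn (fun z => ‖f z‖) (Metric.closedBall (0 : Phase) (R + 1)) :=
            (hf.integrableOn_isCompact (isCompact_closedBall 0 (R + 1))).norm
          have := ((integrable_indicator_iff measurableSet_closedBall).2 hi).const_mul c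
          refine this.congr (Eventually.of_forall fun z => ?_)
          by_cases hz : z ∈ Metric.closedBall (0 : Phase) (R + 1) <;> simp [hz]
        refine hb.mono' ?_ (Eventually.of_forall fun z => ?_)
        · have m1 : AEStronglyMeasurable (fun p : Phase × Phase => f p.1 * (H (p.2 - p.1) * k p.2))
              (volume.prod volume) := by
            refine (hf.aestronglyMeasurable.comp_quasiMeasurePreserving
              Measure.quasiMeasurePreserving_fst).mul (Continuous.aestronglyMeasurable ?_)
            have := hH.continuous; fun_prop
          exact m1.norm.integral_prod_right'
        · dsimp only
          rw [Real.norm_of_nonneg (integral_nonneg fun _ => norm_nonneg _)]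
          by_cases hz : z ∈ Metric.closedBall (0 : Phase) (R + 1)
          · simp only [indicator_of_mem hz, Pi.one_apply, mul_one]
            have hle : ∀ w, ‖f z * (H (w - z) * k w)‖ ≤ (c * ‖f z‖) * H (z - w) := fun w => by
              rw [norm_mul, norm_mul, Real.norm_of_nonneg (hH.nonneg _), hH.sub_comm]
              have := hc w
              have h0 := hH.nonneg (z - w)
              have := mul_le_mul_of_nonneg_left this (mul_nonneg (norm_nonneg (f z)) h0)
              linarith
            calc _ ≤ ∫ w, (c * ‖f z‖) * H (z - w) :=
                  integral_mono_of_nonneg (Eventually.of_forall fun _ => norm_nonneg _)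
                    ((hH.integrable.comp_sub_left z).const_mul _) (Eventually.of_forall hle)
              _ = _ := by rw [integral_const_mul, hH.integral_sub_left, mul_one]
          · have h0 : ∀ w, ‖f z * (H (w - z) * k w)‖ = 0 := fun w => by
              by_contra hne
              rw [norm_eq_zero, mul_eq_zero, mul_eq_zero, not_or, not_or] at hne
              have h1 : w ∈ Metric.closedBall (0 : Phase) R := hR (subset_tsupport _ hne.2.2)
              have h2 : w - z ∈ Metric.closedBall (0 : Phase) 1 := hH.support hne.2.1
              rw [mem_closedBall_zero_iff] at h1 h2 hz
              have := norm_sub_le w (w - z)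
              simp only [sub_sub_cancel] at this
              exact hz (by linarith)
            simp [h0, hz]
    · refine (hf.aestronglyMeasurable.comp_quasiMeasurePreserving
        Measure.quasiMeasurePreserving_snd).mul (Continuous.aestronglyMeasurable ?_)
      have := hH.continuous; fun_prop
  calc _ = ∫ w, ∫ z, f z * (H (w - z) * k w) := by
        refine integral_congr_ae (Eventually.of_forall fun w => ?_)
        dsimp only
        rw [mollify_apply, ← integral_mul_const]
        simp_rw [mul_assoc]
    _ = ∫ z, ∫ w, f z * (H (w - z) * k w) :=
        integral_integral_swap (f := fun w z => f z * (H (w - z) * k w)) hint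
    _ = _ := by
        refine integral_congr_ae (Eventually.of_forall fun z => ?_)
        dsimp only
        rw [mollify_apply, ← integral_const_mul]
        refine integral_congr_ae (Eventually.of_forall fun w => ?_)
        dsimp only
        rw [hH.sub_comm]; ring

end IsMollifier

/-- Translations are continuous in `L¹`. -/
lemma tendsto_lintegral_translate {v : Phase → ℝ} (hv : Integrable v) :
    Tendsto (fun a => ∫⁻ w, ‖v (w - a) - v w‖ₑ) (𝓝 0) (𝓝 0) := by
  have hv1 : MemLp v 1 volume := memLp_one_iff_integrable.2 hv
  set f : Lp ℝ 1 (volume : Measure Phase) := hv1.toLp v with hf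
  let G : C(Phase, C(Phase, Phase)) :=
    (ContinuousMap.mk (fun p : Phase × Phase => p.2 - p.1) (by fun_prop)).curry
  have hG : ∀ a, MeasurePreserving (G a) volume volume := fun a =>
    measurePreserving_sub_right volume a
  have hc : Continuous fun a => Lp.compMeasurePreserving (G a) (hG a) f :=
    Continuous.compMeasurePreservingLp continuous_const G.continuous hG (by simp)
  have h0 : Tendsto (fun a => ‖Lp.compMeasurePreserving (G a) (hG a) f -
      Lp.compMeasurePreserving (G 0) (hG 0) f‖ₑ) (𝓝 0) (𝓝 0) := by
    have := ((hc.sub (continuous_const (y := Lp.compMeasurePreserving (G 0) (hG 0) f))).enorm).tendsto 0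
    simpa using this
  refine h0.congr fun a => ?_
  rw [hf, Lp.toLp_compMeasurePreserving hv1, Lp.toLp_compMeasurePreserving hv1, ← MemLp.toLp_sub,
    Lp.enorm_toLp, eLpNorm_one_eq_lintegral_enorm]
  refine lintegral_congr fun w => ?_
  simp [G]

/-- The L¹ error is at most the average, with weight H, of the L¹ moduli of translation of v; the
supports shrink to the origin, where that modulus tends to zero. -/
lemma tendsto_lintegral_mollify_sub {H : ℕ → Phase → ℝ} (hH : ∀ n, IsMollifier (H n))
    {r : ℕ → ℝ} (hr : Tendsto r atTop (𝓝 0))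
    (hs : ∀ n, Function.support (H n) ⊆ Metric.closedBall 0 (r n))
    {v : Phase → ℝ} (hv : Integrable v) :
    Tendsto (fun n => ∫⁻ w, ‖mollify (H n) v w - v w‖ₑ) atTop (𝓝 0) := by
  have key : ∀ n, ∫⁻ w, ‖mollify (H n) v w - v w‖ₑ ≤
      ∫⁻ a, ENNReal.ofReal (H n a) * ∫⁻ w, ‖v (w - a) - v w‖ₑ := fun n => by
    have hc := (hH n).continuous
    have h1 : ∀ w, ‖mollify (H n) v w - v w‖ₑ ≤
        ∫⁻ a, ENNReal.ofReal (H n a) * ‖v (w - a) - v w‖ₑ := fun w => by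
      have e : mollify (H n) v w - v w = ∫ z, (v z - v w) * H n (w - z) := by
        simp_rw [sub_mul]
        rw [integral_sub ((hH n).integrable_mul_sub hv.locallyIntegrable w)
          (((hH n).integrable.comp_sub_left w).const_mul _), integral_const_mul,
          (hH n).integral_sub_left, mul_one, mollify_apply]
      rw [e, ← integral_sub_left_eq_self _ volume w]
      refine (enorm_integral_le_lintegral_enorm _).trans_eq ?_
      refine lintegral_congr fun a => ?_
      rw [enorm_mul, sub_sub_cancel, (hH n).enorm_eq, mul_comm]
    refine (lintegral_mono h1).trans_eq ?_
    rw [lintegral_lintegral_swap]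
    · refine lintegral_congr fun a => ?_
      rw [lintegral_const_mul' _ _ (by simp)]
    · have m1 : AEMeasurable (fun p : Phase × Phase => v (p.1 - p.2)) (volume.prod volume) :=
        hv.1.aemeasurable.comp_quasiMeasurePreserving
          (quasiMeasurePreserving_sub (μ := (volume : Measure Phase)) (ν := volume))
      have m2 : AEMeasurable (fun p : Phase × Phase => v p.1) (volume.prod volume) :=
        hv.1.aemeasurable.comp_quasiMeasurePreserving Measure.quasiMeasurePreserving_fst
      exact (Measurable.aemeasurable (by fun_prop)).fun_mul (m1.sub m2).enorm
  rw [ENNReal.tendsto_nhds_zero]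
  intro ε hε
  have hT := (ENNReal.tendsto_nhds_zero.1 (tendsto_lintegral_translate hv)) ε hε
  obtain ⟨δ, hδ, hball⟩ := Metric.eventually_nhds_iff_ball.1 hT
  filter_upwards [hr.eventually (gt_mem_nhds hδ)] with n hn
  refine (key n).trans ?_
  calc _ ≤ ∫⁻ a, ENNReal.ofReal (H n a) * ε := by
        refine lintegral_mono fun a => ?_
        by_cases ha : H n a = 0
        · simp [ha]
        · have : a ∈ Metric.ball (0 : Phase) δ :=
            Metric.closedBall_subset_ball hn (hs n ha)
          exact mul_le_mul_right (hball a this) _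
    _ = ε := by
        have hc := (hH n).continuous
        rw [lintegral_mul_const _ (by fun_prop), (hH n).lintegral_eq, one_mul]

/-- Mollification is local at distance one, so a locally integrable function can be truncated to a
slightly larger ball and treated as integrable. -/
lemma mollify_eq_of_eqOn {H : Phase → ℝ} (hH : IsMollifier H) {f f' : Phase → ℝ} {R : ℝ}
    (h : ∀ z ∈ Metric.closedBall (0 : Phase) (R + 1), f z = f' z) {w : Phase}
    (hw : w ∈ Metric.closedBall (0 : Phase) R) : mollify H f w = mollify H f' w := by
  rw [mollify_apply, mollify_apply]
  refine integral_congr_ae (Eventually.of_forall fun z => ?_)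
  dsimp only
  by_cases hz : H (w - z) = 0
  · simp [hz]
  · have h2 : w - z ∈ Metric.closedBall (0 : Phase) 1 := hH.support hz
    rw [mem_closedBall_zero_iff] at h2 hw
    have := norm_sub_le w (w - z)
    simp only [sub_sub_cancel] at this
    rw [h z (by rw [mem_closedBall_zero_iff]; linarith)]

lemma tendsto_setLIntegral_mollify_sub {H : ℕ → Phase → ℝ} (hH : ∀ n, IsMollifier (H n))
    {r : ℕ → ℝ} (hr : Tendsto r atTop (𝓝 0))
    (hs : ∀ n, Function.support (H n) ⊆ Metric.closedBall 0 (r n))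
    {v : Phase → ℝ} (hv : LocallyIntegrable v) (R : ℝ) :
    Tendsto (fun n => ∫⁻ w in Metric.closedBall 0 R, ‖mollify (H n) v w - v w‖ₑ)
      atTop (𝓝 0) := by
  set v' := (Metric.closedBall (0 : Phase) (R + 1)).indicator v with hv'
  have hi : Integrable v' := (integrable_indicator_iff measurableSet_closedBall).2
    (hv.integrableOn_isCompact (isCompact_closedBall 0 (R + 1)))
  refine tendsto_of_tendsto_of_tendsto_of_le_of_le tendsto_const_nhds
    (tendsto_lintegral_mollify_sub hH hr hs hi) (fun _ => zero_le) fun n => ?_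
  refine le_trans (le_of_eq ?_) (setLIntegral_le_lintegral (Metric.closedBall 0 R) _)
  refine setLIntegral_congr_fun measurableSet_closedBall fun w hw => ?_
  have e : ∀ z ∈ Metric.closedBall (0 : Phase) (R + 1), v z = v' z := fun z hz => by
    rw [hv', indicator_of_mem hz]
  rw [mollify_eq_of_eqOn (hH n) e hw, e w (Metric.closedBall_subset_closedBall (by linarith) hw)]

/-! ### Tensor-product mollifiers with separate scales in position and velocity. -/

/-- The tensor product of two bumps, a mollifier on phase space. -/
noncomputable def tensorKernel (η κ : ContDiffBump (0 : R3)) (z : Phase) : ℝ :=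
  η.normed volume z.1 * κ.normed volume z.2

lemma support_tensorKernel (η κ : ContDiffBump (0 : R3)) {r : ℝ} (hη : η.rOut ≤ r)
    (hκ : κ.rOut ≤ r) : Function.support (tensorKernel η κ) ⊆ Metric.closedBall 0 r := by
  intro z hz
  have h1 : η.normed volume z.1 ≠ 0 := left_ne_zero_of_mul hz
  have h2 : κ.normed volume z.2 ≠ 0 := right_ne_zero_of_mul hz
  have h1' : z.1 ∈ Function.support (η.normed volume) := h1
  have h2' : z.2 ∈ Function.support (κ.normed volume) := h2
  rw [ContDiffBump.support_normed_eq, mem_ball_zero_iff] at h1' h2'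
  rw [mem_closedBall_zero_iff]
  exact norm_prod_le_iff.2 ⟨(h1'.trans_le hη).le, (h2'.trans_le hκ).le⟩

lemma isMollifier_tensorKernel {η κ : ContDiffBump (0 : R3)} (hη : η.rOut ≤ 1)
    (hκ : κ.rOut ≤ 1) : IsMollifier (tensorKernel η κ) where
  contDiff := (η.contDiff_normed.comp contDiff_fst).mul (κ.contDiff_normed.comp contDiff_snd)
  support := support_tensorKernel η κ hη hκ
  nonneg z := mul_nonneg (η.nonneg_normed _) (κ.nonneg_normed _)
  even z := by simp [tensorKernel, ContDiffBump.normed_neg]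
  lintegral_eq := by
    have c1 := η.continuous_normed (μ := volume)
    have c2 := κ.continuous_normed (μ := volume)
    unfold tensorKernel
    simp_rw [ENNReal.ofReal_mul (η.nonneg_normed _)]
    rw [lintegral_prod_mul_left (a := fun x => ENNReal.ofReal (η.normed volume x))
      (b := fun z => ENNReal.ofReal (κ.normed volume z.2)) (by fun_prop)
      (by fun_prop)]
    have h := lintegral_ofReal_normed κ 0
    have h' := lintegral_ofReal_normed η 0
    simp only [zero_sub, ContDiffBump.normed_neg] at h h'
    simp [h, h']

/-- The dominating function depends on x only: the velocity bump integrates to one, and the spatial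
bump costs `mollifyConst`. -/
lemma enorm_mollify_tensorKernel_le {η κ : ContDiffBump (0 : R3)} (hη1 : η.rOut ≤ 1)
    (hκ1 : κ.rOut ≤ 1) (hη : η.rOut ≤ 2 * η.rIn) {h : R3 → ℝ≥0∞} (hh : AEMeasurable h)
    {f : Phase → ℝ} {c : ℝ≥0∞} (hf : ∀ᵐ z, ‖f z‖ₑ ≤ c * riesz h z.1) (hc : c ≠ ⊤) (w : Phase) :
    ‖mollify (tensorKernel η κ) f w‖ₑ ≤ c * (mollifyConst * riesz h w.1) := by
  have hH := isMollifier_tensorKernel hη1 hκ1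
  have c1 := η.continuous_normed (μ := volume)
  have c2 := κ.continuous_normed (μ := volume)
  have mr := aemeasurable_riesz hh
  calc _ ≤ ∫⁻ z, ‖f z‖ₑ * ENNReal.ofReal (tensorKernel η κ (w - z)) := hH.enorm_mollify_le f w
    _ ≤ ∫⁻ z : Phase, c * ((ENNReal.ofReal (η.normed volume (w.1 - z.1)) * riesz h z.1) *
          ENNReal.ofReal (κ.normed volume (w.2 - z.2))) := by
        refine lintegral_mono_ae (hf.mono fun z hz => ?_)
        rw [tensorKernel, ENNReal.ofReal_mul (η.nonneg_normed _)]
        calc _ ≤ c * riesz h z.1 * (ENNReal.ofReal (η.normed volume (w - z).1) *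
              ENNReal.ofReal (κ.normed volume (w - z).2)) := by gcongr
          _ = _ := by simp only [Prod.fst_sub, Prod.snd_sub]; ring
    _ = c * ∫⁻ x, (ENNReal.ofReal (η.normed volume (w.1 - x)) * riesz h x) *
          ∫⁻ ξ, ENNReal.ofReal (κ.normed volume (w.2 - ξ)) := by
        rw [lintegral_const_mul' _ _ hc]
        congr 1
        exact lintegral_prod_mul_left
          (a := fun x => ENNReal.ofReal (η.normed volume (w.1 - x)) * riesz h x)
          (b := fun z => ENNReal.ofReal (κ.normed volume (w.2 - z.2)))
          ((Measurable.aemeasurable (by fun_prop)).fun_mul mr)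
          (by fun_prop)
    _ ≤ _ := by
        simp_rw [lintegral_ofReal_normed, mul_one]
        gcongr
        exact lintegral_normed_mul_riesz_le η hη hh _

/-- The spatial bumps of the mollifying sequence. -/
noncomputable def bumpX (n : ℕ) : ContDiffBump (0 : R3) where
  rIn := 1 / (2 * (n + 1))
  rOut := 1 / (n + 1)
  rIn_pos := by positivity
  rIn_lt_rOut := by
    have : (0 : ℝ) < n + 1 := by positivity
    exact one_div_lt_one_div_of_lt this (by linarith)

/-- The `L¹` norm of the gradient of a spatial bump. -/
noncomputable def gradMass (n : ℕ) : ℝ := ∫ x, ‖fderiv ℝ ((bumpX n).normed volume) x‖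

lemma gradMass_nonneg (n : ℕ) : 0 ≤ gradMass n := integral_nonneg fun _ => norm_nonneg _

/-- The velocity bumps of the mollifying sequence, concentrating faster than the spatial ones. -/
noncomputable def bumpV (n : ℕ) : ContDiffBump (0 : R3) where
  rIn := 1 / (2 * ((n + 1) * (1 + gradMass n)))
  rOut := 1 / ((n + 1) * (1 + gradMass n))
  rIn_pos := by have := gradMass_nonneg n; positivity
  rIn_lt_rOut := by
    have := gradMass_nonneg n
    have : (0 : ℝ) < (n + 1) * (1 + gradMass n) := by positivity
    exact one_div_lt_one_div_of_lt this (by linarith)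

/-- The mollifying sequence on phase space. -/
noncomputable def seqKernel (n : ℕ) : Phase → ℝ := tensorKernel (bumpX n) (bumpV n)

lemma bumpX_rOut_le_one (n : ℕ) : (bumpX n).rOut ≤ 1 := by
  simp only [bumpX]
  rw [div_le_one (by positivity)]
  linarith [(n.cast_nonneg : (0 : ℝ) ≤ n)]

lemma bumpV_rOut_le (n : ℕ) : (bumpV n).rOut ≤ 1 / (n + 1) := by
  simp only [bumpV]
  have := gradMass_nonneg n
  refine one_div_le_one_div_of_le (by positivity) ?_
  exact le_mul_of_one_le_right (by positivity) (by linarith)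

lemma bumpV_rOut_le_one (n : ℕ) : (bumpV n).rOut ≤ 1 :=
  (bumpV_rOut_le n).trans (bumpX_rOut_le_one n)

lemma bumpX_rOut_le_two_mul (n : ℕ) : (bumpX n).rOut ≤ 2 * (bumpX n).rIn := by
  simp only [bumpX]
  refine le_of_eq ?_
  field_simp

lemma isMollifier_seqKernel (n : ℕ) : IsMollifier (seqKernel n) :=
  isMollifier_tensorKernel (bumpX_rOut_le_one n) (bumpV_rOut_le_one n)

lemma support_seqKernel (n : ℕ) :
    Function.support (seqKernel n) ⊆ Metric.closedBall 0 (1 / ((n : ℝ) + 1)) :=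
  support_tensorKernel _ _ le_rfl (bumpV_rOut_le n)

lemma hasFDerivAt_tensorKernel (η κ : ContDiffBump (0 : R3)) (z y : Phase) :
    fderiv ℝ (tensorKernel η κ) z y =
      κ.normed volume z.2 * fderiv ℝ (η.normed volume) z.1 y.1 +
        η.normed volume z.1 * fderiv ℝ (κ.normed volume) z.2 y.2 := by
  have h1 : HasFDerivAt (η.normed volume) (fderiv ℝ (η.normed volume) z.1) z.1 :=
    ((η.contDiff_normed (n := 1)).differentiable one_ne_zero).differentiableAt.hasFDerivAt
  have h2 : HasFDerivAt (κ.normed volume) (fderiv ℝ (κ.normed volume) z.2) z.2 :=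
    ((κ.contDiff_normed (n := 1)).differentiable one_ne_zero).differentiableAt.hasFDerivAt
  have h3 := (h1.comp z (hasFDerivAt_fst (p := z))).mul (h2.comp z (hasFDerivAt_snd (p := z)))
  have e : fderiv ℝ (tensorKernel η κ) z = _ := h3.fderiv
  rw [e]
  simp
  ring

/-- The x-derivative of the kernel has mass at most `gradMass n`, which may blow up, but on the
support |ξ| is below the velocity radius, which was chosen as 1/((n+1)(1 + `gradMass n`)). -/
lemma lintegral_seqKernel_commutator_le (n : ℕ) (j : Fin 3) :
    ∫⁻ z : Phase, ‖z.2 j * fderiv ℝ (seqKernel n) z (EuclideanSpace.single j 1, 0)‖ₑ ≤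
      ENNReal.ofReal (1 / (n + 1)) := by
  have hκ := (bumpV n).continuous_normed (μ := volume)
  have hη : Continuous (fderiv ℝ ((bumpX n).normed volume)) :=
    ((bumpX n).contDiff_normed (n := 1)).continuous_fderiv one_ne_zero
  have hηi : Integrable fun x => ‖fderiv ℝ ((bumpX n).normed volume) x‖ :=
    (hη.integrable_of_hasCompactSupport ((bumpX n).hasCompactSupport_normed.fderiv ℝ)).norm
  calc _ ≤ ∫⁻ z : Phase, (ENNReal.ofReal (bumpV n).rOut *
          ENNReal.ofReal ‖fderiv ℝ ((bumpX n).normed volume) z.1‖) *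
            ENNReal.ofReal ((bumpV n).normed volume z.2) := by
        refine lintegral_mono fun z => ?_
        rw [seqKernel, hasFDerivAt_tensorKernel]
        simp only [map_zero, mul_zero, add_zero]
        rw [← ofReal_norm, ← ENNReal.ofReal_mul (bumpV n).rOut_pos.le,
          ← ENNReal.ofReal_mul (mul_nonneg (bumpV n).rOut_pos.le (norm_nonneg _))]
        refine ENNReal.ofReal_le_ofReal ?_
        by_cases h0 : (bumpV n).normed volume z.2 = 0
        · simp [h0]
        · have hz : z.2 ∈ Function.support ((bumpV n).normed volume) := h0
          rw [ContDiffBump.support_normed_eq, mem_ball_zero_iff] at hz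
          rw [norm_mul, norm_mul, Real.norm_of_nonneg ((bumpV n).nonneg_normed _)]
          have h1 : ‖z.2 j‖ ≤ (bumpV n).rOut := (PiLp.norm_apply_le z.2 j).trans hz.le
          have h2 : ‖fderiv ℝ ((bumpX n).normed volume) z.1 (EuclideanSpace.single j 1)‖ ≤
              ‖fderiv ℝ ((bumpX n).normed volume) z.1‖ :=
            (ContinuousLinearMap.le_opNorm _ _).trans_eq (by simp)
          calc _ = ‖z.2 j‖ * ‖fderiv ℝ ((bumpX n).normed volume) z.1 (EuclideanSpace.single j 1)‖ *
                (bumpV n).normed volume z.2 := by ring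
            _ ≤ _ := by
              have := (bumpV n).nonneg_normed (μ := volume) z.2
              have := (bumpV n).rOut_pos
              gcongr
    _ = ∫⁻ x, (ENNReal.ofReal (bumpV n).rOut *
          ENNReal.ofReal ‖fderiv ℝ ((bumpX n).normed volume) x‖) *
            ∫⁻ ξ, ENNReal.ofReal ((bumpV n).normed volume ξ) :=
        lintegral_prod_mul_left (a := fun x => ENNReal.ofReal (bumpV n).rOut *
          ENNReal.ofReal ‖fderiv ℝ ((bumpX n).normed volume) x‖)
          (b := fun z => ENNReal.ofReal ((bumpV n).normed volume z.2)) (by fun_prop) (by fun_prop)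
    _ = ENNReal.ofReal ((bumpV n).rOut * gradMass n) := by
        have h := lintegral_ofReal_normed (bumpV n) 0
        simp only [zero_sub, ContDiffBump.normed_neg] at h
        simp_rw [h, mul_one]
        rw [lintegral_const_mul _ (by fun_prop), gradMass,
          ← ofReal_integral_eq_lintegral_ofReal hηi (Eventually.of_forall fun _ => norm_nonneg _),
          ENNReal.ofReal_mul (bumpV n).rOut_pos.le]
    _ ≤ _ := by
        refine ENNReal.ofReal_le_ofReal ?_
        simp only [bumpV]
        have h0 := gradMass_nonneg n
        rw [div_mul_eq_mul_div, div_le_div_iff₀ (by positivity) (by positivity)]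
        have : (0 : ℝ) < n + 1 := by positivity
        nlinarith

lemma tendsto_one_div_succ : Tendsto (fun n : ℕ => 1 / ((n : ℝ) + 1)) atTop (𝓝 0) :=
  tendsto_one_div_add_atTop_nhds_zero_nat

lemma tendsto_setLIntegral_mollify_seqKernel_sub {v : Phase → ℝ} (hv : LocallyIntegrable v)
    (R : ℝ) :
    Tendsto (fun n => ∫⁻ w in Metric.closedBall 0 R, ‖mollify (seqKernel n) v w - v w‖ₑ)
      atTop (𝓝 0) :=
  tendsto_setLIntegral_mollify_sub isMollifier_seqKernel tendsto_one_div_succ support_seqKernel hv R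

/-! ### The weak velocity gradient on slices. -/

lemma integrable_mul_comp_snd {v : Phase → ℝ} (hv : LocallyIntegrable v) {k : R3 → ℝ}
    (hk : Continuous k) (hks : HasCompactSupport k) {K : Set R3} (hK : IsCompact K) :
    Integrable (fun z : Phase => v z * k z.2) ((volume.restrict K).prod volume) := by
  have hr : (volume.restrict K).prod (volume : Measure R3) =
      (volume : Measure Phase).restrict (K ×ˢ univ) := by
    have := Measure.prod_restrict (μ := (volume : Measure R3)) (ν := (volume : Measure R3)) K univ
    rwa [Measure.restrict_univ] at this
  rw [hr]
  change IntegrableOn _ _ _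
  have hc : IsCompact (K ×ˢ tsupport k) := hK.prod hks
  have h1 : IntegrableOn (fun z : Phase => v z * k z.2) (K ×ˢ tsupport k) :=
    (hv.integrableOn_isCompact hc).mul_continuousOn (by fun_prop) hc
  refine h1.of_forall_sdiff_eq_zero (hK.measurableSet.prod MeasurableSet.univ) fun z hz => ?_
  have : z.2 ∉ tsupport k := fun h => hz.2 ⟨hz.1.1, h⟩
  simp [image_eq_zero_of_notMem_tsupport this]

lemma locallyIntegrable_integral_mul {v : Phase → ℝ} (hv : LocallyIntegrable v) {k : R3 → ℝ}
    (hk : Continuous k) (hks : HasCompactSupport k) :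
    LocallyIntegrable fun x => ∫ ξ, v (x, ξ) * k ξ := by
  rw [locallyIntegrable_iff]
  intro K hK
  exact (integrable_mul_comp_snd hv hk hks hK).integral_prod_left

lemma LocallyIntegrable_inner {g : Phase → R3} (hg : LocallyIntegrable g) (e : R3) :
    LocallyIntegrable fun z => inner ℝ (g z) e := by
  intro z
  obtain ⟨s, hs, hi⟩ := hg z
  exact ⟨s, hs, hi.inner_const e⟩

/-- On almost every velocity slice, the weak velocity gradient acts as a weak gradient against a
given test function. -/
lemma IsWeakVelocityGradient.ae_slice {v : Phase → ℝ} {g : Phase → R3}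
    (h : IsWeakVelocityGradient v g) (hv : LocallyIntegrable v) {q : R3 → ℝ}
    (hq : ContDiff ℝ ∞ q) (hqs : HasCompactSupport q) (e : R3) :
    ∀ᵐ x, ∫ ξ, v (x, ξ) * fderiv ℝ q ξ e = -∫ ξ, inner ℝ (g (x, ξ)) e * q ξ := by
  have hq1 : ContDiff ℝ 1 q := hq.of_le (by norm_cast)
  have hDq : Continuous fun ξ => fderiv ℝ q ξ e :=
    (hq1.continuous_fderiv one_ne_zero).clm_apply continuous_const
  have hDqs : HasCompactSupport fun ξ => fderiv ℝ q ξ e := hqs.fderiv_apply ℝ e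
  have hge := LocallyIntegrable_inner h.1 e
  have I1 := locallyIntegrable_integral_mul hv hDq hDqs
  have I2 := locallyIntegrable_integral_mul hge hq.continuous hqs
  -- Testing the phase-space identity with products p(x)q(ξ) and letting p vary yields the slice
  -- identity for fixed q and almost every x.
  have := ae_eq_zero_of_integral_contDiff_smul_eq_zero (I1.add I2) (fun p hp hps => ?_)
  · filter_upwards [this] with x hx
    exact eq_neg_of_add_eq_zero_left hx
  · have hp1 : ContDiff ℝ 1 p := hp.of_le (by norm_cast)
    set φ : Phase → ℝ := fun z => p z.1 * q z.2 with hφ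
    have hφs : HasCompactSupport φ :=
      HasCompactSupport.of_support_subset_isCompact (hps.isCompact.prod hqs.isCompact)
        fun z hz => ⟨subset_tsupport _ (left_ne_zero_of_mul hz),
          subset_tsupport _ (right_ne_zero_of_mul hz)⟩
    have hφd : ContDiff ℝ ∞ φ := (hp.comp contDiff_fst).mul (hq.comp contDiff_snd)
    have hD : ∀ z : Phase, fderiv ℝ φ z (0, e) = p z.1 * fderiv ℝ q z.2 e := fun z => by
      have h1 : HasFDerivAt p (fderiv ℝ p z.1) z.1 :=
        (hp1.differentiable one_ne_zero).differentiableAt.hasFDerivAt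
      have h2 : HasFDerivAt q (fderiv ℝ q z.2) z.2 :=
        (hq1.differentiable one_ne_zero).differentiableAt.hasFDerivAt
      have h3 := (h1.comp z (hasFDerivAt_fst (p := z))).mul (h2.comp z (hasFDerivAt_snd (p := z)))
      have e' : fderiv ℝ φ z = _ := h3.fderiv
      rw [e']
      simp
    have hw := h.2 φ hφd hφs e
    have hφ1 : ContDiff ℝ 1 φ := hφd.of_le (by norm_cast)
    have i1 : Integrable fun z => v z * fderiv ℝ φ z (0, e) := by
      simp_rw [mul_comm (v _)]
      exact hv.integrable_smul_left_of_hasCompactSupport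
        ((hφ1.continuous_fderiv one_ne_zero).clm_apply continuous_const) (hφs.fderiv_apply ℝ _)
    have i2 : Integrable fun z => inner ℝ (g z) e * φ z := by
      simp_rw [mul_comm (inner ℝ _ _)]
      exact hge.integrable_smul_left_of_hasCompactSupport hφd.continuous hφs
    have f1 : ∫ z, v z * fderiv ℝ φ z (0, e) =
        ∫ x, p x * ∫ ξ, v (x, ξ) * fderiv ℝ q ξ e := by
      refine (integral_prod (μ := (volume : Measure R3)) _ i1).trans ?_
      refine integral_congr_ae (Eventually.of_forall fun x => ?_)
      dsimp only
      rw [← integral_const_mul]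
      refine integral_congr_ae (Eventually.of_forall fun ξ => ?_)
      dsimp only
      rw [hD]; ring
    have f2 : ∫ z, inner ℝ (g z) e * φ z =
        ∫ x, p x * ∫ ξ, inner ℝ (g (x, ξ)) e * q ξ := by
      refine (integral_prod (μ := (volume : Measure R3)) _ i2).trans ?_
      refine integral_congr_ae (Eventually.of_forall fun x => ?_)
      dsimp only
      rw [← integral_const_mul]
      refine integral_congr_ae (Eventually.of_forall fun ξ => ?_)
      simp only [hφ]; ring
    have s1 := I1.integrable_smul_left_of_hasCompactSupport hp.continuous hps
    have s2 := I2.integrable_smul_left_of_hasCompactSupport hp.continuous hps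
    simp only [Pi.add_apply, smul_add]
    rw [integral_add s1 s2]
    simp only [smul_eq_mul]
    rw [← f1, ← f2, hw]
    ring

/-- The velocity derivative of a mollification, in terms of the weak velocity gradient, in the
presence of a weight depending on the position only. -/
lemma fderiv_mollify_tensorKernel {v : Phase → ℝ} {g : Phase → R3}
    (h : IsWeakVelocityGradient v g) (hv : LocallyIntegrable v) {η κ : ContDiffBump (0 : R3)}
    (hη : η.rOut ≤ 1) (hκ : κ.rOut ≤ 1) {W : R3 → ℝ} (e : R3)
    (hvW : LocallyIntegrable fun z : Phase => v z * W z.1)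
    (hgW : LocallyIntegrable fun z : Phase => inner ℝ (g z) e * W z.1) (w : Phase) :
    fderiv ℝ (mollify (tensorKernel η κ) fun z => v z * W z.1) w (0, e) =
      mollify (tensorKernel η κ) (fun z => inner ℝ (g z) e * W z.1) w := by
  have hH := isMollifier_tensorKernel hη hκ
  have hH1 : ContDiff ℝ 1 (tensorKernel η κ) := hH.contDiff.of_le (by norm_cast)
  rw [hH.fderiv_mollify hvW, mollify_apply]
  set q : R3 → ℝ := fun ξ => κ.normed volume (w.2 - ξ) with hq
  have hqd : ContDiff ℝ ∞ q := κ.contDiff_normed.comp (contDiff_const.sub contDiff_id)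
  have hqs : HasCompactSupport q :=
    κ.hasCompactSupport_normed.comp_homeomorph (Homeomorph.subLeft w.2)
  have hDq : ∀ ξ, fderiv ℝ q ξ e = -fderiv ℝ (κ.normed volume) (w.2 - ξ) e := fun ξ => by
    have h1 : HasFDerivAt (κ.normed volume) (fderiv ℝ (κ.normed volume) (w.2 - ξ)) (w.2 - ξ) :=
      ((κ.contDiff_normed (n := 1)).differentiable one_ne_zero).differentiableAt.hasFDerivAt
    have h2 := h1.comp ξ ((hasFDerivAt_id ξ).const_sub w.2)
    have e' : fderiv ℝ q ξ = _ := h2.fderiv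
    rw [e']; simp
  have i1 : Integrable fun z => v z * W z.1 * fderiv ℝ (tensorKernel η κ) (w - z) (0, e) := by
    simp_rw [mul_comm (v _ * W _)]
    refine hvW.integrable_smul_left_of_hasCompactSupport
      (g := fun z => fderiv ℝ (tensorKernel η κ) (w - z) (0, e)) ?_ ?_
    · exact ((hH1.continuous_fderiv one_ne_zero).comp (by fun_prop)).clm_apply continuous_const
    · exact (hH.hasCompactSupport.fderiv_apply ℝ ((0, e) : Phase)).comp_homeomorph
        (Homeomorph.subLeft w)
  have i2 := hH.integrable_mul_sub hgW w
  refine (integral_prod (μ := (volume : Measure R3)) _ i1).trans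
    (Eq.trans ?_ (integral_prod (μ := (volume : Measure R3)) _ i2).symm)
  refine integral_congr_ae ?_
  -- On a slice the weight W(x) is a constant, so the integration by parts in ξ takes place there
  -- and no smoothness of W is needed.
  filter_upwards [h.ae_slice hv hqd hqs e] with x hx
  have c1 : ∀ ξ, v (x, ξ) * W x * fderiv ℝ (tensorKernel η κ) (w - (x, ξ)) (0, e) =
      -(W x * η.normed volume (w.1 - x)) * (v (x, ξ) * fderiv ℝ q ξ e) := fun ξ => by
    rw [hasFDerivAt_tensorKernel, hDq]
    simp only [map_zero, mul_zero, zero_add, Prod.fst_sub, Prod.snd_sub]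
    ring
  have c2 : ∀ ξ, inner ℝ (g (x, ξ)) e * W x * tensorKernel η κ (w - (x, ξ)) =
      (W x * η.normed volume (w.1 - x)) * (inner ℝ (g (x, ξ)) e * q ξ) := fun ξ => by
    simp only [tensorKernel, hq, Prod.fst_sub, Prod.snd_sub]
    ring
  simp_rw [c1, c2]
  rw [integral_const_mul, integral_const_mul, hx]
  ring

/-! ### Limits of pairings of two mollified functions. -/

/-- Every subsequence has a further subsequence converging almost everywhere, to which dominated
convergence applies; the limit is always the same. No rate and no L¹ bound on q is needed, only the
common majorant b of the products. -/
lemma tendsto_integral_mul_of_tendsto_L1 {P : ℕ → Phase → ℝ} {P₀ q b : Phase → ℝ}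
    (hP : ∀ n, AEStronglyMeasurable (P n)) (hP₀ : AEStronglyMeasurable P₀)
    (hlim : Tendsto (fun n => ∫⁻ z, ‖P n z - P₀ z‖ₑ) atTop (𝓝 0))
    (hq : AEStronglyMeasurable q) (hb : Integrable b)
    (hbd : ∀ n, ∀ᵐ z, ‖P n z * q z‖ ≤ b z) :
    Tendsto (fun n => ∫ z, P n z * q z) atTop (𝓝 (∫ z, P₀ z * q z)) := by
  refine tendsto_of_subseq_tendsto fun ns hns => ?_
  have h1 : Tendsto (fun n => eLpNorm (P (ns n) - P₀) 1 volume) atTop (𝓝 0) := by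
    simp_rw [eLpNorm_one_eq_lintegral_enorm]
    exact hlim.comp hns
  obtain ⟨ms, -, hms⟩ := (tendstoInMeasure_of_tendsto_eLpNorm one_ne_zero
    (fun n => hP (ns n)) hP₀ h1).exists_seq_tendsto_ae
  refine ⟨ms, ?_⟩
  refine tendsto_integral_of_dominated_convergence b (fun n => (hP _).mul hq) hb
    (fun n => hbd _) ?_
  filter_upwards [hms] with z hz
  exact hz.mul_const _

lemma closedBall_phase (R : ℝ) : Metric.closedBall (0 : Phase) R =
    Metric.closedBall (0 : R3) R ×ˢ Metric.closedBall (0 : R3) R :=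
  (closedBall_prod_same (0 : R3) (0 : R3) R).symm

/-- The constant in the local `L¹` bound of the product of a bounded function with a Riesz
potential. -/
noncomputable def localConst (R : ℝ) : ℝ≥0∞ :=
  rieszConst * volume (Metric.closedBall (0 : R3) R) ^ (1 / 3 : ℝ) *
    volume (Metric.closedBall (0 : R3) R)

lemma localConst_ne_top (R : ℝ) : localConst R ≠ ⊤ :=
  ENNReal.mul_ne_top (ENNReal.mul_ne_top rieszConst_ne_top
    (ENNReal.rpow_ne_top_of_nonneg (by norm_num) measure_closedBall_lt_top.ne))
    measure_closedBall_lt_top.ne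

lemma setLIntegral_riesz_fst_le {h : R3 → ℝ≥0∞} (hh : AEMeasurable h) (R : ℝ) :
    ∫⁻ z in Metric.closedBall (0 : Phase) R, riesz h z.1 ≤ localConst R * ∫⁻ y, h y := by
  set B := Metric.closedBall (0 : R3) R with hB
  have mB : MeasurableSet B := measurableSet_closedBall
  calc _ = ∫⁻ z : Phase, B.indicator (riesz h) z.1 * B.indicator 1 z.2 := by
        rw [closedBall_phase, ← lintegral_indicator (mB.prod mB)]
        refine lintegral_congr fun z => ?_
        by_cases h1 : z.1 ∈ B <;> by_cases h2 : z.2 ∈ B <;> simp only [indicator, mem_prod, h1, h2,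
          and_true, and_false, if_true, if_false, Pi.one_apply, mul_one, mul_zero]
    _ = ∫⁻ x, B.indicator (riesz h) x * ∫⁻ ξ, B.indicator 1 ξ :=
        lintegral_prod_mul_left ((aemeasurable_riesz hh).indicator mB)
          (b := fun z => B.indicator 1 z.2)
          ((measurable_one.indicator mB).comp measurable_snd).aemeasurable
    _ = (∫⁻ x in B, riesz h x) * volume B := by
        rw [lintegral_indicator_one mB,
          lintegral_mul_const'' _ ((aemeasurable_riesz hh).indicator mB), lintegral_indicator mB]
    _ ≤ rieszConst * (∫⁻ y, h y) * volume B ^ (1 / 3 : ℝ) * volume B := by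
        gcongr; exact setLIntegral_riesz_le hh mB
    _ = _ := by rw [localConst]; ring

lemma locallyIntegrable_of_enorm_le_riesz {h : R3 → ℝ≥0∞} (hh : AEMeasurable h)
    (hfin : ∫⁻ y, h y ≠ ⊤) {V : Phase → ℝ} (hV : AEStronglyMeasurable V) {c : ℝ≥0∞} (hc : c ≠ ⊤)
    (hle : ∀ᵐ z, ‖V z‖ₑ ≤ c * riesz h z.1) : LocallyIntegrable V := by
  rw [locallyIntegrable_iff]
  intro K hK
  obtain ⟨R, hR⟩ := hK.isBounded.subset_closedBall 0
  refine IntegrableOn.mono_set ⟨hV.restrict, ?_⟩ hR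
  refine lt_of_le_of_lt (lintegral_mono_ae (ae_restrict_of_ae hle)) ?_
  rw [lintegral_const_mul' _ _ hc]
  exact (ENNReal.mul_lt_top hc.lt_top (lt_of_le_of_lt (setLIntegral_riesz_fst_le hh R)
    (ENNReal.mul_lt_top (localConst_ne_top R).lt_top hfin.lt_top)))

lemma locallyIntegrable_of_abs_le {u : Phase → ℝ} {M : ℝ} (hu : AEStronglyMeasurable u)
    (hb : ∀ᵐ z, |u z| ≤ M) : LocallyIntegrable u := by
  rw [locallyIntegrable_iff]
  intro K hK
  exact IntegrableOn.of_bound hK.measure_lt_top hu.restrict M (ae_restrict_of_ae hb)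

lemma integrable_indicator_closedBall {G : Phase → ℝ} (hG : LocallyIntegrable G) (R : ℝ) :
    Integrable ((Metric.closedBall (0 : Phase) R).indicator G) :=
  (integrable_indicator_iff measurableSet_closedBall).2
    (hG.integrableOn_isCompact (isCompact_closedBall 0 R))

/-- A continuous cutoff together with the radius of a ball containing its support and a bound. -/
structure IsCutoff (ψ : Phase → ℝ) (R c : ℝ) : Prop where
  continuous : Continuous ψ
  eq_zero : ∀ z ∉ Metric.closedBall (0 : Phase) R, ψ z = 0
  abs_le : ∀ z, |ψ z| ≤ c

namespace IsCutoff

variable {ψ : Phase → ℝ} {R c : ℝ}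

lemma nonneg (hψ : IsCutoff ψ R c) : 0 ≤ c := (abs_nonneg _).trans (hψ.abs_le 0)

lemma hasCompactSupport (hψ : IsCutoff ψ R c) : HasCompactSupport ψ :=
  HasCompactSupport.intro (isCompact_closedBall 0 R) hψ.eq_zero

lemma lintegral_mul_le (hψ : IsCutoff ψ R c) (f : Phase → ℝ) :
    ∫⁻ z, ‖ψ z * f z‖ₑ ≤ ENNReal.ofReal c * ∫⁻ z in Metric.closedBall 0 R, ‖f z‖ₑ := by
  rw [← lintegral_const_mul' _ _ (by simp), ← lintegral_indicator measurableSet_closedBall]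
  refine lintegral_mono fun z => ?_
  by_cases hz : z ∈ Metric.closedBall (0 : Phase) R
  · rw [indicator_of_mem hz, enorm_mul, ← ofReal_norm (ψ z)]
    gcongr
    exact hψ.abs_le z
  · simp [hψ.eq_zero z hz]

end IsCutoff

lemma tendsto_lintegral_cutoff_mollify_sub {ψ : Phase → ℝ} {R c : ℝ} (hψ : IsCutoff ψ R c)
    {v : Phase → ℝ} (hv : LocallyIntegrable v) :
    Tendsto (fun n => ∫⁻ w, ‖ψ w * mollify (seqKernel n) v w - ψ w * v w‖ₑ) atTop (𝓝 0) := by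
  refine tendsto_of_tendsto_of_tendsto_of_le_of_le tendsto_const_nhds ?_ (fun _ => zero_le)
    (fun n => by
      simp_rw [← mul_sub]
      exact hψ.lintegral_mul_le fun w => mollify (seqKernel n) v w - v w)
  have := ENNReal.Tendsto.const_mul (a := ENNReal.ofReal c)
    (tendsto_setLIntegral_mollify_seqKernel_sub hv R) (Or.inr (by simp))
  simpa using this

lemma continuous_mollify {f : Phase → ℝ} (hf : LocallyIntegrable f) (n : ℕ) :
    Continuous (mollify (seqKernel n) f) :=
  ((isMollifier_seqKernel n).contDiff_mollify hf).continuous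

lemma enorm_integral_cutoff_mollify_mollify_le {ψ : Phase → ℝ} {R c : ℝ} (hψ : IsCutoff ψ R c)
    {u G : Phase → ℝ} {M : ℝ} (hM : 0 ≤ M) (hb : ∀ᵐ z, |u z| ≤ M)
    (hG : LocallyIntegrable G) (n : ℕ) :
    ‖∫ w, ψ w * (mollify (seqKernel n) u w * mollify (seqKernel n) G w)‖ₑ ≤
      ENNReal.ofReal (c * M) * ∫⁻ z in Metric.closedBall 0 (R + 1), ‖G z‖ₑ := by
  have hH := isMollifier_seqKernel n
  set G' := (Metric.closedBall (0 : Phase) (R + 1)).indicator G with hG'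
  have hi : Integrable G' := integrable_indicator_closedBall hG (R + 1)
  calc _ ≤ ∫⁻ w, ‖ψ w * (mollify (seqKernel n) u w * mollify (seqKernel n) G w)‖ₑ :=
        enorm_integral_le_lintegral_enorm _
    _ ≤ ∫⁻ w, ENNReal.ofReal (c * M) * ‖mollify (seqKernel n) G' w‖ₑ := by
        refine lintegral_mono fun w => ?_
        by_cases hw : w ∈ Metric.closedBall (0 : Phase) R
        · rw [mollify_eq_of_eqOn hH (f := G) (f' := G')
            (fun z hz => by rw [hG', indicator_of_mem hz]) hw, enorm_mul, enorm_mul,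
            ENNReal.ofReal_mul hψ.nonneg, mul_assoc, ← ofReal_norm (ψ w),
            ← ofReal_norm (mollify (seqKernel n) u w)]
          gcongr
          · exact hψ.abs_le w
          · exact hH.abs_mollify_le hM hb w
        · simp [hψ.eq_zero w hw]
    _ ≤ ENNReal.ofReal (c * M) * ∫⁻ w, ‖G' w‖ₑ := by
        rw [lintegral_const_mul' _ _ (by simp)]
        exact mul_le_mul_right (hH.lintegral_enorm_mollify_le hi.1) _
    _ = _ := by
        rw [← lintegral_indicator measurableSet_closedBall]
        simp_rw [hG', enorm_indicator_eq_indicator_enorm]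

/-- Bounded times locally integrable: replacing the mollified G by G costs its L¹ error times the
uniform bound of the other factor, and then u is unmollified against a fixed integrable function. -/
lemma tendsto_integral_cutoff_mollify_mollify {ψ : Phase → ℝ} {R c : ℝ} (hψ : IsCutoff ψ R c)
    {u G : Phase → ℝ} {M : ℝ} (hM : 0 ≤ M) (hu : AEStronglyMeasurable u)
    (hb : ∀ᵐ z, |u z| ≤ M) (hG : LocallyIntegrable G) :
    Tendsto (fun n => ∫ w, ψ w * (mollify (seqKernel n) u w * mollify (seqKernel n) G w)) atTop
      (𝓝 (∫ w, ψ w * (u w * G w))) := by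
  have hul := locallyIntegrable_of_abs_le hu hb
  set G' := (Metric.closedBall (0 : Phase) (R + 1)).indicator G with hG'
  have hi : Integrable G' := integrable_indicator_closedBall hG (R + 1)
  have hψu : ∀ n w, ‖ψ w * mollify (seqKernel n) u w‖ ≤ c * M := fun n w => by
    rw [norm_mul]
    have h1 := hψ.abs_le w
    have h2 := (isMollifier_seqKernel n).abs_mollify_le hM hb w
    have := hψ.nonneg
    simp only [Real.norm_eq_abs]
    gcongr
  have mn : ∀ n, AEStronglyMeasurable fun w => ψ w * mollify (seqKernel n) u w := fun n =>
    (hψ.continuous.mul (continuous_mollify hul n)).aestronglyMeasurable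
  have e1 : ∀ n w, ψ w * (mollify (seqKernel n) u w * mollify (seqKernel n) G w) =
      ψ w * mollify (seqKernel n) u w * (mollify (seqKernel n) G' w - G' w) +
        ψ w * mollify (seqKernel n) u w * G' w := fun n w => by
    by_cases hw : w ∈ Metric.closedBall (0 : Phase) R
    · rw [mollify_eq_of_eqOn (isMollifier_seqKernel n) (f := G) (f' := G')
        (fun z hz => by rw [hG', indicator_of_mem hz]) hw]
      ring
    · simp [hψ.eq_zero w hw]
  have e2 : ∫ w, ψ w * (u w * G w) = 0 + ∫ w, ψ w * u w * G' w := by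
    rw [zero_add]
    refine integral_congr_ae (Eventually.of_forall fun w => ?_)
    dsimp only
    by_cases hw : w ∈ Metric.closedBall (0 : Phase) R
    · rw [hG', indicator_of_mem (Metric.closedBall_subset_closedBall (by linarith) hw)]; ring
    · simp [hψ.eq_zero w hw]
  have hil : LocallyIntegrable G' := hi.locallyIntegrable
  have hmi : ∀ n, Integrable (mollify (seqKernel n) G') := fun n =>
    ⟨(continuous_mollify hil n).aestronglyMeasurable,
      lt_of_le_of_lt ((isMollifier_seqKernel n).lintegral_enorm_mollify_le hi.1) hi.2⟩
  simp_rw [e1, e2]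
  have i1 : ∀ n, Integrable fun w =>
      ψ w * mollify (seqKernel n) u w * (mollify (seqKernel n) G' w - G' w) := fun n =>
    ((hmi n).sub hi).bdd_mul (mn n) (Eventually.of_forall (hψu n))
  have i2 : ∀ n, Integrable fun w => ψ w * mollify (seqKernel n) u w * G' w := fun n =>
    hi.bdd_mul (mn n) (Eventually.of_forall (hψu n))
  have e3 : ∀ n, ∫ w, (ψ w * mollify (seqKernel n) u w * (mollify (seqKernel n) G' w - G' w) +
      ψ w * mollify (seqKernel n) u w * G' w) =
      (∫ w, ψ w * mollify (seqKernel n) u w * (mollify (seqKernel n) G' w - G' w)) +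
      ∫ w, ψ w * mollify (seqKernel n) u w * G' w := fun n => integral_add (i1 n) (i2 n)
  simp_rw [e3]
  refine Tendsto.add ?_ ?_
  · rw [tendsto_zero_iff_enorm_tendsto_zero]
    refine tendsto_of_tendsto_of_tendsto_of_le_of_le tendsto_const_nhds
      (h := fun n => ENNReal.ofReal (c * M) * ∫⁻ w, ‖mollify (seqKernel n) G' w - G' w‖ₑ) ?_
      (fun _ => zero_le) (fun n => ?_)
    · have := ENNReal.Tendsto.const_mul (a := ENNReal.ofReal (c * M))
        (tendsto_lintegral_mollify_sub isMollifier_seqKernel tendsto_one_div_succ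
          support_seqKernel hi) (Or.inr (by simp))
      simpa using this
    · refine (enorm_integral_le_lintegral_enorm _).trans ?_
      dsimp only
      rw [← lintegral_const_mul' _ _ (by simp)]
      refine lintegral_mono fun w => ?_
      rw [enorm_mul, ← ofReal_norm (ψ w * _)]
      gcongr
      exact hψu n w
  · refine tendsto_integral_mul_of_tendsto_L1 mn
      (hψ.continuous.aestronglyMeasurable.mul hu)
      (tendsto_lintegral_cutoff_mollify_sub hψ hul) hi.1 (hi.norm.const_mul (c * M)) (fun n => ?_)
    refine Eventually.of_forall fun w => ?_
    rw [norm_mul]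
    gcongr
    exact hψu n w

/-- Pairing of two mollifications when one factor is controlled by a Riesz potential and the other
one is only integrable against it. -/
lemma tendsto_integral_cutoff_mollify_riesz {θ : Phase → ℝ} {R c : ℝ} (hθ : IsCutoff θ R c)
    {h : R3 → ℝ≥0∞} (hh : AEMeasurable h) (hfin : ∫⁻ y, h y ≠ ⊤) {V G : Phase → ℝ}
    (hV : AEStronglyMeasurable V) {M : ℝ≥0∞} (hM : M ≠ ⊤) (hVle : ∀ᵐ z, ‖V z‖ₑ ≤ M * riesz h z.1)
    (hG : LocallyIntegrable G) (hGfin : ∫⁻ z, riesz h z.1 * ‖G z‖ₑ ≠ ⊤) :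
    (∀ n, ‖∫ w, θ w * (mollify (seqKernel n) V w * mollify (seqKernel n) G w)‖ₑ ≤
      ENNReal.ofReal c * M * mollifyConst ^ 2 * ∫⁻ z, riesz h z.1 * ‖G z‖ₑ) ∧
    Tendsto (fun n => ∫ w, θ w * (mollify (seqKernel n) V w * mollify (seqKernel n) G w)) atTop
      (𝓝 (∫ w, θ w * (V w * G w))) := by
  have hVl := locallyIntegrable_of_enorm_le_riesz hh hfin hV hM hVle
  -- The mollification of G is moved onto the other factor by symmetry of the kernel. Then G is
  -- fixed, and the doubly mollified Q n is dominated pointwise by a multiple of the potential,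
  -- which is integrable against |G|. This is needed because V is unbounded and G is not known to be
  -- paired with anything better.
  set Q : ℕ → Phase → ℝ := fun n =>
    mollify (seqKernel n) (fun w => θ w * mollify (seqKernel n) V w) with hQ
  have cn : ∀ n, Continuous fun w => θ w * mollify (seqKernel n) V w := fun n =>
    hθ.continuous.mul (continuous_mollify hVl n)
  have ln : ∀ n, LocallyIntegrable fun w => θ w * mollify (seqKernel n) V w := fun n =>
    (cn n).locallyIntegrable
  have e : ∀ n, ∫ w, θ w * (mollify (seqKernel n) V w * mollify (seqKernel n) G w) =
      ∫ z, Q n z * G z := fun n => by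
    have := (isMollifier_seqKernel n).integral_mollify_mul hG (cn n) hθ.hasCompactSupport.mul_right
    calc _ = ∫ w, mollify (seqKernel n) G w * (θ w * mollify (seqKernel n) V w) :=
          integral_congr_ae (Eventually.of_forall fun w => by dsimp only; ring)
      _ = _ := this
      _ = _ := integral_congr_ae (Eventually.of_forall fun w => by simp only [hQ]; ring)
  set c' : ℝ≥0∞ := ENNReal.ofReal c * M * mollifyConst with hc'
  have hc't : c' ≠ ⊤ := ENNReal.mul_ne_top (ENNReal.mul_ne_top (by simp) hM) mollifyConst_ne_top
  have b1 : ∀ n w, ‖θ w * mollify (seqKernel n) V w‖ₑ ≤ c' * riesz h w.1 := fun n w => by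
    rw [enorm_mul, ← ofReal_norm (θ w), hc', mul_assoc, mul_assoc]
    gcongr
    · exact hθ.abs_le w
    · rw [← mul_assoc, mul_assoc]
      exact enorm_mollify_tensorKernel_le (bumpX_rOut_le_one n) (bumpV_rOut_le_one n)
        (bumpX_rOut_le_two_mul n) hh hVle hM w
  have b2 : ∀ n w, ‖Q n w‖ₑ ≤ c' * (mollifyConst * riesz h w.1) := fun n w =>
    enorm_mollify_tensorKernel_le (bumpX_rOut_le_one n) (bumpV_rOut_le_one n)
      (bumpX_rOut_le_two_mul n) hh (Eventually.of_forall (b1 n)) hc't w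
  have b3 : ∀ n w, ‖Q n w * G w‖ₑ ≤ c' * mollifyConst * (riesz h w.1 * ‖G w‖ₑ) := fun n w => by
    rw [enorm_mul]
    calc _ ≤ c' * (mollifyConst * riesz h w.1) * ‖G w‖ₑ := by gcongr; exact b2 n w
      _ = _ := by ring
  have hct : c' * mollifyConst ≠ ⊤ := ENNReal.mul_ne_top hc't mollifyConst_ne_top
  simp_rw [e]
  constructor
  · intro n
    refine (enorm_integral_le_lintegral_enorm _).trans ((lintegral_mono (b3 n)).trans_eq ?_)
    rw [lintegral_const_mul' _ _ hct, hc']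
    ring
  have mr : AEMeasurable fun z : Phase => riesz h z.1 :=
    (aemeasurable_riesz hh).comp_quasiMeasurePreserving Measure.quasiMeasurePreserving_fst
  have hI : ∫⁻ z, c' * mollifyConst * (riesz h z.1 * ‖G z‖ₑ) ≠ ⊤ := by
    rw [lintegral_const_mul' _ _ hct]
    exact ENNReal.mul_ne_top hct hGfin
  have mI : AEMeasurable fun z : Phase => c' * mollifyConst * (riesz h z.1 * ‖G z‖ₑ) :=
    (mr.fun_mul hG.aestronglyMeasurable.enorm).const_mul _
  have hfinae := ae_lt_top' mI hI
  have e2 : ∫ w, θ w * (V w * G w) = ∫ w, (θ w * V w) * G w := by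
    simp_rw [mul_assoc]
  rw [e2]
  have θV : Integrable fun w => θ w * V w :=
    hVl.integrable_smul_left_of_hasCompactSupport hθ.continuous hθ.hasCompactSupport
  refine tendsto_integral_mul_of_tendsto_L1
    (fun n => ((isMollifier_seqKernel n).contDiff_mollify (ln n)).continuous.aestronglyMeasurable)
    θV.1 ?_ hG.aestronglyMeasurable
    (integrable_toReal_of_lintegral_ne_top mI hI) (fun n => ?_)
  · have l1 := tendsto_lintegral_cutoff_mollify_sub hθ hVl
    have l2 := tendsto_lintegral_mollify_sub isMollifier_seqKernel tendsto_one_div_succ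
          support_seqKernel θV
    have l3 := l1.add l2
    rw [add_zero] at l3
    refine tendsto_of_tendsto_of_tendsto_of_le_of_le tendsto_const_nhds l3
      (fun _ => zero_le) (fun n => ?_)
    have hH := isMollifier_seqKernel n
    have hsub : Integrable fun w => θ w * mollify (seqKernel n) V w - θ w * V w :=
      ((cn n).integrable_of_hasCompactSupport hθ.hasCompactSupport.mul_right).sub θV
    -- L¹ convergence of Q n to θV: the inner error is carried through the outer mollification, an
    -- L¹ contraction, and the outer error is that of the fixed integrable function θV.
    have e3 : ∀ w, Q n w - θ w * V w =
        mollify (seqKernel n) (fun w => θ w * mollify (seqKernel n) V w - θ w * V w) w +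
          (mollify (seqKernel n) (fun w => θ w * V w) w - θ w * V w) := fun w => by
      simp only [hQ, mollify_apply (seqKernel n) (fun w => θ w * _)]
      have i1 := hH.integrable_mul_sub (ln n) w
      have i2 := hH.integrable_mul_sub θV.locallyIntegrable w
      have := integral_sub i1 i2
      simp only [mollify_apply] at this ⊢
      simp only [sub_mul]
      rw [this]
      ring
    simp_rw [e3]
    calc _ ≤ ∫⁻ w, (‖mollify (seqKernel n)
            (fun w => θ w * mollify (seqKernel n) V w - θ w * V w) w‖ₑ +
          ‖mollify (seqKernel n) (fun w => θ w * V w) w - θ w * V w‖ₑ) :=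
          lintegral_mono fun w => enorm_add_le _ _
      _ = _ := lintegral_add_left'
          (hH.contDiff_mollify hsub.locallyIntegrable).continuous.aestronglyMeasurable.enorm _
      _ ≤ _ := by
          exact add_le_add_left (hH.lintegral_enorm_mollify_le hsub.1) _
  · filter_upwards [hfinae] with w hw
    have := ENNReal.toReal_mono hw.ne (b3 n w)
    simpa using this

/-! ### Coordinates, test functions, integration by parts. -/

/-- The `j`-th vector of the standard basis of `ℝ³`. -/
noncomputable def stdVec (j : Fin 3) : R3 := EuclideanSpace.single j (1 : ℝ)

lemma norm_stdVec (j : Fin 3) : ‖stdVec j‖ = 1 := by simp [stdVec]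

lemma eq_sum_smul_stdVec (x : R3) : x = ∑ j, x j • stdVec j := by
  ext i
  simp [stdVec, Fin.sum_univ_three]
  fin_cases i <;> simp

lemma pair_eq_sum (a b : R3) :
    ((a, b) : Phase) = ∑ j, (a j • ((stdVec j, 0) : Phase) + b j • ((0, stdVec j) : Phase)) := by
  refine Prod.ext ?_ ?_
  · rw [Prod.fst_sum]
    simpa using eq_sum_smul_stdVec a
  · rw [Prod.snd_sum]
    simpa using eq_sum_smul_stdVec b

lemma norm_stdVec_left (j : Fin 3) : ‖((stdVec j, 0) : Phase)‖ = 1 := by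
  simp [Prod.norm_def, norm_stdVec]

lemma norm_stdVec_right (j : Fin 3) : ‖((0, stdVec j) : Phase)‖ = 1 := by
  simp [Prod.norm_def, norm_stdVec]

/-- A test function on phase space, with the radius of a ball containing its support and a bound
for its values and its derivative. -/
structure IsTest (θ : Phase → ℝ) (R c : ℝ) : Prop where
  contDiff : ContDiff ℝ ∞ θ
  eq_zero : ∀ z ∉ Metric.closedBall (0 : Phase) R, θ z = 0
  abs_le : ∀ z, |θ z| ≤ c
  norm_fderiv_le : ∀ z, ‖fderiv ℝ θ z‖ ≤ c

namespace IsTest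

variable {θ : Phase → ℝ} {R c : ℝ}

lemma contDiff_one (hθ : IsTest θ R c) : ContDiff ℝ 1 θ := hθ.contDiff.of_le (by norm_cast)

lemma isCutoff (hθ : IsTest θ R c) : IsCutoff θ R c :=
  ⟨hθ.contDiff.continuous, hθ.eq_zero, hθ.abs_le⟩

lemma hasCompactSupport (hθ : IsTest θ R c) : HasCompactSupport θ := hθ.isCutoff.hasCompactSupport

lemma nonneg (hθ : IsTest θ R c) : 0 ≤ c := hθ.isCutoff.nonneg

lemma differentiableAt (hθ : IsTest θ R c) (z : Phase) : DifferentiableAt ℝ θ z :=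
  (hθ.contDiff_one.differentiable one_ne_zero).differentiableAt

lemma continuous_fderiv (hθ : IsTest θ R c) : Continuous (fderiv ℝ θ) :=
  hθ.contDiff_one.continuous_fderiv one_ne_zero

lemma fderiv_eq_zero (hθ : IsTest θ R c) {z : Phase}
    (hz : z ∉ Metric.closedBall (0 : Phase) R) : fderiv ℝ θ z = 0 := by
  have : θ =ᶠ[𝓝 z] fun _ => 0 := by
    filter_upwards [Metric.isClosed_closedBall.isOpen_compl.mem_nhds hz] with y hy
    exact hθ.eq_zero y hy
  rw [this.fderiv_eq]; simp

lemma abs_fderiv_le (hθ : IsTest θ R c) (z Y : Phase) : |fderiv ℝ θ z Y| ≤ c * ‖Y‖ :=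
  (ContinuousLinearMap.le_opNorm _ _).trans (mul_le_mul_of_nonneg_right (hθ.norm_fderiv_le z) (norm_nonneg _))

lemma isCutoff_fderiv (hθ : IsTest θ R c) {Y : Phase} (hY : ‖Y‖ = 1) :
    IsCutoff (fun z => fderiv ℝ θ z Y) R c where
  continuous := hθ.continuous_fderiv.clm_apply continuous_const
  eq_zero z hz := by rw [hθ.fderiv_eq_zero hz]; simp
  abs_le z := by simpa [hY] using hθ.abs_fderiv_le z Y

lemma isCutoff_snd_mul_fderiv (hθ : IsTest θ R c) (hR : 0 ≤ R) (j : Fin 3) :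
    IsCutoff (fun z => z.2 j * fderiv ℝ θ z (stdVec j, 0)) R (R * c) where
  continuous := by
    have := (hθ.isCutoff_fderiv (norm_stdVec_left j)).continuous
    fun_prop
  eq_zero z hz := by rw [hθ.fderiv_eq_zero hz]; simp
  abs_le z := by
    by_cases hz : z ∈ Metric.closedBall (0 : Phase) R
    · rw [abs_mul]
      have h1 : |z.2 j| ≤ R := by
        rw [mem_closedBall_zero_iff] at hz
        exact (PiLp.norm_apply_le z.2 j).trans ((norm_snd_le z).trans hz)
      have h2 := (hθ.isCutoff_fderiv (norm_stdVec_left j)).abs_le z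
      gcongr
    · rw [hθ.fderiv_eq_zero hz]
      simpa using mul_nonneg hR hθ.nonneg

end IsTest

lemma contDiff_one_mollify {f : Phase → ℝ} (hf : LocallyIntegrable f) (n : ℕ) :
    ContDiff ℝ 1 (mollify (seqKernel n) f) :=
  ((isMollifier_seqKernel n).contDiff_mollify hf).of_le (by norm_cast)

lemma differentiableAt_mollify {f : Phase → ℝ} (hf : LocallyIntegrable f) (n : ℕ) (z : Phase) :
    DifferentiableAt ℝ (mollify (seqKernel n) f) z :=
  ((contDiff_one_mollify hf n).differentiable one_ne_zero).differentiableAt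

lemma continuous_fderiv_mollify {f : Phase → ℝ} (hf : LocallyIntegrable f) (n : ℕ) (Y : Phase) :
    Continuous fun w => fderiv ℝ (mollify (seqKernel n) f) w Y :=
  ((contDiff_one_mollify hf n).continuous_fderiv one_ne_zero).clm_apply continuous_const

/-- Integration by parts against a test function. -/
lemma integral_test_mul_fderiv {θ F : Phase → ℝ} (hθ : ContDiff ℝ 1 θ) (hs : HasCompactSupport θ)
    (hF : ContDiff ℝ 1 F) (Y : Phase) :
    ∫ w, θ w * fderiv ℝ F w Y = -∫ w, fderiv ℝ θ w Y * F w := by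
  have c1 := hθ.continuous
  have c2 := hF.continuous
  have c3 : Continuous fun w => fderiv ℝ θ w Y :=
    (hθ.continuous_fderiv one_ne_zero).clm_apply continuous_const
  have c4 : Continuous fun w => fderiv ℝ F w Y :=
    (hF.continuous_fderiv one_ne_zero).clm_apply continuous_const
  refine integral_mul_fderiv_eq_neg_fderiv_mul_of_integrable ?_ ?_ ?_
    (fun x _ => (hθ.differentiable one_ne_zero).differentiableAt)
    (fun x _ => (hF.differentiable one_ne_zero).differentiableAt)
  · exact (c3.mul c2).integrable_of_hasCompactSupport (hs.fderiv_apply ℝ Y).mul_right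
  · exact (c1.mul c4).integrable_of_hasCompactSupport hs.mul_right
  · exact (c1.mul c2).integrable_of_hasCompactSupport hs.mul_right

/-! ### Removing the mollification, one coordinate at a time. -/

/-- The data at a fixed time entering the spatial limit for one component of the force. -/
structure IsForceComponent (h : R3 → ℝ≥0∞) (W : R3 → ℝ) : Prop where
  aemeasurable : AEMeasurable h
  lintegral_ne_top : ∫⁻ y, h y ≠ ⊤
  aestronglyMeasurable : AEStronglyMeasurable W
  enorm_le : ∀ᵐ x, ‖W x‖ₑ ≤ riesz h x

namespace IsForceComponent

variable {h : R3 → ℝ≥0∞} {W : R3 → ℝ} {u : Phase → ℝ} {M : ℝ}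

lemma enorm_le_fst (hW : IsForceComponent h W) : ∀ᵐ z : Phase, ‖W z.1‖ₑ ≤ riesz h z.1 :=
  (Measure.quasiMeasurePreserving_fst (μ := (volume : Measure R3))
    (ν := (volume : Measure R3))).ae hW.enorm_le

lemma aestronglyMeasurable_fst (hW : IsForceComponent h W) :
    AEStronglyMeasurable fun z : Phase => W z.1 :=
  hW.aestronglyMeasurable.comp_quasiMeasurePreserving
    (Measure.quasiMeasurePreserving_fst (μ := (volume : Measure R3)) (ν := (volume : Measure R3)))

lemma mul_aestronglyMeasurable (hW : IsForceComponent h W) (hu : AEStronglyMeasurable u) :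
    AEStronglyMeasurable fun z : Phase => u z * W z.1 := hu.mul hW.aestronglyMeasurable_fst

lemma mul_enorm_le (hW : IsForceComponent h W) (hb : ∀ᵐ z, |u z| ≤ M) :
    ∀ᵐ z : Phase, ‖u z * W z.1‖ₑ ≤ ENNReal.ofReal M * riesz h z.1 := by
  filter_upwards [hb, hW.enorm_le_fst] with z h1 h2
  rw [enorm_mul, ← ofReal_norm (u z)]
  gcongr
  exact h1

lemma mul_locallyIntegrable (hW : IsForceComponent h W) (hu : AEStronglyMeasurable u)
    (hb : ∀ᵐ z, |u z| ≤ M) : LocallyIntegrable fun z : Phase => u z * W z.1 :=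
  locallyIntegrable_of_enorm_le_riesz hW.aemeasurable hW.lintegral_ne_top
    (hW.mul_aestronglyMeasurable hu) ENNReal.ofReal_ne_top (hW.mul_enorm_le hb)

lemma setLIntegral_mul_le (hW : IsForceComponent h W)
    (hb : ∀ᵐ z, |u z| ≤ M) (R : ℝ) :
    ∫⁻ z in Metric.closedBall (0 : Phase) R, ‖u z * W z.1‖ₑ ≤
      ENNReal.ofReal M * (localConst R * ∫⁻ y, h y) := by
  refine (lintegral_mono_ae (ae_restrict_of_ae (hW.mul_enorm_le hb))).trans ?_
  rw [lintegral_const_mul' _ _ (by simp)]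
  gcongr
  exact setLIntegral_riesz_fst_le hW.aemeasurable R

variable {g : Phase → R3}

lemma enorm_inner_stdVec_le (a : R3) (j : Fin 3) : ‖inner ℝ a (stdVec j)‖ₑ ≤ ‖a‖ₑ := by
  rw [← ofReal_norm, ← ofReal_norm]
  refine ENNReal.ofReal_le_ofReal ((norm_inner_le_norm _ _).trans_eq ?_)
  rw [norm_stdVec, mul_one]

lemma lintegral_inner_mul_le (hW : IsForceComponent h W) (j : Fin 3) :
    ∫⁻ z, ‖inner ℝ (g z) (stdVec j) * W z.1‖ₑ ≤ ∫⁻ z, riesz h z.1 * ‖g z‖ₑ := by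
  refine lintegral_mono_ae (hW.enorm_le_fst.mono fun z hz => ?_)
  rw [enorm_mul, mul_comm]
  gcongr
  exact enorm_inner_stdVec_le _ j

lemma integrable_inner_mul (hW : IsForceComponent h W) (hg : LocallyIntegrable g)
    (hfin : ∫⁻ z, riesz h z.1 * ‖g z‖ₑ ≠ ⊤) (j : Fin 3) :
    Integrable fun z : Phase => inner ℝ (g z) (stdVec j) * W z.1 :=
  ⟨(LocallyIntegrable_inner hg _).aestronglyMeasurable.mul hW.aestronglyMeasurable_fst,
    lt_of_le_of_lt (hW.lintegral_inner_mul_le j) hfin.lt_top⟩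

end IsForceComponent

section SpatialLimit

variable {θ : Phase → ℝ} {R c : ℝ} {h : R3 → ℝ≥0∞} {W : R3 → ℝ} {u₁ u₂ : Phase → ℝ}
  {g : Phase → R3} {M : ℝ}

/-- The velocity derivative falls on the mollified u₁W, where no regularity is available;
integration by parts transfers it to the test function and to u₂, whose mollified derivative is the
mollification of its weak gradient. -/
lemma velocity_left_eq (hθ : IsTest θ R c) (hW : IsForceComponent h W)
    (hu₁ : AEStronglyMeasurable u₁) (hb₁ : ∀ᵐ z, |u₁ z| ≤ M) (hu₂ : LocallyIntegrable u₂)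
    (hg : IsWeakVelocityGradient u₂ g) (j : Fin 3) (n : ℕ) :
    -∫ w, θ w * (mollify (seqKernel n) u₂ w *
        fderiv ℝ (mollify (seqKernel n) fun z => u₁ z * W z.1) w (0, stdVec j)) =
      (∫ w, fderiv ℝ θ w (0, stdVec j) * (mollify (seqKernel n) u₂ w *
        mollify (seqKernel n) (fun z => u₁ z * W z.1) w)) +
      ∫ w, θ w * (mollify (seqKernel n) (fun z => u₁ z * W z.1) w *
        mollify (seqKernel n) (fun z => inner ℝ (g z) (stdVec j)) w) := by
  have hV := hW.mul_locallyIntegrable hu₁ hb₁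
  set V := fun z : Phase => u₁ z * W z.1
  have hge := LocallyIntegrable_inner hg.1 (stdVec j)
  have c1 := continuous_mollify hu₂ n
  have c2 := continuous_mollify hV n
  have c3 := continuous_mollify hge n
  have hθ2 : ContDiff ℝ 1 fun w => θ w * mollify (seqKernel n) u₂ w :=
    hθ.contDiff_one.mul (contDiff_one_mollify hu₂ n)
  have ibp := integral_test_mul_fderiv hθ2 hθ.hasCompactSupport.mul_right
    (contDiff_one_mollify hV n) (0, stdVec j)
  have hD : ∀ w, fderiv ℝ (mollify (seqKernel n) u₂) w (0, stdVec j) =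
      mollify (seqKernel n) (fun z => inner ℝ (g z) (stdVec j)) w := fun w => by
    have := fderiv_mollify_tensorKernel hg hu₂ (bumpX_rOut_le_one n) (bumpV_rOut_le_one n)
      (W := fun _ => 1) (stdVec j) (by simpa using hu₂) (by simpa using hge) w
    simp only [mul_one] at this
    exact this
  have e1 : ∀ w, fderiv ℝ (fun w => θ w * mollify (seqKernel n) u₂ w) w (0, stdVec j) *
      mollify (seqKernel n) V w =
      fderiv ℝ θ w (0, stdVec j) * (mollify (seqKernel n) u₂ w * mollify (seqKernel n) V w) +
        θ w * (mollify (seqKernel n) V w *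
          mollify (seqKernel n) (fun z => inner ℝ (g z) (stdVec j)) w) := fun w => by
    rw [fderiv_fun_mul (hθ.differentiableAt w) (differentiableAt_mollify hu₂ n w)]
    simp only [FunLike.coe_add, FunLike.coe_smul, Pi.add_apply, Pi.smul_apply, smul_eq_mul]
    rw [hD]; ring
  calc _ = -∫ w, θ w * mollify (seqKernel n) u₂ w *
        fderiv ℝ (mollify (seqKernel n) V) w (0, stdVec j) := by simp_rw [mul_assoc]
    _ = ∫ w, fderiv ℝ (fun w => θ w * mollify (seqKernel n) u₂ w) w (0, stdVec j) *
      mollify (seqKernel n) V w := by rw [ibp, neg_neg]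
    _ = _ := by
      simp_rw [e1]
      refine integral_add ?_ ?_
      · exact ((hθ.isCutoff_fderiv (norm_stdVec_right j)).continuous.mul
          (c1.mul c2)).integrable_of_hasCompactSupport
          (hθ.isCutoff_fderiv (norm_stdVec_right j)).hasCompactSupport.mul_right
      · exact (hθ.contDiff.continuous.mul (c2.mul c3)).integrable_of_hasCompactSupport
          hθ.hasCompactSupport.mul_right

/-- The constant in the bound of the velocity terms. -/
noncomputable def velocityConst (R c M : ℝ) : ℝ≥0∞ :=
  ENNReal.ofReal (c * M) * (ENNReal.ofReal M * localConst (R + 1)) +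
    ENNReal.ofReal c * ENNReal.ofReal M * mollifyConst ^ 2 + ENNReal.ofReal (c * M)

lemma velocityConst_ne_top (R c M : ℝ) : velocityConst R c M ≠ ⊤ := by
  unfold velocityConst
  have h1 := localConst_ne_top (R + 1)
  have h2 := mollifyConst_ne_top
  finiteness

/-- Of the two terms after integration by parts, the one with ∂θ pairs a bounded function with a
locally integrable one, and the one with g pairs a function dominated by the potential with one
integrable against that potential. The uniform bound in n serves dominated convergence in time. -/
lemma velocity_left (hθ : IsTest θ R c) (hW : IsForceComponent h W) (hM : 0 ≤ M)
    (hu₁ : AEStronglyMeasurable u₁) (hb₁ : ∀ᵐ z, |u₁ z| ≤ M)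
    (hu₂ : AEStronglyMeasurable u₂) (hb₂ : ∀ᵐ z, |u₂ z| ≤ M)
    (hg : IsWeakVelocityGradient u₂ g) (hfin : ∫⁻ z, riesz h z.1 * ‖g z‖ₑ ≠ ⊤) (j : Fin 3) :
    (∀ n, ‖-∫ w, θ w * (mollify (seqKernel n) u₂ w *
        fderiv ℝ (mollify (seqKernel n) fun z => u₁ z * W z.1) w (0, stdVec j))‖ₑ ≤
      velocityConst R c M * ((∫⁻ y, h y) + ∫⁻ z, riesz h z.1 * ‖g z‖ₑ)) ∧
    Tendsto (fun n => -∫ w, θ w * (mollify (seqKernel n) u₂ w *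
        fderiv ℝ (mollify (seqKernel n) fun z => u₁ z * W z.1) w (0, stdVec j))) atTop
      (𝓝 ((∫ w, fderiv ℝ θ w (0, stdVec j) * (u₂ w * (u₁ w * W w.1))) +
        ∫ w, θ w * (u₁ w * W w.1 * inner ℝ (g w) (stdVec j)))) := by
  have hu₂l := locallyIntegrable_of_abs_le hu₂ hb₂
  have hV := hW.mul_locallyIntegrable hu₁ hb₁
  have hge := LocallyIntegrable_inner hg.1 (stdVec j)
  have hψ := hθ.isCutoff_fderiv (norm_stdVec_right j)
  have hle : ∫⁻ z, riesz h z.1 * ‖inner ℝ (g z) (stdVec j)‖ₑ ≤ ∫⁻ z, riesz h z.1 * ‖g z‖ₑ :=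
    lintegral_mono fun z => by
      dsimp only; gcongr; exact IsForceComponent.enorm_inner_stdVec_le _ j
  obtain ⟨B, L⟩ := tendsto_integral_cutoff_mollify_riesz hθ.isCutoff hW.aemeasurable
    hW.lintegral_ne_top (hW.mul_aestronglyMeasurable hu₁) ENNReal.ofReal_ne_top
    (hW.mul_enorm_le hb₁) hge (ne_top_of_le_ne_top hfin hle)
  simp_rw [velocity_left_eq hθ hW hu₁ hb₁ hu₂l hg j]
  constructor
  · intro n
    refine (enorm_add_le _ _).trans ?_
    have b1 := enorm_integral_cutoff_mollify_mollify_le hψ hM hb₂ hV n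
    have b2 := hW.setLIntegral_mul_le hb₁ (R + 1)
    calc _ ≤ ENNReal.ofReal (c * M) * (ENNReal.ofReal M * (localConst (R + 1) * ∫⁻ y, h y)) +
          ENNReal.ofReal c * ENNReal.ofReal M * mollifyConst ^ 2 *
            ∫⁻ z, riesz h z.1 * ‖g z‖ₑ := by
          refine add_le_add (b1.trans ?_) ((B n).trans ?_)
          · exact mul_le_mul_right b2 _
          · exact mul_le_mul_right hle _
      _ = ENNReal.ofReal (c * M) * (ENNReal.ofReal M * localConst (R + 1)) * (∫⁻ y, h y) +
          ENNReal.ofReal c * ENNReal.ofReal M * mollifyConst ^ 2 *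
            ∫⁻ z, riesz h z.1 * ‖g z‖ₑ := by ring
      _ ≤ velocityConst R c M * (∫⁻ y, h y) +
          velocityConst R c M * ∫⁻ z, riesz h z.1 * ‖g z‖ₑ := by
          gcongr
          · exact (le_self_add).trans le_self_add
          · exact (le_add_self).trans le_self_add
      _ = _ := by ring
  · exact (tendsto_integral_cutoff_mollify_mollify hψ hM hu₂ hb₂ hV).add L

/-- Here the derivative already falls on u₂; since W does not depend on ξ, the derivative of the
mollified u₂W is the mollification of the integrable function W g_j, paired with the bounded u₁. -/
lemma velocity_right (hθ : IsTest θ R c) (hW : IsForceComponent h W) (hM : 0 ≤ M)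
    (hu₁ : AEStronglyMeasurable u₁) (hb₁ : ∀ᵐ z, |u₁ z| ≤ M)
    (hu₂ : AEStronglyMeasurable u₂) (hb₂ : ∀ᵐ z, |u₂ z| ≤ M)
    (hg : IsWeakVelocityGradient u₂ g) (hfin : ∫⁻ z, riesz h z.1 * ‖g z‖ₑ ≠ ⊤) (j : Fin 3) :
    (∀ n, ‖-∫ w, θ w * (mollify (seqKernel n) u₁ w *
        fderiv ℝ (mollify (seqKernel n) fun z => u₂ z * W z.1) w (0, stdVec j))‖ₑ ≤
      velocityConst R c M * ((∫⁻ y, h y) + ∫⁻ z, riesz h z.1 * ‖g z‖ₑ)) ∧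
    Tendsto (fun n => -∫ w, θ w * (mollify (seqKernel n) u₁ w *
        fderiv ℝ (mollify (seqKernel n) fun z => u₂ z * W z.1) w (0, stdVec j))) atTop
      (𝓝 (-∫ w, θ w * (u₁ w * (inner ℝ (g w) (stdVec j) * W w.1)))) := by
  have hu₂l := locallyIntegrable_of_abs_le hu₂ hb₂
  have hV := hW.mul_locallyIntegrable hu₂ hb₂
  have hG := (hW.integrable_inner_mul hg.1 hfin j).locallyIntegrable
  have e : ∀ n w, fderiv ℝ (mollify (seqKernel n) fun z => u₂ z * W z.1) w (0, stdVec j) =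
      mollify (seqKernel n) (fun z => inner ℝ (g z) (stdVec j) * W z.1) w := fun n w =>
    fderiv_mollify_tensorKernel hg hu₂l (bumpX_rOut_le_one n) (bumpV_rOut_le_one n)
      (stdVec j) hV hG w
  simp_rw [e]
  constructor
  · intro n
    rw [enorm_neg]
    refine (enorm_integral_cutoff_mollify_mollify_le hθ.isCutoff hM hb₁ hG n).trans ?_
    have h1 : ∫⁻ z in Metric.closedBall (0 : Phase) (R + 1),
        ‖inner ℝ (g z) (stdVec j) * W z.1‖ₑ ≤ ∫⁻ z, riesz h z.1 * ‖g z‖ₑ :=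
      (setLIntegral_le_lintegral _ _).trans (hW.lintegral_inner_mul_le j)
    refine mul_le_mul' ?_ (h1.trans le_add_self)
    exact le_add_self
  · exact (tendsto_integral_cutoff_mollify_mollify hθ.isCutoff hM hu₁ hb₁ hG).neg

lemma locallyIntegrable_mul_snd {u : Phase → ℝ} (hu : LocallyIntegrable u) (j : Fin 3) :
    LocallyIntegrable fun z : Phase => u z * z.2 j := by
  rw [locallyIntegrable_iff] at hu ⊢
  intro K hK
  exact (hu K hK).mul_continuousOn (by fun_prop) hK

lemma integrable_mul_fderiv_sub {u : Phase → ℝ} (hu : LocallyIntegrable u) (n : ℕ) (w Y : Phase) :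
    Integrable fun z => u z * fderiv ℝ (seqKernel n) (w - z) Y := by
  have hH := isMollifier_seqKernel n
  have hH1 : ContDiff ℝ 1 (seqKernel n) := hH.contDiff.of_le (by norm_cast)
  simp_rw [mul_comm (u _)]
  refine hu.integrable_smul_left_of_hasCompactSupport
    (g := fun z => fderiv ℝ (seqKernel n) (w - z) Y) ?_ ?_
  · exact ((hH1.continuous_fderiv one_ne_zero).comp (by fun_prop)).clm_apply continuous_const
  · exact (hH.hasCompactSupport.fderiv_apply ℝ Y).comp_homeomorph (Homeomorph.subLeft w)

/-- The commutator of the free transport with the mollification is small. -/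
lemma abs_commutator_le {u : Phase → ℝ} (hu : AEStronglyMeasurable u) (hM : 0 ≤ M)
    (hb : ∀ᵐ z, |u z| ≤ M) (j : Fin 3) (n : ℕ) (w : Phase) :
    |w.2 j * fderiv ℝ (mollify (seqKernel n) u) w (stdVec j, 0) -
      fderiv ℝ (mollify (seqKernel n) fun z => u z * z.2 j) w (stdVec j, 0)| ≤
      M * (1 / (n + 1)) := by
  have hH := isMollifier_seqKernel n
  have hl := locallyIntegrable_of_abs_le hu hb
  rw [hH.fderiv_mollify hl, hH.fderiv_mollify (locallyIntegrable_mul_snd hl j),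
    ← integral_const_mul, ← integral_sub ((integrable_mul_fderiv_sub hl n w _).const_mul _)
      (integrable_mul_fderiv_sub (locallyIntegrable_mul_snd hl j) n w _)]
  have e : ∀ z, w.2 j * (u z * fderiv ℝ (seqKernel n) (w - z) (stdVec j, 0)) -
      u z * z.2 j * fderiv ℝ (seqKernel n) (w - z) (stdVec j, 0) =
      u z * ((w - z).2 j * fderiv ℝ (seqKernel n) (w - z) (stdVec j, 0)) := fun z => by
    simp only [Prod.snd_sub, PiLp.sub_apply]; ring
  simp_rw [e]
  have hle : ‖∫ z, u z * ((w - z).2 j * fderiv ℝ (seqKernel n) (w - z) (stdVec j, 0))‖ₑ ≤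
      ENNReal.ofReal (M * (1 / (n + 1))) := by
    refine (enorm_integral_le_lintegral_enorm _).trans ?_
    calc _ ≤ ∫⁻ z, ENNReal.ofReal M *
          ‖(w - z).2 j * fderiv ℝ (seqKernel n) (w - z) (stdVec j, 0)‖ₑ := by
          refine lintegral_mono_ae (hb.mono fun z hz => ?_)
          rw [enorm_mul, ← ofReal_norm (u z)]
          gcongr
          exact hz
      _ = ENNReal.ofReal M *
          ∫⁻ z : Phase, ‖z.2 j * fderiv ℝ (seqKernel n) z (stdVec j, 0)‖ₑ := by
          rw [lintegral_const_mul' _ _ (by simp), lintegral_sub_left_eq_self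
            (fun z : Phase => ‖z.2 j * fderiv ℝ (seqKernel n) z (stdVec j, 0)‖ₑ)]
      _ ≤ _ := by
          rw [ENNReal.ofReal_mul hM]
          gcongr
          exact lintegral_seqKernel_commutator_le n j
  rw [← ofReal_norm, ENNReal.ofReal_le_ofReal_iff (by positivity)] at hle
  exact hle

/-- The constant in the bound of the free transport terms. -/
noncomputable def transportConst (R c M : ℝ) : ℝ≥0∞ :=
  ENNReal.ofReal (R * c * M) *
      (ENNReal.ofReal M * volume (Metric.closedBall (0 : Phase) (R + 1))) +
    ENNReal.ofReal (2 * c * M ^ 2) * volume (Metric.closedBall (0 : Phase) R)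

lemma transportConst_ne_top (R c M : ℝ) : transportConst R c M ≠ ⊤ := by
  unfold transportConst
  have h1 : volume (Metric.closedBall (0 : Phase) (R + 1)) ≠ ⊤ := measure_closedBall_lt_top.ne
  have h2 : volume (Metric.closedBall (0 : Phase) R) ≠ ⊤ := measure_closedBall_lt_top.ne
  finiteness

/-- Up to commutators the two terms form ξ_j ∂_{x_j} of the product of the mollified functions,
which is integrated by parts onto θ. The commutators are uniformly of size M/(n+1). -/
lemma free_transport (hθ : IsTest θ R c) (hR : 0 ≤ R) (hM : 0 ≤ M)
    (hu₁ : AEStronglyMeasurable u₁) (hb₁ : ∀ᵐ z, |u₁ z| ≤ M)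
    (hu₂ : AEStronglyMeasurable u₂) (hb₂ : ∀ᵐ z, |u₂ z| ≤ M) (j : Fin 3) :
    (∀ n, ‖-∫ w, θ w * (mollify (seqKernel n) u₂ w *
          fderiv ℝ (mollify (seqKernel n) fun z => u₁ z * z.2 j) w (stdVec j, 0) +
        mollify (seqKernel n) u₁ w *
          fderiv ℝ (mollify (seqKernel n) fun z => u₂ z * z.2 j) w (stdVec j, 0))‖ₑ ≤
      transportConst R c M) ∧
    Tendsto (fun n => -∫ w, θ w * (mollify (seqKernel n) u₂ w *
          fderiv ℝ (mollify (seqKernel n) fun z => u₁ z * z.2 j) w (stdVec j, 0) +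
        mollify (seqKernel n) u₁ w *
          fderiv ℝ (mollify (seqKernel n) fun z => u₂ z * z.2 j) w (stdVec j, 0))) atTop
      (𝓝 (∫ w, w.2 j * fderiv ℝ θ w (stdVec j, 0) * (u₁ w * u₂ w))) := by
  have hl₁ := locallyIntegrable_of_abs_le hu₁ hb₁
  have hl₂ := locallyIntegrable_of_abs_le hu₂ hb₂
  have hψ := hθ.isCutoff_snd_mul_fderiv hR j
  set a₁ := fun n => mollify (seqKernel n) u₁ with ha₁
  set a₂ := fun n => mollify (seqKernel n) u₂ with ha₂
  set d₁ := fun n w => fderiv ℝ (mollify (seqKernel n) fun z => u₁ z * z.2 j) w (stdVec j, 0)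
    with hd₁
  set d₂ := fun n w => fderiv ℝ (mollify (seqKernel n) fun z => u₂ z * z.2 j) w (stdVec j, 0)
    with hd₂
  -- The commutators of multiplication by ξ_j with mollification, after differentiation in x_j.
  set r₁ := fun n (w : Phase) => w.2 j * fderiv ℝ (a₁ n) w (stdVec j, 0) - d₁ n w with hr₁
  set r₂ := fun n (w : Phase) => w.2 j * fderiv ℝ (a₂ n) w (stdVec j, 0) - d₂ n w with hr₂
  have ca₁ : ∀ n, Continuous (a₁ n) := continuous_mollify hl₁
  have ca₂ : ∀ n, Continuous (a₂ n) := continuous_mollify hl₂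
  have cd₁ : ∀ n, Continuous (d₁ n) := fun n =>
    continuous_fderiv_mollify (locallyIntegrable_mul_snd hl₁ j) n _
  have cd₂ : ∀ n, Continuous (d₂ n) := fun n =>
    continuous_fderiv_mollify (locallyIntegrable_mul_snd hl₂ j) n _
  have cD₁ : ∀ n, Continuous fun w => fderiv ℝ (a₁ n) w (stdVec j, 0) := fun n =>
    continuous_fderiv_mollify hl₁ n _
  have cD₂ : ∀ n, Continuous fun w => fderiv ℝ (a₂ n) w (stdVec j, 0) := fun n =>
    continuous_fderiv_mollify hl₂ n _
  have cs : Continuous fun w : Phase => w.2 j := by fun_prop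
  have cr₁ : ∀ n, Continuous (r₁ n) := fun n => (cs.mul (cD₁ n)).sub (cd₁ n)
  have cr₂ : ∀ n, Continuous (r₂ n) := fun n => (cs.mul (cD₂ n)).sub (cd₂ n)
  have cθ := hθ.contDiff.continuous
  set θj : Phase → ℝ := fun w => θ w * w.2 j with hθj
  have dcs : ContDiff ℝ 1 fun w : Phase => w.2 j := by fun_prop
  have hθjd : ContDiff ℝ 1 θj := hθ.contDiff_one.mul dcs
  have hθjD : ∀ w, fderiv ℝ θj w (stdVec j, 0) = w.2 j * fderiv ℝ θ w (stdVec j, 0) := fun w => by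
    have h2 : HasFDerivAt (fun w : Phase => w.2 j)
        ((EuclideanSpace.proj j : R3 →L[ℝ] ℝ) ∘L ContinuousLinearMap.snd ℝ R3 R3) w :=
      ((EuclideanSpace.proj j : R3 →L[ℝ] ℝ) ∘L ContinuousLinearMap.snd ℝ R3 R3).hasFDerivAt
    have h3 := (hθ.differentiableAt w).hasFDerivAt.mul h2
    have e : fderiv ℝ θj w = _ := h3.fderiv
    rw [e]; simp
  have e : ∀ n, -∫ w, θ w * (a₂ n w * d₁ n w + a₁ n w * d₂ n w) =
      (∫ w, w.2 j * fderiv ℝ θ w (stdVec j, 0) * (a₁ n w * a₂ n w)) +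
        ∫ w, θ w * (a₂ n w * r₁ n w + a₁ n w * r₂ n w) := fun n => by
    have ibp := integral_test_mul_fderiv hθjd hθ.hasCompactSupport.mul_right
      (F := fun w => a₁ n w * a₂ n w)
      ((contDiff_one_mollify hl₁ n).mul (contDiff_one_mollify hl₂ n)) (stdVec j, 0)
    simp_rw [hθjD] at ibp
    have hp : ∀ w, fderiv ℝ (fun w => a₁ n w * a₂ n w) w (stdVec j, 0) =
        a₁ n w * fderiv ℝ (a₂ n) w (stdVec j, 0) + a₂ n w * fderiv ℝ (a₁ n) w (stdVec j, 0) :=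
      fun w => by
        rw [fderiv_fun_mul (differentiableAt_mollify hl₁ n w) (differentiableAt_mollify hl₂ n w)]
        rfl
    simp_rw [hp] at ibp
    rw [eq_neg_iff_add_eq_zero, add_comm, ← eq_neg_iff_add_eq_zero] at ibp
    rw [ibp, ← integral_neg, ← integral_neg, ← integral_add]
    · refine integral_congr_ae (Eventually.of_forall fun w => ?_)
      simp only [hr₁, hr₂, hθj]; ring
    · refine Integrable.neg ?_
      have k1 := cD₁ n; have k2 := cD₂ n; have k3 := ca₁ n; have k4 := ca₂ n
      exact Continuous.integrable_of_hasCompactSupport (by fun_prop)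
        (hθ.hasCompactSupport.mul_right (f' := fun w : Phase => w.2 j)).mul_right
    · have k1 := cr₁ n; have k2 := cr₂ n; have k3 := ca₁ n; have k4 := ca₂ n
      exact Continuous.integrable_of_hasCompactSupport (by fun_prop) hθ.hasCompactSupport.mul_right
  have err : ∀ n, ‖∫ w, θ w * (a₂ n w * r₁ n w + a₁ n w * r₂ n w)‖ₑ ≤
      ENNReal.ofReal (1 / (n + 1)) *
        (ENNReal.ofReal (2 * c * M ^ 2) * volume (Metric.closedBall (0 : Phase) R)) := fun n => by
    refine (enorm_integral_le_lintegral_enorm _).trans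
      ((hθ.isCutoff.lintegral_mul_le _).trans ?_)
    have hpt : ∀ w, ‖a₂ n w * r₁ n w + a₁ n w * r₂ n w‖ₑ ≤
        ENNReal.ofReal (2 * M ^ 2 * (1 / (n + 1))) := fun w => by
      rw [← ofReal_norm]
      refine ENNReal.ofReal_le_ofReal ?_
      have q1 := (isMollifier_seqKernel n).abs_mollify_le hM hb₁ w
      have q2 := (isMollifier_seqKernel n).abs_mollify_le hM hb₂ w
      have q3 : |r₁ n w| ≤ _ := abs_commutator_le hu₁ hM hb₁ j n w
      have q4 : |r₂ n w| ≤ _ := abs_commutator_le hu₂ hM hb₂ j n w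
      calc ‖a₂ n w * r₁ n w + a₁ n w * r₂ n w‖ ≤ ‖a₂ n w * r₁ n w‖ + ‖a₁ n w * r₂ n w‖ :=
            norm_add_le _ _
        _ = |a₂ n w| * |r₁ n w| + |a₁ n w| * |r₂ n w| := by simp [norm_mul]
        _ ≤ M * (M * (1 / (n + 1))) + M * (M * (1 / (n + 1))) := by
            have := hM
            refine add_le_add (mul_le_mul q2 q3 (abs_nonneg _) hM)
              (mul_le_mul q1 q4 (abs_nonneg _) hM)
        _ = _ := by ring
    calc _ ≤ ENNReal.ofReal c * ∫⁻ w in Metric.closedBall (0 : Phase) R,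
          ENNReal.ofReal (2 * M ^ 2 * (1 / (n + 1))) :=
          mul_le_mul_right (lintegral_mono fun w => hpt w) _
      _ = _ := by
          rw [lintegral_const, Measure.restrict_apply MeasurableSet.univ, univ_inter, ← mul_assoc,
            ← mul_assoc, ← ENNReal.ofReal_mul hθ.nonneg, ← ENNReal.ofReal_mul (by positivity)]
          congr 2; ring
  change (∀ n, ‖-∫ w, θ w * (a₂ n w * d₁ n w + a₁ n w * d₂ n w)‖ₑ ≤ _) ∧
    Tendsto (fun n => -∫ w, θ w * (a₂ n w * d₁ n w + a₁ n w * d₂ n w)) atTop _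
  simp_rw [e]
  constructor
  · intro n
    refine (enorm_add_le _ _).trans (add_le_add ?_ ((err n).trans ?_))
    · refine (enorm_integral_cutoff_mollify_mollify_le hψ hM hb₁ hl₂ n).trans ?_
      refine mul_le_mul_right ?_ _
      calc _ ≤ ∫⁻ z in Metric.closedBall (0 : Phase) (R + 1), ENNReal.ofReal M := by
            refine lintegral_mono_ae (ae_restrict_of_ae (hb₂.mono fun z hz => ?_))
            rw [← ofReal_norm]
            exact ENNReal.ofReal_le_ofReal hz
        _ = _ := by simp
    · refine mul_le_of_le_one_left' ?_
      rw [ENNReal.ofReal_le_one]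
      exact (bumpX_rOut_le_one n)
  · have L1 := tendsto_integral_cutoff_mollify_mollify hψ hM hu₁ hb₁ hl₂
    have L2 : Tendsto (fun n => ∫ w, θ w * (a₂ n w * r₁ n w + a₁ n w * r₂ n w)) atTop (𝓝 0) := by
      rw [tendsto_zero_iff_enorm_tendsto_zero]
      refine tendsto_of_tendsto_of_tendsto_of_le_of_le tendsto_const_nhds ?_
        (fun _ => zero_le) err
      have h0 : Tendsto (fun n : ℕ => ENNReal.ofReal (1 / ((n : ℝ) + 1))) atTop (𝓝 0) := by
        simpa using ENNReal.tendsto_ofReal tendsto_one_div_succ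
      have hne : ENNReal.ofReal (2 * c * M ^ 2) * volume (Metric.closedBall (0 : Phase) R) ≠ ⊤ :=
        ENNReal.mul_ne_top (by simp) measure_closedBall_lt_top.ne
      have := ENNReal.Tendsto.mul_const h0 (Or.inr hne)
      simpa using this
    simpa using L1.add L2

end SpatialLimit

/-! ### The fixed-time product rule after the mollification is removed. -/

/-- The data at a fixed time for a force field dominated by a Riesz potential. -/
structure IsForce (h : R3 → ℝ≥0∞) (E : R3 → R3) : Prop where
  aemeasurable : AEMeasurable h
  lintegral_ne_top : ∫⁻ y, h y ≠ ⊤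
  aestronglyMeasurable : AEStronglyMeasurable E
  enorm_le : ∀ᵐ x, ‖E x‖ₑ ≤ riesz h x

lemma enorm_apply_le (x : R3) (j : Fin 3) : ‖x j‖ₑ ≤ ‖x‖ₑ := by
  rw [← ofReal_norm, ← ofReal_norm]
  exact ENNReal.ofReal_le_ofReal (PiLp.norm_apply_le x j)

lemma inner_stdVec (x : R3) (j : Fin 3) : inner ℝ x (stdVec j) = x j := by
  simp [stdVec, EuclideanSpace.inner_single_right]

lemma inner_eq_sum (x y : R3) : inner ℝ x y = ∑ j, inner ℝ x (stdVec j) * y j := by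
  simp_rw [inner_stdVec, PiLp.inner_apply, RCLike.inner_apply, conj_trivial, mul_comm]

lemma fderiv_apply_pair (θ : Phase → ℝ) (w : Phase) (a b : R3) :
    fderiv ℝ θ w (a, b) =
      ∑ j, (a j * fderiv ℝ θ w (stdVec j, 0) + b j * fderiv ℝ θ w (0, stdVec j)) := by
  conv_lhs => rw [pair_eq_sum a b]
  simp only [map_sum, map_add, map_smul, smul_eq_mul]

namespace IsForce

variable {h : R3 → ℝ≥0∞} {E : R3 → R3} {u : Phase → ℝ} {M : ℝ}

lemma component (hE : IsForce h E) (j : Fin 3) : IsForceComponent h fun x => E x j where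
  aemeasurable := hE.aemeasurable
  lintegral_ne_top := hE.lintegral_ne_top
  aestronglyMeasurable :=
    (EuclideanSpace.proj (𝕜 := ℝ) j).continuous.comp_aestronglyMeasurable hE.aestronglyMeasurable
  enorm_le := hE.enorm_le.mono fun _ hx => (enorm_apply_le _ j).trans hx

end IsForce

/-- Minus the divergence of the transport flux of `u`, mollified. -/
noncomputable def transportDeriv (H u : Phase → ℝ) (E : R3 → R3) (w : Phase) : ℝ :=
  -∫ z, u z * fderiv ℝ H (w - z) (z.2, E z.1)

section

variable {θ : Phase → ℝ} {R c : ℝ} {h₁ h₂ : R3 → ℝ≥0∞} {E₁ E₂ E : R3 → R3} {h : R3 → ℝ≥0∞}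
  {u u₁ u₂ : Phase → ℝ} {g : Phase → R3} {M : ℝ}

lemma transportDeriv_eq_sum (hE : IsForce h E) (hu : AEStronglyMeasurable u)
    (hb : ∀ᵐ z, |u z| ≤ M) (n : ℕ) (w : Phase) :
    transportDeriv (seqKernel n) u E w =
      -∑ j, (fderiv ℝ (mollify (seqKernel n) fun z => u z * z.2 j) w (stdVec j, 0) +
        fderiv ℝ (mollify (seqKernel n) fun z => u z * E z.1 j) w (0, stdVec j)) := by
  have hH := isMollifier_seqKernel n
  have hl := locallyIntegrable_of_abs_le hu hb
  have h1 := fun j => integrable_mul_fderiv_sub (locallyIntegrable_mul_snd hl j) n w (stdVec j, 0)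
  have h2 := fun j => integrable_mul_fderiv_sub
    ((hE.component j).mul_locallyIntegrable hu hb) n w (0, stdVec j)
  unfold transportDeriv
  congr 1
  have e : ∀ z : Phase, u z * fderiv ℝ (seqKernel n) (w - z) (z.2, E z.1) =
      ∑ j, (u z * z.2 j * fderiv ℝ (seqKernel n) (w - z) (stdVec j, 0) +
        u z * E z.1 j * fderiv ℝ (seqKernel n) (w - z) (0, stdVec j)) := fun z => by
    rw [fderiv_apply_pair, Finset.mul_sum]
    exact Finset.sum_congr rfl fun j _ => by ring
  simp_rw [e]
  rw [integral_finsetSum _ fun j _ => (h1 j).fun_add (h2 j)]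
  refine Finset.sum_congr rfl fun j _ => ?_
  rw [integral_add (h1 j) (h2 j), hH.fderiv_mollify (locallyIntegrable_mul_snd hl j),
    hH.fderiv_mollify ((hE.component j).mul_locallyIntegrable hu hb)]

/-- The time derivative of the localized product of two mollified solutions. -/
noncomputable def productRate (θ : Phase → ℝ) (n : ℕ) (u₁ u₂ : Phase → ℝ) (E₁ E₂ : R3 → R3) : ℝ :=
  ∫ w, θ w * (transportDeriv (seqKernel n) u₁ E₁ w * mollify (seqKernel n) u₂ w +
    mollify (seqKernel n) u₁ w * transportDeriv (seqKernel n) u₂ E₂ w)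

/-- Splits the rate into the three kinds of terms treated above: free transport for both functions
together, the force on u₁, and the force on u₂. -/
lemma productRate_eq_sum (hθ : IsTest θ R c) (hE₁ : IsForce h₁ E₁) (hE₂ : IsForce h₂ E₂)
    (hu₁ : AEStronglyMeasurable u₁) (hb₁ : ∀ᵐ z, |u₁ z| ≤ M)
    (hu₂ : AEStronglyMeasurable u₂) (hb₂ : ∀ᵐ z, |u₂ z| ≤ M) (n : ℕ) :
    productRate θ n u₁ u₂ E₁ E₂ =
      ∑ j, (-(∫ w, θ w * (mollify (seqKernel n) u₂ w *
            fderiv ℝ (mollify (seqKernel n) fun z => u₁ z * z.2 j) w (stdVec j, 0) +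
          mollify (seqKernel n) u₁ w *
            fderiv ℝ (mollify (seqKernel n) fun z => u₂ z * z.2 j) w (stdVec j, 0))) +
        -(∫ w, θ w * (mollify (seqKernel n) u₂ w *
          fderiv ℝ (mollify (seqKernel n) fun z => u₁ z * E₁ z.1 j) w (0, stdVec j))) +
        -(∫ w, θ w * (mollify (seqKernel n) u₁ w *
          fderiv ℝ (mollify (seqKernel n) fun z => u₂ z * E₂ z.1 j) w (0, stdVec j)))) := by
  have hl₁ := locallyIntegrable_of_abs_le hu₁ hb₁
  have hl₂ := locallyIntegrable_of_abs_le hu₂ hb₂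
  have c0 := hθ.contDiff.continuous
  have c1 := continuous_mollify hl₁ n
  have c2 := continuous_mollify hl₂ n
  have d1 := fun j => continuous_fderiv_mollify (locallyIntegrable_mul_snd hl₁ j) n (stdVec j, 0)
  have d2 := fun j => continuous_fderiv_mollify (locallyIntegrable_mul_snd hl₂ j) n (stdVec j, 0)
  have e1 := fun j => continuous_fderiv_mollify
    ((hE₁.component j).mul_locallyIntegrable hu₁ hb₁) n (0, stdVec j)
  have e2 := fun j => continuous_fderiv_mollify
    ((hE₂.component j).mul_locallyIntegrable hu₂ hb₂) n (0, stdVec j)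
  have i1 : ∀ j, Integrable fun w => θ w * (mollify (seqKernel n) u₂ w *
      fderiv ℝ (mollify (seqKernel n) fun z => u₁ z * z.2 j) w (stdVec j, 0) +
        mollify (seqKernel n) u₁ w *
          fderiv ℝ (mollify (seqKernel n) fun z => u₂ z * z.2 j) w (stdVec j, 0)) := fun j =>
    (c0.mul ((c2.mul (d1 j)).add (c1.mul (d2 j)))).integrable_of_hasCompactSupport
      hθ.hasCompactSupport.mul_right
  have i2 : ∀ j, Integrable fun w => θ w * (mollify (seqKernel n) u₂ w *
      fderiv ℝ (mollify (seqKernel n) fun z => u₁ z * E₁ z.1 j) w (0, stdVec j)) := fun j =>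
    (c0.mul (c2.mul (e1 j))).integrable_of_hasCompactSupport hθ.hasCompactSupport.mul_right
  have i3 : ∀ j, Integrable fun w => θ w * (mollify (seqKernel n) u₁ w *
      fderiv ℝ (mollify (seqKernel n) fun z => u₂ z * E₂ z.1 j) w (0, stdVec j)) := fun j =>
    (c0.mul (c1.mul (e2 j))).integrable_of_hasCompactSupport hθ.hasCompactSupport.mul_right
  unfold productRate
  simp_rw [transportDeriv_eq_sum hE₁ hu₁ hb₁, transportDeriv_eq_sum hE₂ hu₂ hb₂]
  simp_rw [← neg_add, Finset.sum_neg_distrib]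
  have e : ∀ j, _ := fun j => integral_add ((i1 j).fun_add (i2 j)) (i3 j)
  have e' : ∀ j, _ := fun j => integral_add (i1 j) (i2 j)
  simp_rw [← e', ← e]
  rw [← integral_finsetSum _ fun j _ => ((i1 j).fun_add (i2 j)).fun_add (i3 j), ← integral_neg]
  refine integral_congr_ae (Eventually.of_forall fun w => ?_)
  simp only [Fin.sum_univ_three]
  ring

/-- The constant in the bound of `productRate`. -/
noncomputable def productConst (R c M : ℝ) : ℝ≥0∞ := 3 * (transportConst R c M + velocityConst R c M)

lemma productConst_ne_top (R c M : ℝ) : productConst R c M ≠ ⊤ := by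
  have h1 := transportConst_ne_top R c M
  have h2 := velocityConst_ne_top R c M
  unfold productConst
  finiteness

lemma integrable_test_velocity (hθ : IsTest θ R c) (hE : IsForce h E)
    (hu₁ : AEStronglyMeasurable u₁) (hb₁ : ∀ᵐ z, |u₁ z| ≤ M)
    (hu₂ : AEStronglyMeasurable u₂) (hb₂ : ∀ᵐ z, |u₂ z| ≤ M) (j : Fin 3) :
    Integrable fun w => fderiv ℝ θ w (0, stdVec j) * (u₂ w * (u₁ w * E w.1 j)) := by
  have hψ := hθ.isCutoff_fderiv (norm_stdVec_right j)
  have := ((hE.component j).mul_locallyIntegrable hu₁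
    hb₁).integrable_smul_left_of_hasCompactSupport hψ.continuous hψ.hasCompactSupport
  refine (this.bdd_mul hu₂ hb₂).congr (Eventually.of_forall fun w => ?_)
  simp only [smul_eq_mul]; ring

lemma integrable_test_spatial (hθ : IsTest θ R c) (hR : 0 ≤ R)
    (hu₁ : AEStronglyMeasurable u₁) (hb₁ : ∀ᵐ z, |u₁ z| ≤ M)
    (hu₂ : AEStronglyMeasurable u₂) (hb₂ : ∀ᵐ z, |u₂ z| ≤ M) (j : Fin 3) :
    Integrable fun w => w.2 j * fderiv ℝ θ w (stdVec j, 0) * (u₁ w * u₂ w) := by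
  have hψ := hθ.isCutoff_snd_mul_fderiv hR j
  have := (locallyIntegrable_of_abs_le hu₁ hb₁).integrable_smul_left_of_hasCompactSupport
    hψ.continuous hψ.hasCompactSupport
  refine (this.bdd_mul hu₂ hb₂).congr (Eventually.of_forall fun w => ?_)
  simp only [smul_eq_mul]; ring

lemma integrable_test_inner (hθ : IsTest θ R c) (hE : IsForce h E)
    (hu : AEStronglyMeasurable u) (hb : ∀ᵐ z, |u z| ≤ M) (hg : LocallyIntegrable g)
    (hfin : ∫⁻ z, riesz h z.1 * ‖g z‖ₑ ≠ ⊤) (j : Fin 3) :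
    Integrable fun w => θ w * (u w * (inner ℝ (g w) (stdVec j) * E w.1 j)) := by
  have := (hE.component j).integrable_inner_mul hg hfin j
  exact (this.bdd_mul hu hb).bdd_mul hθ.contDiff.continuous.aestronglyMeasurable
    (Eventually.of_forall hθ.abs_le)

/-- The limit of `productRate` as the mollification is removed. -/
theorem productRate_bound_tendsto (hθ : IsTest θ R c) (hR : 0 ≤ R) (hM : 0 ≤ M)
    (hE₁ : IsForce h₁ E₁) (hE₂ : IsForce h₂ E₂)
    (hu₁ : AEStronglyMeasurable u₁) (hb₁ : ∀ᵐ z, |u₁ z| ≤ M)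
    (hu₂ : AEStronglyMeasurable u₂) (hb₂ : ∀ᵐ z, |u₂ z| ≤ M)
    (hg : IsWeakVelocityGradient u₂ g) (hfin₁ : ∫⁻ z, riesz h₁ z.1 * ‖g z‖ₑ ≠ ⊤)
    (hfin₂ : ∫⁻ z, riesz h₂ z.1 * ‖g z‖ₑ ≠ ⊤) :
    (∀ n, ‖productRate θ n u₁ u₂ E₁ E₂‖ₑ ≤ productConst R c M *
      (1 + ((∫⁻ y, h₁ y) + ∫⁻ z, riesz h₁ z.1 * ‖g z‖ₑ) +
        ((∫⁻ y, h₂ y) + ∫⁻ z, riesz h₂ z.1 * ‖g z‖ₑ))) ∧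
    Tendsto (fun n => productRate θ n u₁ u₂ E₁ E₂) atTop
      (𝓝 ((∫ w, u₁ w * u₂ w * fderiv ℝ θ w (w.2, E₁ w.1)) +
        ∫ w, θ w * (u₁ w * inner ℝ (g w) (E₁ w.1 - E₂ w.1)))) := by
  have F := fun j => free_transport hθ hR hM hu₁ hb₁ hu₂ hb₂ j
  have L := fun j => velocity_left hθ (hE₁.component j) hM hu₁ hb₁ hu₂ hb₂ hg hfin₁ j
  have D := fun j => velocity_right hθ (hE₂.component j) hM hu₁ hb₁ hu₂ hb₂ hg hfin₂ j
  simp_rw [productRate_eq_sum hθ hE₁ hE₂ hu₁ hb₁ hu₂ hb₂]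
  constructor
  · intro n
    refine (enorm_sum_le _ _).trans ?_
    refine (Finset.sum_le_card_nsmul _ _ _ fun j _ => (enorm_add_le _ _).trans
      (add_le_add ((enorm_add_le _ _).trans (add_le_add ((F j).1 n) ((L j).1 n)))
        ((D j).1 n))).trans ?_
    simp only [Finset.card_univ, Fintype.card_fin, nsmul_eq_mul, Nat.cast_ofNat]
    unfold productConst
    rw [mul_assoc]
    refine mul_le_mul_right ?_ _
    rw [mul_add _ (1 + _), mul_add _ 1, mul_one]
    refine add_le_add (add_le_add le_self_add ?_) ?_
    · exact mul_le_mul' le_add_self le_rfl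
    · exact mul_le_mul' le_add_self le_rfl
  · have T := tendsto_finsetSum (Finset.univ : Finset (Fin 3)) fun j _ =>
      ((F j).2.add (L j).2).add (D j).2
    convert T using 2
    have i1 := integrable_test_spatial hθ hR hu₁ hb₁ hu₂ hb₂
    have i2 := integrable_test_velocity hθ hE₁ hu₁ hb₁ hu₂ hb₂
    have i3 := integrable_test_inner hθ hE₁ hu₁ hb₁ hg.1 hfin₁
    have i4 := integrable_test_inner hθ hE₂ hu₁ hb₁ hg.1 hfin₂
    have e1 : ∫ w, u₁ w * u₂ w * fderiv ℝ θ w (w.2, E₁ w.1) =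
        ∑ j, ((∫ w, w.2 j * fderiv ℝ θ w (stdVec j, 0) * (u₁ w * u₂ w)) +
          ∫ w, fderiv ℝ θ w (0, stdVec j) * (u₂ w * (u₁ w * E₁ w.1 j))) := by
      simp_rw [← integral_add (i1 _) (i2 _)]
      rw [← integral_finsetSum _ fun j _ => (i1 j).fun_add (i2 j)]
      refine integral_congr_ae (Eventually.of_forall fun w => ?_)
      simp only [fderiv_apply_pair θ w w.2, Fin.sum_univ_three]
      ring
    have e2 : ∫ w, θ w * (u₁ w * inner ℝ (g w) (E₁ w.1 - E₂ w.1)) =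
        ∑ j, ((∫ w, θ w * (u₁ w * (inner ℝ (g w) (stdVec j) * E₁ w.1 j))) -
          ∫ w, θ w * (u₁ w * (inner ℝ (g w) (stdVec j) * E₂ w.1 j))) := by
      have i34 : ∀ j, Integrable fun w => θ w * (u₁ w * (inner ℝ (g w) (stdVec j) * E₁ w.1 j)) -
          θ w * (u₁ w * (inner ℝ (g w) (stdVec j) * E₂ w.1 j)) := fun j => (i3 j).sub (i4 j)
      simp_rw [← integral_sub (i3 _) (i4 _)]
      rw [← integral_finsetSum _ fun j _ => i34 j]
      refine integral_congr_ae (Eventually.of_forall fun w => ?_)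
      simp only [inner_eq_sum (g w) (E₁ w.1 - E₂ w.1), Fin.sum_univ_three, PiLp.sub_apply]
      ring
    have e3 : ∀ j, ∫ w, θ w * (u₁ w * E₁ w.1 j * inner ℝ (g w) (stdVec j)) =
        ∫ w, θ w * (u₁ w * (inner ℝ (g w) (stdVec j) * E₁ w.1 j)) := fun j => by
      congr 1; ext w; ring
    rw [e1, e2, ← Finset.sum_add_distrib]
    refine Finset.sum_congr rfl fun j _ => ?_
    rw [e3]; ring

/-- The velocity part of the renormalization identity. -/
theorem integral_test_mul_inner_self (hθ : IsTest θ R c) (hM : 0 ≤ M) (hE : IsForce h E)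
    (hu : AEStronglyMeasurable u) (hb : ∀ᵐ z, |u z| ≤ M)
    (hg : IsWeakVelocityGradient u g) (hfin : ∫⁻ z, riesz h z.1 * ‖g z‖ₑ ≠ ⊤) :
    2 * ∫ w, θ w * (u w * inner ℝ (g w) (E w.1)) =
      -∫ w, u w * u w * fderiv ℝ θ w (0, E w.1) := by
  have key : ∀ j, (∫ w, fderiv ℝ θ w (0, stdVec j) * (u w * (u w * E w.1 j))) =
      -(2 * ∫ w, θ w * (u w * (inner ℝ (g w) (stdVec j) * E w.1 j))) := fun j => by
    -- With u₁ = u₂ = u and the same force component, the left and the right expressions coincide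
    -- before the limit, so their two limits agree; this is the chain rule 2u∂u = ∂(u²) tested
    -- against θ.
    have := tendsto_nhds_unique
      (velocity_left hθ (hE.component j) hM hu hb hu hb hg hfin j).2
      (velocity_right hθ (hE.component j) hM hu hb hu hb hg hfin j).2
    have e3 : ∫ w, θ w * (u w * E w.1 j * inner ℝ (g w) (stdVec j)) =
        ∫ w, θ w * (u w * (inner ℝ (g w) (stdVec j) * E w.1 j)) := by
      congr 1; ext w; ring
    rw [e3] at this
    linarith
  have i2 := integrable_test_velocity hθ hE hu hb hu hb
  have i3 := integrable_test_inner hθ hE hu hb hg.1 hfin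
  have e1 : ∫ w, u w * u w * fderiv ℝ θ w (0, E w.1) =
      ∑ j, ∫ w, fderiv ℝ θ w (0, stdVec j) * (u w * (u w * E w.1 j)) := by
    rw [← integral_finsetSum _ fun j _ => i2 j]
    refine integral_congr_ae (Eventually.of_forall fun w => ?_)
    have := fderiv_apply_pair θ w 0 (E w.1)
    simp only [PiLp.zero_apply, zero_mul, zero_add] at this
    simp only [this, Fin.sum_univ_three]
    ring
  have e2 : ∫ w, θ w * (u w * inner ℝ (g w) (E w.1)) =
      ∑ j, ∫ w, θ w * (u w * (inner ℝ (g w) (stdVec j) * E w.1 j)) := by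
    rw [← integral_finsetSum _ fun j _ => i3 j]
    refine integral_congr_ae (Eventually.of_forall fun w => ?_)
    simp only [inner_eq_sum (g w) (E w.1), Fin.sum_univ_three]
    ring
  rw [e1, e2, Finset.mul_sum, ← Finset.sum_neg_distrib]
  refine Finset.sum_congr rfl fun j _ => ?_
  rw [key, neg_neg]

end

/-! ### Functions of time: primitives and weak derivatives. -/

/-- The product rule for two primitives. -/
lemma mul_sub_mul_eq_integral {T : ℝ} (hT : 0 ≤ T) {F f G g : ℝ → ℝ}
    (hf : IntervalIntegrable f volume 0 T) (hg : IntervalIntegrable g volume 0 T)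
    (hF : ∀ t ∈ Icc 0 T, F t - F 0 = ∫ r in 0..t, f r)
    (hG : ∀ t ∈ Icc 0 T, G t - G 0 = ∫ r in 0..t, g r) :
    F T * G T - F 0 * G 0 = ∫ r in 0..T, (f r * G r + F r * g r) := by
  have h0 : (0 : ℝ) ∈ uIcc 0 T := left_mem_uIcc
  have ac : ∀ (k : ℝ → ℝ) (c : ℝ), IntervalIntegrable k volume 0 T →
      AbsolutelyContinuousOnInterval (fun t => c + ∫ r in 0..t, k r) 0 T := fun k c hk =>
    (LipschitzWith.const (α := ℝ) c).lipschitzOnWith.absolutelyContinuousOnInterval.fun_add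
      (hk.absolutelyContinuousOnInterval_intervalIntegral h0)
  have dv : ∀ (k : ℝ → ℝ) (c : ℝ), IntervalIntegrable k volume 0 T →
      ∀ᵐ t, t ∈ uIcc 0 T → deriv (fun t => c + ∫ r in 0..t, k r) t = k t := fun k c hk => by
    filter_upwards [hk.ae_hasDerivAt_integral] with t ht hm
    exact ((ht hm 0 h0).const_add c).deriv
  have key := (ac f (F 0) hf).integral_deriv_mul_eq_sub (ac g (G 0) hg)
  simp only [intervalIntegral.integral_same, add_zero, ← hF T (right_mem_Icc.2 hT),
    ← hG T (right_mem_Icc.2 hT), add_sub_cancel] at key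
  rw [← key]
  refine intervalIntegral.integral_congr_ae ?_
  filter_upwards [dv f (F 0) hf, dv g (G 0) hg] with t h1 h2 hm
  have hm1 := uIoc_subset_uIcc hm
  have hm2 : t ∈ Icc 0 T := by rwa [uIcc_of_le hT] at hm1
  rw [h1 hm1, h2 hm1, ← hF t hm2, ← hG t hm2]
  ring

lemma exists_Icc_of_tsupport_subset {T : ℝ} (hT : 0 < T) {ζ : ℝ → ℝ} (hs : HasCompactSupport ζ)
    (hsub : tsupport ζ ⊆ Ioo 0 T) :
    ∃ a b, 0 < a ∧ a ≤ b ∧ b < T ∧ tsupport ζ ⊆ Icc a b := by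
  have hK : IsCompact (tsupport ζ ∪ {T / 2}) := hs.isCompact.union isCompact_singleton
  have hne : (tsupport ζ ∪ {T / 2}).Nonempty := ⟨T / 2, by simp⟩
  have hK2 : tsupport ζ ∪ {T / 2} ⊆ Ioo 0 T :=
    union_subset hsub (singleton_subset_iff.2 ⟨by linarith, by linarith⟩)
  obtain ⟨a, ha, ha'⟩ := hK.exists_isLeast hne
  obtain ⟨b, hb, hb'⟩ := hK.exists_isGreatest hne
  exact ⟨a, b, (hK2 ha).1, ha' hb, (hK2 hb).2, fun x hx =>
    ⟨ha' (Or.inl hx), hb' (Or.inl hx)⟩⟩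

/-- The primitive of a test function of vanishing integral is a test function. -/
lemma primitive_test {T : ℝ} (hT : 0 < T) {ζ : ℝ → ℝ} (hζ : ContDiff ℝ ∞ ζ)
    (hs : HasCompactSupport ζ) (hsub : tsupport ζ ⊆ Ioo 0 T) (h0 : ∫ t, ζ t = 0) :
    ContDiff ℝ ∞ (fun t => ∫ r in 0..t, ζ r) ∧ HasCompactSupport (fun t => ∫ r in 0..t, ζ r) ∧
      tsupport (fun t => ∫ r in 0..t, ζ r) ⊆ Ioo 0 T ∧
      deriv (fun t => ∫ r in 0..t, ζ r) = ζ := by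
  have hd : ∀ t, HasDerivAt (fun t => ∫ r in 0..t, ζ r) (ζ t) t := fun t =>
    hζ.continuous.integral_hasStrictDerivAt 0 t |>.hasDerivAt
  have hder : deriv (fun t => ∫ r in 0..t, ζ r) = ζ := funext fun t => (hd t).deriv
  obtain ⟨a, b, ha, hab, hb, hsup⟩ := exists_Icc_of_tsupport_subset hT hs hsub
  have hz : ∀ t ∉ Icc a b, ∫ r in 0..t, ζ r = 0 := fun t ht => by
    -- To the left of the support the integrand vanishes on the whole interval; to the right the
    -- primitive equals the full integral, which is zero.
    rcases lt_or_ge t a with h | h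
    · refine (intervalIntegral.integral_congr (g := fun _ => 0) fun r hr => ?_).trans
        intervalIntegral.integral_zero
      refine image_eq_zero_of_notMem_tsupport fun hr' => ?_
      have h1 := (hsup hr').1
      have h2 : r ≤ max 0 t := hr.2
      exact absurd (h1.trans h2) (not_le.2 (max_lt ha h))
    · have hbt : b < t := not_le.1 fun h' => ht ⟨h, h'⟩
      rw [intervalIntegral.integral_eq_integral_of_support_subset, h0]
      intro r hr
      have := hsup (subset_tsupport _ hr)
      exact ⟨ha.trans_le this.1, this.2.trans hbt.le⟩
  have hts : tsupport (fun t => ∫ r in 0..t, ζ r) ⊆ Icc a b :=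
    closure_minimal (fun t ht => by_contra fun h => ht (hz t h)) isClosed_Icc
  refine ⟨?_, HasCompactSupport.intro isCompact_Icc hz, hts.trans fun t ht =>
    ⟨ha.trans_le ht.1, ht.2.trans_lt hb⟩, hder⟩
  rw [contDiff_infty_iff_deriv, hder]
  exact ⟨fun t => (hd t).differentiableAt, hζ⟩

lemma integral_mul_eq_intervalIntegral {T : ℝ} {ζ b : ℝ → ℝ}
    (hsub : tsupport ζ ⊆ Ioo 0 T) : ∫ t, ζ t * b t = ∫ t in 0..T, ζ t * b t := by
  refine (intervalIntegral.integral_eq_integral_of_support_subset fun t ht => ?_).symm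
  have := hsub (subset_tsupport _ (left_ne_zero_of_mul ht))
  exact ⟨this.1, this.2.le⟩

/-- A continuous function whose distributional derivative is integrable is its primitive. -/
lemma sub_eq_integral_of_weak_deriv {T : ℝ} {b c : ℝ → ℝ} (hb : ContinuousOn b (Icc 0 T))
    (hc : IntegrableOn c (Icc 0 T))
    (hw : ∀ η : ℝ → ℝ, ContDiff ℝ ∞ η → HasCompactSupport η → tsupport η ⊆ Ioo 0 T →
      (∫ t, deriv η t * b t) + ∫ t, η t * c t = 0) :
    ∀ t ∈ Icc 0 T, b t - b 0 = ∫ r in 0..t, c r := by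
  intro t ht
  rcases (ht.1.trans ht.2).eq_or_lt with hT | hT
  · obtain rfl : t = 0 := le_antisymm (hT ▸ ht.2) ht.1
    simp
  have hci : IntervalIntegrable c volume 0 T :=
    (intervalIntegrable_iff_integrableOn_Icc_of_le hT.le).2 hc
  set C : ℝ → ℝ := fun t => ∫ r in 0..t, c r with hC
  have hCac : AbsolutelyContinuousOnInterval C 0 T :=
    hci.absolutelyContinuousOnInterval_intervalIntegral left_mem_uIcc
  have hCc : ContinuousOn C (Icc 0 T) := by simpa [uIcc_of_le hT.le] using hCac.continuousOn
  set B : ℝ → ℝ := fun t => b t - C t with hB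
  have hBc : ContinuousOn B (Icc 0 T) := hb.sub hCc
  -- The weak equation makes b minus the primitive of c orthogonal to derivatives of test functions,
  -- that is, to test functions of mean zero.
  have hzero : ∀ ζ : ℝ → ℝ, ContDiff ℝ ∞ ζ → HasCompactSupport ζ → tsupport ζ ⊆ Ioo 0 T →
      ∫ t, ζ t = 0 → ∫ t in 0..T, ζ t * B t = 0 := by
    intro ζ h1 h2 h3 h4
    obtain ⟨p1, p2, p3, p4⟩ := primitive_test hT h1 h2 h3 h4
    set η : ℝ → ℝ := fun t => ∫ r in 0..t, ζ r with hη
    have e := hw η p1 p2 p3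
    rw [p4, integral_mul_eq_intervalIntegral h3,
      integral_mul_eq_intervalIntegral p3] at e
    have ηac : AbsolutelyContinuousOnInterval η 0 T :=
      (h1.continuous.intervalIntegrable 0 T).absolutelyContinuousOnInterval_intervalIntegral
        left_mem_uIcc
    have ibp := ηac.integral_mul_deriv_eq_deriv_mul hCac
    have hηT : η T = 0 := image_eq_zero_of_notMem_tsupport fun h => lt_irrefl _ (p3 h).2
    have hη0 : η 0 = 0 := image_eq_zero_of_notMem_tsupport fun h => lt_irrefl _ (p3 h).1
    have e2 : ∫ t in 0..T, η t * deriv C t = ∫ t in 0..T, η t * c t := by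
      refine intervalIntegral.integral_congr_ae ?_
      filter_upwards [hci.ae_hasDerivAt_integral] with r hr hm
      rw [(hr (uIoc_subset_uIcc hm) 0 left_mem_uIcc).deriv]
    rw [e2, hηT, hη0, p4] at ibp
    rw [ibp] at e
    have i1 : IntervalIntegrable (fun t => ζ t * b t) volume 0 T :=
      (h1.continuous.continuousOn.mul (by rwa [uIcc_of_le hT.le])).intervalIntegrable
    have i2 : IntervalIntegrable (fun t => ζ t * C t) volume 0 T :=
      (h1.continuous.continuousOn.mul (by rwa [uIcc_of_le hT.le])).intervalIntegrable
    simp only [hB, mul_sub]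
    rw [intervalIntegral.integral_sub i1 i2]
    linarith
  -- A fixed bump of mass one inside (0, T): subtracting a multiple of it gives any test function
  -- mean zero, which shows B to be the constant k almost everywhere.
  obtain ⟨κ, hκ⟩ : ∃ κ : ContDiffBump (T / 2), κ.rOut = T / 4 :=
    ⟨⟨T / 8, T / 4, by positivity, by linarith⟩, rfl⟩
  have κ1 : ContDiff ℝ ∞ (κ.normed volume) := κ.contDiff_normed
  have κ2 : HasCompactSupport (κ.normed volume) := κ.hasCompactSupport_normed
  have κ3 : tsupport (κ.normed volume) ⊆ Ioo 0 T := by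
    rw [κ.tsupport_normed_eq, hκ, Real.closedBall_eq_Icc]
    exact fun r hr => ⟨by linarith [hr.1], by linarith [hr.2]⟩
  set k := ∫ t in 0..T, κ.normed volume t * B t with hk
  have hBi : ∀ ζ : ℝ → ℝ, Continuous ζ → IntervalIntegrable (fun t => ζ t * B t) volume 0 T :=
    fun ζ h => (h.continuousOn.mul (by rwa [uIcc_of_le hT.le])).intervalIntegrable
  have hae : ∀ᵐ t, t ∈ Ioo 0 T → B t - k = 0 := by
    refine isOpen_Ioo.ae_eq_zero_of_integral_contDiff_smul_eq_zero ?_ fun ζ h1 h2 h3 => ?_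
    · exact ((hBc.mono Ioo_subset_Icc_self).sub continuousOn_const).locallyIntegrableOn
        measurableSet_Ioo
    · have hm := hzero (fun t => ζ t - (∫ r, ζ r) * κ.normed volume t)
        (h1.sub (contDiff_const.mul κ1)) (h2.sub κ2.mul_left) ?_ ?_
      · simp only [sub_mul, mul_assoc] at hm
        rw [intervalIntegral.integral_sub (hBi ζ h1.continuous)
          ((hBi _ κ1.continuous).const_mul _), intervalIntegral.integral_const_mul, ← hk] at hm
        simp only [smul_eq_mul]
        rw [integral_mul_eq_intervalIntegral h3]
        simp only [mul_sub]
        rw [intervalIntegral.integral_sub (hBi ζ h1.continuous)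
          ((h1.continuous.intervalIntegrable 0 T).mul_const k), intervalIntegral.integral_mul_const]
        rw [intervalIntegral.integral_eq_integral_of_support_subset (f := ζ)]
        · exact hm
        · intro r hr
          have := h3 (subset_tsupport _ hr)
          exact ⟨this.1, this.2.le⟩
      · refine (tsupport_sub _ _).trans (union_subset h3 ?_)
        exact (closure_mono fun r hr => right_ne_zero_of_mul hr).trans κ3
      · rw [integral_sub (h1.continuous.integrable_of_hasCompactSupport h2)
          (κ.integrable_normed.const_mul _), integral_const_mul, κ.integral_normed]
        ring
  have hae2 : B =ᵐ[volume.restrict (Ioo 0 T)] fun _ => k := by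
    rw [Filter.EventuallyEq, ae_restrict_iff' measurableSet_Ioo]
    filter_upwards [hae] with r hr hm
    linarith [hr hm]
  -- Continuity upgrades the almost everywhere statement to all of (0, T), and then to the
  -- endpoints.
  have hIoo : EqOn B (fun _ => k) (Ioo 0 T) :=
    Measure.eqOn_open_of_ae_eq hae2 isOpen_Ioo (hBc.mono Ioo_subset_Icc_self) continuousOn_const
  have hIcc : EqOn B (fun _ => k) (Icc 0 T) :=
    hIoo.of_subset_closure hBc continuousOn_const Ioo_subset_Icc_self
      (by rw [closure_Ioo hT.ne])
  have e1 : b t - C t = k := hIcc ht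
  have e0 : b 0 - C 0 = k := hIcc (left_mem_Icc.2 hT.le)
  have : C 0 = 0 := by simp [hC]
  change b t - b 0 = C t
  linarith

/-! ### Curves of bounded functions transported by a dominated force. -/

/-- A bounded curve of functions on phase space together with a force field dominated by Riesz
potentials. -/
structure IsCurve (T M : ℝ) (N : ℝ≥0∞) (h : ℝ → R3 → ℝ≥0∞) (u : ℝ → Phase → ℝ)
    (E : ℝ → R3 → R3) : Prop where
  nonneg : 0 ≤ M
  ne_top : N ≠ ⊤
  meas : AEStronglyMeasurable (fun p : ℝ × Phase => u p.1 p.2)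
    ((volume.restrict (Icc 0 T)).prod volume)
  force_meas : AEStronglyMeasurable (fun p : ℝ × R3 => E p.1 p.2)
    ((volume.restrict (Icc 0 T)).prod volume)
  slice_meas : ∀ t ∈ Icc 0 T, AEStronglyMeasurable (u t)
  abs_le : ∀ t ∈ Icc 0 T, ∀ᵐ z, |u t z| ≤ M
  isForce : ∀ t ∈ Icc 0 T, IsForce (h t) (E t)
  lintegral_le : ∀ t ∈ Icc 0 T, ∫⁻ y, h t y ≤ N

/-- The constant in the bound of the weak time derivative. -/
noncomputable def curveConst (R c M : ℝ) (N : ℝ≥0∞) : ℝ≥0∞ :=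
  ENNReal.ofReal M * (ENNReal.ofReal c *
    (ENNReal.ofReal R * volume (Metric.closedBall (0 : Phase) R) + localConst R * N))

lemma curveConst_ne_top (R c M : ℝ) {N : ℝ≥0∞} (hN : N ≠ ⊤) : curveConst R c M N ≠ ⊤ := by
  unfold curveConst
  have h1 := localConst_ne_top R
  have h2 : volume (Metric.closedBall (0 : Phase) R) ≠ ⊤ := measure_closedBall_lt_top.ne
  finiteness

/-- On the support of θ the transport direction (ξ, E) has norm at most R + |·|⁻² * h, and the
potential is integrable on balls with a bound depending only on the mass of h. Hence uniformity in
time. -/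
lemma lintegral_test_transport_le {θ u : Phase → ℝ} {R c M : ℝ} {h : R3 → ℝ≥0∞} {E : R3 → R3}
    (hθ : IsTest θ R c) (hE : IsForce h E) (hb : ∀ᵐ z, |u z| ≤ M) :
    ∫⁻ z, ‖u z * fderiv ℝ θ z (z.2, E z.1)‖ₑ ≤ curveConst R c M (∫⁻ y, h y) := by
  have he : ∀ᵐ z : Phase, ‖E z.1‖ₑ ≤ riesz h z.1 :=
    (Measure.quasiMeasurePreserving_fst (μ := (volume : Measure R3))
      (ν := (volume : Measure R3))).ae hE.enorm_le
  calc _ ≤ ∫⁻ z, (Metric.closedBall (0 : Phase) R).indicator (fun z => ENNReal.ofReal M *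
        (ENNReal.ofReal c * (ENNReal.ofReal R + riesz h z.1))) z := by
        refine lintegral_mono_ae ?_
        filter_upwards [he, hb] with z h1 h2
        by_cases hz : z ∈ Metric.closedBall (0 : Phase) R
        · rw [indicator_of_mem hz, enorm_mul, ← ofReal_norm (u z)]
          refine mul_le_mul' (ENNReal.ofReal_le_ofReal h2) ?_
          refine (ContinuousLinearMap.le_opENorm _ _).trans (mul_le_mul' ?_ ?_)
          · rw [← ofReal_norm]
            exact ENNReal.ofReal_le_ofReal (hθ.norm_fderiv_le z)
          · rw [← ofReal_norm, Prod.norm_mk, ENNReal.ofReal_max, ofReal_norm (E z.1)]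
            rw [mem_closedBall_zero_iff] at hz
            exact max_le ((ENNReal.ofReal_le_ofReal ((norm_snd_le z).trans hz)).trans le_self_add)
              (h1.trans le_add_self)
        · rw [hθ.fderiv_eq_zero hz]; simp
    _ = ENNReal.ofReal M * (ENNReal.ofReal c *
          ∫⁻ z in Metric.closedBall (0 : Phase) R, (ENNReal.ofReal R + riesz h z.1)) := by
        rw [lintegral_indicator measurableSet_closedBall, lintegral_const_mul' _ _ (by simp),
          lintegral_const_mul' _ _ (by simp)]
    _ ≤ _ := by
        unfold curveConst
        gcongr
        rw [lintegral_add_left measurable_const, setLIntegral_const]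
        gcongr
        exact setLIntegral_riesz_fst_le hE.aemeasurable R

namespace IsCurve

variable {T M : ℝ} {N : ℝ≥0∞} {h : ℝ → R3 → ℝ≥0∞} {u : ℝ → Phase → ℝ} {E : ℝ → R3 → R3}

lemma force_meas_phase (hc : IsCurve T M N h u E) :
    AEStronglyMeasurable (fun p : ℝ × Phase => E p.1 p.2.1)
      ((volume.restrict (Icc 0 T)).prod volume) := by
  have q : Measure.QuasiMeasurePreserving (Prod.map id Prod.fst : ℝ × Phase → ℝ × R3)
      ((volume.restrict (Icc 0 T)).prod volume) ((volume.restrict (Icc 0 T)).prod volume) :=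
    QuasiMeasurePreserving.prodMap (.id _) Measure.quasiMeasurePreserving_fst
  exact hc.force_meas.comp_quasiMeasurePreserving q

lemma aestronglyMeasurable_clm_apply {α : Type*} [MeasurableSpace α] {μ : Measure α}
    {L : α → Phase →L[ℝ] ℝ} {Y : α → Phase} (hL : AEStronglyMeasurable L μ)
    (hY : AEStronglyMeasurable Y μ) : AEStronglyMeasurable (fun a => L a (Y a)) μ :=
  isBoundedBilinearMap_apply.continuous.comp_aestronglyMeasurable (hL.prodMk hY)

variable {θ : Phase → ℝ} {R c : ℝ}

lemma lintegral_test_le (hc : IsCurve T M N h u E) (hθ : IsTest θ R c) {t : ℝ}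
    (ht : t ∈ Icc 0 T) :
    ∫⁻ z, ‖u t z * fderiv ℝ θ z (z.2, E t z.1)‖ₑ ≤ curveConst R c M N := by
  refine (lintegral_test_transport_le hθ (hc.isForce t ht) (hc.abs_le t ht)).trans ?_
  unfold curveConst
  have := hc.lintegral_le t ht
  gcongr

lemma integrable_test (hc : IsCurve T M N h u E) (hθ : IsTest θ R c) :
    Integrable (fun p : ℝ × Phase => u p.1 p.2 * fderiv ℝ θ p.2 (p.2.2, E p.1 p.2.1))
      ((volume.restrict (Icc 0 T)).prod volume) := by
  have m : AEStronglyMeasurable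
      (fun p : ℝ × Phase => u p.1 p.2 * fderiv ℝ θ p.2 (p.2.2, E p.1 p.2.1))
      ((volume.restrict (Icc 0 T)).prod volume) := by
    refine hc.meas.mul (aestronglyMeasurable_clm_apply ?_ ?_)
    · exact (hθ.continuous_fderiv.comp continuous_snd).aestronglyMeasurable
    · exact AEStronglyMeasurable.prodMk (by fun_prop) hc.force_meas_phase
  refine ⟨m, ?_⟩
  rw [hasFiniteIntegral_iff_enorm, lintegral_prod _ m.enorm]
  refine lt_of_le_of_lt (setLIntegral_mono' measurableSet_Icc fun t ht => hc.lintegral_test_le hθ ht) ?_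
  rw [setLIntegral_const]
  exact ENNReal.mul_lt_top (curveConst_ne_top R c M hc.ne_top).lt_top (by simp)

lemma intervalIntegrable_test (hc : IsCurve T M N h u E) (hT : 0 ≤ T) (hθ : IsTest θ R c) :
    IntervalIntegrable (fun t => ∫ z, u t z * fderiv ℝ θ z (z.2, E t z.1)) volume 0 T :=
  (intervalIntegrable_iff_integrableOn_Icc_of_le hT).2 (hc.integrable_test hθ).integral_prod_left

end IsCurve

lemma exists_isTest {ψ : Phase → ℝ} (h1 : ContDiff ℝ ∞ ψ) (h2 : HasCompactSupport ψ) :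
    ∃ R c, 0 ≤ R ∧ IsTest ψ R c := by
  have hd : ContDiff ℝ 1 ψ := h1.of_le (by norm_cast)
  obtain ⟨r, hr⟩ := h2.isCompact.isBounded.subset_closedBall 0
  obtain ⟨a, ha⟩ := h1.continuous.bounded_above_of_compact_support h2
  obtain ⟨b, hb⟩ := (hd.continuous_fderiv one_ne_zero).bounded_above_of_compact_support
    (h2.fderiv ℝ)
  refine ⟨max r 0, max a b, le_max_right _ _, h1, fun z hz => ?_, fun z => ?_, fun z => ?_⟩
  · exact image_eq_zero_of_notMem_tsupport fun h =>
      hz (Metric.closedBall_subset_closedBall (le_max_left _ _) (hr h))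
  · exact (ha z).trans (le_max_left _ _)
  · exact (hb z).trans (le_max_right _ _)

lemma IsMollifier.fderiv_sub {H : Phase → ℝ} (hH : IsMollifier H) (w z : Phase) :
    fderiv ℝ (fun z => H (w - z)) z = -fderiv ℝ H (w - z) := by
  have h1 : ContDiff ℝ 1 H := hH.contDiff.of_le (by norm_cast)
  have h2 := (h1.differentiable one_ne_zero (w - z)).hasFDerivAt.comp z
    ((hasFDerivAt_id z).const_sub w)
  have e : fderiv ℝ (fun z => H (w - z)) z = _ := h2.fderiv
  rw [e]
  ext <;> simp

/-- The translates of a mollifier, uniformly as test functions. -/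
lemma IsMollifier.exists_isTest_sub {H : Phase → ℝ} (hH : IsMollifier H) :
    ∃ c, ∀ R w, w ∈ Metric.closedBall (0 : Phase) R → IsTest (fun z => H (w - z)) (R + 1) c := by
  obtain ⟨r, c, -, ht⟩ := exists_isTest hH.contDiff hH.hasCompactSupport
  refine ⟨c, fun R w hw => ⟨hH.contDiff.comp (by fun_prop), fun z hz => ?_, fun z => ht.abs_le _,
    fun z => ?_⟩⟩
  · by_contra hne
    have h1 := hH.support (Function.mem_support.2 hne)
    rw [mem_closedBall_zero_iff] at h1 hw hz
    have : ‖z‖ ≤ ‖w‖ + ‖w - z‖ := by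
      calc ‖z‖ = ‖w - (w - z)‖ := by rw [sub_sub_cancel]
        _ ≤ _ := norm_sub_le _ _
    linarith
  · rw [hH.fderiv_sub, norm_neg]
    exact ht.norm_fderiv_le _

/-- A curve solving the transport equation in the weak sense, integrated in time. -/
structure IsWeakCurve (T M : ℝ) (N : ℝ≥0∞) (h : ℝ → R3 → ℝ≥0∞) (u : ℝ → Phase → ℝ)
    (E : ℝ → R3 → R3) : Prop extends IsCurve T M N h u E where
  weak : ∀ ψ : Phase → ℝ, ContDiff ℝ ∞ ψ → HasCompactSupport ψ → ∀ t ∈ Icc 0 T,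
    (∫ z, u t z * ψ z) - ∫ z, u 0 z * ψ z =
      ∫ r in 0..t, ∫ z, u r z * fderiv ℝ ψ z (z.2, E r z.1)

namespace IsWeakCurve

variable {T M : ℝ} {N N₁ N₂ : ℝ≥0∞} {h h₁ h₂ : ℝ → R3 → ℝ≥0∞} {u u₁ u₂ : ℝ → Phase → ℝ}
  {E E₁ E₂ : ℝ → R3 → R3}

lemma transportDeriv_eq {H : Phase → ℝ} (hH : IsMollifier H) (u : Phase → ℝ) (E : R3 → R3)
    (w : Phase) : transportDeriv H u E w =
      ∫ z, u z * fderiv ℝ (fun z => H (w - z)) z (z.2, E z.1) := by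
  unfold transportDeriv
  simp_rw [hH.fderiv_sub]
  rw [← integral_neg]
  refine integral_congr_ae (Eventually.of_forall fun z => ?_)
  exact (mul_neg (u z) (fderiv ℝ H (w - z) (z.2, E z.1))).symm

/-- The weak equation tested with the translated kernel H(w - ·): a mollified solution is, at each
fixed point w, a primitive in time. -/
lemma mollify_sub (hc : IsWeakCurve T M N h u E) {H : Phase → ℝ} (hH : IsMollifier H)
    (w : Phase) {t : ℝ} (ht : t ∈ Icc 0 T) :
    mollify H (u t) w - mollify H (u 0) w =
      ∫ r in 0..t, transportDeriv H (u r) (E r) w := by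
  simp_rw [transportDeriv_eq hH, mollify_apply]
  exact hc.weak (fun z => H (w - z)) (hH.contDiff.comp (by fun_prop))
    (hH.hasCompactSupport.comp_homeomorph (Homeomorph.subLeft w)) t ht

end IsWeakCurve

namespace IsCurve

variable {T M : ℝ} {N : ℝ≥0∞} {h : ℝ → R3 → ℝ≥0∞} {u : ℝ → Phase → ℝ} {E : ℝ → R3 → R3}
  {H : Phase → ℝ}

lemma intervalIntegrable_transportDeriv (hc : IsCurve T M N h u E) (hT : 0 ≤ T)
    (hH : IsMollifier H) (w : Phase) :
    IntervalIntegrable (fun t => transportDeriv H (u t) (E t) w) volume 0 T := by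
  obtain ⟨c, hc'⟩ := hH.exists_isTest_sub
  simp_rw [IsWeakCurve.transportDeriv_eq hH]
  exact hc.intervalIntegrable_test hT (hc' ‖w‖ w (by simp))

lemma exists_abs_transportDeriv_le (hc : IsCurve T M N h u E) (hH : IsMollifier H) (R : ℝ) :
    ∃ K, ∀ t ∈ Icc 0 T, ∀ w ∈ Metric.closedBall (0 : Phase) R,
      |transportDeriv H (u t) (E t) w| ≤ K := by
  obtain ⟨c, hc'⟩ := hH.exists_isTest_sub
  refine ⟨(curveConst (R + 1) c M N).toReal, fun t ht w hw => ?_⟩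
  rw [IsWeakCurve.transportDeriv_eq hH]
  have := (enorm_integral_le_lintegral_enorm _).trans (hc.lintegral_test_le (hc' R w hw) ht)
  rw [← ofReal_norm, ENNReal.ofReal_le_iff_le_toReal (curveConst_ne_top _ _ _ hc.ne_top)] at this
  exact this

lemma aestronglyMeasurable_curry (hc : IsCurve T M N h u E) :
    AEStronglyMeasurable (fun q : (ℝ × Phase) × Phase => u q.1.1 q.2)
      (((volume.restrict (Icc 0 T)).prod volume).prod volume) := by
  have q : Measure.QuasiMeasurePreserving (Prod.map Prod.fst id : (ℝ × Phase) × Phase → ℝ × Phase)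
      (((volume.restrict (Icc 0 T)).prod volume).prod volume)
      ((volume.restrict (Icc 0 T)).prod volume) :=
    QuasiMeasurePreserving.prodMap Measure.quasiMeasurePreserving_fst (.id _)
  exact hc.meas.comp_quasiMeasurePreserving q

lemma aestronglyMeasurable_force_curry (hc : IsCurve T M N h u E) :
    AEStronglyMeasurable (fun q : (ℝ × Phase) × Phase => E q.1.1 q.2.1)
      (((volume.restrict (Icc 0 T)).prod volume).prod volume) := by
  have q : Measure.QuasiMeasurePreserving (Prod.map Prod.fst id : (ℝ × Phase) × Phase → ℝ × Phase)
      (((volume.restrict (Icc 0 T)).prod volume).prod volume)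
      ((volume.restrict (Icc 0 T)).prod volume) :=
    QuasiMeasurePreserving.prodMap Measure.quasiMeasurePreserving_fst (.id _)
  exact hc.force_meas_phase.comp_quasiMeasurePreserving q

lemma aestronglyMeasurable_mollify (hc : IsCurve T M N h u E) (hH : IsMollifier H) :
    AEStronglyMeasurable (fun p : ℝ × Phase => mollify H (u p.1) p.2)
      ((volume.restrict (Icc 0 T)).prod volume) := by
  have hk : Continuous fun q : (ℝ × Phase) × Phase => H (q.1.2 - q.2) :=
    hH.continuous.comp (by fun_prop)
  exact (hc.aestronglyMeasurable_curry.mul hk.aestronglyMeasurable).integral_prod_right'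

lemma aestronglyMeasurable_transportDeriv (hc : IsCurve T M N h u E) (hH : IsMollifier H) :
    AEStronglyMeasurable (fun p : ℝ × Phase => transportDeriv H (u p.1) (E p.1) p.2)
      ((volume.restrict (Icc 0 T)).prod volume) := by
  have hH1 : ContDiff ℝ 1 H := hH.contDiff.of_le (by norm_cast)
  have hk : Continuous fun q : (ℝ × Phase) × Phase => fderiv ℝ H (q.1.2 - q.2) :=
    (hH1.continuous_fderiv one_ne_zero).comp (by fun_prop)
  have hY : AEStronglyMeasurable (fun q : (ℝ × Phase) × Phase => ((q.2.2, E q.1.1 q.2.1) : Phase))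
      (((volume.restrict (Icc 0 T)).prod volume).prod volume) :=
    AEStronglyMeasurable.prodMk (by fun_prop) hc.aestronglyMeasurable_force_curry
  exact (hc.aestronglyMeasurable_curry.mul (aestronglyMeasurable_clm_apply
    hk.aestronglyMeasurable hY)).integral_prod_right'.neg

end IsCurve

/-! ### Evolution of the localized product of two weak solutions. -/

section Doubling

variable {T M : ℝ} {N₁ N₂ : ℝ≥0∞} {h₁ h₂ : ℝ → R3 → ℝ≥0∞} {u₁ u₂ : ℝ → Phase → ℝ}
  {E₁ E₂ : ℝ → R3 → R3} {θ : Phase → ℝ} {R c : ℝ}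

lemma integrable_productRate_integrand (hc₁ : IsCurve T M N₁ h₁ u₁ E₁)
    (hc₂ : IsCurve T M N₂ h₂ u₂ E₂) (hθ : IsTest θ R c) (n : ℕ) :
    Integrable (fun p : ℝ × Phase => θ p.2 *
      (transportDeriv (seqKernel n) (u₁ p.1) (E₁ p.1) p.2 * mollify (seqKernel n) (u₂ p.1) p.2 +
        mollify (seqKernel n) (u₁ p.1) p.2 * transportDeriv (seqKernel n) (u₂ p.1) (E₂ p.1) p.2))
      ((volume.restrict (Icc 0 T)).prod volume) := by
  have hH := isMollifier_seqKernel n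
  obtain ⟨K₁, hK₁⟩ := hc₁.exists_abs_transportDeriv_le hH R
  obtain ⟨K₂, hK₂⟩ := hc₂.exists_abs_transportDeriv_le hH R
  have hθc : Continuous fun p : ℝ × Phase => θ p.2 := hθ.contDiff.continuous.comp continuous_snd
  have m := hθc.aestronglyMeasurable (μ := (volume.restrict (Icc 0 T)).prod volume) |>.mul
    (((hc₁.aestronglyMeasurable_transportDeriv hH).mul (hc₂.aestronglyMeasurable_mollify hH)).add
      ((hc₁.aestronglyMeasurable_mollify hH).mul (hc₂.aestronglyMeasurable_transportDeriv hH)))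
  have hr : (volume.restrict (Icc 0 T)).prod (volume : Measure Phase) =
      (volume.prod volume).restrict (Icc 0 T ×ˢ univ) := by
    rw [← Measure.prod_restrict, Measure.restrict_univ]
  refine (IntegrableOn.integrable_indicator (μ := (volume.restrict (Icc 0 T)).prod volume)
    (s := univ ×ˢ Metric.closedBall (0 : Phase) R)
    (f := fun _ => c * (K₁ * M + M * K₂)) ?_
    (MeasurableSet.univ.prod measurableSet_closedBall)).mono' m ?_
  · refine integrableOn_const ?_
    rw [Measure.prod_prod]
    exact ENNReal.mul_ne_top (by simp) measure_closedBall_lt_top.ne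
  · have hmem : ∀ᵐ p ∂((volume.restrict (Icc 0 T)).prod (volume : Measure Phase)),
        p.1 ∈ Icc 0 T := by
      rw [hr]
      filter_upwards [ae_restrict_mem (measurableSet_Icc.prod MeasurableSet.univ)] with p hp
      exact hp.1
    filter_upwards [hmem] with p hp
    by_cases hw : p.2 ∈ Metric.closedBall (0 : Phase) R
    · have q1 := hH.abs_mollify_le hc₁.nonneg (hc₁.abs_le p.1 hp) p.2
      have q2 := hH.abs_mollify_le hc₂.nonneg (hc₂.abs_le p.1 hp) p.2
      have q3 := hK₁ p.1 hp p.2 hw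
      have q4 := hK₂ p.1 hp p.2 hw
      have q5 := hθ.abs_le p.2
      rw [indicator_of_mem (show p ∈ univ ×ˢ Metric.closedBall (0 : Phase) R from
        ⟨mem_univ _, hw⟩)]
      change |_ * (_ * _ + _ * _)| ≤ _
      rw [abs_mul]
      refine mul_le_mul q5 ((abs_add_le _ _).trans ?_) (abs_nonneg _) hθ.nonneg
      rw [abs_mul, abs_mul]
      exact add_le_add (mul_le_mul q3 q2 (abs_nonneg _) ((abs_nonneg _).trans q3))
        (mul_le_mul q1 q4 (abs_nonneg _) hc₁.nonneg)
    · rw [indicator_of_notMem fun h => hw h.2]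
      simp [hθ.eq_zero _ hw]

/-- At each fixed w both mollified functions are absolutely continuous in time, so the ordinary
product rule applies; integration against θ and Fubini give the identity. -/
lemma integral_mollify_mul_sub (hc₁ : IsWeakCurve T M N₁ h₁ u₁ E₁)
    (hc₂ : IsWeakCurve T M N₂ h₂ u₂ E₂) (hT : 0 ≤ T) (hθ : IsTest θ R c) (n : ℕ) :
    (∫ w, θ w * (mollify (seqKernel n) (u₁ T) w * mollify (seqKernel n) (u₂ T) w)) -
        ∫ w, θ w * (mollify (seqKernel n) (u₁ 0) w * mollify (seqKernel n) (u₂ 0) w) =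
      ∫ r in 0..T, productRate θ n (u₁ r) (u₂ r) (E₁ r) (E₂ r) := by
  have hH := isMollifier_seqKernel n
  have hT0 : (0 : ℝ) ∈ Icc 0 T := left_mem_Icc.2 hT
  have hTT : T ∈ Icc 0 T := right_mem_Icc.2 hT
  have hint : ∀ t ∈ Icc 0 T, Integrable fun w =>
      θ w * (mollify (seqKernel n) (u₁ t) w * mollify (seqKernel n) (u₂ t) w) := fun t ht => by
    have c1 := continuous_mollify
      (locallyIntegrable_of_abs_le (hc₁.slice_meas t ht) (hc₁.abs_le t ht)) n
    have c2 := continuous_mollify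
      (locallyIntegrable_of_abs_le (hc₂.slice_meas t ht) (hc₂.abs_le t ht)) n
    exact (hθ.contDiff.continuous.mul (c1.mul c2)).integrable_of_hasCompactSupport
      hθ.hasCompactSupport.mul_right
  have e : ∀ w, θ w * (mollify (seqKernel n) (u₁ T) w * mollify (seqKernel n) (u₂ T) w) -
      θ w * (mollify (seqKernel n) (u₁ 0) w * mollify (seqKernel n) (u₂ 0) w) =
      ∫ r in Icc 0 T, θ w *
        (transportDeriv (seqKernel n) (u₁ r) (E₁ r) w * mollify (seqKernel n) (u₂ r) w +
          mollify (seqKernel n) (u₁ r) w * transportDeriv (seqKernel n) (u₂ r) (E₂ r) w) := by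
    intro w
    rw [integral_Icc_eq_integral_Ioc, ← intervalIntegral.integral_of_le hT,
      intervalIntegral.integral_const_mul,
      ← mul_sub_mul_eq_integral hT (hc₁.intervalIntegrable_transportDeriv hT hH w)
        (hc₂.intervalIntegrable_transportDeriv hT hH w)
        (fun t ht => hc₁.mollify_sub hH w ht) (fun t ht => hc₂.mollify_sub hH w ht)]
    ring
  rw [← integral_sub (hint T hTT) (hint 0 hT0)]
  simp_rw [e]
  rw [intervalIntegral.integral_of_le hT, ← integral_Icc_eq_integral_Ioc]
  exact (integral_integral_swap (f := fun r w => θ w *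
    (transportDeriv (seqKernel n) (u₁ r) (E₁ r) w * mollify (seqKernel n) (u₂ r) w +
      mollify (seqKernel n) (u₁ r) w * transportDeriv (seqKernel n) (u₂ r) (E₂ r) w))
    (integrable_productRate_integrand hc₁.toIsCurve hc₂.toIsCurve hθ n)).symm

/-- The localized evolution of the product of two weak solutions. -/
theorem integral_test_mul_sub (hc₁ : IsWeakCurve T M N₁ h₁ u₁ E₁)
    (hc₂ : IsWeakCurve T M N₂ h₂ u₂ E₂) (hT : 0 ≤ T) (hθ : IsTest θ R c) (hR : 0 ≤ R)
    {g : ℝ → Phase → R3} (hg : ∀ᵐ t ∂volume.restrict (Icc 0 T), IsWeakVelocityGradient (u₂ t) (g t))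
    {P : ℝ → ℝ≥0∞} (hPm : AEMeasurable P (volume.restrict (Icc 0 T)))
    (hP : ∫⁻ t in Icc 0 T, P t ≠ ⊤)
    (hP₁ : ∀ t ∈ Icc 0 T, ∫⁻ z, riesz (h₁ t) z.1 * ‖g t z‖ₑ ≤ P t)
    (hP₂ : ∀ t ∈ Icc 0 T, ∫⁻ z, riesz (h₂ t) z.1 * ‖g t z‖ₑ ≤ P t) :
    (∫ w, θ w * (u₁ T w * u₂ T w)) - ∫ w, θ w * (u₁ 0 w * u₂ 0 w) =
      ∫ t in 0..T, ((∫ w, u₁ t w * u₂ t w * fderiv ℝ θ w (w.2, E₁ t w.1)) +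
        ∫ w, θ w * (u₁ t w * inner ℝ (g t w) (E₁ t w.1 - E₂ t w.1))) := by
  have hT0 : (0 : ℝ) ∈ Icc 0 T := left_mem_Icc.2 hT
  have hTT : T ∈ Icc 0 T := right_mem_Icc.2 hT
  have L : ∀ t ∈ Icc 0 T, Tendsto (fun n => ∫ w, θ w *
      (mollify (seqKernel n) (u₁ t) w * mollify (seqKernel n) (u₂ t) w)) atTop
      (𝓝 (∫ w, θ w * (u₁ t w * u₂ t w))) := fun t ht =>
    tendsto_integral_cutoff_mollify_mollify hθ.isCutoff hc₁.nonneg (hc₁.slice_meas t ht)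
      (hc₁.abs_le t ht) (locallyIntegrable_of_abs_le (hc₂.slice_meas t ht) (hc₂.abs_le t ht))
  refine tendsto_nhds_unique ((L T hTT).sub (L 0 hT0)) ?_
  simp_rw [integral_mollify_mul_sub hc₁ hc₂ hT hθ]
  have hPfin : ∀ᵐ t ∂volume.restrict (Icc 0 T), P t < ⊤ := ae_lt_top' hPm hP
  -- A majorant in time, uniform in n: the forces contribute the masses N₁ and N₂, and their
  -- pairings with |g| contribute P.
  set B : ℝ → ℝ≥0∞ := fun t => productConst R c M * (1 + (N₁ + P t) + (N₂ + P t)) with hB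
  have hBm : AEMeasurable B (volume.restrict (Icc 0 T)) := by fun_prop
  have hBi : ∫⁻ t in Icc 0 T, B t ≠ ⊤ := by
    have h1 := productConst_ne_top R c M
    have h2 := hc₁.ne_top
    have h3 := hc₂.ne_top
    rw [lintegral_const_mul' _ _ h1, lintegral_add_right' _ (by fun_prop),
      lintegral_add_right' _ (by fun_prop), lintegral_add_right' _ hPm,
      lintegral_add_right' _ hPm]
    simp only [lintegral_const, Measure.restrict_apply MeasurableSet.univ, univ_inter,
      Real.volume_Icc]
    finiteness
  have key : ∀ᵐ t ∂volume.restrict (Icc 0 T),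
      (∀ n, ‖productRate θ n (u₁ t) (u₂ t) (E₁ t) (E₂ t)‖ ≤ (B t).toReal) ∧
      Tendsto (fun n => productRate θ n (u₁ t) (u₂ t) (E₁ t) (E₂ t)) atTop
        (𝓝 ((∫ w, u₁ t w * u₂ t w * fderiv ℝ θ w (w.2, E₁ t w.1)) +
          ∫ w, θ w * (u₁ t w * inner ℝ (g t w) (E₁ t w.1 - E₂ t w.1)))) := by
    filter_upwards [hg, hPfin, ae_restrict_mem measurableSet_Icc] with t hgt hPt ht
    obtain ⟨b, l⟩ := productRate_bound_tendsto hθ hR hc₁.nonneg (hc₁.isForce t ht)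
      (hc₂.isForce t ht) (hc₁.slice_meas t ht) (hc₁.abs_le t ht) (hc₂.slice_meas t ht)
      (hc₂.abs_le t ht) hgt (ne_top_of_le_ne_top hPt.ne (hP₁ t ht))
      (ne_top_of_le_ne_top hPt.ne (hP₂ t ht))
    refine ⟨fun n => ?_, l⟩
    have h1 := productConst_ne_top R c M
    have h2 := hc₁.ne_top
    have h3 := hc₂.ne_top
    have h4 := hPt.ne
    have hle : ‖productRate θ n (u₁ t) (u₂ t) (E₁ t) (E₂ t)‖ₑ ≤ B t := (b n).trans (by
      have := hc₁.lintegral_le t ht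
      have := hc₂.lintegral_le t ht
      have := hP₁ t ht
      have := hP₂ t ht
      simp only [hB]
      gcongr)
    rw [← ofReal_norm, ENNReal.ofReal_le_iff_le_toReal (by simp only [hB]; finiteness)] at hle
    exact hle
  have hres : volume.restrict (uIoc 0 T) ≤ volume.restrict (Icc 0 T) := by
    rw [uIoc_of_le hT]; exact Measure.restrict_mono Ioc_subset_Icc_self le_rfl
  refine intervalIntegral.tendsto_integral_filter_of_dominated_convergence
    (fun t => (B t).toReal) (Eventually.of_forall fun n => ?_) (Eventually.of_forall fun n => ?_)
    ?_ ?_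
  · exact (integrable_productRate_integrand hc₁.toIsCurve hc₂.toIsCurve hθ
      n).integral_prod_left.1.mono_measure hres
  · rw [← ae_restrict_iff' measurableSet_uIoc]
    exact (ae_mono hres) (key.mono fun t ht => ht.1 n)
  · rw [intervalIntegrable_iff_integrableOn_Icc_of_le hT]
    exact integrable_toReal_of_lintegral_ne_top hBm hBi
  · rw [← ae_restrict_iff' measurableSet_uIoc]
    exact (ae_mono hres) (key.mono fun t ht => ht.2)

end Doubling

/-! ### From renormalized solutions to weak curves. -/

lemma volume_restrict_Icc_prod_univ (T : ℝ) :
    (volume : Measure (ℝ × Phase)).restrict (Icc 0 T ×ˢ univ) =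
      (volume.restrict (Icc 0 T)).prod volume := by
  rw [Measure.volume_eq_prod, ← Measure.prod_restrict, Measure.restrict_univ]

lemma aestronglyMeasurable_forceField_slice (σ : ℝ) {f : Phase → ℝ} (hf : AEStronglyMeasurable f) :
    AEStronglyMeasurable (forceField σ f) := by
  rw [forceField_congr σ hf.ae_eq_mk]
  have h := stronglyMeasurable_forceField σ (f := fun _ => hf.mk f)
    (hf.stronglyMeasurable_mk.comp_measurable measurable_snd)
  exact (h.comp_measurable (measurable_prodMk_left (x := (0 : ℝ)))).aestronglyMeasurable

namespace IsSolution

variable {σ T : ℝ} {f : ℝ → Phase → ℝ} {Cinf : ℝ≥0} {N : ℝ≥0∞}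

lemma meas (hf : IsSolution σ T f) : AEStronglyMeasurable (fun p : ℝ × Phase => f p.1 p.2)
    ((volume.restrict (Icc 0 T)).prod volume) := by
  have h := hf.aestronglyMeasurable
  rwa [volume_restrict_Icc_prod_univ] at h

lemma ae_mem_Icc (hf : IsSolution σ T f)
    (hb : ∀ t ∈ Icc 0 T, eLpNorm (f t) ⊤ volume ≤ (Cinf : ℝ≥0∞)) {t : ℝ} (ht : t ∈ Icc 0 T) :
    ∀ᵐ z, f t z ∈ Icc (0 : ℝ) Cinf := by
  have h1 : ∀ᵐ z, ‖f t z‖ₑ ≤ (Cinf : ℝ≥0∞) := by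
    have := hb t ht
    rw [eLpNorm_exponent_top] at this
    filter_upwards [enorm_ae_le_eLpNormEssSup (f t) volume] with z hz using hz.trans this
  filter_upwards [hf.nonneg t ht, h1] with z hz hz1
  refine ⟨hz, ?_⟩
  rw [Real.enorm_of_nonneg hz, ENNReal.ofReal_le_iff_le_toReal (by simp)] at hz1
  simpa using hz1

/-- The mass is bounded on the time interval. -/
lemma exists_lintegral_le (hf : IsSolution σ T f) :
    ∃ N : ℝ≥0∞, N ≠ ⊤ ∧ ∀ t ∈ Icc 0 T, ∫⁻ z, ‖f t z‖ₑ ≤ N := by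
  -- Continuity into L¹ bounds the mass near each time by one plus the mass at that time;
  -- compactness of the interval makes the bound uniform.
  have hloc : ∀ t ∈ Icc 0 T, ∃ S ∈ 𝓝[Icc 0 T] t, ∃ N : ℝ≥0∞, N ≠ ⊤ ∧
      ∀ s ∈ S ∩ Icc 0 T, ∫⁻ z, ‖f s z‖ₑ ≤ N := fun t ht => by
    have h1 : ∀ᶠ s in 𝓝[Icc 0 T] t, eLpNorm (f s - f t) 1 volume < 1 :=
      (hf.continuous_L1 t ht).eventually (gt_mem_nhds one_pos)
    refine ⟨_, h1, 1 + ∫⁻ z, ‖f t z‖ₑ, ?_, fun s hs => ?_⟩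
    · have := (hf.integrable t ht).2.ne
      exact ENNReal.add_ne_top.2 ⟨ENNReal.one_ne_top, this⟩
    · have h2 : eLpNorm (f s - f t) 1 volume < 1 := hs.1
      rw [eLpNorm_one_eq_lintegral_enorm] at h2
      calc ∫⁻ z, ‖f s z‖ₑ ≤ ∫⁻ z, (‖(f s - f t) z‖ₑ + ‖f t z‖ₑ) := lintegral_mono fun z => by
            have := enorm_add_le ((f s - f t) z) (f t z)
            simpa using this
        _ = (∫⁻ z, ‖(f s - f t) z‖ₑ) + ∫⁻ z, ‖f t z‖ₑ :=
            lintegral_add_right' _ (hf.integrable t ht).1.enorm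
        _ ≤ _ := by gcongr
  refine isCompact_Icc.induction_on (p := fun S => ∃ N : ℝ≥0∞, N ≠ ⊤ ∧
    ∀ s ∈ S ∩ Icc 0 T, ∫⁻ z, ‖f s z‖ₑ ≤ N) (s := Icc 0 T) ?_ ?_ ?_ ?_ |>.imp
      fun N hN => ⟨hN.1, fun t ht => hN.2 t ⟨ht, ht⟩⟩
  · exact ⟨0, by simp, by simp⟩
  · rintro S S' hS ⟨N, h1, h2⟩
    exact ⟨N, h1, fun s hs => h2 s ⟨hS hs.1, hs.2⟩⟩
  · rintro S S' ⟨N, h1, h2⟩ ⟨N', h1', h2'⟩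
    refine ⟨N + N', ENNReal.add_ne_top.2 ⟨h1, h1'⟩, ?_⟩
    rintro s ⟨hs | hs, hs'⟩
    · exact (h2 s ⟨hs, hs'⟩).trans le_self_add
    · exact (h2' s ⟨hs, hs'⟩).trans le_add_self
  · exact hloc

lemma isForce (hf : IsSolution σ T f) (hσ : σ = 1 ∨ σ = -1) {t : ℝ} (ht : t ∈ Icc 0 T) :
    IsForce (fun y => ‖density (f t) y‖ₑ) (forceField σ (f t)) where
  aemeasurable := (aestronglyMeasurable_density (hf.integrable t ht).1).enorm
  lintegral_ne_top := ne_top_of_le_ne_top (hf.integrable t ht).2.ne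
    (lintegral_enorm_density_le (hf.integrable t ht).1)
  aestronglyMeasurable := aestronglyMeasurable_forceField_slice σ (hf.integrable t ht).1
  enorm_le := Eventually.of_forall fun x => enorm_forceField_le hσ (f t) x

lemma isCurve (hf : IsSolution σ T f) (hσ : σ = 1 ∨ σ = -1)
    (hb : ∀ t ∈ Icc 0 T, eLpNorm (f t) ⊤ volume ≤ (Cinf : ℝ≥0∞)) (hN : N ≠ ⊤)
    (hfN : ∀ t ∈ Icc 0 T, ∫⁻ z, ‖f t z‖ₑ ≤ N) {γ : ℝ → ℝ} (hγ : Continuous γ) {K : ℝ} (hK : 0 ≤ K)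
    (hγK : ∀ s ∈ Icc (0 : ℝ) Cinf, |γ s| ≤ K) :
    IsCurve T K N (fun t y => ‖density (f t) y‖ₑ) (fun t z => γ (f t z))
      (fun t => forceField σ (f t)) where
  nonneg := hK
  ne_top := hN
  meas := hγ.comp_aestronglyMeasurable hf.meas
  force_meas := aestronglyMeasurable_forceField σ hf.meas
  slice_meas _ ht := hγ.comp_aestronglyMeasurable (hf.integrable _ ht).1
  abs_le _ ht := (hf.ae_mem_Icc hb ht).mono fun _ hz => hγK _ hz
  isForce _ ht := hf.isForce hσ ht
  lintegral_le t ht := (lintegral_enorm_density_le (hf.integrable t ht).1).trans (hfN t ht)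

end IsSolution

lemma IsCurve.integrable_mul_test {T M : ℝ} {N : ℝ≥0∞} {h : ℝ → R3 → ℝ≥0∞} {u : ℝ → Phase → ℝ}
    {E : ℝ → R3 → R3} (hc : IsCurve T M N h u E) {θ : Phase → ℝ} {R c : ℝ} (hθ : IsTest θ R c) :
    Integrable (fun p : ℝ × Phase => u p.1 p.2 * θ p.2)
      ((volume.restrict (Icc 0 T)).prod volume) := by
  have hi : Integrable θ :=
    hθ.contDiff.continuous.integrable_of_hasCompactSupport hθ.hasCompactSupport
  have m : AEStronglyMeasurable (fun p : ℝ × Phase => u p.1 p.2 * θ p.2)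
      ((volume.restrict (Icc 0 T)).prod volume) :=
    hc.meas.mul (hθ.contDiff.continuous.comp continuous_snd).aestronglyMeasurable
  refine ⟨m, ?_⟩
  rw [hasFiniteIntegral_iff_enorm, lintegral_prod _ m.enorm]
  refine lt_of_le_of_lt (setLIntegral_mono' (g := fun _ => ENNReal.ofReal M * ∫⁻ z, ‖θ z‖ₑ)
    measurableSet_Icc fun t ht => ?_) ?_
  · rw [← lintegral_const_mul' _ _ (by simp)]
    refine lintegral_mono_ae ((hc.abs_le t ht).mono fun z hz => ?_)
    rw [enorm_mul, ← ofReal_norm (u t z)]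
    exact mul_le_mul_left (ENNReal.ofReal_le_ofReal hz) _
  · rw [setLIntegral_const]
    exact ENNReal.mul_lt_top (ENNReal.mul_lt_top (by simp) hi.2) (by simp)

/-- Product test functions. -/
lemma fderiv_mul_prod {η : ℝ → ℝ} {ψ : Phase → ℝ} (hη : ContDiff ℝ ∞ η) (hψ : ContDiff ℝ ∞ ψ)
    (p : ℝ × Phase) (Y : Phase) :
    fderiv ℝ (fun p : ℝ × Phase => η p.1 * ψ p.2) p ((1 : ℝ), Y) =
      deriv η p.1 * ψ p.2 + η p.1 * fderiv ℝ ψ p.2 Y := by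
  have h1 : DifferentiableAt ℝ η p.1 :=
    (hη.differentiable (by simp)).differentiableAt
  have h2 : DifferentiableAt ℝ ψ p.2 := (hψ.differentiable (by simp)).differentiableAt
  have h3 := (h1.hasFDerivAt.comp p hasFDerivAt_fst).mul (h2.hasFDerivAt.comp p hasFDerivAt_snd)
  have e : fderiv ℝ (fun p : ℝ × Phase => η p.1 * ψ p.2) p = _ := h3.fderiv
  rw [e]
  simp
  ring

namespace IsSolution

variable {σ T : ℝ} {f : ℝ → Phase → ℝ} {Cinf : ℝ≥0} {N : ℝ≥0∞}

/-- The renormalized equation, tested in space and integrated in time. -/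
lemma weak_of_contDiff (hf : IsSolution σ T f) (hσ : σ = 1 ∨ σ = -1)
    (hb : ∀ t ∈ Icc 0 T, eLpNorm (f t) ⊤ volume ≤ (Cinf : ℝ≥0∞)) (hN : N ≠ ⊤)
    (hfN : ∀ t ∈ Icc 0 T, ∫⁻ z, ‖f t z‖ₑ ≤ N) {β : ℝ → ℝ} (hβ : ContDiff ℝ 1 β)
    (hβM : ∃ M : ℝ, ∀ s, |β s| ≤ M) {ψ : Phase → ℝ} (hψ : ContDiff ℝ ∞ ψ)
    (hψs : HasCompactSupport ψ) {t : ℝ} (ht : t ∈ Icc 0 T) :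
    (∫ z, β (f t z) * ψ z) - ∫ z, β (f 0 z) * ψ z =
      ∫ r in 0..t, ∫ z, β (f r z) * fderiv ℝ ψ z (z.2, forceField σ (f r) z.1) := by
  obtain ⟨M, hM⟩ := hβM
  obtain ⟨R, c, hR, hθ⟩ := exists_isTest hψ hψs
  have hM0 : 0 ≤ M := (abs_nonneg _).trans (hM 0)
  have hc := hf.isCurve hσ hb hN hfN hβ.continuous hM0 (fun s _ => hM s)
  have i1 := hc.integrable_mul_test hθ
  have i2 := hc.integrable_test hθ
  refine sub_eq_integral_of_weak_deriv (b := fun t => ∫ z, β (f t z) * ψ z)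
    (c := fun r => ∫ z, β (f r z) * fderiv ℝ ψ z (z.2, forceField σ (f r) z.1))
    ?_ i2.integral_prod_left ?_ t ht
  -- β is Lipschitz on the compact range [0, C_∞] of f, so continuity of f in L¹ passes to the
  -- tested renormalization.
  · obtain ⟨L, hL⟩ := (hβ.contDiffOn (s := Icc (0 : ℝ) Cinf)).exists_lipschitzOnWith one_ne_zero
      (convex_Icc _ _) isCompact_Icc
    intro t ht
    change Tendsto _ _ _
    rw [tendsto_iff_edist_tendsto_0]
    have hlim : Tendsto (fun s => (L : ℝ≥0∞) * ENNReal.ofReal c * eLpNorm (f s - f t) 1 volume)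
        (𝓝[Icc 0 T] t) (𝓝 0) := by
      have := ENNReal.Tendsto.const_mul (a := (L : ℝ≥0∞) * ENNReal.ofReal c)
        (hf.continuous_L1 t ht) (Or.inr (by finiteness))
      simpa using this
    refine tendsto_of_tendsto_of_tendsto_of_le_of_le' tendsto_const_nhds hlim
      (Eventually.of_forall fun _ => zero_le) ?_
    filter_upwards [self_mem_nhdsWithin] with s hs
    have hi : ∀ r ∈ Icc 0 T, Integrable fun z => β (f r z) * ψ z := fun r hr =>
      (hψ.continuous.integrable_of_hasCompactSupport hψs).bdd_mul (hc.slice_meas r hr)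
        (Eventually.of_forall fun z => hM _)
    rw [edist_eq_enorm_sub, ← integral_sub (hi s hs) (hi t ht), eLpNorm_one_eq_lintegral_enorm,
      ← lintegral_const_mul' _ _ (by finiteness)]
    refine (enorm_integral_le_lintegral_enorm _).trans (lintegral_mono_ae ?_)
    filter_upwards [hf.ae_mem_Icc hb hs, hf.ae_mem_Icc hb ht] with z h1 h2
    rw [← sub_mul, enorm_mul, ← edist_eq_enorm_sub, Pi.sub_apply, ← edist_eq_enorm_sub,
      mul_right_comm, ← ofReal_norm (ψ z)]
    exact mul_le_mul' (hL h1 h2) (ENNReal.ofReal_le_ofReal (hθ.abs_le z))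
  · intro η hη hηs hηsub
    have hder : tsupport (deriv η) ⊆ Ioo 0 T := (tsupport_deriv_subset (f := η)).trans hηsub
    have hsub : tsupport (fun p : ℝ × Phase => η p.1 * ψ p.2) ⊆ tsupport η ×ˢ tsupport ψ :=
      closure_minimal (fun p hp => ⟨subset_tsupport _ (left_ne_zero_of_mul hp),
        subset_tsupport _ (right_ne_zero_of_mul hp)⟩)
        ((isClosed_tsupport _).prod (isClosed_tsupport _))
    -- Testing with η(t)ψ(z) turns the space-time equation into a weak derivative in time of the
    -- tested quantity.
    have key := hf.transport β hβ ⟨M, hM⟩ (fun p => η p.1 * ψ p.2)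
      ((hη.comp contDiff_fst).mul (hψ.comp contDiff_snd))
      ((hηs.isCompact.prod hψs.isCompact).of_isClosed_subset (isClosed_tsupport _) hsub)
      (hsub.trans (prod_mono hηsub (subset_univ _)))
    simp_rw [fderiv_mul_prod hη hψ] at key
    have hη1 : ContDiff ℝ 1 η := hη.of_le (by norm_cast)
    have cd : Continuous (deriv η) := hη1.continuous_deriv le_rfl
    obtain ⟨a₁, ha₁⟩ := cd.bounded_above_of_compact_support hηs.deriv
    obtain ⟨a₂, ha₂⟩ := hη.continuous.bounded_above_of_compact_support hηs
    have j1 : Integrable (fun p : ℝ × Phase => deriv η p.1 * (β (f p.1 p.2) * ψ p.2))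
        ((volume.restrict (Icc 0 T)).prod volume) :=
      i1.bdd_mul (cd.comp continuous_fst).aestronglyMeasurable (Eventually.of_forall fun p => ha₁ _)
    have j2 : Integrable (fun p : ℝ × Phase => η p.1 *
        (β (f p.1 p.2) * fderiv ℝ ψ p.2 (p.2.2, forceField σ (f p.1) p.2.1)))
        ((volume.restrict (Icc 0 T)).prod volume) :=
      i2.bdd_mul (hη.continuous.comp continuous_fst).aestronglyMeasurable
        (Eventually.of_forall fun p => ha₂ _)
    have hz : ∀ (ζ b : ℝ → ℝ), tsupport ζ ⊆ Ioo 0 T → ∫ t, ζ t * b t = ∫ t in Icc 0 T, ζ t * b t :=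
      fun ζ b h => (setIntegral_eq_integral_of_forall_compl_eq_zero fun t ht => by
        rw [image_eq_zero_of_notMem_tsupport fun h' => ht (Ioo_subset_Icc_self (h h')),
          zero_mul]).symm
    rw [hz _ _ hder, hz _ _ hηsub]
    refine Eq.trans ?_ key
    rw [← setIntegral_eq_integral_of_forall_compl_eq_zero (s := Icc 0 T ×ˢ univ),
      volume_restrict_Icc_prod_univ]
    · have e : ∀ p : ℝ × Phase, β (f p.1 p.2) * (deriv η p.1 * ψ p.2 +
          η p.1 * fderiv ℝ ψ p.2 (p.2.2, forceField σ (f p.1) p.2.1)) =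
          deriv η p.1 * (β (f p.1 p.2) * ψ p.2) + η p.1 *
            (β (f p.1 p.2) * fderiv ℝ ψ p.2 (p.2.2, forceField σ (f p.1) p.2.1)) :=
        fun p => by ring
      simp_rw [e]
      rw [integral_add j1 j2, integral_prod _ j1, integral_prod _ j2]
      simp_rw [integral_const_mul]
    · intro p hp
      have hp1 : p.1 ∉ Icc 0 T := fun h => hp ⟨h, mem_univ _⟩
      rw [image_eq_zero_of_notMem_tsupport fun h' => hp1 (Ioo_subset_Icc_self (hder h')),
        image_eq_zero_of_notMem_tsupport fun h' => hp1 (Ioo_subset_Icc_self (hηsub h'))]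
      ring

/-- Continuous renormalizations which are limits of admissible ones. -/
theorem isWeakCurve (hf : IsSolution σ T f) (hσ : σ = 1 ∨ σ = -1)
    (hb : ∀ t ∈ Icc 0 T, eLpNorm (f t) ⊤ volume ≤ (Cinf : ℝ≥0∞)) (hN : N ≠ ⊤)
    (hfN : ∀ t ∈ Icc 0 T, ∫⁻ z, ‖f t z‖ₑ ≤ N) {γ : ℝ → ℝ} (hγ : Continuous γ) {K : ℝ} (hK : 0 ≤ K)
    {β : ℕ → ℝ → ℝ} (hβ : ∀ k, ContDiff ℝ 1 (β k)) (hβM : ∀ k, ∃ M : ℝ, ∀ s, |β k s| ≤ M)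
    (hβK : ∀ k, ∀ s ∈ Icc (0 : ℝ) Cinf, |β k s| ≤ K)
    (hlim : ∀ s ∈ Icc (0 : ℝ) Cinf, Tendsto (fun k => β k s) atTop (𝓝 (γ s))) :
    IsWeakCurve T K N (fun t y => ‖density (f t) y‖ₑ) (fun t z => γ (f t z))
      (fun t => forceField σ (f t)) where
  toIsCurve := hf.isCurve hσ hb hN hfN hγ hK fun s hs =>
    le_of_tendsto (hlim s hs).abs (Eventually.of_forall fun k => hβK k s hs)
  weak ψ hψ hψs t ht := by
    obtain ⟨R, c, hR, hθ⟩ := exists_isTest hψ hψs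
    have hck := fun k => hf.isCurve hσ hb hN hfN (hβ k).continuous hK (hβK k)
    have L1 : ∀ r ∈ Icc 0 T, Tendsto (fun k => ∫ z, β k (f r z) * ψ z) atTop
        (𝓝 (∫ z, γ (f r z) * ψ z)) := fun r hr => by
      refine tendsto_integral_of_dominated_convergence (fun z => K * ‖ψ z‖) (fun k => ?_)
        ((hψ.continuous.integrable_of_hasCompactSupport hψs).norm.const_mul K) (fun k => ?_) ?_
      · exact ((hck k).slice_meas r hr).mul hψ.continuous.aestronglyMeasurable
      · filter_upwards [(hck k).abs_le r hr] with z hz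
        rw [norm_mul]
        exact mul_le_mul_of_nonneg_right hz (norm_nonneg _)
      · filter_upwards [hf.ae_mem_Icc hb hr] with z hz
        exact (hlim _ hz).mul_const _
    have mE : ∀ r ∈ Icc 0 T, AEStronglyMeasurable fun z : Phase =>
        fderiv ℝ ψ z (z.2, forceField σ (f r) z.1) := fun r hr =>
      IsCurve.aestronglyMeasurable_clm_apply hθ.continuous_fderiv.aestronglyMeasurable
        (AEStronglyMeasurable.prodMk (by fun_prop)
          ((hf.isForce hσ hr).aestronglyMeasurable.comp_quasiMeasurePreserving
            Measure.quasiMeasurePreserving_fst))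
    have L2 : ∀ r ∈ Icc 0 T, Tendsto (fun k =>
        ∫ z, β k (f r z) * fderiv ℝ ψ z (z.2, forceField σ (f r) z.1)) atTop
        (𝓝 (∫ z, γ (f r z) * fderiv ℝ ψ z (z.2, forceField σ (f r) z.1))) := fun r hr => by
      have hi : Integrable fun z : Phase => fderiv ℝ ψ z (z.2, forceField σ (f r) z.1) := by
        refine ⟨mE r hr, ?_⟩
        have := lintegral_test_transport_le (u := fun _ => 1) (M := 1) hθ (hf.isForce hσ hr)
          (by simp)
        simp only [one_mul] at this
        exact lt_of_le_of_lt this (curveConst_ne_top _ _ _ (hf.isForce hσ hr).lintegral_ne_top).lt_top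
      refine tendsto_integral_of_dominated_convergence
        (fun z => K * ‖fderiv ℝ ψ z (z.2, forceField σ (f r) z.1)‖) (fun k => ?_)
        (hi.norm.const_mul K) (fun k => ?_) ?_
      · exact ((hck k).slice_meas r hr).mul (mE r hr)
      · filter_upwards [(hck k).abs_le r hr] with z hz
        rw [norm_mul]
        exact mul_le_mul_of_nonneg_right hz (norm_nonneg _)
      · filter_upwards [hf.ae_mem_Icc hb hr] with z hz
        exact (hlim _ hz).mul_const _
    have h0 : (0 : ℝ) ∈ Icc 0 T := left_mem_Icc.2 (ht.1.trans ht.2)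
    -- The weak identity for each β_k passes to the limit by dominated convergence, first in phase
    -- space and then in time. Only the values of β_k on [0, C_∞] matter, so γ itself need not be C¹
    -- or bounded.
    refine tendsto_nhds_unique ((L1 t ht).sub (L1 0 h0)) ?_
    simp_rw [fun k => hf.weak_of_contDiff hσ hb hN hfN (hβ k) (hβM k) hψ hψs ht]
    have hmem : ∀ r ∈ uIoc 0 t, r ∈ Icc 0 T := fun r hr => by
      rw [uIoc_of_le ht.1] at hr
      exact ⟨hr.1.le, hr.2.trans ht.2⟩
    refine intervalIntegral.tendsto_integral_filter_of_dominated_convergence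
      (fun _ => (curveConst R c K N).toReal) (Eventually.of_forall fun k => ?_)
      (Eventually.of_forall fun k => Eventually.of_forall fun r hr => ?_)
      intervalIntegrable_const (Eventually.of_forall fun r hr => L2 r (hmem r hr))
    · refine ((hck k).integrable_test hθ).integral_prod_left.1.mono_measure ?_
      exact Measure.restrict_mono (fun r hr => hmem r hr) le_rfl
    · have := (enorm_integral_le_lintegral_enorm _).trans
        ((hck k).lintegral_test_le hθ (hmem r hr))
      rwa [← ofReal_norm, ENNReal.ofReal_le_iff_le_toReal (curveConst_ne_top _ _ _ hN)] at this

end IsSolution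

/-! ### Velocity mass in a ball controlled by the velocity gradient. -/

/-- The difference of two translated bumps on the line is the derivative of a bounded test
function. -/
lemma exists_primitive_bump_sub (a : ContDiffBump (0 : ℝ)) (L : ℝ) (hL : 0 ≤ L) :
    ∃ k : ℝ → ℝ, ContDiff ℝ ∞ k ∧ HasCompactSupport k ∧ deriv k = (fun s => a s - a (s - L)) ∧
      ∀ s, |k s| ≤ 4 * a.rOut := by
  -- A shift placing both bumps to the right of the origin, so that the primitive from 0 sees all of
  -- them; it is undone in the definition of k. The bound 4·`a.rOut` is the total mass of two bumps
  -- of height at most one and width 2·`a.rOut`.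
  set c := a.rOut + 1 with hc
  have hr := a.rOut_pos
  set ζ : ℝ → ℝ := fun s => a (s - c) - a (s - c - L) with hζ
  have hsupp : ∀ s, ζ s ≠ 0 → s ∈ Icc 1 (L + 2 * a.rOut + 1) := fun s hs => by
    by_contra hn
    refine hs ?_
    have z : ∀ r, a.rOut ≤ |r| → a r = 0 := fun r h => a.zero_of_le_dist (by simpa using h)
    rw [mem_Icc, not_and_or, not_le, not_le] at hn
    rcases hn with h | h
    · simp only [hζ]
      rw [z _ (by rw [abs_of_nonpos (by linarith)]; linarith),
        z _ (by rw [abs_of_nonpos (by linarith)]; linarith), sub_zero]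
    · simp only [hζ]
      rw [z _ (by rw [abs_of_nonneg (by linarith)]; linarith),
        z _ (by rw [abs_of_nonneg (by linarith)]; linarith), sub_zero]
  have hts : tsupport ζ ⊆ Icc 1 (L + 2 * a.rOut + 1) :=
    closure_minimal (fun s hs => hsupp s hs) isClosed_Icc
  have h1 : ContDiff ℝ ∞ ζ :=
    (a.contDiff.comp (by fun_prop)).sub (a.contDiff.comp (by fun_prop))
  have h2 : HasCompactSupport ζ := HasCompactSupport.intro isCompact_Icc fun s hs =>
    by_contra fun h => hs (hsupp s h)
  have ia : Integrable a := a.integrable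
  have i1 : Integrable fun s => a (s - c) := ia.comp_sub_right c
  have i2 : Integrable fun s => a (s - c - L) := by
    simp_rw [sub_sub]; exact ia.comp_sub_right _
  have e1 : ∫ s, a (s - c) = ∫ s, a s := integral_sub_right_eq_self (fun s => a s) c
  have e2 : ∫ s, a (s - c - L) = ∫ s, a s := by
    simp_rw [sub_sub]; exact integral_sub_right_eq_self (fun s => a s) (c + L)
  have h3 : ∫ s, ζ s = 0 := by
    rw [integral_sub i1 i2, e1, e2, sub_self]
  obtain ⟨p1, p2, -, p4⟩ := primitive_test (T := L + 2 * a.rOut + 2) (by linarith) h1 h2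
    (hts.trans fun s hs => ⟨by linarith [hs.1], by linarith [hs.2]⟩) h3
  set K : ℝ → ℝ := fun t => ∫ r in 0..t, ζ r with hK
  refine ⟨fun s => K (s + c), p1.comp (by fun_prop),
    p2.comp_homeomorph (Homeomorph.addRight c), ?_, fun s => ?_⟩
  · ext s
    rw [deriv_comp_add_const, p4]
    simp [hζ]
  · have hle : ∫ s, a s ≤ 2 * a.rOut := by
      refine (a.integral_le_measure_closedBall volume).trans_eq ?_
      rw [Measure.real, Real.volume_closedBall, ENNReal.toReal_ofReal (by linarith)]
    calc |K (s + c)| = ‖∫ r in 0..s + c, ζ r‖ := rfl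
      _ ≤ ∫ r in uIoc 0 (s + c), ‖ζ r‖ :=
          intervalIntegral.norm_integral_le_integral_norm_uIoc
      _ ≤ ∫ r, ‖ζ r‖ := setIntegral_le_integral (i1.sub i2).norm
          (Eventually.of_forall fun _ => norm_nonneg _)
      _ ≤ ∫ r, (a (r - c) + a (r - c - L)) := by
          refine integral_mono (i1.sub i2).norm (i1.add i2) fun r => ?_
          refine (norm_sub_le _ _).trans_eq ?_
          rw [Real.norm_of_nonneg a.nonneg, Real.norm_of_nonneg a.nonneg]
      _ = 2 * ∫ s, a s := by rw [integral_add i1 i2, e1, e2]; ring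
      _ ≤ _ := by linarith

/-- A bump on `ℝ³` of product form. -/
noncomputable def boxBump (a : ContDiffBump (0 : ℝ)) (ξ : R3) : ℝ := a (ξ 0) * (a (ξ 1) * a (ξ 2))

lemma norm_le_sum_abs (ξ : R3) : ‖ξ‖ ≤ |ξ 0| + |ξ 1| + |ξ 2| := by
  conv_lhs => rw [eq_sum_smul_stdVec ξ]
  refine (norm_sum_le _ _).trans_eq ?_
  simp [norm_smul, norm_stdVec, Fin.sum_univ_three]

lemma hasCompactSupport_box {k a : ℝ → ℝ} (hk : HasCompactSupport k) (ha : HasCompactSupport a) :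
    HasCompactSupport fun ξ : R3 => k (ξ 0) * (a (ξ 1) * a (ξ 2)) := by
  obtain ⟨r, hr⟩ := hk.isCompact.isBounded.subset_closedBall 0
  obtain ⟨s, hs⟩ := ha.isCompact.isBounded.subset_closedBall 0
  refine HasCompactSupport.intro (isCompact_closedBall (0 : R3) (r + s + s)) fun ξ hξ => ?_
  by_contra hne
  have h0 := hr (subset_tsupport _ (left_ne_zero_of_mul hne))
  have h1 := hs (subset_tsupport _ (left_ne_zero_of_mul (right_ne_zero_of_mul hne)))
  have h2 := hs (subset_tsupport _ (right_ne_zero_of_mul (right_ne_zero_of_mul hne)))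
  rw [mem_closedBall_zero_iff, Real.norm_eq_abs] at h0 h1 h2
  refine hξ (mem_closedBall_zero_iff.2 ((norm_le_sum_abs ξ).trans ?_))
  linarith

/-- The product structure allows the primitive to be taken in the first coordinate alone while
compact support is kept. The bound on q does not depend on the translation L, so the far box may be
sent to infinity. -/
lemma exists_box_test (a : ContDiffBump (0 : ℝ)) (L : ℝ) (hL : 0 ≤ L) :
    ∃ q : R3 → ℝ, ContDiff ℝ ∞ q ∧ HasCompactSupport q ∧
      (∀ ξ, fderiv ℝ q ξ (stdVec 0) = boxBump a ξ - boxBump a (ξ - L • stdVec 0)) ∧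
      ∀ ξ, |q ξ| ≤ 4 * a.rOut := by
  obtain ⟨k, k1, k2, k3, k4⟩ := exists_primitive_bump_sub a L hL
  have hca : ∀ j : Fin 3, ContDiff ℝ ∞ fun ξ : R3 => a (ξ j) := fun j => a.contDiff.comp (by fun_prop)
  refine ⟨fun ξ => k (ξ 0) * (a (ξ 1) * a (ξ 2)), ?_, hasCompactSupport_box k2 a.hasCompactSupport,
    fun ξ => ?_, fun ξ => ?_⟩
  · exact (k1.comp (by fun_prop)).mul ((hca 1).mul (hca 2))
  · have hp : ∀ j : Fin 3, HasFDerivAt (fun ξ : R3 => ξ j) (EuclideanSpace.proj (𝕜 := ℝ) j) ξ :=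
      fun j => (EuclideanSpace.proj (𝕜 := ℝ) j : R3 →L[ℝ] ℝ).hasFDerivAt
    have d0 := ((k1.differentiable (by simp)).differentiableAt.hasDerivAt
      (x := ξ 0)).comp_hasFDerivAt ξ (hp 0)
    have da : ∀ j : Fin 3, _ := fun j => ((a.contDiff (n := 1)).differentiable
      one_ne_zero).differentiableAt.hasDerivAt (x := ξ j) |>.comp_hasFDerivAt ξ (hp j)
    have e : fderiv ℝ (fun ξ : R3 => k (ξ 0) * (a (ξ 1) * a (ξ 2))) ξ = _ :=
      (d0.mul ((da 1).mul (da 2))).fderiv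
    rw [e]
    simp [stdVec, boxBump, k3]
    ring
  · rw [abs_mul, abs_mul, abs_of_nonneg a.nonneg, abs_of_nonneg a.nonneg]
    calc _ ≤ |k (ξ 0)| * (1 * 1) := by
          gcongr
          · exact a.nonneg
          · exact a.le_one
          · exact a.le_one
      _ ≤ _ := by simpa using k4 (ξ 0)

lemma boxBump_nonneg (a : ContDiffBump (0 : ℝ)) (ξ : R3) : 0 ≤ boxBump a ξ :=
  mul_nonneg a.nonneg (mul_nonneg a.nonneg a.nonneg)

lemma boxBump_le_one (a : ContDiffBump (0 : ℝ)) (ξ : R3) : boxBump a ξ ≤ 1 :=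
  mul_le_one₀ a.le_one (mul_nonneg a.nonneg a.nonneg) (mul_le_one₀ a.le_one a.nonneg a.le_one)

lemma continuous_boxBump (a : ContDiffBump (0 : ℝ)) : Continuous (boxBump a) := by
  have := a.continuous
  unfold boxBump
  fun_prop

lemma hasCompactSupport_boxBump (a : ContDiffBump (0 : ℝ)) : HasCompactSupport (boxBump a) :=
  hasCompactSupport_box a.hasCompactSupport a.hasCompactSupport

lemma integrable_boxBump (a : ContDiffBump (0 : ℝ)) : Integrable (boxBump a) :=
  (continuous_boxBump a).integrable_of_hasCompactSupport (hasCompactSupport_boxBump a)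

lemma boxBump_eq_one (a : ContDiffBump (0 : ℝ)) {ξ : R3} (h : ‖ξ‖ ≤ a.rIn) : boxBump a ξ = 1 := by
  have : ∀ j : Fin 3, a (ξ j) = 1 := fun j => a.one_of_mem_closedBall (by
    rw [mem_closedBall_zero_iff]; exact (PiLp.norm_apply_le ξ j).trans h)
  simp [boxBump, this]

/-- The mass of a square integrable function in a translated box vanishes at infinity. -/
lemma tendsto_lintegral_mul_boxBump {v : R3 → ℝ} (hv : AEStronglyMeasurable v)
    (h2 : ∫⁻ ξ, ‖v ξ‖ₑ ^ (2 : ℝ) ≠ ⊤) (a : ContDiffBump (0 : ℝ)) :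
    Tendsto (fun n : ℕ => ∫⁻ ξ, ‖v ξ‖ₑ * ‖boxBump a (ξ - (n : ℝ) • stdVec 0)‖ₑ) atTop (𝓝 0) := by
  have hc : ∀ n : ℕ, Continuous fun ξ => boxBump a (ξ - (n : ℝ) • stdVec 0) := fun n =>
    (continuous_boxBump a).comp (by fun_prop)
  set Q : ℕ → R3 → ℝ≥0∞ := fun n ξ => ‖boxBump a (ξ - (n : ℝ) • stdVec 0)‖ₑ with hQ
  have mQ : ∀ n, Measurable (Q n) := fun n => (hc n).enorm.measurable
  have hQ1 : ∀ n ξ, Q n ξ ≤ 1 := fun n ξ => by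
    simp only [hQ]
    rw [Real.enorm_of_nonneg (boxBump_nonneg _ _)]
    exact ENNReal.ofReal_le_one.2 (boxBump_le_one _ _)
  have hI : ∀ n, ∫⁻ ξ, Q n ξ = ∫⁻ ξ, ‖boxBump a ξ‖ₑ := fun n =>
    lintegral_sub_right_eq_self (fun ξ => ‖boxBump a ξ‖ₑ) _
  -- Cauchy–Schwarz on a box of fixed volume: only the L² mass of v in the moving box remains, and
  -- each point is eventually left behind by the box.
  have hCS : ∀ n, ∫⁻ ξ, ‖v ξ‖ₑ * Q n ξ ≤
      (∫⁻ ξ, ‖v ξ‖ₑ ^ (2 : ℝ) * Q n ξ) ^ (1 / 2 : ℝ) *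
        (∫⁻ ξ, ‖boxBump a ξ‖ₑ) ^ (1 / 2 : ℝ) := fun n => by
    have := lintegral_mul_le_sqrt (f := fun ξ => ‖v ξ‖ₑ * Q n ξ ^ (1 / 2 : ℝ))
      (g := fun ξ => Q n ξ ^ (1 / 2 : ℝ)) (hv.enorm.fun_mul ((mQ n).pow_const _).aemeasurable)
      ((mQ n).pow_const _).aemeasurable
    have e : ∀ ξ, Q n ξ ^ (1 / 2 : ℝ) * Q n ξ ^ (1 / 2 : ℝ) = Q n ξ := fun ξ => by
      rw [← ENNReal.rpow_add_of_nonneg _ _ (by norm_num) (by norm_num)]; norm_num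
    simp_rw [mul_assoc, e, ENNReal.mul_rpow_of_nonneg _ _ (zero_le_two : (0 : ℝ) ≤ 2),
      ← ENNReal.rpow_mul] at this
    norm_num at this
    rw [hI] at this
    simpa using this
  have hlim : Tendsto (fun n => ∫⁻ ξ, ‖v ξ‖ₑ ^ (2 : ℝ) * Q n ξ) atTop (𝓝 0) := by
    have := tendsto_lintegral_of_dominated_convergence' (μ := volume)
      (F := fun n ξ => ‖v ξ‖ₑ ^ (2 : ℝ) * Q n ξ) (f := fun _ => 0)
      (fun ξ => ‖v ξ‖ₑ ^ (2 : ℝ))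
      (fun n => (hv.enorm.pow_const _).fun_mul (mQ n).aemeasurable)
      (fun n => Eventually.of_forall fun ξ => mul_le_of_le_one_right' (hQ1 n ξ)) h2
      (Eventually.of_forall fun ξ => ?_)
    · simpa using this
    · refine tendsto_const_nhds.congr' ?_
      filter_upwards [eventually_ge_atTop ⌈ξ 0 + a.rOut⌉₊] with n hn
      have h1 : ξ 0 + a.rOut ≤ n := (Nat.le_ceil _).trans (by exact_mod_cast hn)
      have : a (ξ 0 - n) = 0 := a.zero_of_le_dist (by
        rw [dist_zero_right, Real.norm_eq_abs, abs_sub_comm]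
        exact le_trans (by linarith) (le_abs_self _))
      simp [hQ, boxBump, stdVec, this]
  have hV : (∫⁻ ξ, ‖boxBump a ξ‖ₑ) ^ (1 / 2 : ℝ) ≠ ⊤ :=
    ENNReal.rpow_ne_top_of_nonneg (by norm_num) (integrable_boxBump a).2.ne
  have h3 : Tendsto (fun n => (∫⁻ ξ, ‖v ξ‖ₑ ^ (2 : ℝ) * Q n ξ) ^ (1 / 2 : ℝ) *
      (∫⁻ ξ, ‖boxBump a ξ‖ₑ) ^ (1 / 2 : ℝ)) atTop (𝓝 0) := by
    have h4 := (ENNReal.continuous_rpow_const (y := (1 / 2 : ℝ))).tendsto 0 |>.comp hlim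
    have h5 := ENNReal.Tendsto.mul_const h4 (Or.inr hV)
    simpa using h5
  exact tendsto_of_tendsto_of_tendsto_of_le_of_le tendsto_const_nhds h3 (fun _ => zero_le) hCS

/-- On almost every slice, the mass in a ball is controlled by the radius times the mass of the
velocity gradient. -/
theorem IsWeakVelocityGradient.ae_setLIntegral_le {v : Phase → ℝ} {g : Phase → R3} {M : ℝ}
    (h : IsWeakVelocityGradient v g) (hv : AEStronglyMeasurable v) (hb : ∀ᵐ z, |v z| ≤ M)
    (h0 : ∀ᵐ z, 0 ≤ v z) (h2 : ∫⁻ z, ‖v z‖ₑ ^ (2 : ℝ) ≠ ⊤) (n : ℕ) :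
    ∀ᵐ x : R3, ∫⁻ ξ in Metric.closedBall (0 : R3) (2 * (n + 1)), ‖v (x, ξ)‖ₑ ≤
      ENNReal.ofReal (16 * (n + 1)) * ∫⁻ ξ, ‖g (x, ξ)‖ₑ := by
  -- The box bump equals one on the ball of radius 2(n+1); its outer radius 4(n+1) yields the
  -- constant 16(n+1).
  let a : ContDiffBump (0 : ℝ) := ⟨2 * (n + 1), 4 * (n + 1), by positivity, by
    have : (0 : ℝ) < n + 1 := by positivity
    linarith⟩
  have har : 4 * a.rOut = 16 * (n + 1) := by simp only [a]; ring
  choose q q1 q2 q3 q4 using fun L : ℕ => exists_box_test a L L.cast_nonneg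
  have hvl := locallyIntegrable_of_abs_le hv hb
  have hs : ∀ᵐ x : R3, ∀ L, ∫ ξ, v (x, ξ) * fderiv ℝ (q L) ξ (stdVec 0) =
      -∫ ξ, inner ℝ (g (x, ξ)) (stdVec 0) * q L ξ :=
    ae_all_iff.2 fun L => h.ae_slice hvl (q1 L) (q2 L) (stdVec 0)
  have hvs : ∀ᵐ x : R3, AEStronglyMeasurable fun ξ => v (x, ξ) := by
    have e := Measure.ae_ae_of_ae_prod (μ := (volume : Measure R3)) hv.ae_eq_mk
    filter_upwards [e] with x hx
    exact ⟨fun ξ => hv.mk v (x, ξ), hv.stronglyMeasurable_mk.comp_measurable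
      measurable_prodMk_left, hx⟩
  have hbs : ∀ᵐ x : R3, ∀ᵐ ξ : R3, |v (x, ξ)| ≤ M :=
    Measure.ae_ae_of_ae_prod (μ := (volume : Measure R3)) hb
  have h0s : ∀ᵐ x : R3, ∀ᵐ ξ : R3, 0 ≤ v (x, ξ) :=
    Measure.ae_ae_of_ae_prod (μ := (volume : Measure R3)) h0
  have h2s : ∀ᵐ x : R3, ∫⁻ ξ, ‖v (x, ξ)‖ₑ ^ (2 : ℝ) < ⊤ := by
    have m : AEMeasurable fun z : Phase => ‖v z‖ₑ ^ (2 : ℝ) := hv.enorm.pow_const _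
    refine ae_lt_top' (aemeasurable_lintegral_slice m) ?_
    rwa [Measure.volume_eq_prod, lintegral_prod _ m] at h2
  filter_upwards [hs, hvs, hbs, h0s, h2s] with x hx1 hx2 hx3 hx4 hx5
  have hint : ∀ L : ℕ, Integrable fun ξ => v (x, ξ) * boxBump a (ξ - (L : ℝ) • stdVec 0) :=
    fun L => ((integrable_boxBump a).comp_sub_right _).bdd_mul hx2 hx3
  have hint0 : Integrable fun ξ => v (x, ξ) * boxBump a ξ := (integrable_boxBump a).bdd_mul hx2 hx3
  -- The mass in the central box equals that in the box translated by L, up to the gradient tested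
  -- with q. The translated mass disappears as L grows because the slice is square integrable;
  -- without decay at infinity a constant v would violate the bound.
  have key : ∀ L : ℕ, ∫⁻ ξ in Metric.closedBall (0 : R3) (2 * (n + 1)), ‖v (x, ξ)‖ₑ ≤
      (∫⁻ ξ, ‖v (x, ξ)‖ₑ * ‖boxBump a (ξ - (L : ℝ) • stdVec 0)‖ₑ) +
        ENNReal.ofReal (16 * (n + 1)) * ∫⁻ ξ, ‖g (x, ξ)‖ₑ := fun L => by
    have e : ∫ ξ, v (x, ξ) * boxBump a ξ =
        (∫ ξ, v (x, ξ) * boxBump a (ξ - (L : ℝ) • stdVec 0)) -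
          ∫ ξ, inner ℝ (g (x, ξ)) (stdVec 0) * q L ξ := by
      have := hx1 L
      simp_rw [q3, mul_sub] at this
      rw [integral_sub hint0 (hint L)] at this
      linarith
    calc _ ≤ ∫⁻ ξ, ‖v (x, ξ) * boxBump a ξ‖ₑ := by
          rw [← lintegral_indicator measurableSet_closedBall]
          refine lintegral_mono fun ξ => ?_
          by_cases hξ : ξ ∈ Metric.closedBall (0 : R3) (2 * (n + 1))
          · rw [indicator_of_mem hξ, boxBump_eq_one a (mem_closedBall_zero_iff.1 hξ), mul_one]
          · rw [indicator_of_notMem hξ]; exact zero_le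
      _ = ‖∫ ξ, v (x, ξ) * boxBump a ξ‖ₑ := by
          rw [← ofReal_integral_norm_eq_lintegral_enorm hint0]
          have e0 : ∫ ξ, ‖v (x, ξ) * boxBump a ξ‖ = ∫ ξ, v (x, ξ) * boxBump a ξ :=
            integral_congr_ae (hx4.mono fun ξ hξ =>
              Real.norm_of_nonneg (mul_nonneg hξ (boxBump_nonneg a ξ)))
          rw [e0, Real.enorm_of_nonneg]
          exact integral_nonneg_of_ae (hx4.mono fun ξ hξ => mul_nonneg hξ (boxBump_nonneg a ξ))
      _ ≤ _ := by
          rw [e]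
          refine (enorm_sub_le).trans (add_le_add ?_ ?_)
          · refine (enorm_integral_le_lintegral_enorm _).trans_eq ?_
            simp_rw [enorm_mul]
          · refine (enorm_integral_le_lintegral_enorm _).trans ?_
            rw [← lintegral_const_mul' _ _ ENNReal.ofReal_ne_top]
            refine lintegral_mono fun ξ => ?_
            rw [enorm_mul, mul_comm, ← ofReal_norm (q L ξ)]
            refine mul_le_mul' (ENNReal.ofReal_le_ofReal ?_)
              (IsForceComponent.enorm_inner_stdVec_le _ 0)
            rw [← har]; exact q4 L ξ
  have lim := (tendsto_lintegral_mul_boxBump hx2 hx5.ne a).add_const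
    (ENNReal.ofReal (16 * (n + 1)) * ∫⁻ ξ, ‖g (x, ξ)‖ₑ)
  rw [zero_add] at lim
  exact ge_of_tendsto' lim key

/-! ### Removing the cutoff in phase space. -/

/-- A fixed smooth cutoff on `ℝ³`. -/
noncomputable def unitBump : ContDiffBump (0 : R3) := ⟨1, 2, one_pos, one_lt_two⟩

/-- The scale of the cutoffs exhausting phase space. -/
noncomputable def cutoffScale (n : ℕ) : ℝ := ((n : ℝ) + 1)⁻¹

lemma cutoffScale_pos (n : ℕ) : 0 < cutoffScale n := by unfold cutoffScale; positivity

lemma tendsto_cutoffScale : Tendsto cutoffScale atTop (𝓝 0) := by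
  refine tendsto_one_div_succ.congr fun n => ?_
  rw [cutoffScale, one_div]

/-- Smooth cutoffs exhausting phase space. -/
noncomputable def phaseCutoff (n : ℕ) (z : Phase) : ℝ :=
  unitBump (cutoffScale n • z.1) * unitBump (cutoffScale n • z.2)

lemma contDiff_phaseCutoff (n : ℕ) : ContDiff ℝ ∞ (phaseCutoff n) :=
  (unitBump.contDiff.comp (by fun_prop)).mul (unitBump.contDiff.comp (by fun_prop))

lemma unitBump_eq_zero {n : ℕ} {x : R3} (hx : 2 * ((n : ℝ) + 1) < ‖x‖) :
    unitBump (cutoffScale n • x) = 0 := by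
  refine unitBump.zero_of_le_dist ?_
  rw [dist_zero_right, norm_smul, Real.norm_of_nonneg (cutoffScale_pos n).le]
  change (2 : ℝ) ≤ _
  rw [cutoffScale, inv_mul_eq_div, le_div_iff₀ (by positivity)]
  exact hx.le

lemma hasCompactSupport_phaseCutoff (n : ℕ) : HasCompactSupport (phaseCutoff n) := by
  refine HasCompactSupport.intro (isCompact_closedBall (0 : Phase) (2 * (n + 1))) fun z hz => ?_
  rw [mem_closedBall_zero_iff, Prod.norm_def, sup_le_iff, not_and_or, not_le, not_le] at hz
  unfold phaseCutoff
  rcases hz with h | h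
  · rw [unitBump_eq_zero h, zero_mul]
  · rw [unitBump_eq_zero h, mul_zero]

lemma exists_isTest_phaseCutoff (n : ℕ) : ∃ R c, 0 ≤ R ∧ IsTest (phaseCutoff n) R c :=
  exists_isTest (contDiff_phaseCutoff n) (hasCompactSupport_phaseCutoff n)

lemma phaseCutoff_nonneg (n : ℕ) (z : Phase) : 0 ≤ phaseCutoff n z :=
  mul_nonneg unitBump.nonneg unitBump.nonneg

lemma abs_phaseCutoff_le_one (n : ℕ) (z : Phase) : |phaseCutoff n z| ≤ 1 := by
  rw [abs_of_nonneg (phaseCutoff_nonneg n z)]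
  exact mul_le_one₀ unitBump.le_one unitBump.nonneg unitBump.le_one

lemma eventually_norm_smul_lt (x : R3) : ∀ᶠ n in atTop, ‖cutoffScale n • x‖ < 1 := by
  have : Tendsto (fun n => ‖cutoffScale n • x‖) atTop (𝓝 0) := by
    have := (tendsto_cutoffScale.smul_const x).norm
    simpa using this
  exact this.eventually (gt_mem_nhds one_pos)

lemma unitBump_eventuallyEq {x : R3} (hx : ‖x‖ < 1) : unitBump =ᶠ[𝓝 x] fun _ => 1 := by
  filter_upwards [(isOpen_lt continuous_norm continuous_const).mem_nhds hx] with y hy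
  exact unitBump.one_of_mem_closedBall (mem_closedBall_zero_iff.2 hy.le)

lemma tendsto_phaseCutoff (z : Phase) : Tendsto (fun n => phaseCutoff n z) atTop (𝓝 1) := by
  refine tendsto_const_nhds.congr' ?_
  filter_upwards [eventually_norm_smul_lt z.1, eventually_norm_smul_lt z.2] with n h1 h2
  rw [phaseCutoff, (unitBump_eventuallyEq h1).eq_of_nhds, (unitBump_eventuallyEq h2).eq_of_nhds,
    one_mul]

lemma exists_norm_fderiv_unitBump_le : ∃ L : ℝ, 0 ≤ L ∧ ∀ x, ‖fderiv ℝ unitBump x‖ ≤ L := by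
  obtain ⟨L, hL⟩ := (((unitBump.contDiff (n := 1)).continuous_fderiv
    one_ne_zero).bounded_above_of_compact_support (unitBump.hasCompactSupport.fderiv ℝ))
  exact ⟨L, (norm_nonneg _).trans (hL 0), hL⟩

lemma fderiv_phaseCutoff (n : ℕ) (z : Phase) (a b : R3) :
    fderiv ℝ (phaseCutoff n) z (a, b) =
      cutoffScale n * fderiv ℝ unitBump (cutoffScale n • z.1) a *
          unitBump (cutoffScale n • z.2) +
        unitBump (cutoffScale n • z.1) *
          (cutoffScale n * fderiv ℝ unitBump (cutoffScale n • z.2) b) := by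
  have hd : ∀ x, HasFDerivAt unitBump (fderiv ℝ unitBump x) x := fun x =>
    ((unitBump.contDiff (n := 1)).differentiable one_ne_zero).differentiableAt.hasFDerivAt
  have h1 := (hd (cutoffScale n • z.1)).comp z
    ((hasFDerivAt_fst (𝕜 := ℝ) (p := z)).const_smul (cutoffScale n))
  have h2 := (hd (cutoffScale n • z.2)).comp z
    ((hasFDerivAt_snd (𝕜 := ℝ) (p := z)).const_smul (cutoffScale n))
  have e : fderiv ℝ (phaseCutoff n) z = _ := (h1.mul h2).fderiv
  rw [e]
  simp
  ring

section

variable {L : ℝ}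

/-- On the support of the velocity cutoff |ξ| ≤ 2(n+1), which exactly compensates the factor 1/(n+1)
from differentiating the spatial cutoff. -/
lemma abs_spatial_cutoff_le (hL : ∀ x, ‖fderiv ℝ unitBump x‖ ≤ L) (n : ℕ) (z : Phase) :
    |cutoffScale n * fderiv ℝ unitBump (cutoffScale n • z.1) z.2 *
      unitBump (cutoffScale n • z.2)| ≤ 2 * L := by
  have hL0 : 0 ≤ L := (norm_nonneg _).trans (hL 0)
  by_cases hz : ‖z.2‖ ≤ 2 * ((n : ℝ) + 1)
  · rw [abs_mul, abs_mul, abs_of_pos (cutoffScale_pos n), abs_of_nonneg unitBump.nonneg]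
    calc _ ≤ cutoffScale n * (L * (2 * ((n : ℝ) + 1))) * 1 := by
          have h1 : |fderiv ℝ unitBump (cutoffScale n • z.1) z.2| ≤ L * (2 * ((n : ℝ) + 1)) :=
            (ContinuousLinearMap.le_opNorm _ _).trans (mul_le_mul (hL _) hz (norm_nonneg _) hL0)
          have h2 := (cutoffScale_pos n).le
          refine mul_le_mul (mul_le_mul_of_nonneg_left h1 h2) unitBump.le_one unitBump.nonneg ?_
          positivity
      _ = _ := by unfold cutoffScale; field_simp
  · rw [unitBump_eq_zero (not_le.1 hz)]
    simpa using hL0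

lemma abs_velocity_cutoff_le (hL : ∀ x, ‖fderiv ℝ unitBump x‖ ≤ L) (n : ℕ) (z : Phase) (b : R3) :
    |unitBump (cutoffScale n • z.1) *
      (cutoffScale n * fderiv ℝ unitBump (cutoffScale n • z.2) b)| ≤ L * cutoffScale n * ‖b‖ := by
  have hL0 : 0 ≤ L := (norm_nonneg _).trans (hL 0)
  rw [abs_mul, abs_mul, abs_of_nonneg unitBump.nonneg, abs_of_pos (cutoffScale_pos n)]
  calc _ ≤ 1 * (cutoffScale n * (L * ‖b‖)) := by
        have h2 := (cutoffScale_pos n).le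
        refine mul_le_mul unitBump.le_one (mul_le_mul_of_nonneg_left ?_ h2)
          (by positivity) zero_le_one
        exact (ContinuousLinearMap.le_opNorm _ _).trans
          (mul_le_mul_of_nonneg_right (hL _) (norm_nonneg _))
    _ = _ := by ring

lemma velocity_cutoff_eq_zero {n : ℕ} {z : Phase} (b : R3) (hz : 2 * ((n : ℝ) + 1) < ‖z.2‖) :
    fderiv ℝ unitBump (cutoffScale n • z.2) b = 0 := by
  have h1 : 2 < ‖cutoffScale n • z.2‖ := by
    rw [norm_smul, Real.norm_of_nonneg (cutoffScale_pos n).le, cutoffScale, inv_mul_eq_div,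
      lt_div_iff₀ (by positivity)]
    exact hz
  have : unitBump =ᶠ[𝓝 (cutoffScale n • z.2)] fun _ => 0 := by
    filter_upwards [(isOpen_lt continuous_const continuous_norm).mem_nhds h1] with y hy
    exact unitBump.zero_of_le_dist (by
      rw [dist_zero_right]; exact le_of_lt hy)
  rw [this.fderiv_eq]
  simp

/-- At a fixed point the spatial cutoff is eventually identically one nearby, so its derivative
vanishes. -/
lemma tendsto_spatial_cutoff (z : Phase) :
    Tendsto (fun n => cutoffScale n * fderiv ℝ unitBump (cutoffScale n • z.1) z.2 *
      unitBump (cutoffScale n • z.2)) atTop (𝓝 0) := by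
  refine tendsto_const_nhds.congr' ?_
  filter_upwards [eventually_norm_smul_lt z.1] with n h1
  rw [(unitBump_eventuallyEq h1).fderiv_eq]
  simp

variable {h : R3 → ℝ≥0∞} {E : R3 → R3} {p v u : Phase → ℝ} {g : Phase → R3} {M : ℝ}

/-- The velocity part of the cutoff error. -/
lemma velocity_cutoff_bound_tendsto (hL : ∀ x, ‖fderiv ℝ unitBump x‖ ≤ L) (hE : IsForce h E)
    (hv : AEStronglyMeasurable v) (hb : ∀ᵐ z, |v z| ≤ M) (h0 : ∀ᵐ z, 0 ≤ v z)
    (h2 : ∫⁻ z, ‖v z‖ₑ ^ (2 : ℝ) ≠ ⊤) (hg : IsWeakVelocityGradient v g)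
    (hfin : ∫⁻ z, riesz h z.1 * ‖g z‖ₑ ≠ ⊤) (hp : Integrable p) (hpv : ∀ᵐ z, |p z| ≤ M * |v z|)
    (hM : 0 ≤ M) :
    (∀ n, ∫⁻ z : Phase, ‖p z * (unitBump (cutoffScale n • z.1) *
        (cutoffScale n * fderiv ℝ unitBump (cutoffScale n • z.2) (E z.1)))‖ₑ ≤
      ENNReal.ofReal (16 * L * M) * ∫⁻ z, riesz h z.1 * ‖g z‖ₑ) ∧
    Tendsto (fun n => ∫⁻ z : Phase, ‖p z * (unitBump (cutoffScale n • z.1) *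
        (cutoffScale n * fderiv ℝ unitBump (cutoffScale n • z.2) (E z.1)))‖ₑ) atTop (𝓝 0) := by
  have hL0 : 0 ≤ L := (norm_nonneg _).trans (hL 0)
  have mr := aemeasurable_riesz hE.aemeasurable
  set S : ℕ → Set R3 := fun n => Metric.closedBall (0 : R3) (2 * (n + 1)) with hS
  have mS : ∀ n, MeasurableSet (S n) := fun n => measurableSet_closedBall
  set b : ℕ → Phase → ℝ≥0∞ := fun n z => (S n).indicator 1 z.2 * ‖p z‖ₑ with hbdef
  have mb : ∀ n, AEMeasurable (b n) := fun n => by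
    have h1 : Measurable fun z : Phase => (S n).indicator (1 : R3 → ℝ≥0∞) z.2 :=
      (measurable_one.indicator (mS n)).comp measurable_snd
    exact h1.aemeasurable.fun_mul hp.1.enorm
  set G : ℕ → R3 → ℝ≥0∞ := fun n x =>
    ENNReal.ofReal (cutoffScale n) * ∫⁻ ξ, b n (x, ξ) with hG
  have hb' : ∀ n x, ∫⁻ ξ, b n (x, ξ) = ∫⁻ ξ in S n, ‖p (x, ξ)‖ₑ := fun n x => by
    rw [← lintegral_indicator (mS n)]
    refine lintegral_congr fun ξ => ?_
    by_cases hξ : ξ ∈ S n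
    · simp [hbdef, indicator_of_mem hξ]
    · simp [hbdef, indicator_of_notMem hξ]
  have mG : ∀ n, AEMeasurable (G n) := fun n => (aemeasurable_lintegral_slice (mb n)).const_mul _
  have hE' : ∀ᵐ z : Phase, ‖E z.1‖ₑ ≤ riesz h z.1 :=
    (Measure.quasiMeasurePreserving_fst (μ := (volume : Measure R3))
      (ν := (volume : Measure R3))).ae hE.enorm_le
  have step : ∀ n, ∫⁻ z : Phase, ‖p z * (unitBump (cutoffScale n • z.1) *
      (cutoffScale n * fderiv ℝ unitBump (cutoffScale n • z.2) (E z.1)))‖ₑ ≤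
      ENNReal.ofReal L * ∫⁻ x, riesz h x * G n x := fun n => by
    calc _ ≤ ∫⁻ z : Phase, ENNReal.ofReal (L * cutoffScale n) * (riesz h z.1 * b n z) := by
          refine lintegral_mono_ae (hE'.mono fun z hz => ?_)
          by_cases hm : z.2 ∈ S n
          · simp only [hbdef, indicator_of_mem hm, Pi.one_apply, one_mul]
            rw [enorm_mul, mul_comm, ← mul_assoc (ENNReal.ofReal (L * cutoffScale n))]
            refine mul_le_mul' ?_ le_rfl
            rw [← ofReal_norm]
            refine (ENNReal.ofReal_le_ofReal (abs_velocity_cutoff_le hL n z (E z.1))).trans ?_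
            rw [ENNReal.ofReal_mul (mul_nonneg hL0 (cutoffScale_pos n).le), ofReal_norm]
            exact mul_le_mul' le_rfl hz
          · have hz2 : 2 * ((n : ℝ) + 1) < ‖z.2‖ := by
              by_contra hle
              exact hm (mem_closedBall_zero_iff.2 (not_lt.1 hle))
            rw [velocity_cutoff_eq_zero _ hz2]
            simp
      _ = _ := by
          rw [lintegral_const_mul' _ _ (by simp), lintegral_prod_mul_left mr (mb n),
            ENNReal.ofReal_mul hL0, mul_assoc, ← lintegral_const_mul' _ _ (by simp)]
          congr 1
          refine lintegral_congr fun x => ?_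
          simp only [hG]
          ring
  have hpvs : ∀ᵐ x : R3, ∀ᵐ ξ : R3, |p (x, ξ)| ≤ M * |v (x, ξ)| :=
    Measure.ae_ae_of_ae_prod (μ := (volume : Measure R3)) hpv
  -- The factor 1/(n+1) from the cutoff cancels the radius in the mass bound, leaving a majorant
  -- independent of n that is integrable against the potential. This replaces integrability of E p,
  -- which is not available.
  have hGle : ∀ n, ∀ᵐ x, G n x ≤ ENNReal.ofReal (16 * M) * ∫⁻ ξ, ‖g (x, ξ)‖ₑ := fun n => by
    filter_upwards [hpvs, hg.ae_setLIntegral_le hv hb h0 h2 n] with x hx1 hx2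
    simp only [hG]
    rw [hb']
    calc _ ≤ ENNReal.ofReal (cutoffScale n) * (ENNReal.ofReal M *
          ∫⁻ ξ in S n, ‖v (x, ξ)‖ₑ) := by
          rw [← lintegral_const_mul' (ENNReal.ofReal M) _ (by simp)]
          refine mul_le_mul_right (lintegral_mono_ae (ae_restrict_of_ae (hx1.mono fun ξ hξ => ?_))) _
          rw [← ofReal_norm, ← ofReal_norm, ← ENNReal.ofReal_mul hM]
          exact ENNReal.ofReal_le_ofReal hξ
      _ ≤ ENNReal.ofReal (cutoffScale n) * (ENNReal.ofReal M *
          (ENNReal.ofReal (16 * (n + 1)) * ∫⁻ ξ, ‖g (x, ξ)‖ₑ)) := by gcongr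
      _ = _ := by
          rw [← mul_assoc, ← mul_assoc, ← ENNReal.ofReal_mul (cutoffScale_pos n).le,
            ← ENNReal.ofReal_mul (mul_nonneg (cutoffScale_pos n).le hM)]
          congr 2
          unfold cutoffScale
          field_simp
  have mg : AEMeasurable fun z => ‖g z‖ₑ := hg.1.aestronglyMeasurable.enorm
  have hprod : ∫⁻ x, riesz h x * (ENNReal.ofReal (16 * M) * ∫⁻ ξ, ‖g (x, ξ)‖ₑ) =
      ENNReal.ofReal (16 * M) * ∫⁻ z, riesz h z.1 * ‖g z‖ₑ := by
    rw [lintegral_prod_mul_left mr mg, ← lintegral_const_mul' _ _ ENNReal.ofReal_ne_top]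
    refine lintegral_congr fun x => ?_
    ring
  constructor
  · intro n
    refine (step n).trans ?_
    rw [show 16 * L * M = L * (16 * M) by ring, ENNReal.ofReal_mul hL0, mul_assoc, ← hprod]
    refine mul_le_mul_right (lintegral_mono_ae ((hGle n).mono fun x hx => ?_)) _
    exact mul_le_mul_right hx _
  -- With that majorant it is enough that G n tends to zero for almost every x, which follows from
  -- p(x,·) ∈ L¹ and the vanishing scale.
  · have lim : Tendsto (fun n => ∫⁻ x, riesz h x * G n x) atTop (𝓝 0) := by
      have := tendsto_lintegral_of_dominated_convergence' (μ := volume)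
        (F := fun n x => riesz h x * G n x) (f := fun _ => 0)
        (fun x => riesz h x * (ENNReal.ofReal (16 * M) * ∫⁻ ξ, ‖g (x, ξ)‖ₑ))
        (fun n => mr.fun_mul (mG n))
        (fun n => (hGle n).mono fun x hx => mul_le_mul_right hx _)
        (by rw [hprod]; exact ENNReal.mul_ne_top ENNReal.ofReal_ne_top hfin) ?_
      · simpa using this
      · have hps : ∀ᵐ x : R3, ∫⁻ ξ, ‖p (x, ξ)‖ₑ < ⊤ := by
          refine ae_lt_top' (aemeasurable_lintegral_slice hp.1.enorm) ?_
          have := hp.2.ne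
          rwa [Measure.volume_eq_prod, lintegral_prod _ hp.1.enorm] at this
        filter_upwards [hps, ae_riesz_lt_top hE.aemeasurable hE.lintegral_ne_top] with x h1 h3
        have hr : Tendsto (fun n => ENNReal.ofReal (cutoffScale n)) atTop (𝓝 0) := by
          simpa using ENNReal.tendsto_ofReal tendsto_cutoffScale
        have l1 : Tendsto (fun n => ENNReal.ofReal (cutoffScale n) * ∫⁻ ξ, ‖p (x, ξ)‖ₑ)
            atTop (𝓝 0) := by
          simpa using ENNReal.Tendsto.mul_const hr (Or.inr h1.ne)
        have l2 : Tendsto (fun n => G n x) atTop (𝓝 0) := by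
          refine tendsto_of_tendsto_of_tendsto_of_le_of_le tendsto_const_nhds l1
            (fun _ => zero_le) fun n => ?_
          simp only [hG]
          rw [hb']
          exact mul_le_mul_right (setLIntegral_le_lintegral _ _) _
        simpa using ENNReal.Tendsto.const_mul l2 (Or.inr h3.ne)
    have l3 : Tendsto (fun n => ENNReal.ofReal L * ∫⁻ x, riesz h x * G n x) atTop (𝓝 0) := by
      simpa using ENNReal.Tendsto.const_mul lim (Or.inr ENNReal.ofReal_ne_top)
    exact tendsto_of_tendsto_of_tendsto_of_le_of_le tendsto_const_nhds l3 (fun _ => zero_le) step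

lemma tendsto_integral_of_lintegral_tendsto_zero {F : ℕ → Phase → ℝ}
    (hF : Tendsto (fun n => ∫⁻ z, ‖F n z‖ₑ) atTop (𝓝 0)) :
    Tendsto (fun n => ∫ z, F n z) atTop (𝓝 0) := by
  rw [tendsto_zero_iff_enorm_tendsto_zero]
  exact tendsto_of_tendsto_of_tendsto_of_le_of_le tendsto_const_nhds hF (fun _ => zero_le)
    fun n => enorm_integral_le_lintegral_enorm _

/-- The cutoff error of the transport term. -/
lemma transport_cutoff_bound_tendsto (hL : ∀ x, ‖fderiv ℝ unitBump x‖ ≤ L) (hE : IsForce h E)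
    (hv : AEStronglyMeasurable v) (hb : ∀ᵐ z, |v z| ≤ M) (h0 : ∀ᵐ z, 0 ≤ v z)
    (h2 : ∫⁻ z, ‖v z‖ₑ ^ (2 : ℝ) ≠ ⊤) (hg : IsWeakVelocityGradient v g)
    (hfin : ∫⁻ z, riesz h z.1 * ‖g z‖ₑ ≠ ⊤) (hp : Integrable p) (hpv : ∀ᵐ z, |p z| ≤ M * |v z|)
    (hM : 0 ≤ M) :
    (∀ n, ‖∫ z, p z * fderiv ℝ (phaseCutoff n) z (z.2, E z.1)‖ₑ ≤
      ENNReal.ofReal (2 * L) * (∫⁻ z, ‖p z‖ₑ) +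
        ENNReal.ofReal (16 * L * M) * ∫⁻ z, riesz h z.1 * ‖g z‖ₑ) ∧
    Tendsto (fun n => ∫ z, p z * fderiv ℝ (phaseCutoff n) z (z.2, E z.1)) atTop (𝓝 0) := by
  obtain ⟨B, V⟩ := velocity_cutoff_bound_tendsto hL hE hv hb h0 h2 hg hfin hp hpv hM
  set A : ℕ → Phase → ℝ := fun n z => cutoffScale n *
    fderiv ℝ unitBump (cutoffScale n • z.1) z.2 * unitBump (cutoffScale n • z.2) with hA
  have cA : ∀ n, Continuous (A n) := fun n => by
    have h1 := (unitBump.contDiff (n := 1)).continuous_fderiv one_ne_zero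
    have h2 := unitBump.continuous
    have h3 : Continuous fun z : Phase => fderiv ℝ unitBump (cutoffScale n • z.1) z.2 :=
      (h1.comp (by fun_prop)).clm_apply (by fun_prop)
    fun_prop
  have hAle : ∀ n, ∫⁻ z, ‖p z * A n z‖ₑ ≤ ENNReal.ofReal (2 * L) * ∫⁻ z, ‖p z‖ₑ := fun n => by
    rw [← lintegral_const_mul' _ _ ENNReal.ofReal_ne_top]
    refine lintegral_mono fun z => ?_
    rw [enorm_mul, mul_comm, ← ofReal_norm (A n z)]
    exact mul_le_mul' (ENNReal.ofReal_le_ofReal (abs_spatial_cutoff_le hL n z)) le_rfl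
  have hAlim : Tendsto (fun n => ∫⁻ z, ‖p z * A n z‖ₑ) atTop (𝓝 0) := by
    have := tendsto_lintegral_of_dominated_convergence' (μ := volume)
      (F := fun n z => ‖p z * A n z‖ₑ) (f := fun _ => 0)
      (fun z => ENNReal.ofReal (2 * L) * ‖p z‖ₑ)
      (fun n => (hp.1.mul (cA n).aestronglyMeasurable).enorm)
      (fun n => Eventually.of_forall fun z => ?_) ?_ (Eventually.of_forall fun z => ?_)
    · simpa using this
    · dsimp only
      rw [enorm_mul, mul_comm, ← ofReal_norm (A n z)]
      exact mul_le_mul' (ENNReal.ofReal_le_ofReal (abs_spatial_cutoff_le hL n z)) le_rfl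
    · rw [lintegral_const_mul' _ _ ENNReal.ofReal_ne_top]
      exact ENNReal.mul_ne_top ENNReal.ofReal_ne_top hp.2.ne
    · have := ((tendsto_spatial_cutoff z).const_mul (p z)).enorm
      simpa only [mul_zero, enorm_zero] using this
  have split : ∀ n, ∫⁻ z, ‖p z * fderiv ℝ (phaseCutoff n) z (z.2, E z.1)‖ₑ ≤
      (∫⁻ z, ‖p z * A n z‖ₑ) + ∫⁻ z : Phase, ‖p z * (unitBump (cutoffScale n • z.1) *
        (cutoffScale n * fderiv ℝ unitBump (cutoffScale n • z.2) (E z.1)))‖ₑ := fun n => by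
    rw [← lintegral_add_left' (f := fun z => ‖p z * A n z‖ₑ)
      (hp.1.mul (cA n).aestronglyMeasurable).enorm]
    refine lintegral_mono fun z => ?_
    rw [fderiv_phaseCutoff, mul_add]
    exact enorm_add_le _ _
  constructor
  · intro n
    exact (enorm_integral_le_lintegral_enorm _).trans ((split n).trans (add_le_add (hAle n) (B n)))
  · refine tendsto_integral_of_lintegral_tendsto_zero ?_
    have := hAlim.add V
    rw [add_zero] at this
    exact tendsto_of_tendsto_of_tendsto_of_le_of_le tendsto_const_nhds this (fun _ => zero_le) split

lemma velocity_transport_cutoff_tendsto (hL : ∀ x, ‖fderiv ℝ unitBump x‖ ≤ L) (hE : IsForce h E)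
    (hv : AEStronglyMeasurable v) (hb : ∀ᵐ z, |v z| ≤ M) (h0 : ∀ᵐ z, 0 ≤ v z)
    (h2 : ∫⁻ z, ‖v z‖ₑ ^ (2 : ℝ) ≠ ⊤) (hg : IsWeakVelocityGradient v g)
    (hfin : ∫⁻ z, riesz h z.1 * ‖g z‖ₑ ≠ ⊤) (hp : Integrable p) (hpv : ∀ᵐ z, |p z| ≤ M * |v z|)
    (hM : 0 ≤ M) :
    Tendsto (fun n => ∫ z, p z * fderiv ℝ (phaseCutoff n) z (0, E z.1)) atTop (𝓝 0) := by
  refine tendsto_integral_of_lintegral_tendsto_zero ?_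
  have V := (velocity_cutoff_bound_tendsto hL hE hv hb h0 h2 hg hfin hp hpv hM).2
  simpa [fderiv_phaseCutoff] using V

/-- Bounded functions times the force are integrable against the velocity gradient. -/
lemma integrable_mul_inner_force (hE : IsForce h E) (hu : AEStronglyMeasurable u)
    (hb : ∀ᵐ z, |u z| ≤ M) (hg : AEStronglyMeasurable g)
    (hfin : ∫⁻ z, riesz h z.1 * ‖g z‖ₑ ≠ ⊤) :
    (∫⁻ z, ‖u z * inner ℝ (g z) (E z.1)‖ₑ ≤
      ENNReal.ofReal M * ∫⁻ z, riesz h z.1 * ‖g z‖ₑ) ∧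
    Integrable fun z => u z * inner ℝ (g z) (E z.1) := by
  have hE' : ∀ᵐ z : Phase, ‖E z.1‖ₑ ≤ riesz h z.1 :=
    (Measure.quasiMeasurePreserving_fst (μ := (volume : Measure R3))
      (ν := (volume : Measure R3))).ae hE.enorm_le
  have mE : AEStronglyMeasurable fun z : Phase => E z.1 :=
    hE.aestronglyMeasurable.comp_quasiMeasurePreserving Measure.quasiMeasurePreserving_fst
  have hle : ∫⁻ z, ‖u z * inner ℝ (g z) (E z.1)‖ₑ ≤
      ENNReal.ofReal M * ∫⁻ z, riesz h z.1 * ‖g z‖ₑ := by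
    rw [← lintegral_const_mul' _ _ ENNReal.ofReal_ne_top]
    refine lintegral_mono_ae ?_
    filter_upwards [hE', hb] with z h1 h2
    rw [enorm_mul, ← ofReal_norm (u z)]
    refine mul_le_mul' (ENNReal.ofReal_le_ofReal h2) ?_
    calc ‖inner ℝ (g z) (E z.1)‖ₑ ≤ ‖g z‖ₑ * ‖E z.1‖ₑ := by
          rw [← ofReal_norm, ← ofReal_norm, ← ofReal_norm,
            ← ENNReal.ofReal_mul (norm_nonneg _)]
          exact ENNReal.ofReal_le_ofReal (norm_inner_le_norm _ _)
      _ ≤ _ := by rw [mul_comm]; exact mul_le_mul' h1 le_rfl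
  exact ⟨hle, hu.mul (hg.inner mE), lt_of_le_of_lt hle
    (ENNReal.mul_lt_top ENNReal.ofReal_lt_top hfin.lt_top)⟩

lemma tendsto_integral_phaseCutoff_mul {F : Phase → ℝ} (hF : Integrable F) :
    Tendsto (fun n => ∫ z, phaseCutoff n z * F z) atTop (𝓝 (∫ z, F z)) := by
  refine tendsto_integral_of_dominated_convergence (fun z => ‖F z‖) (fun n => ?_) hF.norm
    (fun n => Eventually.of_forall fun z => ?_) (Eventually.of_forall fun z => ?_)
  · exact (contDiff_phaseCutoff n).continuous.aestronglyMeasurable.mul hF.1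
  · rw [norm_mul]
    exact mul_le_of_le_one_left (norm_nonneg _) (abs_phaseCutoff_le_one n z)
  · simpa using (tendsto_phaseCutoff z).mul_const (F z)

/-- A velocity-independent force does no work on the square. -/
theorem integral_mul_inner_force_eq_zero (hE : IsForce h E)
    (hv : AEStronglyMeasurable v) (hb : ∀ᵐ z, |v z| ≤ M) (h0 : ∀ᵐ z, 0 ≤ v z)
    (h2 : ∫⁻ z, ‖v z‖ₑ ^ (2 : ℝ) ≠ ⊤) (hg : IsWeakVelocityGradient v g)
    (hfin : ∫⁻ z, riesz h z.1 * ‖g z‖ₑ ≠ ⊤) (hM : 0 ≤ M) :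
    ∫ z, v z * inner ℝ (g z) (E z.1) = 0 := by
  obtain ⟨L, -, hL⟩ := exists_norm_fderiv_unitBump_le
  have hp : Integrable fun z => v z * v z := by
    refine ⟨hv.mul hv, ?_⟩
    rw [hasFiniteIntegral_iff_enorm]
    refine lt_of_eq_of_lt ?_ h2.lt_top
    refine lintegral_congr fun z => ?_
    rw [enorm_mul, ENNReal.rpow_two, sq]
  have hpv : ∀ᵐ z, |v z * v z| ≤ M * |v z| := hb.mono fun z hz => by
    rw [abs_mul]; exact mul_le_mul_of_nonneg_right hz (abs_nonneg _)
  have l1 := velocity_transport_cutoff_tendsto hL hE hv hb h0 h2 hg hfin hp hpv hM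
  have l2 := tendsto_integral_phaseCutoff_mul
    (integrable_mul_inner_force hE hv hb hg.1.aestronglyMeasurable hfin).2
  -- The localized chain rule expresses the cut-off work by an error supported on the derivative of
  -- the cutoff, which vanishes in the limit.
  have e : ∀ n, ∫ z, phaseCutoff n z * (v z * inner ℝ (g z) (E z.1)) =
      -(1 / 2) * ∫ z, v z * v z * fderiv ℝ (phaseCutoff n) z (0, E z.1) := fun n => by
    obtain ⟨R, c, -, hθ⟩ := exists_isTest_phaseCutoff n
    have := integral_test_mul_inner_self hθ hM hE hv hb hg hfin
    linarith
  simp_rw [e] at l2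
  have l3 := l1.const_mul (-(1 / 2))
  rw [mul_zero] at l3
  exact tendsto_nhds_unique l2 l3

end

/-! ### Global evolution of products and conservation of mass. -/

namespace IsCurve

variable {T M : ℝ} {N : ℝ≥0∞} {h : ℝ → R3 → ℝ≥0∞} {u : ℝ → Phase → ℝ} {E : ℝ → R3 → R3}

lemma restrict_prod_le {α : Type*} [MeasurableSpace α] {μ : Measure α} [SFinite μ] {t : ℝ}
    (ht : t ≤ T) : (volume.restrict (Icc 0 t)).prod μ ≤ (volume.restrict (Icc 0 T)).prod μ := by
  have e : ∀ s : ℝ, (volume.restrict (Icc 0 s)).prod μ =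
      (volume.prod μ).restrict (Icc 0 s ×ˢ univ) := fun s => by
    rw [← Measure.prod_restrict, Measure.restrict_univ]
  rw [e, e]
  exact Measure.restrict_mono (prod_mono (Icc_subset_Icc_right ht) le_rfl) le_rfl

lemma mono (hc : IsCurve T M N h u E) {t : ℝ} (ht : t ≤ T) : IsCurve t M N h u E where
  nonneg := hc.nonneg
  ne_top := hc.ne_top
  meas := hc.meas.mono_measure (restrict_prod_le ht)
  force_meas := hc.force_meas.mono_measure (restrict_prod_le ht)
  slice_meas s hs := hc.slice_meas s (Icc_subset_Icc_right ht hs)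
  abs_le s hs := hc.abs_le s (Icc_subset_Icc_right ht hs)
  isForce s hs := hc.isForce s (Icc_subset_Icc_right ht hs)
  lintegral_le s hs := hc.lintegral_le s (Icc_subset_Icc_right ht hs)

end IsCurve

lemma IsWeakCurve.mono {T M : ℝ} {N : ℝ≥0∞} {h : ℝ → R3 → ℝ≥0∞} {u : ℝ → Phase → ℝ}
    {E : ℝ → R3 → R3} (hc : IsWeakCurve T M N h u E) {t : ℝ} (ht : t ≤ T) :
    IsWeakCurve t M N h u E where
  toIsCurve := hc.toIsCurve.mono ht
  weak ψ h1 h2 s hs := hc.weak ψ h1 h2 s (Icc_subset_Icc_right ht hs)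

section Evolution

variable {T M : ℝ} {N₁ N₂ : ℝ≥0∞} {h₁ h₂ : ℝ → R3 → ℝ≥0∞} {u₁ u₂ : ℝ → Phase → ℝ}
  {E₁ E₂ : ℝ → R3 → R3} {g : ℝ → Phase → R3}

lemma aestronglyMeasurable_mul_inner_force (hc₁ : IsCurve T M N₁ h₁ u₁ E₁)
    (hc₂ : IsCurve T M N₂ h₂ u₂ E₂)
    (hgm : AEStronglyMeasurable (fun p : ℝ × Phase => g p.1 p.2)
      ((volume.restrict (Icc 0 T)).prod volume)) :
    AEStronglyMeasurable (fun p : ℝ × Phase =>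
      u₁ p.1 p.2 * inner ℝ (g p.1 p.2) (E₁ p.1 p.2.1 - E₂ p.1 p.2.1))
      ((volume.restrict (Icc 0 T)).prod volume) :=
  hc₁.meas.mul (hgm.inner (hc₁.force_meas_phase.sub hc₂.force_meas_phase))

lemma mul_inner_force_sub {u : Phase → ℝ} {G : Phase → R3} {F₁ F₂ : R3 → R3} {k₁ k₂ : R3 → ℝ≥0∞}
    {P : ℝ≥0∞} (hP : P ≠ ⊤) (hF₁ : IsForce k₁ F₁) (hF₂ : IsForce k₂ F₂) (hu : AEStronglyMeasurable u)
    (hb : ∀ᵐ z, |u z| ≤ M) (hG : AEStronglyMeasurable G)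
    (hP₁ : ∫⁻ z, riesz k₁ z.1 * ‖G z‖ₑ ≤ P) (hP₂ : ∫⁻ z, riesz k₂ z.1 * ‖G z‖ₑ ≤ P) :
    (∫⁻ z, ‖u z * inner ℝ (G z) (F₁ z.1 - F₂ z.1)‖ₑ ≤ ENNReal.ofReal M * P + ENNReal.ofReal M * P) ∧
    Integrable (fun z => u z * inner ℝ (G z) (F₁ z.1 - F₂ z.1)) ∧
    ∫ z, u z * inner ℝ (G z) (F₁ z.1 - F₂ z.1) =
      (∫ z, u z * inner ℝ (G z) (F₁ z.1)) - ∫ z, u z * inner ℝ (G z) (F₂ z.1) := by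
  obtain ⟨b₁, i₁⟩ := integrable_mul_inner_force hF₁ hu hb hG (ne_top_of_le_ne_top hP hP₁)
  obtain ⟨b₂, i₂⟩ := integrable_mul_inner_force hF₂ hu hb hG (ne_top_of_le_ne_top hP hP₂)
  simp_rw [inner_sub_right, mul_sub]
  refine ⟨?_, i₁.sub i₂, integral_sub i₁ i₂⟩
  calc _ ≤ ∫⁻ z, (‖u z * inner ℝ (G z) (F₁ z.1)‖ₑ + ‖u z * inner ℝ (G z) (F₂ z.1)‖ₑ) :=
        lintegral_mono fun z => enorm_sub_le
    _ = _ := lintegral_add_left' i₁.1.enorm _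
    _ ≤ _ := add_le_add (b₁.trans (mul_le_mul_right hP₁ _)) (b₂.trans (mul_le_mul_right hP₂ _))

/-- The evolution of the product of two weak solutions. -/
theorem integral_mul_sub (hc₁ : IsWeakCurve T M N₁ h₁ u₁ E₁)
    (hc₂ : IsWeakCurve T M N₂ h₂ u₂ E₂) (hT : 0 ≤ T)
    (h0 : ∀ t ∈ Icc 0 T, ∀ᵐ z, 0 ≤ u₂ t z) {N : ℝ≥0∞} (hN : N ≠ ⊤)
    (hN₁ : ∀ t ∈ Icc 0 T, ∫⁻ z, ‖u₁ t z‖ₑ ^ (2 : ℝ) ≤ N)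
    (hN₂ : ∀ t ∈ Icc 0 T, ∫⁻ z, ‖u₂ t z‖ₑ ^ (2 : ℝ) ≤ N)
    (hgm : AEStronglyMeasurable (fun p : ℝ × Phase => g p.1 p.2)
      ((volume.restrict (Icc 0 T)).prod volume))
    (hg : ∀ᵐ t ∂volume.restrict (Icc 0 T), IsWeakVelocityGradient (u₂ t) (g t))
    {P : ℝ → ℝ≥0∞} (hPm : AEMeasurable P (volume.restrict (Icc 0 T)))
    (hP : ∫⁻ t in Icc 0 T, P t ≠ ⊤)
    (hP₁ : ∀ t ∈ Icc 0 T, ∫⁻ z, riesz (h₁ t) z.1 * ‖g t z‖ₑ ≤ P t)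
    (hP₂ : ∀ t ∈ Icc 0 T, ∫⁻ z, riesz (h₂ t) z.1 * ‖g t z‖ₑ ≤ P t) :
    IntervalIntegrable (fun t => ∫ w, u₁ t w * inner ℝ (g t w) (E₁ t w.1 - E₂ t w.1))
      volume 0 T ∧
    (∫ w, u₁ T w * u₂ T w) - ∫ w, u₁ 0 w * u₂ 0 w =
      ∫ t in 0..T, ∫ w, u₁ t w * inner ℝ (g t w) (E₁ t w.1 - E₂ t w.1) := by
  have hT0 : (0 : ℝ) ∈ Icc 0 T := left_mem_Icc.2 hT
  have hTT : T ∈ Icc 0 T := right_mem_Icc.2 hT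
  have hM := hc₁.nonneg
  obtain ⟨L, -, hL⟩ := exists_norm_fderiv_unitBump_le
  have hPfin : ∀ᵐ t ∂volume.restrict (Icc 0 T), P t < ⊤ := ae_lt_top' hPm hP
  -- The product of two nonnegative numbers is at most the larger square, hence at most the sum of
  -- the squares.
  have hpN : ∀ t ∈ Icc 0 T, ∫⁻ z, ‖u₁ t z * u₂ t z‖ₑ ≤ N + N := fun t ht => by
    calc _ ≤ ∫⁻ z, (‖u₁ t z‖ₑ ^ (2 : ℝ) + ‖u₂ t z‖ₑ ^ (2 : ℝ)) := lintegral_mono fun z => by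
          dsimp only
          rw [enorm_mul, ENNReal.rpow_two, ENNReal.rpow_two, sq, sq]
          rcases le_total ‖u₁ t z‖ₑ ‖u₂ t z‖ₑ with h | h
          · exact (mul_le_mul_left h _).trans le_add_self
          · exact (mul_le_mul_right h _).trans le_self_add
      _ = (∫⁻ z, ‖u₁ t z‖ₑ ^ (2 : ℝ)) + ∫⁻ z, ‖u₂ t z‖ₑ ^ (2 : ℝ) :=
          lintegral_add_left' ((hc₁.slice_meas t ht).enorm.pow_const _) _
      _ ≤ _ := add_le_add (hN₁ t ht) (hN₂ t ht)
  have hpi : ∀ t ∈ Icc 0 T, Integrable fun z => u₁ t z * u₂ t z := fun t ht =>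
    ⟨(hc₁.slice_meas t ht).mul (hc₂.slice_meas t ht),
      lt_of_le_of_lt (hpN t ht) (ENNReal.add_lt_top.2 ⟨hN.lt_top, hN.lt_top⟩)⟩
  -- A majorant in time for both the cutoff errors and the localized force term.
  set B : ℝ → ℝ≥0∞ := fun t => ENNReal.ofReal (2 * L) * (N + N) +
    ENNReal.ofReal (16 * L * M) * P t + (ENNReal.ofReal M * P t + ENNReal.ofReal M * P t) with hB
  have hBm : AEMeasurable B (volume.restrict (Icc 0 T)) := by fun_prop
  have hBi : ∫⁻ t in Icc 0 T, B t ≠ ⊤ := by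
    have hc : ∀ c : ℝ, ∫⁻ t in Icc 0 T, ENNReal.ofReal c * P t ≠ ⊤ := fun c => by
      rw [lintegral_const_mul' _ _ ENNReal.ofReal_ne_top]
      exact ENNReal.mul_ne_top ENNReal.ofReal_ne_top hP
    rw [lintegral_add_right' _ (by fun_prop), lintegral_add_right' _ (by fun_prop),
      lintegral_add_right' _ (by fun_prop), setLIntegral_const, Real.volume_Icc]
    exact ENNReal.add_ne_top.2 ⟨ENNReal.add_ne_top.2 ⟨ENNReal.mul_ne_top
      (ENNReal.mul_ne_top ENNReal.ofReal_ne_top (ENNReal.add_ne_top.2 ⟨hN, hN⟩))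
      ENNReal.ofReal_ne_top, hc _⟩, ENNReal.add_ne_top.2 ⟨hc _, hc _⟩⟩
  have hBtop : ∀ t, P t < ⊤ → B t ≠ ⊤ := fun t ht => by
    have hc : ∀ c : ℝ, ENNReal.ofReal c * P t ≠ ⊤ := fun c =>
      ENNReal.mul_ne_top ENNReal.ofReal_ne_top ht.ne
    exact ENNReal.add_ne_top.2 ⟨ENNReal.add_ne_top.2 ⟨ENNReal.mul_ne_top ENNReal.ofReal_ne_top
      (ENNReal.add_ne_top.2 ⟨hN, hN⟩), hc _⟩, ENNReal.add_ne_top.2 ⟨hc _, hc _⟩⟩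
  have hres : volume.restrict (uIoc 0 T) ≤ volume.restrict (Icc 0 T) := by
    rw [uIoc_of_le hT]; exact Measure.restrict_mono Ioc_subset_Icc_self le_rfl
  have mI := aestronglyMeasurable_mul_inner_force hc₁.toIsCurve hc₂.toIsCurve hgm
  have hBint : IntervalIntegrable (fun t => (B t).toReal) volume 0 T := by
    rw [intervalIntegrable_iff_integrableOn_Icc_of_le hT]
    exact integrable_toReal_of_lintegral_ne_top hBm hBi
  have key : ∀ᵐ t ∂volume.restrict (Icc 0 T),
      ‖∫ w, u₁ t w * inner ℝ (g t w) (E₁ t w.1 - E₂ t w.1)‖ ≤ (B t).toReal ∧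
      (∀ n, ‖(∫ w, u₁ t w * u₂ t w * fderiv ℝ (phaseCutoff n) w (w.2, E₁ t w.1)) +
        ∫ w, phaseCutoff n w * (u₁ t w * inner ℝ (g t w) (E₁ t w.1 - E₂ t w.1))‖ ≤ (B t).toReal) ∧
      Tendsto (fun n => (∫ w, u₁ t w * u₂ t w * fderiv ℝ (phaseCutoff n) w (w.2, E₁ t w.1)) +
        ∫ w, phaseCutoff n w * (u₁ t w * inner ℝ (g t w) (E₁ t w.1 - E₂ t w.1))) atTop
        (𝓝 (∫ w, u₁ t w * inner ℝ (g t w) (E₁ t w.1 - E₂ t w.1))) := by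
    filter_upwards [hg, hPfin, ae_restrict_mem measurableSet_Icc] with t hgt hPt ht
    have hpv : ∀ᵐ z, |u₁ t z * u₂ t z| ≤ M * |u₂ t z| := (hc₁.abs_le t ht).mono fun z hz => by
      rw [abs_mul]; exact mul_le_mul_of_nonneg_right hz (abs_nonneg _)
    obtain ⟨b₁, l₁⟩ := transport_cutoff_bound_tendsto hL (hc₁.isForce t ht) (hc₂.slice_meas t ht)
      (hc₂.abs_le t ht) (h0 t ht) (ne_top_of_le_ne_top hN (hN₂ t ht)) hgt
      (ne_top_of_le_ne_top hPt.ne (hP₁ t ht)) (hpi t ht) hpv hM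
    obtain ⟨b₂, i₂, -⟩ := mul_inner_force_sub hPt.ne (hc₁.isForce t ht) (hc₂.isForce t ht)
      (hc₁.slice_meas t ht) (hc₁.abs_le t ht) hgt.1.aestronglyMeasurable (hP₁ t ht) (hP₂ t ht)
    refine ⟨?_, fun n => ?_, ?_⟩
    · have : ‖∫ w, u₁ t w * inner ℝ (g t w) (E₁ t w.1 - E₂ t w.1)‖ₑ ≤ B t :=
        (enorm_integral_le_lintegral_enorm _).trans (b₂.trans le_add_self)
      rwa [← ofReal_norm, ENNReal.ofReal_le_iff_le_toReal (hBtop t hPt)] at this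
    · have : ‖(∫ w, u₁ t w * u₂ t w * fderiv ℝ (phaseCutoff n) w (w.2, E₁ t w.1)) +
          ∫ w, phaseCutoff n w * (u₁ t w * inner ℝ (g t w) (E₁ t w.1 - E₂ t w.1))‖ₑ ≤ B t := by
        refine (enorm_add_le _ _).trans (add_le_add ((b₁ n).trans ?_) ?_)
        · exact add_le_add (mul_le_mul_right (hpN t ht) _) (mul_le_mul_right (hP₁ t ht) _)
        · refine (enorm_integral_le_lintegral_enorm _).trans (le_trans ?_ b₂)
          refine lintegral_mono fun w => ?_
          rw [enorm_mul, ← ofReal_norm (phaseCutoff n w)]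
          refine mul_le_of_le_one_left' (ENNReal.ofReal_le_one.2 (abs_phaseCutoff_le_one n w))
      rwa [← ofReal_norm, ENNReal.ofReal_le_iff_le_toReal (hBtop t hPt)] at this
    · have := l₁.add (tendsto_integral_phaseCutoff_mul i₂)
      rwa [zero_add] at this
  constructor
  · refine hBint.mono_fun' (mI.integral_prod_right'.mono_measure hres) ?_
    exact (ae_mono hres) (key.mono fun t ht => ht.1)
  · refine tendsto_nhds_unique ((tendsto_integral_phaseCutoff_mul (hpi T hTT)).sub
      (tendsto_integral_phaseCutoff_mul (hpi 0 hT0))) ?_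
    have e : ∀ n, (∫ w, phaseCutoff n w * (u₁ T w * u₂ T w)) -
        ∫ w, phaseCutoff n w * (u₁ 0 w * u₂ 0 w) =
        ∫ t in 0..T, ((∫ w, u₁ t w * u₂ t w * fderiv ℝ (phaseCutoff n) w (w.2, E₁ t w.1)) +
          ∫ w, phaseCutoff n w * (u₁ t w * inner ℝ (g t w) (E₁ t w.1 - E₂ t w.1))) := fun n => by
      obtain ⟨R, c, hR, hθ⟩ := exists_isTest_phaseCutoff n
      exact integral_test_mul_sub hc₁ hc₂ hT hθ hR hg hPm hP hP₁ hP₂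
    simp_rw [e]
    refine intervalIntegral.tendsto_integral_filter_of_dominated_convergence
      (fun t => (B t).toReal) (Eventually.of_forall fun n => ?_) (Eventually.of_forall fun n => ?_)
      hBint ?_
    · obtain ⟨R, c, hR, hθ⟩ := exists_isTest_phaseCutoff n
      have m1 : AEStronglyMeasurable (fun p : ℝ × Phase => u₁ p.1 p.2 * u₂ p.1 p.2 *
          fderiv ℝ (phaseCutoff n) p.2 (p.2.2, E₁ p.1 p.2.1))
          ((volume.restrict (Icc 0 T)).prod volume) := by
        have := hc₂.meas.mul (hc₁.toIsCurve.integrable_test hθ).1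
        refine this.congr (Eventually.of_forall fun p => ?_)
        simp only [Pi.mul_apply]; ring
      have m2 := ((contDiff_phaseCutoff n).continuous.comp
        (continuous_snd (X := ℝ))).aestronglyMeasurable.mul mI
      exact (m1.integral_prod_right'.add m2.integral_prod_right').mono_measure hres
    · rw [← ae_restrict_iff' measurableSet_uIoc]
      exact (ae_mono hres) (key.mono fun t ht => ht.2.1 n)
    · rw [← ae_restrict_iff' measurableSet_uIoc]
      exact (ae_mono hres) (key.mono fun t ht => ht.2.2)

end Evolution

/-- Conservation of mass. -/
theorem IsWeakCurve.integral_eq {T M : ℝ} {N : ℝ≥0∞} {h : ℝ → R3 → ℝ≥0∞} {u : ℝ → Phase → ℝ}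
    {E : ℝ → R3 → R3} (hc : IsWeakCurve T M N h u E) (hT : 0 ≤ T)
    (hi : ∀ t ∈ Icc 0 T, Integrable (u t)) {N' : ℝ≥0∞} (hN : N' ≠ ⊤)
    (hN' : ∀ t ∈ Icc 0 T, ∫⁻ z, ‖u t z‖ₑ ≤ N')
    (hE : Integrable (fun p : ℝ × Phase => u p.1 p.2 • E p.1 p.2.1)
      ((volume.restrict (Icc 0 T)).prod volume)) :
    ∫ z, u T z = ∫ z, u 0 z := by
  obtain ⟨L, hL0, hL⟩ := exists_norm_fderiv_unitBump_le
  have hT0 : (0 : ℝ) ∈ Icc 0 T := left_mem_Icc.2 hT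
  have hTT : T ∈ Icc 0 T := right_mem_Icc.2 hT
  have hui : Integrable (fun p : ℝ × Phase => u p.1 p.2)
      ((volume.restrict (Icc 0 T)).prod volume) := by
    refine ⟨hc.meas, ?_⟩
    rw [hasFiniteIntegral_iff_enorm, lintegral_prod _ hc.meas.enorm]
    refine lt_of_le_of_lt (setLIntegral_mono' (g := fun _ => N') measurableSet_Icc
      fun t ht => hN' t ht) ?_
    rw [setLIntegral_const]
    exact ENNReal.mul_lt_top hN.lt_top (by simp)
  -- Here both u and uE are integrable in space-time, so the cutoff errors are dominated directly
  -- and no velocity gradient enters.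
  have hlim : Tendsto (fun n => ∫ p : ℝ × Phase, u p.1 p.2 *
      fderiv ℝ (phaseCutoff n) p.2 (p.2.2, E p.1 p.2.1) ∂(volume.restrict (Icc 0 T)).prod volume)
      atTop (𝓝 (∫ _ : ℝ × Phase, (0 : ℝ) ∂(volume.restrict (Icc 0 T)).prod volume)) := by
    refine tendsto_integral_of_dominated_convergence
      (fun p => 2 * L * ‖u p.1 p.2‖ + L * ‖u p.1 p.2 • E p.1 p.2.1‖) (fun n => ?_)
      ((hui.norm.const_mul _).add (hE.norm.const_mul _))
      (fun n => Eventually.of_forall fun p => ?_) (Eventually.of_forall fun p => ?_)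
    · obtain ⟨R, c, hR, hθ⟩ := exists_isTest_phaseCutoff n
      exact (hc.toIsCurve.integrable_test hθ).1
    · rw [norm_mul, norm_smul, fderiv_phaseCutoff]
      have h1 := abs_spatial_cutoff_le hL n p.2
      have h2 := abs_velocity_cutoff_le hL n p.2 (E p.1 p.2.1)
      have h3 : cutoffScale n ≤ 1 := by
        unfold cutoffScale
        exact inv_le_one_of_one_le₀ (by linarith [(n.cast_nonneg : (0 : ℝ) ≤ n)])
      have h4 : L * cutoffScale n * ‖E p.1 p.2.1‖ ≤ L * ‖E p.1 p.2.1‖ := by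
        have := mul_le_of_le_one_right hL0 h3
        gcongr
      calc _ ≤ ‖u p.1 p.2‖ * (2 * L + L * ‖E p.1 p.2.1‖) := by
            refine mul_le_mul_of_nonneg_left ?_ (norm_nonneg _)
            exact (norm_add_le _ _).trans (add_le_add h1 (h2.trans h4))
        _ = _ := by ring
    · simp_rw [fderiv_phaseCutoff]
      have l1 := tendsto_spatial_cutoff p.2
      have l2 : Tendsto (fun n => unitBump (cutoffScale n • p.2.1) * (cutoffScale n *
          fderiv ℝ unitBump (cutoffScale n • p.2.2) (E p.1 p.2.1))) atTop (𝓝 0) := by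
        refine squeeze_zero_norm (fun n => abs_velocity_cutoff_le hL n p.2 (E p.1 p.2.1)) ?_
        have := (tendsto_cutoffScale.const_mul L).mul_const ‖E p.1 p.2.1‖
        simpa using this
      have := (l1.add l2).const_mul (u p.1 p.2)
      simpa using this
  have e : ∀ n, ∫ p : ℝ × Phase, u p.1 p.2 *
      fderiv ℝ (phaseCutoff n) p.2 (p.2.2, E p.1 p.2.1) ∂(volume.restrict (Icc 0 T)).prod volume =
      (∫ z, phaseCutoff n z * u T z) - ∫ z, phaseCutoff n z * u 0 z := fun n => by
    obtain ⟨R, c, hR, hθ⟩ := exists_isTest_phaseCutoff n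
    have := hc.weak (phaseCutoff n) (contDiff_phaseCutoff n) (hasCompactSupport_phaseCutoff n) T hTT
    rw [intervalIntegral.integral_of_le hT, ← integral_Icc_eq_integral_Ioc] at this
    rw [integral_prod _ (hc.toIsCurve.integrable_test hθ), ← this]
    simp_rw [mul_comm]
  simp_rw [e, integral_zero] at hlim
  have := tendsto_nhds_unique hlim ((tendsto_integral_phaseCutoff_mul (hi T hTT)).sub
    (tendsto_integral_phaseCutoff_mul (hi 0 hT0)))
  linarith

/-! ### Grönwall's inequality with an integrable coefficient. -/

lemma AbsolutelyContinuousOnInterval.of_dist_le {f k : ℝ → ℝ} {a b : ℝ}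
    (hk : AbsolutelyContinuousOnInterval k a b)
    (h : ∀ s ∈ uIcc a b, ∀ t ∈ uIcc a b, dist (f s) (f t) ≤ dist (k s) (k t)) :
    AbsolutelyContinuousOnInterval f a b := by
  rw [absolutelyContinuousOnInterval_iff] at hk ⊢
  intro ε hε
  obtain ⟨δ, hδ, H⟩ := hk ε hε
  refine ⟨δ, hδ, fun I hI hlen => lt_of_le_of_lt (Finset.sum_le_sum fun i hi => ?_) (H I hI hlen)⟩
  exact h _ (hI.1 i hi).1 _ (hI.1 i hi).2

/-- Grönwall's inequality with an integrable coefficient. -/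
lemma le_mul_exp_integral {T : ℝ} (hT : 0 ≤ T) {y a : ℝ → ℝ} (hy : ContinuousOn y (Icc 0 T))
    (ha : IntervalIntegrable a volume 0 T) (ha0 : ∀ t, 0 ≤ a t)
    (h : ∀ t ∈ Icc 0 T, y t ≤ y 0 + ∫ s in 0..t, a s * y s) :
    y T ≤ y 0 * Real.exp (∫ s in 0..T, a s) := by
  have hu : uIcc 0 T = Icc 0 T := uIcc_of_le hT
  have hay : IntervalIntegrable (fun s => a s * y s) volume 0 T :=
    ha.mul_continuousOn (by rwa [hu])
  set z : ℝ → ℝ := fun t => y 0 + ∫ s in 0..t, a s * y s with hz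
  set A : ℝ → ℝ := fun t => ∫ s in 0..t, a s with hA
  have Aac : AbsolutelyContinuousOnInterval A 0 T :=
    ha.absolutelyContinuousOnInterval_intervalIntegral left_mem_uIcc
  have zac : AbsolutelyContinuousOnInterval z 0 T :=
    (LipschitzWith.const (α := ℝ) (y 0)).lipschitzOnWith.absolutelyContinuousOnInterval.fun_add
      (hay.absolutelyContinuousOnInterval_intervalIntegral left_mem_uIcc)
  have A0 : ∀ t ∈ Icc 0 T, 0 ≤ A t := fun t ht =>
    intervalIntegral.integral_nonneg ht.1 fun s _ => ha0 s
  -- The map p ↦ e^{-p} is 1-Lipschitz on p ≥ 0, and A ≥ 0, so absolute continuity passes from A to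
  -- e^{-A}.
  have eac : AbsolutelyContinuousOnInterval (fun t => Real.exp (-A t)) 0 T := by
    refine AbsolutelyContinuousOnInterval.of_dist_le Aac fun s hs t ht => ?_
    rw [hu] at hs ht
    have key : ∀ p q : ℝ, 0 ≤ p → p ≤ q → Real.exp (-p) - Real.exp (-q) ≤ q - p := fun p q h1 h2 => by
      have h3 := Real.add_one_le_exp (-(q - p))
      have h4 : Real.exp (-p) ≤ 1 := Real.exp_le_one_iff.2 (by linarith)
      have h5 : Real.exp (-q) = Real.exp (-p) * Real.exp (-(q - p)) := by
        rw [← Real.exp_add]; congr 1; ring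
      rw [h5]
      nlinarith [Real.exp_pos (-p)]
    rw [Real.dist_eq, Real.dist_eq]
    rcases le_total (A s) (A t) with hst | hst
    · rw [abs_of_nonneg (sub_nonneg.2 (Real.exp_le_exp.2 (by linarith))), abs_sub_comm,
        abs_of_nonneg (sub_nonneg.2 hst)]
      exact key _ _ (A0 s hs) hst
    · rw [abs_sub_comm, abs_of_nonneg (sub_nonneg.2 (Real.exp_le_exp.2 (by linarith))),
        abs_of_nonneg (sub_nonneg.2 hst)]
      exact key _ _ (A0 t ht) hst
  -- The derivative of z e^{-A} is a(y - z)e^{-A} ≤ 0 almost everywhere, so z e^{-A} has nonpositive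
  -- increment over [0, T].
  have prod := zac.integral_deriv_mul_eq_sub eac
  have hneg : ∫ t in 0..T, (deriv z t * Real.exp (-A t) +
      z t * deriv (fun t => Real.exp (-A t)) t) ≤ ∫ t in 0..T, (0 : ℝ) := by
    refine intervalIntegral.integral_mono_ae_restrict hT ?_ intervalIntegrable_const ?_
    · exact (zac.intervalIntegrable_deriv.mul_continuousOn eac.continuousOn).add
        (eac.intervalIntegrable_deriv.continuousOn_mul zac.continuousOn)
    · rw [Filter.EventuallyLE, ae_restrict_iff' measurableSet_Icc]
      filter_upwards [hay.ae_hasDerivAt_integral, ha.ae_hasDerivAt_integral] with t h1 h2 ht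
      have ht' : t ∈ uIcc 0 T := by rwa [hu]
      have d1 : HasDerivAt z (a t * y t) t := (h1 ht' 0 left_mem_uIcc).const_add _
      have d2 : HasDerivAt (fun t => Real.exp (-A t)) (Real.exp (-A t) * -a t) t :=
        ((h2 ht' 0 left_mem_uIcc).neg).exp
      rw [d1.deriv, d2.deriv]
      have h3 : y t ≤ z t := h t ht
      have h4 := mul_nonneg (ha0 t) (Real.exp_pos (-A t)).le
      nlinarith
  rw [prod, intervalIntegral.integral_zero] at hneg
  have z0 : z 0 = y 0 := by simp [hz]
  have e0 : A 0 = 0 := by simp [hA]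
  rw [z0, e0, neg_zero, Real.exp_zero, mul_one] at hneg
  have hzT : y T ≤ z T := h T (right_mem_Icc.2 hT)
  calc y T ≤ z T := hzT
    _ = z T * Real.exp (-A T) * Real.exp (A T) := by
        rw [mul_assoc, ← Real.exp_add]; simp
    _ ≤ y 0 * Real.exp (A T) := mul_le_mul_of_nonneg_right (by linarith) (Real.exp_pos _).le

/-! ### The stability estimate for square roots. -/

lemma aemeasurable_lintegral_riesz_density_mul {τ : Measure ℝ} [SFinite τ] {f : ℝ → Phase → ℝ}
    {g : ℝ → Phase → R3}
    (hf : AEStronglyMeasurable (fun p : ℝ × Phase => f p.1 p.2) (τ.prod volume))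
    (hg : AEStronglyMeasurable (fun p : ℝ × Phase => g p.1 p.2) (τ.prod volume)) :
    AEMeasurable (fun t => ∫⁻ z, riesz (fun y => ‖density (f t) y‖ₑ) z.1 * ‖g t z‖ₑ) τ := by
  set f' := fun t z => hf.mk _ (t, z) with hf'
  have e : ∀ᵐ t ∂τ, f t =ᵐ[volume] f' t := Measure.ae_ae_of_ae_prod hf.ae_eq_mk
  have m : Measurable fun p : ℝ × Phase => riesz (fun y => ‖density (f' p.1) y‖ₑ) p.2.1 := by
    have hd : StronglyMeasurable fun p : ℝ × R3 => density (f' p.1) p.2 := by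
      have : StronglyMeasurable fun q : (ℝ × R3) × R3 => f' q.1.1 (q.1.2, q.2) :=
        hf.stronglyMeasurable_mk.comp_measurable
          (g := fun q : (ℝ × R3) × R3 => (q.1.1, (q.1.2, q.2))) (by fun_prop)
      exact this.integral_prod_right' (ν := (volume : Measure R3))
    have hk : Measurable fun q : (ℝ × Phase) × R3 =>
        ‖density (f' q.1.1) q.2‖ₑ * rieszKernel (q.1.2.1 - q.2) :=
      (hd.enorm.comp (g := fun p : ℝ × R3 => ‖density (f' p.1) p.2‖ₑ)
        (f := fun q : (ℝ × Phase) × R3 => (q.1.1, q.2)) (by fun_prop)).mul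
        (measurable_rieszKernel.comp (by fun_prop))
    exact hk.lintegral_prod_right' (ν := (volume : Measure R3))
  refine (AEMeasurable.lintegral_prod_right' (m.aemeasurable.mul hg.enorm)).congr ?_
  filter_upwards [e] with t ht
  refine lintegral_congr fun z => ?_
  have : riesz (fun y => ‖density (f' t) y‖ₑ) = riesz (fun y => ‖density (f t) y‖ₑ) :=
    riesz_congr ((density_congr ht).mono fun y hy => by simp only [hy])
  simp only [Pi.mul_apply, this]

lemma eLpNorm_two_eq {v : Phase → ℝ} :
    eLpNorm v 2 volume = (∫⁻ z, ‖v z‖ₑ ^ (2 : ℝ)) ^ (1 / 2 : ℝ) := by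
  simp [eLpNorm_eq_lintegral_rpow_enorm_toReal]

lemma ofReal_integral_sq {v : Phase → ℝ} (hv : Integrable fun z => v z ^ 2) :
    ENNReal.ofReal (∫ z, v z ^ 2) = ∫⁻ z, ‖v z‖ₑ ^ (2 : ℝ) := by
  rw [ofReal_integral_eq_lintegral_ofReal hv (Eventually.of_forall fun z => sq_nonneg _)]
  refine lintegral_congr fun z => ?_
  rw [ENNReal.rpow_two, ← ofReal_norm, ← ENNReal.ofReal_pow (norm_nonneg _), Real.norm_eq_abs,
    sq_abs]

namespace IsSolution

variable {σ T : ℝ} {f : ℝ → Phase → ℝ} {Cinf : ℝ≥0} {N : ℝ≥0∞}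

/-- Renormalize with s ↦ χ(s)s, where χ is a bump equal to one on [0, C_∞]; on the range of f this
is the identity, and the approximating sequence is constant. -/
lemma isWeakCurve_self (hf : IsSolution σ T f) (hσ : σ = 1 ∨ σ = -1)
    (hb : ∀ t ∈ Icc 0 T, eLpNorm (f t) ⊤ volume ≤ (Cinf : ℝ≥0∞)) (hN : N ≠ ⊤)
    (hfN : ∀ t ∈ Icc 0 T, ∫⁻ z, ‖f t z‖ₑ ≤ N) :
    IsWeakCurve T Cinf N (fun t y => ‖density (f t) y‖ₑ) f (fun t => forceField σ (f t)) := by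
  let χ : ContDiffBump (0 : ℝ) := ⟨Cinf + 1, Cinf + 2, by positivity, by linarith⟩
  have hone : ∀ s ∈ Icc (0 : ℝ) Cinf, χ s = 1 := fun s hs => χ.one_of_mem_closedBall <| by
    rw [mem_closedBall_zero_iff, Real.norm_of_nonneg hs.1]
    exact hs.2.trans (le_add_of_nonneg_right zero_le_one)
  have hc : ContDiff ℝ 1 fun s : ℝ => χ s * s := χ.contDiff.mul contDiff_id
  refine hf.isWeakCurve hσ hb hN hfN (γ := id) continuous_id Cinf.2 (β := fun _ s => χ s * s)
    (fun _ => hc) (fun _ => ?_) (fun _ s hs => ?_) (fun s hs => ?_)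
  · exact hc.continuous.bounded_above_of_compact_support χ.hasCompactSupport.mul_right
  · rw [hone s hs, one_mul, abs_of_nonneg hs.1]; exact hs.2
  · simp [hone s hs]

/-- The square root is not C¹ at 0. It is approximated by χ(s)(s² + 1/(k+1))^{1/4}, which is C¹ and
bounded and tends to √s on [0, C_∞]. The uniform bound there is (C_∞² + 1)^{1/4}. -/
lemma isWeakCurve_sqrt (hf : IsSolution σ T f) (hσ : σ = 1 ∨ σ = -1)
    (hb : ∀ t ∈ Icc 0 T, eLpNorm (f t) ⊤ volume ≤ (Cinf : ℝ≥0∞)) (hN : N ≠ ⊤)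
    (hfN : ∀ t ∈ Icc 0 T, ∫⁻ z, ‖f t z‖ₑ ≤ N) :
    IsWeakCurve T (√√((Cinf : ℝ) ^ 2 + 1)) N (fun t y => ‖density (f t) y‖ₑ)
      (fun t z => √(f t z)) (fun t => forceField σ (f t)) := by
  let χ : ContDiffBump (0 : ℝ) := ⟨Cinf + 1, Cinf + 2, by positivity, by linarith⟩
  have hone : ∀ s ∈ Icc (0 : ℝ) Cinf, χ s = 1 := fun s hs => χ.one_of_mem_closedBall <| by
    rw [mem_closedBall_zero_iff, Real.norm_of_nonneg hs.1]
    exact hs.2.trans (le_add_of_nonneg_right zero_le_one)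
  have hpos : ∀ (k : ℕ) (s : ℝ), 0 < s ^ 2 + 1 / ((k : ℝ) + 1) := fun k s => by positivity
  have hc : ∀ k : ℕ, ContDiff ℝ 1 fun s : ℝ => χ s * √√(s ^ 2 + 1 / ((k : ℝ) + 1)) := fun k =>
    χ.contDiff.mul ((((contDiff_id.pow 2).add contDiff_const).sqrt fun s => (hpos k s).ne').sqrt
      fun s => (Real.sqrt_pos.2 (hpos k s)).ne')
  refine hf.isWeakCurve hσ hb hN hfN Real.continuous_sqrt (Real.sqrt_nonneg _)
    (β := fun k s => χ s * √√(s ^ 2 + 1 / ((k : ℝ) + 1))) hc (fun k => ?_) (fun k s hs => ?_)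
    (fun s hs => ?_)
  · exact (hc k).continuous.bounded_above_of_compact_support χ.hasCompactSupport.mul_right
  · rw [hone s hs, one_mul, abs_of_nonneg (Real.sqrt_nonneg _)]
    refine Real.sqrt_le_sqrt (Real.sqrt_le_sqrt (add_le_add (pow_le_pow_left₀ hs.1 hs.2 2) ?_))
    exact (div_le_one (by positivity)).2 (le_add_of_nonneg_left k.cast_nonneg)
  · simp only [hone s hs, one_mul]
    have := (tendsto_const_nhds (x := s ^ 2)).add (tendsto_one_div_add_atTop_nhds_zero_nat (𝕜 := ℝ))
    have := this.sqrt.sqrt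
    rwa [add_zero, Real.sqrt_sq hs.1] at this

lemma integrable_force_prod (hf : IsSolution σ T f) {S : ℝ} (hS : S ≤ T) :
    Integrable (fun p : ℝ × Phase => f p.1 p.2 • forceField σ (f p.1) p.2.1)
      ((volume.restrict (Icc 0 S)).prod volume) := by
  have h := hf.integrable_force
  rw [Measure.volume_eq_prod, ← Measure.prod_restrict, Measure.restrict_univ,
    restrict_Ioo_eq_restrict_Icc] at h
  exact h.mono_measure (IsCurve.restrict_prod_le hS)

lemma lintegral_sqrt_rpow_two (hf : IsSolution σ T f) {t : ℝ} (ht : t ∈ Icc 0 T) :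
    ∫⁻ z, ‖√(f t z)‖ₑ ^ (2 : ℝ) = ∫⁻ z, ‖f t z‖ₑ := by
  refine lintegral_congr_ae ((hf.nonneg t ht).mono fun z hz => ?_)
  dsimp only
  rw [ENNReal.rpow_two, ← enorm_pow, Real.sq_sqrt hz]

end IsSolution

section Stability

variable {σ T : ℝ} {Cinf : ℝ≥0} {f₁ f₂ : ℝ → Phase → ℝ} {g : ℝ → Phase → R3}

/-- The evolution of the `L²` distance of the square roots of two solutions. -/
theorem IsSolution.sq_distance_eq (hσ : σ = 1 ∨ σ = -1) (hf₁ : IsSolution σ T f₁)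
    (hf₂ : IsSolution σ T f₂)
    (hb₁ : ∀ t ∈ Icc 0 T, eLpNorm (f₁ t) ⊤ volume ≤ (Cinf : ℝ≥0∞))
    (hb₂ : ∀ t ∈ Icc 0 T, eLpNorm (f₂ t) ⊤ volume ≤ (Cinf : ℝ≥0∞)) (hC : Cinf ≠ 0) {S : ℝ}
    (hS0 : 0 ≤ S) (hST : S ≤ T)
    (hgm : AEStronglyMeasurable (fun p : ℝ × Phase => g p.1 p.2)
      ((volume.restrict (Icc 0 S)).prod volume))
    (hg : ∀ᵐ t ∂volume.restrict (Icc 0 S), IsWeakVelocityGradient (fun z => √(f₂ t z)) (g t))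
    (hr : ∫⁻ t in Icc 0 S, rate Cinf (f₂ t) (g t) ≠ ⊤) :
    ∃ J : ℝ → ℝ, IntervalIntegrable J volume 0 S ∧
      (∀ᵐ t ∂volume.restrict (Icc 0 S), ‖J t‖ₑ ≤ 8 * rieszConst * rate Cinf (f₂ t) (g t) *
        ∫⁻ z, ‖√(f₁ t z) - √(f₂ t z)‖ₑ ^ (2 : ℝ)) ∧
      (∀ t ∈ Icc 0 S, Integrable fun z => (√(f₁ t z) - √(f₂ t z)) ^ 2) ∧
      ∀ t ∈ Icc 0 S, ∫ z, (√(f₁ t z) - √(f₂ t z)) ^ 2 =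
        (∫ z, (√(f₁ 0 z) - √(f₂ 0 z)) ^ 2) - 2 * ∫ r in 0..t, J r := by
  have hsub : Icc 0 S ⊆ Icc 0 T := Icc_subset_Icc_right hST
  obtain ⟨N₁, hN₁, hfN₁⟩ := hf₁.exists_lintegral_le
  obtain ⟨N₂, hN₂, hfN₂⟩ := hf₂.exists_lintegral_le
  have s₁ := (hf₁.isWeakCurve_sqrt hσ hb₁ hN₁ hfN₁).mono hST
  have s₂ := (hf₂.isWeakCurve_sqrt hσ hb₂ hN₂ hfN₂).mono hST
  have m₁ := hf₁.meas.mono_measure (IsCurve.restrict_prod_le hST)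
  have m₂ := hf₂.meas.mono_measure (IsCurve.restrict_prod_le hST)
  set P₁ : ℝ → ℝ≥0∞ := fun t => ∫⁻ z, riesz (fun y => ‖density (f₁ t) y‖ₑ) z.1 * ‖g t z‖ₑ with hP₁
  set P₂ : ℝ → ℝ≥0∞ := fun t => ∫⁻ z, riesz (fun y => ‖density (f₂ t) y‖ₑ) z.1 * ‖g t z‖ₑ with hP₂
  have mP₁ : AEMeasurable P₁ (volume.restrict (Icc 0 S)) :=
    aemeasurable_lintegral_riesz_density_mul m₁ hgm
  have mP₂ : AEMeasurable P₂ (volume.restrict (Icc 0 S)) :=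
    aemeasurable_lintegral_riesz_density_mul m₂ hgm
  have hc0 : (Cinf : ℝ≥0∞) ^ (1 / 2 : ℝ) ≠ 0 := by
    simp [ENNReal.rpow_eq_zero_iff, hC]
  have hct : (Cinf : ℝ≥0∞) ^ (1 / 2 : ℝ) ≠ ⊤ :=
    ENNReal.rpow_ne_top_of_nonneg (by norm_num) (by simp)
  -- The pairing of the potential with |g| is bounded by the mass times the L^{3,1} norm of g, and
  -- C_∞^{1/2} times that norm is part of the rate. Dividing by C_∞^{1/2} is where C_∞ ≠ 0 is used.
  have hPfin : ∀ {f : ℝ → Phase → ℝ} {N : ℝ≥0∞}, IsSolution σ T f → N ≠ ⊤ →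
      (∀ t ∈ Icc 0 T, ∫⁻ z, ‖f t z‖ₑ ≤ N) →
      ∫⁻ t in Icc 0 S, ∫⁻ z, riesz (fun y => ‖density (f t) y‖ₑ) z.1 * ‖g t z‖ₑ ≠ ⊤ := by
    intro f N hf hN hfN
    have hle : (Cinf : ℝ≥0∞) ^ (1 / 2 : ℝ) * ∫⁻ t in Icc 0 S,
        ∫⁻ z, riesz (fun y => ‖density (f t) y‖ₑ) z.1 * ‖g t z‖ₑ ≤
        rieszConst * N * ∫⁻ t in Icc 0 S, rate Cinf (f₂ t) (g t) := by
      rw [← lintegral_const_mul' _ _ hct,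
        ← lintegral_const_mul' _ _ (ENNReal.mul_ne_top rieszConst_ne_top hN)]
      refine lintegral_mono_ae ?_
      filter_upwards [hg, ae_restrict_mem measurableSet_Icc] with t hgt ht
      calc _ ≤ (Cinf : ℝ≥0∞) ^ (1 / 2 : ℝ) *
            (rieszConst * (∫⁻ y, ‖density (f t) y‖ₑ) * mixedLorentzNorm 3 1 (g t)) :=
            mul_le_mul_right (lintegral_riesz_mul_enorm_le
              (hf.isForce hσ (hsub ht)).aemeasurable hgt.1.aestronglyMeasurable) _
        _ = rieszConst * (∫⁻ y, ‖density (f t) y‖ₑ) *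
            ((Cinf : ℝ≥0∞) ^ (1 / 2 : ℝ) * mixedLorentzNorm 3 1 (g t)) := by ring
        _ ≤ _ := mul_le_mul' (mul_le_mul_right
            ((lintegral_enorm_density_le (hf.integrable t (hsub ht)).1).trans
              (hfN t (hsub ht))) _) (mul_mixedLorentzNorm_le_rate _ _ _)
    intro h
    rw [h, ENNReal.mul_top hc0, top_le_iff] at hle
    exact ENNReal.mul_ne_top (ENNReal.mul_ne_top rieszConst_ne_top hN) hr hle
  have fP₁ : ∫⁻ t in Icc 0 S, P₁ t ≠ ⊤ := hPfin hf₁ hN₁ hfN₁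
  have fP₂ : ∫⁻ t in Icc 0 S, P₂ t ≠ ⊤ := hPfin hf₂ hN₂ hfN₂
  have fP : ∫⁻ t in Icc 0 S, (P₁ t + P₂ t) ≠ ⊤ := by
    rw [lintegral_add_left' mP₁]
    exact ENNReal.add_ne_top.2 ⟨fP₁, fP₂⟩
  have q₁ : ∀ t ∈ Icc 0 S, ∫⁻ z, ‖√(f₁ t z)‖ₑ ^ (2 : ℝ) ≤ N₁ + N₂ := fun t ht =>
    (hf₁.lintegral_sqrt_rpow_two (hsub ht)).trans_le ((hfN₁ t (hsub ht)).trans le_self_add)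
  have q₂ : ∀ t ∈ Icc 0 S, ∫⁻ z, ‖√(f₂ t z)‖ₑ ^ (2 : ℝ) ≤ N₁ + N₂ := fun t ht =>
    (hf₂.lintegral_sqrt_rpow_two (hsub ht)).trans_le ((hfN₂ t (hsub ht)).trans le_add_self)
  have hN : N₁ + N₂ ≠ ⊤ := ENNReal.add_ne_top.2 ⟨hN₁, hN₂⟩
  have key := fun {s : ℝ} (hs : s ∈ Icc 0 S) =>
    have hsS : Icc 0 s ⊆ Icc 0 S := Icc_subset_Icc_right hs.2
    have hle : volume.restrict (Icc 0 s) ≤ volume.restrict (Icc 0 S) :=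
      Measure.restrict_mono hsS le_rfl
    integral_mul_sub (g := g) (P := fun t => P₁ t + P₂ t) (s₁.mono hs.2) (s₂.mono hs.2) hs.1
      (fun t _ => Eventually.of_forall fun z => Real.sqrt_nonneg _) hN
      (fun t ht => q₁ t (hsS ht)) (fun t ht => q₂ t (hsS ht))
      (hgm.mono_measure (IsCurve.restrict_prod_le hs.2)) (ae_mono hle hg)
      ((mP₁.add mP₂).mono_measure hle) (ne_top_of_le_ne_top fP (lintegral_mono' hle le_rfl))
      (fun t _ => le_self_add) (fun t _ => le_add_self)
  have mass : ∀ {f : ℝ → Phase → ℝ} {N : ℝ≥0∞}, IsSolution σ T f → N ≠ ⊤ →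
      (∀ t ∈ Icc 0 T, ∫⁻ z, ‖f t z‖ₑ ≤ N) →
      (∀ t ∈ Icc 0 T, eLpNorm (f t) ⊤ volume ≤ (Cinf : ℝ≥0∞)) →
      ∀ t ∈ Icc 0 S, ∫ z, f t z = ∫ z, f 0 z := fun hf hN hfN hb t ht =>
    ((hf.isWeakCurve_self hσ hb hN hfN).mono (ht.2.trans hST)).integral_eq ht.1
      (fun r hr => hf.integrable r (Icc_subset_Icc_right (ht.2.trans hST) hr)) hN
      (fun r hr => hfN r (Icc_subset_Icc_right (ht.2.trans hST) hr))
      (hf.integrable_force_prod (ht.2.trans hST))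
  have cross : ∀ t ∈ Icc 0 S, Integrable fun z => √(f₁ t z) * √(f₂ t z) := fun t ht => by
    have m : ∀ {f : ℝ → Phase → ℝ}, IsSolution σ T f → MemLp (fun z => √(f t z)) 2 := fun hf => by
      refine ⟨Real.continuous_sqrt.comp_aestronglyMeasurable (hf.integrable t (hsub ht)).1, ?_⟩
      rw [eLpNorm_two_eq, hf.lintegral_sqrt_rpow_two (hsub ht)]
      exact ENNReal.rpow_lt_top_of_nonneg (by norm_num) (hf.integrable t (hsub ht)).2.ne
    exact (m hf₁).integrable_mul (m hf₂)
  have expand : ∀ t ∈ Icc 0 S, (fun z => (√(f₁ t z) - √(f₂ t z)) ^ 2) =ᵐ[volume]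
      fun z => f₁ t z + f₂ t z - 2 * (√(f₁ t z) * √(f₂ t z)) := fun t ht => by
    filter_upwards [hf₁.nonneg t (hsub ht), hf₂.nonneg t (hsub ht)] with z h1 h2
    nlinarith [Real.sq_sqrt h1, Real.sq_sqrt h2]
  have int_eq : ∀ t ∈ Icc 0 S, ∫ z, (√(f₁ t z) - √(f₂ t z)) ^ 2 =
      (∫ z, f₁ t z) + (∫ z, f₂ t z) - 2 * ∫ z, √(f₁ t z) * √(f₂ t z) := fun t ht => by
    have i1 := hf₁.integrable t (hsub ht)
    have i2 := hf₂.integrable t (hsub ht)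
    rw [integral_congr_ae (expand t ht), integral_sub (i1.fun_add i2) ((cross t ht).const_mul 2),
      integral_add i1 i2, integral_const_mul]
  refine ⟨_, (key (right_mem_Icc.2 hS0)).1, ?_, fun t ht => ?_, fun t ht => ?_⟩
  · have a₁ := ae_lt_top' mP₁ fP₁
    have a₂ := ae_lt_top' mP₂ fP₂
    filter_upwards [a₁, a₂, hg, ae_restrict_mem measurableSet_Icc] with t ht₁ ht₂ hgt ht
    have F₁ := s₁.isForce t ht
    have F₂ := s₂.isForce t ht
    have Gm := hgt.1.aestronglyMeasurable
    -- Each force separately does no work on f₂, so √f₁ may be replaced by √f₁ - √f₂ in the rate;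
    -- this makes the rate quadratic in the difference.
    have hz : ∀ {h : R3 → ℝ≥0∞} {E : R3 → R3}, IsForce h E →
        ∫⁻ z, riesz h z.1 * ‖g t z‖ₑ ≠ ⊤ → ∫ z, √(f₂ t z) * inner ℝ (g t z) (E z.1) = 0 :=
      fun F hfin => integral_mul_inner_force_eq_zero F (s₂.slice_meas t ht) (s₂.abs_le t ht)
        (Eventually.of_forall fun z => Real.sqrt_nonneg _) (ne_top_of_le_ne_top hN (q₂ t ht)) hgt
        hfin s₂.nonneg
    obtain ⟨-, i₁, -⟩ := mul_inner_force_sub (P := P₁ t + P₂ t)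
      (ENNReal.add_ne_top.2 ⟨ht₁.ne, ht₂.ne⟩) F₁ F₂ (s₁.slice_meas t ht) (s₁.abs_le t ht) Gm
      le_self_add le_add_self
    obtain ⟨-, i₂, e₂⟩ := mul_inner_force_sub (P := P₁ t + P₂ t)
      (ENNReal.add_ne_top.2 ⟨ht₁.ne, ht₂.ne⟩) F₁ F₂ (s₂.slice_meas t ht) (s₂.abs_le t ht) Gm
      le_self_add le_add_self
    rw [hz F₁ ht₁.ne, hz F₂ ht₂.ne, sub_zero] at e₂
    rw [← sub_zero (∫ w, _), ← e₂, ← integral_sub i₁ i₂]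
    have h1 := hf₁.ae_mem_Icc hb₁ (hsub ht)
    have h2 := hf₂.ae_mem_Icc hb₂ (hsub ht)
    refine (enorm_integral_le_lintegral_enorm _).trans (le_trans (lintegral_mono fun z => ?_)
      (lintegral_forceField_sub_le hσ Cinf (hf₁.integrable t (hsub ht))
        (hf₂.integrable t (hsub ht)) (hf₁.nonneg t (hsub ht)) (hf₂.nonneg t (hsub ht))
        (h1.mono fun z hz => hz.2) (h2.mono fun z hz => hz.2) Gm))
    rw [← sub_mul, enorm_mul, mul_left_comm, mul_comm ‖forceField σ (f₁ t) z.1 - _‖ₑ]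
    refine mul_le_mul_right ?_ _
    rw [← ofReal_norm, ← ofReal_norm (g t z), ← ofReal_norm (_ - _),
      ← ENNReal.ofReal_mul (norm_nonneg _)]
    exact ENNReal.ofReal_le_ofReal (norm_inner_le_norm _ _)
  · exact (((hf₁.integrable t (hsub ht)).add (hf₂.integrable t (hsub ht))).sub
      ((cross t ht).const_mul 2)).congr (expand t ht).symm
  · have e := (key ht).2
    rw [int_eq t ht, int_eq 0 (left_mem_Icc.2 hS0), ← e, mass hf₁ hN₁ hfN₁ hb₁ t ht,
      mass hf₂ hN₂ hfN₂ hb₂ t ht]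
    ring

/-- Stability of the square roots in `L²`, squared. -/
theorem IsSolution.lintegral_sq_le (hσ : σ = 1 ∨ σ = -1) (hf₁ : IsSolution σ T f₁)
    (hf₂ : IsSolution σ T f₂)
    (hb₁ : ∀ t ∈ Icc 0 T, eLpNorm (f₁ t) ⊤ volume ≤ (Cinf : ℝ≥0∞))
    (hb₂ : ∀ t ∈ Icc 0 T, eLpNorm (f₂ t) ⊤ volume ≤ (Cinf : ℝ≥0∞)) (hC : Cinf ≠ 0) {S : ℝ}
    (hS0 : 0 ≤ S) (hST : S ≤ T)
    (hgm : AEStronglyMeasurable (fun p : ℝ × Phase => g p.1 p.2)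
      ((volume.restrict (Icc 0 S)).prod volume))
    (hg : ∀ᵐ t ∂volume.restrict (Icc 0 S), IsWeakVelocityGradient (fun z => √(f₂ t z)) (g t))
    (hr : ∫⁻ t in Icc 0 S, rate Cinf (f₂ t) (g t) ≠ ⊤) :
    ∫⁻ z, ‖√(f₁ S z) - √(f₂ S z)‖ₑ ^ (2 : ℝ) ≤
      (∫⁻ z, ‖√(f₁ 0 z) - √(f₂ 0 z)‖ₑ ^ (2 : ℝ)) * ENNReal.ofReal (Real.exp
        (2 * ((8 * rieszConst).toReal * (∫⁻ t in Icc 0 S, rate Cinf (f₂ t) (g t)).toReal))) := by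
  obtain ⟨J, hJ, hJb, hi, hy⟩ :=
    IsSolution.sq_distance_eq hσ hf₁ hf₂ hb₁ hb₂ hC hS0 hST hgm hg hr
  set y : ℝ → ℝ := fun t => ∫ z, (√(f₁ t z) - √(f₂ t z)) ^ 2 with hyd
  have y0 : ∀ t, 0 ≤ y t := fun t => integral_nonneg fun z => sq_nonneg _
  have ey : ∀ t ∈ Icc 0 S, ENNReal.ofReal (y t) = ∫⁻ z, ‖√(f₁ t z) - √(f₂ t z)‖ₑ ^ (2 : ℝ) :=
    fun t ht => ofReal_integral_sq (hi t ht)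
  have c8 : 8 * rieszConst ≠ ⊤ := ENNReal.mul_ne_top (by simp) rieszConst_ne_top
  have yc : ContinuousOn y (Icc 0 S) := by
    have h1 : ContinuousOn (fun t => ∫ r in 0..t, J r) (Icc 0 S) := by
      have := intervalIntegral.continuousOn_primitive_interval' hJ left_mem_uIcc
      rwa [uIcc_of_le hS0] at this
    exact (continuousOn_const.sub (continuousOn_const.mul h1)).congr hy
  have Jm : AEStronglyMeasurable J (volume.restrict (Icc 0 S)) :=
    ((intervalIntegrable_iff_integrableOn_Icc_of_le hS0).1 hJ).1
  -- The Grönwall coefficient is built from J and y, whose measurability is known, rather than from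
  -- `rate`. Where y = 0 the quotient is 0 by convention, and there J = 0 by its bound.
  set a : ℝ → ℝ := fun t => 2 * |J t| / y t with had
  have a0 : ∀ t, 0 ≤ a t := fun t => div_nonneg (by positivity) (y0 t)
  have am : AEStronglyMeasurable a (volume.restrict (Icc 0 S)) :=
    ((Jm.aemeasurable.abs.const_mul 2).div
      (yc.aestronglyMeasurable measurableSet_Icc).aemeasurable).aestronglyMeasurable
  have ab : ∀ᵐ t ∂volume.restrict (Icc 0 S),
      ENNReal.ofReal (a t) ≤ 2 * (8 * rieszConst) * rate Cinf (f₂ t) (g t) := by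
    filter_upwards [hJb, ae_restrict_mem measurableSet_Icc] with t h1 ht
    rcases (y0 t).eq_or_lt with h | h
    · simp [had, ← h]
    · rw [← ey t ht, ← ofReal_norm, Real.norm_eq_abs] at h1
      simp only [had]
      rw [ENNReal.ofReal_div_of_pos h, ENNReal.ofReal_mul (by norm_num)]
      refine ENNReal.div_le_of_le_mul ?_
      calc _ ≤ ENNReal.ofReal 2 * _ := mul_le_mul_right h1 _
        _ = _ := by rw [ENNReal.ofReal_ofNat]; ring
  have aint : ∫⁻ t in Icc 0 S, ENNReal.ofReal (a t) ≤
      2 * (8 * rieszConst) * ∫⁻ t in Icc 0 S, rate Cinf (f₂ t) (g t) := by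
    rw [← lintegral_const_mul' _ _ (ENNReal.mul_ne_top (by simp) c8)]
    exact lintegral_mono_ae ab
  have atop := ENNReal.mul_ne_top (ENNReal.mul_ne_top (by simp : (2 : ℝ≥0∞) ≠ ⊤) c8) hr
  have ai : IntegrableOn a (Icc 0 S) := by
    refine ⟨am, ?_⟩
    rw [hasFiniteIntegral_iff_ofReal (Eventually.of_forall a0)]
    exact aint.trans_lt atop.lt_top
  have ai' : IntervalIntegrable a volume 0 S :=
    (intervalIntegrable_iff_integrableOn_Icc_of_le hS0).2 ai
  have hay : ∀ᵐ t ∂volume.restrict (Icc 0 S), -(2 * J t) ≤ a t * y t := by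
    filter_upwards [hJb, ae_restrict_mem measurableSet_Icc] with t h1 ht
    rcases (y0 t).eq_or_lt with h | h
    · rw [← ey t ht, ← h, ENNReal.ofReal_zero, mul_zero, nonpos_iff_eq_zero, enorm_eq_zero] at h1
      simp [h1, ← h]
    · simp only [had]
      rw [div_mul_cancel₀ _ h.ne']
      linarith [neg_abs_le (J t)]
  have gron := le_mul_exp_integral hS0 yc ai' a0 fun t ht => by
    have hsubt : uIcc 0 t ⊆ uIcc 0 S := by
      rw [uIcc_of_le ht.1, uIcc_of_le hS0]; exact Icc_subset_Icc_right ht.2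
    have hJt := hJ.mono_set hsubt
    have hat : IntervalIntegrable (fun s => a s * y s) volume 0 t :=
      (ai'.mul_continuousOn (by rwa [uIcc_of_le hS0])).mono_set hsubt
    have : ∫ r in 0..t, -(2 * J r) ≤ ∫ r in 0..t, a r * y r :=
      intervalIntegral.integral_mono_ae_restrict ht.1 (hJt.const_mul 2).neg hat
        (ae_mono (Measure.restrict_mono (Icc_subset_Icc_right ht.2) le_rfl) hay)
    rw [intervalIntegral.integral_neg, intervalIntegral.integral_const_mul] at this
    have := hy t ht
    linarith
  have hexp : ∫ s in 0..S, a s ≤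
      2 * ((8 * rieszConst).toReal * (∫⁻ t in Icc 0 S, rate Cinf (f₂ t) (g t)).toReal) := by
    rw [intervalIntegral.integral_of_le hS0, ← integral_Icc_eq_integral_Ioc,
      integral_eq_lintegral_of_nonneg_ae (Eventually.of_forall a0) am]
    refine (ENNReal.toReal_mono atop aint).trans_eq ?_
    rw [mul_assoc, ENNReal.toReal_mul, ENNReal.toReal_mul, ENNReal.toReal_ofNat]
  rw [← ey S (right_mem_Icc.2 hS0), ← ey 0 (left_mem_Icc.2 hS0), ← ENNReal.ofReal_mul (y0 0)]
  exact ENNReal.ofReal_le_ofReal (gron.trans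
    (mul_le_mul_of_nonneg_left (Real.exp_le_exp.2 hexp) (y0 0)))

/-- Stability of the square roots in `L²`. -/
theorem IsSolution.eLpNorm_sqrt_sub_le (hσ : σ = 1 ∨ σ = -1) (hf₁ : IsSolution σ T f₁)
    (hf₂ : IsSolution σ T f₂)
    (hb₁ : ∀ t ∈ Icc 0 T, eLpNorm (f₁ t) ⊤ volume ≤ (Cinf : ℝ≥0∞))
    (hb₂ : ∀ t ∈ Icc 0 T, eLpNorm (f₂ t) ⊤ volume ≤ (Cinf : ℝ≥0∞))
    (hgm : AEStronglyMeasurable (fun p : ℝ × Phase => g p.1 p.2)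
      (volume.restrict (Icc 0 T ×ˢ univ)))
    (hg : ∀ᵐ t ∂volume.restrict (Icc 0 T), IsWeakVelocityGradient (fun z => √(f₂ t z)) (g t))
    {t : ℝ} (ht : t ∈ Icc 0 T) (hr : ∫⁻ s in Ioc 0 t, rate Cinf (f₂ s) (g s) ≠ ⊤) :
    eLpNorm (fun z => √(f₁ t z) - √(f₂ t z)) 2 volume ≤
      eLpNorm (fun z => √(f₁ 0 z) - √(f₂ 0 z)) 2 volume * ENNReal.ofReal (Real.exp
        ((8 * rieszConst).toReal * (∫⁻ s in Ioc 0 t, rate Cinf (f₂ s) (g s)).toReal)) := by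
  -- For C_∞ = 0 both solutions vanish almost everywhere at time t.
  rcases eq_or_ne Cinf 0 with rfl | hC
  · have h0 : (fun z => √(f₁ t z) - √(f₂ t z)) =ᵐ[volume] 0 := by
      filter_upwards [hf₁.ae_mem_Icc hb₁ ht, hf₂.ae_mem_Icc hb₂ ht] with z h1 h2
      rw [le_antisymm h1.2 h1.1, le_antisymm h2.2 h2.1]
      simp
    rw [eLpNorm_congr_ae h0, eLpNorm_zero]
    exact zero_le
  · rw [volume_restrict_Icc_prod_univ] at hgm
    rw [restrict_Ioc_eq_restrict_Icc] at hr ⊢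
    have := IsSolution.lintegral_sq_le hσ hf₁ hf₂ hb₁ hb₂ hC ht.1 ht.2
      (hgm.mono_measure (IsCurve.restrict_prod_le ht.2))
      (ae_mono (Measure.restrict_mono (Icc_subset_Icc_right ht.2) le_rfl) hg) hr
    rw [eLpNorm_two_eq, eLpNorm_two_eq]
    -- Taking the square root halves the exponent and removes the factor 2 that came from
    -- differentiating the square.
    refine (ENNReal.rpow_le_rpow this (by norm_num)).trans_eq ?_
    rw [ENNReal.mul_rpow_of_nonneg _ _ (by norm_num),
      ENNReal.ofReal_rpow_of_nonneg (Real.exp_pos _).le (by norm_num), ← Real.exp_mul]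
    congr 3
    ring

end Stability

/-! ### Comparison between solutions and their square roots; conclusion. -/

lemma abs_sub_le_sqrt_mul {a b c : ℝ} (ha : a ∈ Icc 0 c) (hb : b ∈ Icc 0 c) :
    |a - b| ≤ 2 * √c * |√a - √b| := by
  have h1 : a - b = (√a + √b) * (√a - √b) := by
    nlinarith [Real.sq_sqrt ha.1, Real.sq_sqrt hb.1]
  rw [h1, abs_mul]
  refine mul_le_mul_of_nonneg_right ?_ (abs_nonneg _)
  rw [abs_of_nonneg (by positivity)]
  linarith [Real.sqrt_le_sqrt ha.2, Real.sqrt_le_sqrt hb.2]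

/-- Since |√a - √b| ≤ √a + √b, one factor of the square can be enlarged to √a + √b. This converts
the initial L² distance of the roots into the L¹ distance of the data. -/
lemma sq_sqrt_sub_le {a b : ℝ} (ha : 0 ≤ a) (hb : 0 ≤ b) : (√a - √b) ^ 2 ≤ |a - b| := by
  have h1 : a - b = (√a + √b) * (√a - √b) := by
    nlinarith [Real.sq_sqrt ha, Real.sq_sqrt hb]
  have h2 := Real.sqrt_nonneg a
  have h3 := Real.sqrt_nonneg b
  rw [h1, abs_mul, ← sq_abs, sq, abs_of_nonneg (add_nonneg h2 h3)]
  refine mul_le_mul_of_nonneg_right ?_ (abs_nonneg _)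
  rw [abs_le]
  constructor <;> linarith

lemma eLpNorm_sub_le_eLpNorm_sqrt_sub {Cinf : ℝ≥0} {f₁ f₂ : Phase → ℝ}
    (h₁ : ∀ᵐ z, f₁ z ∈ Icc (0 : ℝ) Cinf) (h₂ : ∀ᵐ z, f₂ z ∈ Icc (0 : ℝ) Cinf) :
    eLpNorm (fun z => f₁ z - f₂ z) 2 volume ≤
      2 * (Cinf : ℝ≥0∞) ^ (1 / 2 : ℝ) * eLpNorm (fun z => √(f₁ z) - √(f₂ z)) 2 volume := by
  have h := eLpNorm_le_mul_eLpNorm_of_ae_le_mul (f := fun z => f₁ z - f₂ z)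
    (g := fun z => √(f₁ z) - √(f₂ z)) (c := 2 * √(Cinf : ℝ)) (μ := volume)
    (by filter_upwards [h₁, h₂] with z h1 h2 using abs_sub_le_sqrt_mul h1 h2) 2
  refine h.trans_eq ?_
  rw [ENNReal.ofReal_mul (by norm_num), Real.sqrt_eq_rpow,
    ← ENNReal.ofReal_rpow_of_nonneg Cinf.coe_nonneg (by norm_num), ENNReal.ofReal_coe_nnreal,
    ENNReal.ofReal_ofNat]

lemma eLpNorm_sqrt_sub_le_eLpNorm_sub {f₁ f₂ : Phase → ℝ} (h₁ : ∀ᵐ z, 0 ≤ f₁ z)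
    (h₂ : ∀ᵐ z, 0 ≤ f₂ z) :
    eLpNorm (fun z => √(f₁ z) - √(f₂ z)) 2 volume ≤
      eLpNorm (fun z => f₁ z - f₂ z) 1 volume ^ (1 / 2 : ℝ) := by
  rw [eLpNorm_two_eq, eLpNorm_one_eq_lintegral_enorm]
  refine ENNReal.rpow_le_rpow (lintegral_mono_ae ?_) (by norm_num)
  filter_upwards [h₁, h₂] with z h1 h2
  rw [ENNReal.rpow_two, ← enorm_pow, ← ofReal_norm, ← ofReal_norm,
    Real.norm_of_nonneg (sq_nonneg _)]
  exact ENNReal.ofReal_le_ofReal (sq_sqrt_sub_le h1 h2)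

end VlasovPoisson

theorem theorem2p1 :
    ∃ C : ℝ, 0 < C ∧
      ∀ (σ : ℝ), (σ = 1 ∨ σ = -1) →
      ∀ (T : ℝ) (Cinf : ℝ≥0) (f₁ f₂ : ℝ → VlasovPoisson.Phase → ℝ),
        VlasovPoisson.IsSolution σ T f₁ →
        VlasovPoisson.IsSolution σ T f₂ →
        (∀ t ∈ Icc 0 T, eLpNorm (f₁ t) ⊤ volume ≤ (Cinf : ℝ≥0∞)) →
        (∀ t ∈ Icc 0 T, eLpNorm (f₂ t) ⊤ volume ≤ (Cinf : ℝ≥0∞)) →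
      ∀ g₂ : ℝ → VlasovPoisson.Phase → VlasovPoisson.R3,
        AEStronglyMeasurable (fun p : ℝ × VlasovPoisson.Phase => g₂ p.1 p.2)
          (volume.restrict (Icc 0 T ×ˢ univ)) →
        (∀ᵐ t ∂(volume.restrict (Icc 0 T)),
          VlasovPoisson.IsWeakVelocityGradient (fun z => √(f₂ t z)) (g₂ t)) →
      ∀ t ∈ Icc 0 T,
        (∫⁻ s in Ioc 0 t, VlasovPoisson.rate Cinf (f₂ s) (g₂ s)) ≠ ⊤ →
        eLpNorm (fun z => √(f₁ t z) - √(f₂ t z)) 2 volume ≤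
          eLpNorm (fun z => √(f₁ 0 z) - √(f₂ 0 z)) 2 volume *
            ENNReal.ofReal (Real.exp
              (C * (∫⁻ s in Ioc 0 t, VlasovPoisson.rate Cinf (f₂ s) (g₂ s)).toReal)) ∧
        eLpNorm (fun z => f₁ t z - f₂ t z) 2 volume ≤
          2 * (Cinf : ℝ≥0∞) ^ (1 / 2 : ℝ) *
            eLpNorm (fun z => f₁ 0 z - f₂ 0 z) 1 volume ^ (1 / 2 : ℝ) *
            ENNReal.ofReal (Real.exp
              (C * (∫⁻ s in Ioc 0 t, VlasovPoisson.rate Cinf (f₂ s) (g₂ s)).toReal)) := by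
  have hc : 0 < (8 * VlasovPoisson.rieszConst).toReal :=
    ENNReal.toReal_pos
      (mul_ne_zero (by simp) (zero_lt_one.trans_le VlasovPoisson.one_le_rieszConst).ne')
      (ENNReal.mul_ne_top (by simp) VlasovPoisson.rieszConst_ne_top)
  refine ⟨_, hc, fun σ hσ T Cinf f₁ f₂ hf₁ hf₂ hb₁ hb₂ g₂ hgm hg t ht hr => ?_⟩
  have h0 : (0 : ℝ) ∈ Icc 0 T := left_mem_Icc.2 (ht.1.trans ht.2)
  have h := VlasovPoisson.IsSolution.eLpNorm_sqrt_sub_le hσ hf₁ hf₂ hb₁ hb₂ hgm hg ht hr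
  refine ⟨h, (VlasovPoisson.eLpNorm_sub_le_eLpNorm_sqrt_sub (hf₁.ae_mem_Icc hb₁ ht)
    (hf₂.ae_mem_Icc hb₂ ht)).trans ?_⟩
  rw [mul_assoc (2 * (Cinf : ℝ≥0∞) ^ (1 / 2 : ℝ))]
  exact mul_le_mul_right (h.trans (mul_le_mul_left
    (VlasovPoisson.eLpNorm_sqrt_sub_le_eLpNorm_sub (hf₁.nonneg 0 h0) (hf₂.nonneg 0 h0)) _)) _
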